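/- Let $N\ge 3$, $\Lambda_N=\frac{(N-2)^2}{4}$, $\lambda_1,\lambda_2\in(0,\Lambda_N)$, $0<s<2$, $2^*_s=\frac{2(N-s)}{N-2}$, and let $\alpha,\beta>1$ with $\alpha+\beta\le 2^*_s$. Let $h\in L^\infty(\mathbb{R}^N)$ with $h\ge 0$, $h\not\equiv 0$, be continuous around $0$ and around $\infty$, with $h(0)=\lim_{|x|\to\infty}h(x)=0$. Let $\mathcal{D}^{1,2}(\mathbb{R}^N)$ be the completion of $C_0^\infty(\mathbb{R}^N)$ under $\|u\|^2=\int|\nabla u|^2\,dx$, let $\mathbb{D}=\mathcal{D}^{1,2}(\mathbb{R}^N)\times\mathcal{D}^{1,2}(\mathbb{R}^N)$, and put $\|u\|_\lambda^2=\int|\nabla u|^2dx-\lambda\int\frac{u^2}{|x|^2}dx$. If $\alpha+\beta<2^*_s$, assume moreover that $h\frac{|u|^\alpha|v|^\beta}{|x|^s}\in L^1(\mathbb{R}^N)$ for all $(u,v)\in\mathbb{D}$ (so that the functionals below are defined on $\mathbb{D}$; this is automatic if $\alpha+\beta=2^*_s$). For $\nu>0$ define on $\mathbb{D}$ $$\mathcal{J}_\nu(u,v)=\tfrac12\|u\|_{\lambda_1}^2+\tfrac12\|v\|_{\lambda_2}^2-\frac1{2^*_s}\int\frac{|u|^{2^*_s}}{|x|^s}dx-\frac1{2^*_s}\int\frac{|v|^{2^*_s}}{|x|^s}dx-\nu\int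 h\frac{|u|^\alpha|v|^\beta}{|x|^s}dx,$$ $$\Psi(u,v)=\|u\|_{\lambda_1}^2+\|v\|_{\lambda_2}^2-\int\frac{|u|^{2^*_s}}{|x|^s}dx-\int\frac{|v|^{2^*_s}}{|x|^s}dx-\nu(\alpha+\beta)\int h\frac{|u|^\alpha|v|^\beta}{|x|^s}dx,$$ and the Nehari manifold $\mathcal{N}_\nu=\{(u,v)\in\mathbb{D}\setminus\{(0,0)\}:\Psi(u,v)=0\}$. For $\mu>0$ and $j=1,2$ let $z_\mu^{(j)}(x)=\mu^{-\frac{N-2}{2}}z_1^{\lambda_j,s}(x/\mu)$, where $$z_1^{\lambda,s}(x)=\frac{A(N,\lambda)^{\frac{N-2}{2(2-s)}}}{|x|^{a_\lambda}\bigl(1+|x|^{(2-s)(1-\frac{2}{N-2}a_\lambda)}\bigr)^{\frac{N-2}{2-s}}},\quad A(N,\lambda)=2(\Lambda_N-\lambda)\frac{N-s}{\sqrt{\Lambda_N}},\quad a_\lambda=\sqrt{\Lambda_N}-\sqrt{\Lambda_N-\lambda}.$$ A point $p\in\mathcal{N}_\nu$ is called a saddle point of $\mathcal{J}_\nu$ on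 $\mathcal{N}_\nu$ if it is a critical point of $\mathcal{J}_\nu|_{\mathcal{N}_\nu}$, that is, $\mathcal{J}_\nu'(p)=\omega\Psi'(p)$ for some $\omega\in\mathbb{R}$, and every neighbourhood of $p$ contains points $q_1,q_2\in\mathcal{N}_\nu$ with $\mathcal{J}_\nu(q_1)<\mathcal{J}_\nu(p)<\mathcal{J}_\nu(q_2)$. Then $z_\mu^{(1)},z_\mu^{(2)}\in\mathcal{D}^{1,2}(\mathbb{R}^N)$ for all $\mu>0$, and: i) If $\alpha>2$, then $(0,z_\mu^{(2)})$ is a local minimum of $\mathcal{J}_\nu$ on $\mathcal{N}_\nu$ for all $\nu,\mu>0$. If $\alpha=2$, there is $\nu_0>0$ such that this holds for all $0<\nu<\nu_0$ and all $\mu>0$. ii) If $\beta>2$, then $(z_\mu^{(1)},0)$ is a local minimum of $\mathcal{J}_\nu$ on $\mathcal{N}_\nu$ for all $\nu,\mu>0$. If $\beta=2$, there is $\nu_0>0$ such that this holds for all $0<\nu<\nu_0$ and all $\mu>0$. iii) If $\alpha<2$, then $(0,z_\mu^{(2)})$ is a saddle point of $\mathcal{J}_\nu$ on $\mathcal{N}_\nu$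 for all $\nu,\mu>0$. If $\alpha=2$, then for every $\mu>0$ there is $\nu_1>0$ such that this holds for all $\nu>\nu_1$. iv) If $\beta<2$, then $(z_\mu^{(1)},0)$ is a saddle point of $\mathcal{J}_\nu$ on $\mathcal{N}_\nu$ for all $\nu,\mu>0$. If $\beta=2$, then for every $\mu>0$ there is $\nu_1>0$ such that this holds for all $\nu>\nu_1$. -/

import Mathlib

open MeasureTheory Filter Topology
open scoped ENNReal NNReal ContDiff Gradient

noncomputable section

namespace HardySobolev

/-- The Euclidean space `ℝ^N`. -/
abbrev E (N : ℕ) : Type := EuclideanSpace ℝ (Fin N)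

/-- The critical Hardy-Sobolev exponent `2(N-s)/(N-2)`; for `s = 0` it is `2N/(N-2)`. -/
def critExp (N : ℕ) (s : ℝ) : ℝ := 2 * ((N : ℝ) - s) / ((N : ℝ) - 2)

/-- The best constant `(N-2)^2/4` in Hardy's inequality. -/
def hardyConst (N : ℕ) : ℝ := ((N : ℝ) - 2) ^ 2 / 4

/-- Test functions: smooth with compact support. -/
def IsTest {N : ℕ} (φ : E N → ℝ) : Prop := ContDiff ℝ ∞ φ ∧ HasCompactSupport φ

/-- `(u, G)` is the limit of pairs `(φ n, ∇ φ n)` with `φ n` test functions: `φ n → u` in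
`L^{2N/(N-2)}` and `∇ φ n → G` in `L^2`. -/
def IsTestLimit {N : ℕ} (u : E N → ℝ) (G : E N → E N) : Prop :=
  ∃ φ : ℕ → E N → ℝ, (∀ n, IsTest (φ n)) ∧
    Tendsto (fun n => eLpNorm (fun x => φ n x - u x) (ENNReal.ofReal (critExp N 0)) volume)
      atTop (𝓝 0) ∧
    Tendsto (fun n => eLpNorm (fun x => ∇ (φ n) x - G x) 2 volume) atTop (𝓝 0)

theorem IsTest.contDiff_one {N : ℕ} {φ : E N → ℝ} (h : IsTest φ) : ContDiff ℝ 1 φ :=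
  h.1.of_le (by exact_mod_cast le_top)

theorem continuous_gradient {N : ℕ} {φ : E N → ℝ} (h : ContDiff ℝ 1 φ) :
    Continuous (∇ φ) :=
  (InnerProductSpace.toDual ℝ (E N)).symm.continuous.comp (h.continuous_fderiv (by simp))

theorem one_le_critExp {N : ℕ} (hN : 3 ≤ N) : (1 : ℝ≥0∞) ≤ ENNReal.ofReal (critExp N 0) := by
  have h3 : (3 : ℝ) ≤ N := by exact_mod_cast hN
  rw [← ENNReal.ofReal_one]
  apply ENNReal.ofReal_le_ofReal
  unfold critExp
  rw [le_div_iff₀ (by linarith)]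
  linarith

/-- Sobolev's inequality for test functions. -/
theorem sobolev_test {N : ℕ} (hN : 3 ≤ N) : ∃ C : ℝ≥0, ∀ φ : E N → ℝ, ContDiff ℝ 1 φ →
    HasCompactSupport φ → eLpNorm φ (ENNReal.ofReal (critExp N 0)) volume
      ≤ C * eLpNorm (∇ φ) 2 volume := by
  have h3 : (3 : ℝ) ≤ N := by exact_mod_cast hN
  refine ⟨eLpNormLESNormFDerivOfEqInnerConst (volume : Measure (E N)) (2 : ℝ≥0), ?_⟩
  intro φ h1 h2
  have key := eLpNorm_le_eLpNorm_fderiv_of_eq_inner (volume : Measure (E N)) h1 h2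
    (p := 2) (p' := Real.toNNReal (critExp N 0)) (by norm_num) (by simp; omega)
    (by
      rw [Real.coe_toNNReal]
      · unfold critExp
        simp only [finrank_euclideanSpace, Fintype.card_fin, sub_zero]
        have : (N : ℝ) - 2 ≠ 0 := by linarith
        have : (N : ℝ) ≠ 0 := by linarith
        field_simp
        push_cast
        ring
      · unfold critExp
        apply div_nonneg <;> linarith)
  refine key.trans (le_of_eq ?_)
  congr 1
  apply eLpNorm_congr_norm_ae
  filter_upwards with x
  simp [gradient]

theorem gradient_add {N : ℕ} {φ ψ : E N → ℝ} (hφ : ContDiff ℝ 1 φ) (hψ : ContDiff ℝ 1 ψ)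
    (x : E N) : ∇ (fun y => φ y + ψ y) x = ∇ φ x + ∇ ψ x := by
  have h1 : DifferentiableAt ℝ φ x := hφ.differentiable (by simp) x
  have h2 : DifferentiableAt ℝ ψ x := hψ.differentiable (by simp) x
  simp only [gradient]
  rw [fderiv_fun_add h1 h2, map_add]

theorem gradient_smul {N : ℕ} {φ : E N → ℝ} (hφ : ContDiff ℝ 1 φ) (c : ℝ)
    (x : E N) : ∇ (fun y => c * φ y) x = c • ∇ φ x := by
  have h1 : DifferentiableAt ℝ φ x := hφ.differentiable (by simp) x
  simp only [gradient]
  rw [fderiv_const_mul h1, map_smulₛₗ]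
  simp

theorem IsTestLimit.congr {N : ℕ} {u v : E N → ℝ} {G H : E N → E N} (h : IsTestLimit u G)
    (huv : u =ᵐ[volume] v) (hGH : G =ᵐ[volume] H) : IsTestLimit v H := by
  obtain ⟨φ, h0, h1, h2⟩ := h
  refine ⟨φ, h0, ?_, ?_⟩
  · refine h1.congr fun n => eLpNorm_congr_ae ?_
    filter_upwards [huv] with x hx
    rw [hx]
  · refine h2.congr fun n => eLpNorm_congr_ae ?_
    filter_upwards [hGH] with x hx
    rw [hx]

theorem IsTestLimit.zero (N : ℕ) : IsTestLimit (fun _ : E N => (0 : ℝ)) (fun _ => 0) := by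
  refine ⟨fun _ _ => 0, fun n => ⟨contDiff_const, HasCompactSupport.zero⟩, ?_, ?_⟩
  · simp
  · have : (∇ fun _ : E N => (0 : ℝ)) = fun _ => 0 := by
      funext x; simp [gradient]
    simp [this]

theorem IsTestLimit.add {N : ℕ} (hN : 3 ≤ N) {u v : E N → ℝ} {G H : E N → E N}
    (hu : AEStronglyMeasurable u volume) (hv : AEStronglyMeasurable v volume)
    (hG : AEStronglyMeasurable G volume) (hH : AEStronglyMeasurable H volume)
    (h : IsTestLimit u G) (k : IsTestLimit v H) :
    IsTestLimit (fun x => u x + v x) (fun x => G x + H x) := by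
  obtain ⟨φ, h0, h1, h2⟩ := h
  obtain ⟨ψ, k0, k1, k2⟩ := k
  refine ⟨fun n x => φ n x + ψ n x, fun n => ⟨(h0 n).1.add (k0 n).1, (h0 n).2.add (k0 n).2⟩,
    ?_, ?_⟩
  · have hs := h1.add k1
    rw [add_zero] at hs
    refine tendsto_of_tendsto_of_tendsto_of_le_of_le tendsto_const_nhds hs
      (fun n => zero_le) fun n => ?_
    have e : (fun x => φ n x + ψ n x - (u x + v x))
        = (fun x => φ n x - u x) + fun x => ψ n x - v x := by
      funext x; simp only [Pi.add_apply]; ring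
    simp only [e]
    exact eLpNorm_add_le ((h0 n).1.continuous.aestronglyMeasurable.sub hu)
      ((k0 n).1.continuous.aestronglyMeasurable.sub hv) (one_le_critExp hN)
  · have hs := h2.add k2
    rw [add_zero] at hs
    refine tendsto_of_tendsto_of_tendsto_of_le_of_le tendsto_const_nhds hs
      (fun n => zero_le) fun n => ?_
    have e : (fun x => ∇ (fun y => φ n y + ψ n y) x - (G x + H x))
        = (fun x => ∇ (φ n) x - G x) + fun x => ∇ (ψ n) x - H x := by
      funext x
      simp only [Pi.add_apply]
      rw [gradient_add (h0 n).contDiff_one (k0 n).contDiff_one]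
      abel
    simp only [e]
    exact eLpNorm_add_le
      ((continuous_gradient (h0 n).contDiff_one).aestronglyMeasurable.sub hG)
      ((continuous_gradient (k0 n).contDiff_one).aestronglyMeasurable.sub hH) (by norm_num)

theorem IsTestLimit.smul {N : ℕ} {u : E N → ℝ} {G : E N → E N} (c : ℝ)
    (h : IsTestLimit u G) : IsTestLimit (fun x => c * u x) (fun x => c • G x) := by
  obtain ⟨φ, h0, h1, h2⟩ := h
  refine ⟨fun n x => c * φ n x, fun n => ⟨contDiff_const.mul (h0 n).1, (h0 n).2.mul_left⟩, ?_, ?_⟩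
  · have hs := ENNReal.Tendsto.const_mul (a := ‖c‖ₑ) h1 (Or.inr enorm_ne_top)
    rw [mul_zero] at hs
    refine hs.congr fun n => ?_
    have e : (fun x => c * φ n x - c * u x) = c • fun x => φ n x - u x := by
      funext x; simp only [Pi.smul_apply, smul_eq_mul]; ring
    rw [e, eLpNorm_const_smul]
  · have hs := ENNReal.Tendsto.const_mul (a := ‖c‖ₑ) h2 (Or.inr enorm_ne_top)
    rw [mul_zero] at hs
    refine hs.congr fun n => ?_
    have e : (fun x => ∇ (fun y => c * φ n y) x - c • G x) = c • fun x => ∇ (φ n) x - G x := by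
      funext x
      simp only [Pi.smul_apply]
      rw [gradient_smul (h0 n).contDiff_one, smul_sub]
    rw [e, eLpNorm_const_smul]

theorem IsTestLimit.ae_eq_zero {N : ℕ} (hN : 3 ≤ N) {u : E N → ℝ} {G : E N → E N}
    (hu : AEStronglyMeasurable u volume) (h : IsTestLimit u G) (hG : G =ᵐ[volume] 0) :
    u =ᵐ[volume] 0 := by
  obtain ⟨φ, h0, h1, h2⟩ := h.congr (Filter.EventuallyEq.refl _ u) hG
  obtain ⟨C, hC⟩ := sobolev_test hN
  have hp := one_le_critExp hN
  have h3 : Tendsto (fun n => eLpNorm (φ n) (ENNReal.ofReal (critExp N 0)) volume)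
      atTop (𝓝 0) := by
    have hs := ENNReal.Tendsto.const_mul (a := (C : ℝ≥0∞)) h2 (Or.inr ENNReal.coe_ne_top)
    rw [mul_zero] at hs
    refine tendsto_of_tendsto_of_tendsto_of_le_of_le tendsto_const_nhds hs
      (fun n => zero_le) fun n => ?_
    simpa using hC (φ n) (h0 n).contDiff_one (h0 n).2
  have h4 : eLpNorm u (ENNReal.ofReal (critExp N 0)) volume ≤ 0 := by
    have hs := h3.add h1
    rw [add_zero] at hs
    refine ge_of_tendsto' hs fun n => ?_
    have e : u = φ n - fun x => φ n x - u x := by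
      funext x; simp
    have hm := (h0 n).1.continuous.aestronglyMeasurable (μ := (volume : Measure (E N)))
    calc eLpNorm u (ENNReal.ofReal (critExp N 0)) volume
        = eLpNorm (φ n - fun x => φ n x - u x) (ENNReal.ofReal (critExp N 0)) volume := by
          rw [← e]
      _ ≤ _ := eLpNorm_sub_le hm (hm.sub hu) hp
  exact (eLpNorm_eq_zero_iff hu (lt_of_lt_of_le one_pos hp).ne').1 (le_antisymm h4 zero_le)

variable (N : ℕ) [hN : Fact (3 ≤ N)]

/-- The limits of test functions, as a subspace: a pair consists of (the class of) a function `u`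
and its gradient in `L^2`. -/
def D12.submodule : Submodule ℝ ((E N →ₘ[volume] ℝ) × Lp (E N) 2 (volume : Measure (E N))) where
  carrier := {p | IsTestLimit (fun x => p.1 x) (fun x => p.2 x)}
  add_mem' {a b} ha hb := by
    refine (IsTestLimit.add hN.out a.1.aestronglyMeasurable b.1.aestronglyMeasurable
      (Lp.aestronglyMeasurable a.2) (Lp.aestronglyMeasurable b.2) ha hb).congr ?_ ?_
    · exact (AEEqFun.coeFn_add a.1 b.1).symm
    · exact (Lp.coeFn_add a.2 b.2).symm
  zero_mem' := by
    refine (IsTestLimit.zero N).congr ?_ ?_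
    · exact (AEEqFun.coeFn_zero (α := E N) (β := ℝ)).symm
    · exact (Lp.coeFn_zero (E N) 2 (volume : Measure (E N))).symm
  smul_mem' c a ha := by
    refine (IsTestLimit.smul c ha).congr ?_ ?_
    · exact (AEEqFun.coeFn_smul c a.1).symm
    · exact (Lp.coeFn_smul c a.2).symm

/-- The space `D^{1,2}(ℝ^N)`, the completion of the test functions under the norm `‖∇ φ‖_{L^2}`,
realized (through Sobolev's inequality) as a space of functions with a gradient in `L^2`. -/
def D12 : Type := D12.submodule N

instance : AddCommGroup (D12 N) := inferInstanceAs (AddCommGroup (D12.submodule N))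
instance : Module ℝ (D12 N) := inferInstanceAs (Module ℝ (D12.submodule N))

variable {N}

/-- The function `ℝ^N → ℝ` underlying an element of `D^{1,2}` (defined up to null sets). -/
instance : CoeFun (D12 N) (fun _ => E N → ℝ) := ⟨fun u x => u.1.1 x⟩

variable (N) in
/-- The gradient, as a linear map from `D^{1,2}` to `L^2`. -/
def D12.grad : D12 N →ₗ[ℝ] Lp (E N) 2 (volume : Measure (E N)) :=
  (LinearMap.snd ℝ (E N →ₘ[volume] ℝ) (Lp (E N) 2 (volume : Measure (E N)))).comp
    (D12.submodule N).subtype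

theorem D12.grad_injective : Function.Injective (D12.grad N) := by
  rw [injective_iff_map_eq_zero]
  intro u hu
  have h0 : u.1.2 = 0 := hu
  have h1 : (fun x => u.1.2 x) =ᵐ[volume] 0 := by
    rw [h0]; exact Lp.coeFn_zero (E N) 2 (volume : Measure (E N))
  have h2 := IsTestLimit.ae_eq_zero hN.out u.1.1.aestronglyMeasurable u.2 h1
  apply Subtype.ext
  refine Prod.ext ?_ h0
  exact AEEqFun.ext (h2.trans (AEEqFun.coeFn_zero (α := E N) (β := ℝ)).symm)

/-- The norm of `D^{1,2}` is `‖u‖ = ‖∇ u‖_{L^2}`. -/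
instance : NormedAddCommGroup (D12 N) :=
  NormedAddCommGroup.induced (D12 N) (Lp (E N) 2 (volume : Measure (E N))) (D12.grad N)
    D12.grad_injective

instance : NormedSpace ℝ (D12 N) :=
  NormedSpace.induced ℝ (D12 N) (Lp (E N) 2 (volume : Measure (E N))) (D12.grad N)

variable (N) in
/-- The energy space `𝔻 = D^{1,2} × D^{1,2}`. Local minima and derivatives depend only on the
equivalence class of its norm, so we use the product norm of Mathlib. -/
abbrev DD : Type := D12 N × D12 N

/-- `‖u‖_λ^2 = ∫ |∇ u|^2 - λ ∫ u^2 / |x|^2`. -/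
def normSq (lam : ℝ) (u : D12 N) : ℝ :=
  (∫ x, ‖D12.grad N u x‖ ^ 2) - lam * ∫ x, u x ^ 2 / ‖x‖ ^ 2

/-- `∫ |u|^{2*_s} / |x|^s`. -/
def critInt (s : ℝ) (u : D12 N) : ℝ := ∫ x, |u x| ^ critExp N s / ‖x‖ ^ s

/-- The integrand `h |u|^α |v|^β / |x|^s` of the coupling term. -/
def couplingFun (s α β : ℝ) (h : E N → ℝ) (u v : D12 N) (x : E N) : ℝ :=
  h x * (|u x| ^ α * |v x| ^ β) / ‖x‖ ^ s

/-- The energy functional `J_ν`. -/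
def energy (lam₁ lam₂ s α β : ℝ) (h : E N → ℝ) (ν : ℝ) (p : DD N) : ℝ :=
  normSq lam₁ p.1 / 2 + normSq lam₂ p.2 / 2
    - critInt s p.1 / critExp N s - critInt s p.2 / critExp N s
    - ν * ∫ x, couplingFun s α β h p.1 p.2 x

/-- The functional `Ψ(u,v) = ⟨J_ν'(u,v), (u,v)⟩`. -/
def nehariFun (lam₁ lam₂ s α β : ℝ) (h : E N → ℝ) (ν : ℝ) (p : DD N) : ℝ :=
  normSq lam₁ p.1 + normSq lam₂ p.2 - critInt s p.1 - critInt s p.2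
    - ν * (α + β) * ∫ x, couplingFun s α β h p.1 p.2 x

/-- The Nehari manifold `N_ν`. -/
def nehari (lam₁ lam₂ s α β : ℝ) (h : E N → ℝ) (ν : ℝ) : Set (DD N) :=
  {p | p ≠ 0 ∧ nehariFun lam₁ lam₂ s α β h ν p = 0}

/-- `p` is a local minimum of `J_ν` on `N_ν`. -/
def IsLocalMinimum (lam₁ lam₂ s α β : ℝ) (h : E N → ℝ) (ν : ℝ) (p : DD N) : Prop :=
  p ∈ nehari lam₁ lam₂ s α β h ν ∧
    IsLocalMinOn (energy lam₁ lam₂ s α β h ν) (nehari lam₁ lam₂ s α β h ν) p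

/-- `p` is a critical point of `J_ν` restricted to `N_ν`: it lies on `N_ν`, and
`J_ν'(p) = κ Ψ'(p)` for some multiplier `κ`. -/
def IsCriticalPoint (lam₁ lam₂ s α β : ℝ) (h : E N → ℝ) (ν : ℝ) (p : DD N) : Prop :=
  p ∈ nehari lam₁ lam₂ s α β h ν ∧
    ∃ (J' Ψ' : DD N →L[ℝ] ℝ) (κ : ℝ), HasFDerivAt (energy lam₁ lam₂ s α β h ν) J' p ∧
      HasFDerivAt (nehariFun lam₁ lam₂ s α β h ν) Ψ' p ∧ J' = κ • Ψ'

/-- `p` is a saddle point of `J_ν` on `N_ν`: a critical point of the restriction such that every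
neighbourhood of `p` contains points of `N_ν` of strictly smaller and of strictly larger energy. -/
def IsSaddlePoint (lam₁ lam₂ s α β : ℝ) (h : E N → ℝ) (ν : ℝ) (p : DD N) : Prop :=
  IsCriticalPoint lam₁ lam₂ s α β h ν p ∧
    ∀ U ∈ 𝓝 p,
      (∃ q ∈ U ∩ nehari lam₁ lam₂ s α β h ν,
        energy lam₁ lam₂ s α β h ν q < energy lam₁ lam₂ s α β h ν p) ∧
      (∃ q ∈ U ∩ nehari lam₁ lam₂ s α β h ν,
        energy lam₁ lam₂ s α β h ν p < energy lam₁ lam₂ s α β h ν q)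

variable (N) in
/-- `a_λ = √Λ_N - √(Λ_N - λ)`. -/
def aExp (lam : ℝ) : ℝ := √(hardyConst N) - √(hardyConst N - lam)

variable (N) in
/-- `A(N,λ) = 2 (Λ_N - λ) (N - s) / √Λ_N`. -/
def aConst (lam s : ℝ) : ℝ :=
  2 * (hardyConst N - lam) * (((N : ℝ) - s) / √(hardyConst N))

variable (N) in
/-- The profile `z_1^{λ,s}`. -/
def zOne (lam s : ℝ) (x : E N) : ℝ :=
  aConst N lam s ^ (((N : ℝ) - 2) / (2 * (2 - s))) /
    (‖x‖ ^ aExp N lam *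
      (1 + ‖x‖ ^ ((2 - s) * (1 - 2 / ((N : ℝ) - 2) * aExp N lam))) ^ (((N : ℝ) - 2) / (2 - s)))

variable (N) in
/-- The rescaled profile `z_μ(x) = μ^{-(N-2)/2} z_1(x/μ)`. -/
def zMu (lam s μ : ℝ) (x : E N) : ℝ :=
  μ ^ (-(((N : ℝ) - 2) / 2)) * zOne N lam s (μ⁻¹ • x)

/-- `h` is continuous around `0` and around infinity, and vanishes at both. -/
def HypH (h : E N → ℝ) : Prop :=
  (∃ r > 0, ContinuousOn h (Metric.ball 0 r)) ∧ (∃ R : ℝ, ContinuousOn h {x | R < ‖x‖}) ∧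
    h 0 = 0 ∧ Tendsto h (cocompact (E N)) (𝓝 0)

end HardySobolev

end

open HardySobolev

/-!
Write `p = 2*_s`, `z` for the profile with parameter `λ`, and `J(v) = ‖v‖_λ²/2 - (∫ |v|^p/|x|^s)/p`
for the energy of a single component.

**Reduction to a single component.** Along the ray through a point of the Nehari manifold the
coupled energy is maximal at this point (`energy_smul_le`; a consequence of Bernoulli's inequality,
as all the exponents are at least `2`). Hence, for `(u, v)` on the Nehari manifold and any `t > 0`,
the energy at `(u, v)` is at least
`t² ‖u‖_λ²/2 - O(‖u‖^p) - O(ν ‖u‖^α) + J(t v)`, and for `α > 2`, or `α = 2` and `ν` small, it is at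
least `J(t v)` when `u` is small. So it suffices to find, for `v` near `z_μ`, a factor `t` near `1`
with `J(t v) ≥ J(z_μ)` (`single_local_min`). For `α < 2`, or `α = 2` and `ν` large, the coupling
term dominates `‖u‖²` and the energy decreases when a small multiple of a positive function is added
in the first component (`exists_energy_lt`); it increases in the second component away from the
curve of the dilations and multiples of the profile (`exists_energy_gt`). In both cases the points
are moved to the Nehari manifold by `exists_smul_mem_nehari`. That the coupling term is bounded by
`C ‖u‖^α ‖v‖^β` is known only qualitatively in the subcritical case, where integrability is assumed;
Baire's theorem makes it quantitative (`exists_coupling_le`).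

**The single functional.** No classification of the minimizers of `J` is needed, only the local
statement, which follows from the coercivity of the second variation `‖b‖_λ² - (p-1) ∫ V b²/|x|²`,
`V = z^{p-2} |x|^{2-s}`, on the common kernel of two linear functionals: the integrals over two
spherical shells, one on each side of the unit sphere, with weight `|x|^{-(N+2)/2}`
(`secondVar_coercive`). In the variable `y = tanh (κ log r)` the potential is a multiple of
`1 - y²`. Split `b` into its spherical means and the rest. The means vanish at a radius in each
shell, and between consecutive zeros explicit solutions of a Riccati inequality give coercivity
(`ray_coercive`). For the rest, the sharp Poincaré inequality on the sphere contributes `N - 1`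
(`sphere_poincare`), which exceeds what the radial operator lacks (`spectral_gap`). The sharp
Poincaré inequality is deduced from the Gaussian one, which follows in turn from an inequality on
the circle (`circle_inequality`), applied to the rotations of a pair of independent Gaussian
vectors.

A function near `z` is brought into the affine space on which coercivity applies by a dilation, found
by the intermediate value theorem, and multiplication by a constant; the dilations leave `J`
unchanged. The Euler-Lagrange equation of the profile (`euler`) is checked for test functions by
integrating along rays, and extended by density.
-/

noncomputable section

namespace HardySobolev

/-! ### The space `D^{1,2}`: test functions are dense, Sobolev's inequality, completeness -/

section Basic

variable {N : ℕ}

theorem IsTest.hasCompactSupport_gradient {φ : E N → ℝ} (h : IsTest φ) :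
    HasCompactSupport (∇ φ) := by
  have := h.2.fderiv (𝕜 := ℝ)
  exact this.comp_left (g := (InnerProductSpace.toDual ℝ (E N)).symm) (map_zero _)

theorem IsTest.memLp_gradient {φ : E N → ℝ} (h : IsTest φ) (p : ℝ≥0∞) : MemLp (∇ φ) p volume :=
  (continuous_gradient h.contDiff_one).memLp_of_hasCompactSupport h.hasCompactSupport_gradient

theorem IsTest.isTestLimit {φ : E N → ℝ} (h : IsTest φ) : IsTestLimit φ (∇ φ) :=
  ⟨fun _ => φ, fun _ => h, by simp, by simp⟩

theorem critExp_zero_pos (hN : 3 ≤ N) : 0 < critExp N 0 := by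
  have h3 : (3 : ℝ) ≤ N := by exact_mod_cast hN
  unfold critExp
  apply div_pos <;> linarith

variable [hN : Fact (3 ≤ N)]

/-- The element of `D^{1,2}` given by a function and its weak gradient. -/
def D12.ofLimit (u : E N → ℝ) (G : E N → E N) (hu : AEStronglyMeasurable u volume)
    (hG : MemLp G 2 volume) (h : IsTestLimit u G) : D12 N :=
  ⟨(AEEqFun.mk u hu, hG.toLp G),
    h.congr (AEEqFun.coeFn_mk u hu).symm hG.coeFn_toLp.symm⟩

theorem D12.coe_ofLimit {u : E N → ℝ} {G : E N → E N} (hu : AEStronglyMeasurable u volume)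
    (hG : MemLp G 2 volume) (h : IsTestLimit u G) : D12.ofLimit u G hu hG h =ᵐ[volume] u :=
  AEEqFun.coeFn_mk u hu

theorem D12.grad_ofLimit {u : E N → ℝ} {G : E N → E N} (hu : AEStronglyMeasurable u volume)
    (hG : MemLp G 2 volume) (h : IsTestLimit u G) :
    D12.grad N (D12.ofLimit u G hu hG h) = hG.toLp G := rfl

/-- A test function, as an element of `D^{1,2}`. -/
def IsTest.toD12 {φ : E N → ℝ} (h : IsTest φ) : D12 N :=
  D12.ofLimit φ (∇ φ) h.1.continuous.aestronglyMeasurable (h.memLp_gradient 2) h.isTestLimit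

theorem IsTest.coe_toD12 {φ : E N → ℝ} (h : IsTest φ) : h.toD12 =ᵐ[volume] φ :=
  D12.coe_ofLimit _ _ _

theorem IsTest.grad_toD12 {φ : E N → ℝ} (h : IsTest φ) :
    D12.grad N h.toD12 = (h.memLp_gradient 2).toLp (∇ φ) := rfl

theorem D12.norm_def (u : D12 N) : ‖u‖ = ‖D12.grad N u‖ := rfl

variable (N) in
/-- The gradient as an isometric embedding into `L^2`. -/
def D12.gradₗᵢ : D12 N →ₗᵢ[ℝ] Lp (E N) 2 (volume : Measure (E N)) :=
  ⟨D12.grad N, fun _ => rfl⟩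

theorem D12.aestronglyMeasurable (u : D12 N) : AEStronglyMeasurable u volume :=
  u.1.1.aestronglyMeasurable

theorem D12.isTestLimit (u : D12 N) : IsTestLimit u (D12.grad N u) := u.2

theorem D12.coe_add (u v : D12 N) : (u + v : D12 N) =ᵐ[volume] fun x => u x + v x :=
  AEEqFun.coeFn_add u.1.1 v.1.1

theorem D12.coe_sub (u v : D12 N) : (u - v : D12 N) =ᵐ[volume] fun x => u x - v x :=
  AEEqFun.coeFn_sub u.1.1 v.1.1

theorem D12.coe_smul (c : ℝ) (u : D12 N) : (c • u : D12 N) =ᵐ[volume] fun x => c * u x :=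
  AEEqFun.coeFn_smul c u.1.1

variable (N) in
theorem D12.coe_zero : (0 : D12 N) =ᵐ[volume] fun _ => 0 :=
  AEEqFun.coeFn_zero (α := E N) (β := ℝ)

theorem D12.ext_ae {u v : D12 N} (h : (u : E N → ℝ) =ᵐ[volume] v)
    (h' : D12.grad N u =ᵐ[volume] D12.grad N v) : u = v :=
  Subtype.ext (Prod.ext (AEEqFun.ext h) (Lp.ext h'))

/-- Every element of `D^{1,2}` is a limit of test functions. -/
theorem D12.exists_test_tendsto (u : D12 N) : ∃ (φ : ℕ → E N → ℝ) (hφ : ∀ n, IsTest (φ n)),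
    Tendsto (fun n => (hφ n).toD12) atTop (𝓝 u) := by
  obtain ⟨φ, h0, -, h2⟩ := u.isTestLimit
  refine ⟨φ, h0, ?_⟩
  rw [(D12.gradₗᵢ N).isometry.isEmbedding.tendsto_nhds_iff]
  rw [Lp.tendsto_Lp_iff_tendsto_eLpNorm']
  refine h2.congr fun n => eLpNorm_congr_ae ?_
  filter_upwards [((h0 n).memLp_gradient 2).coeFn_toLp] with x hx
  simp only [Pi.sub_apply, Function.comp]
  exact congrArg₂ _ hx.symm rfl

theorem D12.dense_test {P : D12 N → Prop} (hc : IsClosed {u | P u})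
    (h : ∀ φ (hφ : IsTest φ), P hφ.toD12) (u : D12 N) : P u := by
  obtain ⟨φ, h0, h1⟩ := u.exists_test_tendsto
  exact hc.mem_of_tendsto h1 (Eventually.of_forall fun n => h _ (h0 n))

theorem D12.eLpNorm_grad (u : D12 N) : eLpNorm (D12.grad N u) 2 volume = ENNReal.ofReal ‖u‖ := by
  rw [D12.norm_def, Lp.norm_def, ENNReal.ofReal_toReal (Lp.eLpNorm_ne_top _)]

variable (N) in
/-- Sobolev's inequality on `D^{1,2}`. -/
theorem D12.sobolev : ∃ C : ℝ≥0, ∀ u : D12 N,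
    eLpNorm u (ENNReal.ofReal (critExp N 0)) volume ≤ C * ENNReal.ofReal ‖u‖ := by
  obtain ⟨C, hC⟩ := sobolev_test hN.out
  have hp := one_le_critExp hN.out
  refine ⟨C, fun u => ?_⟩
  obtain ⟨φ, h0, h1, h2⟩ := u.isTestLimit
  have hum := u.aestronglyMeasurable
  have hGm := Lp.aestronglyMeasurable (D12.grad N u)
  have hs : Tendsto (fun n => C * (eLpNorm (fun x => ∇ (φ n) x - D12.grad N u x) 2 volume
      + ENNReal.ofReal ‖u‖) + eLpNorm (fun x => φ n x - u x) (ENNReal.ofReal (critExp N 0)) volume)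
      atTop (𝓝 (C * (0 + ENNReal.ofReal ‖u‖) + 0)) :=
    (ENNReal.Tendsto.const_mul (h2.add tendsto_const_nhds) (Or.inr ENNReal.coe_ne_top)).add h1
  rw [zero_add, add_zero] at hs
  refine ge_of_tendsto' hs fun n => ?_
  have hm := (h0 n).1.continuous.aestronglyMeasurable (μ := (volume : Measure (E N)))
  have hgm := (continuous_gradient (h0 n).contDiff_one).aestronglyMeasurable
    (μ := (volume : Measure (E N)))
  have e : (u : E N → ℝ) = φ n - fun x => φ n x - u x := by
    funext x; simp
  calc eLpNorm u (ENNReal.ofReal (critExp N 0)) volume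
      = eLpNorm (φ n - fun x => φ n x - u x) (ENNReal.ofReal (critExp N 0)) volume := by
        rw [← e]
    _ ≤ eLpNorm (φ n) (ENNReal.ofReal (critExp N 0)) volume + _ :=
        eLpNorm_sub_le hm (hm.sub hum) hp
    _ ≤ _ := by
        gcongr
        refine (hC (φ n) (h0 n).contDiff_one (h0 n).2).trans ?_
        gcongr
        have e : ∇ (φ n) = (fun x => ∇ (φ n) x - D12.grad N u x) + D12.grad N u := by
          funext x; simp
        rw [← D12.eLpNorm_grad]
        conv_lhs => rw [e]
        exact eLpNorm_add_le (hgm.sub hGm) hGm (by norm_num)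

theorem D12.memLp (u : D12 N) : MemLp u (ENNReal.ofReal (critExp N 0)) volume := by
  obtain ⟨C, hC⟩ := D12.sobolev N
  exact ⟨u.aestronglyMeasurable, (hC u).trans_lt
    (ENNReal.mul_lt_top ENNReal.coe_lt_top ENNReal.ofReal_lt_top)⟩

theorem D12.tendsto_eLpNorm {u : ℕ → D12 N} {v : D12 N} (h : Tendsto u atTop (𝓝 v)) :
    Tendsto (fun n => eLpNorm (fun x => u n x - v x) (ENNReal.ofReal (critExp N 0)) volume)
      atTop (𝓝 0) := by
  obtain ⟨C, hC⟩ := D12.sobolev N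
  have h1 : Tendsto (fun n => (C : ℝ≥0∞) * ENNReal.ofReal ‖u n - v‖) atTop (𝓝 0) := by
    have := ENNReal.Tendsto.const_mul (a := (C : ℝ≥0∞))
      (ENNReal.tendsto_ofReal (tendsto_iff_norm_sub_tendsto_zero.1 h)) (Or.inr ENNReal.coe_ne_top)
    simpa using this
  refine tendsto_of_tendsto_of_tendsto_of_le_of_le tendsto_const_nhds h1
    (fun n => zero_le) fun n => ?_
  rw [← eLpNorm_congr_ae (D12.coe_sub (u n) v)]
  exact hC _

/-- A convergent sequence of `D^{1,2}` has an almost everywhere convergent subsequence. -/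
theorem D12.exists_subseq_ae {u : ℕ → D12 N} {v : D12 N} (h : Tendsto u atTop (𝓝 v)) :
    ∃ ns : ℕ → ℕ, StrictMono ns ∧ ∀ᵐ x, Tendsto (fun k => u (ns k) x) atTop (𝓝 (v x)) := by
  refine (tendstoInMeasure_of_tendsto_eLpNorm (p := ENNReal.ofReal (critExp N 0)) ?_
    (fun n => (u n).aestronglyMeasurable) v.aestronglyMeasurable
    (D12.tendsto_eLpNorm h)).exists_seq_tendsto_ae
  exact (ENNReal.ofReal_pos.2 (critExp_zero_pos hN.out)).ne'

instance : CompleteSpace (D12 N) := by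
  refine Metric.complete_of_cauchySeq_tendsto fun u hu => ?_
  have hp := one_le_critExp hN.out
  have : Fact (1 ≤ ENNReal.ofReal (critExp N 0)) := ⟨hp⟩
  obtain ⟨C, hC⟩ := D12.sobolev N
  -- the gradients converge in `L^2`, the functions in `L^{2N/(N-2)}`
  obtain ⟨G, hG⟩ := cauchySeq_tendsto_of_complete
    ((D12.gradₗᵢ N).isometry.uniformContinuous.comp_cauchySeq hu)
  have hU : CauchySeq fun n => (u n).memLp.toLp (u n) := by
    rw [Metric.cauchySeq_iff'] at hu ⊢
    intro ε hε
    obtain ⟨n₀, hn⟩ := hu (ε / (C + 1)) (by positivity)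
    refine ⟨n₀, fun n hn' => ?_⟩
    rw [dist_eq_norm, ← MemLp.toLp_sub, Lp.norm_toLp]
    have h1 := hn n hn'
    rw [dist_eq_norm, lt_div_iff₀ (by positivity)] at h1
    have h2 := hC (u n - u n₀)
    rw [eLpNorm_congr_ae (D12.coe_sub (u n) (u n₀))] at h2
    have h3 : eLpNorm (⇑(u n) - ⇑(u n₀)) (ENNReal.ofReal (critExp N 0)) volume
        ≤ ENNReal.ofReal (C * ‖u n - u n₀‖) := by
      rw [ENNReal.ofReal_mul C.coe_nonneg, ENNReal.ofReal_coe_nnreal]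
      exact h2
    refine (ENNReal.toReal_le_of_le_ofReal (by positivity) h3).trans_lt ?_
    nlinarith [norm_nonneg (u n - u n₀)]
  obtain ⟨U, hU⟩ := cauchySeq_tendsto_of_complete hU
  rw [Lp.tendsto_Lp_iff_tendsto_eLpNorm'] at hU hG
  have hsel : ∀ n, ∃ φ, IsTest φ ∧
      eLpNorm (fun x => φ x - u n x) (ENNReal.ofReal (critExp N 0)) volume < ((n : ℝ≥0∞) + 1)⁻¹ ∧
      eLpNorm (fun x => ∇ φ x - D12.grad N (u n) x) 2 volume < ((n : ℝ≥0∞) + 1)⁻¹ := by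
    intro n
    obtain ⟨φ, h0, h1, h2⟩ := (u n).isTestLimit
    have hpos : (0 : ℝ≥0∞) < ((n : ℝ≥0∞) + 1)⁻¹ := by
      simp [ENNReal.add_eq_top]
    obtain ⟨k, hk⟩ := ((h1.eventually_lt_const hpos).and (h2.eventually_lt_const hpos)).exists
    exact ⟨φ k, h0 k, hk.1, hk.2⟩
  choose φ hφ h1 h2 using hsel
  have hinv : Tendsto (fun n : ℕ => ((n : ℝ≥0∞) + 1)⁻¹) atTop (𝓝 0) := by
    have := (tendsto_add_atTop_iff_nat 1).2 ENNReal.tendsto_inv_nat_nhds_zero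
    simpa using this
  have hlim : IsTestLimit U G := by
    refine ⟨φ, hφ, ?_, ?_⟩
    · have hs := hinv.add hU
      rw [add_zero] at hs
      refine tendsto_of_tendsto_of_tendsto_of_le_of_le tendsto_const_nhds hs
        (fun n => zero_le) fun n => ?_
      have e : (fun x => φ n x - U x) =ᵐ[volume] (fun x => φ n x - u n x)
          + (⇑((u n).memLp.toLp (u n)) - ⇑U) := by
        filter_upwards [(u n).memLp.coeFn_toLp] with x hx
        simp only [Pi.add_apply, Pi.sub_apply, hx]; ring
      simp only [eLpNorm_congr_ae e]
      refine (eLpNorm_add_le ((hφ n).1.continuous.aestronglyMeasurable.sub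
        (u n).aestronglyMeasurable) ((Lp.aestronglyMeasurable _).sub (Lp.aestronglyMeasurable _))
        hp).trans ?_
      gcongr
      exact (h1 n).le
    · have hs := hinv.add hG
      rw [add_zero] at hs
      refine tendsto_of_tendsto_of_tendsto_of_le_of_le tendsto_const_nhds hs
        (fun n => zero_le) fun n => ?_
      have e : (fun x => ∇ (φ n) x - G x) = (fun x => ∇ (φ n) x - D12.grad N (u n) x)
          + (⇑(D12.grad N (u n)) - ⇑G) := by
        funext x
        simp only [Pi.add_apply, Pi.sub_apply]; abel
      simp only [e]
      refine (eLpNorm_add_le ((continuous_gradient (hφ n).contDiff_one).aestronglyMeasurable.sub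
        (Lp.aestronglyMeasurable _)) ((Lp.aestronglyMeasurable _).sub (Lp.aestronglyMeasurable _))
        (by norm_num)).trans ?_
      gcongr
      · exact (h2 n).le
      · exact le_rfl
  refine ⟨D12.ofLimit U G (Lp.aestronglyMeasurable _) (Lp.memLp G) hlim, ?_⟩
  rw [(D12.gradₗᵢ N).isometry.isEmbedding.tendsto_nhds_iff]
  have : (D12.gradₗᵢ N) (D12.ofLimit U G (Lp.aestronglyMeasurable _) (Lp.memLp G) hlim) = G :=
    Lp.toLp_coeFn G (Lp.memLp G)
  rw [this, Lp.tendsto_Lp_iff_tendsto_eLpNorm']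
  exact hG

end Basic

/-! ### Integration in polar coordinates -/

section Polar

/-- The unit sphere of `ℝ^N`. -/
abbrev Sph (N : ℕ) : Type := Metric.sphere (0 : E N) 1

/-- The surface measure of the unit sphere. -/
abbrev sphMeas (N : ℕ) : Measure (Sph N) := (volume : Measure (E N)).toSphere

/-- The measure `r^n dr` on the half-line `(0, ∞)`, as a measure on `ℝ`. -/
def radMeas (n : ℕ) : Measure ℝ :=
  (volume.restrict (Set.Ioi 0)).withDensity fun r => ENNReal.ofReal (r ^ n)

theorem map_val_volumeIoiPow (n : ℕ) :
    (Measure.volumeIoiPow n).map Subtype.val = radMeas n := by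
  ext s hs
  rw [Measure.map_apply measurable_subtype_coe hs, Measure.volumeIoiPow,
    withDensity_apply _ (measurable_subtype_coe hs), radMeas, withDensity_apply _ hs,
    setLIntegral_subtype measurableSet_Ioi _ fun r : ℝ => ENNReal.ofReal (r ^ n),
    Subtype.image_preimage_coe, Measure.restrict_restrict hs, Set.inter_comm]

variable {N : ℕ}

theorem norm_sph (w : Sph N) : ‖(w : E N)‖ = 1 := by simp

theorem norm_smul_sph {r : ℝ} (hr : 0 ≤ r) (w : Sph N) : ‖r • (w : E N)‖ = r := by
  rw [norm_smul, norm_sph, mul_one, Real.norm_of_nonneg hr]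

theorem integrable_prod_of_continuous {k : Sph N → ℝ → ℝ} {R : ℝ}
    (hk : ContinuousOn (Function.uncurry k) (Set.univ ×ˢ Set.Icc 0 R)) :
    Integrable (Function.uncurry k) ((sphMeas N).prod (volume.restrict (Set.Ioc 0 R))) := by
  have h1 : IntegrableOn (Function.uncurry k) (Set.univ ×ˢ Set.Icc 0 R)
      ((sphMeas N).prod volume) :=
    hk.integrableOn_compact (isCompact_univ.prod isCompact_Icc)
  have h2 := h1.mono_set (Set.prod_mono_right (s := (Set.univ : Set (Sph N)))
    (Set.Ioc_subset_Icc_self (a := (0 : ℝ)) (b := R)))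
  rw [IntegrableOn, ← Measure.prod_restrict, Measure.restrict_univ] at h2
  exact h2

variable [hN : Fact (3 ≤ N)]

/-- Polar coordinates preserve the measure. -/
theorem measurePreserving_polar :
    MeasurePreserving (fun q : Sph N × ℝ => q.2 • (q.1 : E N))
      ((sphMeas N).prod (radMeas (N - 1))) volume := by
  have hT : Measurable fun q : Sph N × ℝ => q.2 • (q.1 : E N) := by fun_prop
  refine ⟨hT, ?_⟩
  have h1 : MeasurePreserving (Prod.map (id : Sph N → Sph N) (Subtype.val : Set.Ioi (0 : ℝ) → ℝ))
      ((sphMeas N).prod (Measure.volumeIoiPow (N - 1))) ((sphMeas N).prod (radMeas (N - 1))) :=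
    (MeasurePreserving.id _).prod ⟨measurable_subtype_coe, map_val_volumeIoiPow _⟩
  have h2 := (volume : Measure (E N)).measurePreserving_homeomorphUnitSphereProd
  rw [finrank_euclideanSpace, Fintype.card_fin] at h2
  have h3 : MeasurePreserving (Subtype.val : ({0}ᶜ : Set (E N)) → E N)
      (Measure.comap Subtype.val volume) (volume.restrict {0}ᶜ) :=
    measurePreserving_subtype_coe (measurableSet_singleton _).compl
  have : Nontrivial (E N) := by
    have : Nonempty (Fin N) := ⟨⟨0, by have := hN.out; omega⟩⟩
    infer_instance
  rw [restrict_compl_singleton] at h3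
  have h4 := h2.symm (homeomorphUnitSphereProd (E N)).toMeasurableEquiv
  rw [← h1.map_eq, Measure.map_map hT h1.measurable, ← (h3.comp h4).map_eq]
  congr 1

theorem integrable_iff_polar {f : E N → ℝ} (hf : AEStronglyMeasurable f volume) :
    Integrable f ↔ Integrable (fun q : Sph N × ℝ => q.2 ^ (N - 1) * f (q.2 • (q.1 : E N)))
      ((sphMeas N).prod (volume.restrict (Set.Ioi 0))) := by
  rw [← measurePreserving_polar.integrable_comp hf, radMeas, prod_withDensity_right (by fun_prop),
    integrable_withDensity_iff_integrable_smul' (by fun_prop) (by simp)]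
  refine integrable_congr ?_
  have : ∀ᵐ q : Sph N × ℝ ∂((sphMeas N).prod (volume.restrict (Set.Ioi 0))), 0 < q.2 :=
    Measure.quasiMeasurePreserving_snd.ae (ae_restrict_mem measurableSet_Ioi)
  filter_upwards [this] with q hq
  rw [ENNReal.toReal_ofReal (by positivity)]
  rfl

theorem integral_polar {f : E N → ℝ} (hf : AEStronglyMeasurable f volume) :
    ∫ x, f x = ∫ q : Sph N × ℝ, q.2 ^ (N - 1) * f (q.2 • (q.1 : E N))
      ∂((sphMeas N).prod (volume.restrict (Set.Ioi 0))) := by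
  have h := measurePreserving_polar (N := N)
  rw [← h.map_eq, integral_map h.measurable.aemeasurable (by rwa [h.map_eq]), radMeas,
    prod_withDensity_right (by fun_prop),
    integral_withDensity_eq_integral_toReal_smul (by fun_prop) (by simp)]
  refine integral_congr_ae ?_
  have : ∀ᵐ q : Sph N × ℝ ∂((sphMeas N).prod (volume.restrict (Set.Ioi 0))), 0 < q.2 :=
    Measure.quasiMeasurePreserving_snd.ae (ae_restrict_mem measurableSet_Ioi)
  filter_upwards [this] with q hq
  rw [ENNReal.toReal_ofReal (by positivity)]
  rfl

/-- A function supported in a ball whose product with the Jacobian `r^{N-1}` extends continuously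
to `r = 0` is integrable, and can be integrated along the rays. -/
theorem integral_polar_of_continuous {f : E N → ℝ} {k : Sph N → ℝ → ℝ} {R : ℝ} (hR : 0 ≤ R)
    (hf : AEStronglyMeasurable f volume)
    (hk : ContinuousOn (Function.uncurry k) (Set.univ ×ˢ Set.Icc 0 R))
    (hfk : ∀ (w : Sph N) (r : ℝ), 0 < r → r ≤ R → r ^ (N - 1) * f (r • (w : E N)) = k w r)
    (h0 : ∀ x, R < ‖x‖ → f x = 0) :
    Integrable f ∧ ∫ x, f x = ∫ w : Sph N, ∫ r in (0 : ℝ)..R, k w r ∂volume ∂(sphMeas N) := by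
  have hi := integrable_prod_of_continuous hk
  have hsplit : ((sphMeas N).prod (volume.restrict (Set.Ioi (0 : ℝ)))).restrict
      (Set.univ ×ˢ Set.Ioc 0 R) = (sphMeas N).prod (volume.restrict (Set.Ioc 0 R)) := by
    rw [← Measure.prod_restrict, Measure.restrict_univ, Measure.restrict_restrict measurableSet_Ioc]
    congr 2
    exact Set.inter_eq_left.2 Set.Ioc_subset_Ioi_self
  have hms : MeasurableSet ((Set.univ : Set (Sph N)) ×ˢ Set.Ioc (0 : ℝ) R) :=
    MeasurableSet.univ.prod measurableSet_Ioc
  have hae : (fun q : Sph N × ℝ => q.2 ^ (N - 1) * f (q.2 • (q.1 : E N)))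
      =ᵐ[(sphMeas N).prod (volume.restrict (Set.Ioi 0))]
      (Set.univ ×ˢ Set.Ioc 0 R).indicator (Function.uncurry k) := by
    have : ∀ᵐ q : Sph N × ℝ ∂((sphMeas N).prod (volume.restrict (Set.Ioi 0))), 0 < q.2 :=
      Measure.quasiMeasurePreserving_snd.ae (ae_restrict_mem measurableSet_Ioi)
    filter_upwards [this] with q hq
    by_cases hqR : q.2 ≤ R
    · rw [Set.indicator_of_mem (by simp [hq, hqR])]
      exact hfk q.1 q.2 hq hqR
    · rw [Set.indicator_of_notMem (by simp [hqR]), h0 _ (by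
        rw [norm_smul_sph hq.le]; exact not_le.1 hqR), mul_zero]
  refine ⟨?_, ?_⟩
  · rw [integrable_iff_polar hf, integrable_congr hae, integrable_indicator_iff hms, IntegrableOn,
      hsplit]
    exact hi
  · rw [integral_polar hf, integral_congr_ae hae, integral_indicator hms, hsplit, integral_prod _ hi]
    simp only [intervalIntegral.integral_of_le hR]
    rfl

theorem integrable_radial_iff {g : ℝ → ℝ} :
    Integrable (fun x : E N => g ‖x‖) ↔ IntegrableOn (fun r => r ^ (N - 1) * g r) (Set.Ioi 0) := by
  have : Nontrivial (E N) := by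
    have : Nonempty (Fin N) := ⟨⟨0, by have := hN.out; omega⟩⟩
    infer_instance
  have h := integrable_fun_norm_addHaar (volume : Measure (E N)) (f := g)
  simpa using h

theorem sphMeas_pos : 0 < (sphMeas N).real Set.univ := by
  have : Nontrivial (E N) := by
    have : Nonempty (Fin N) := ⟨⟨0, by have := hN.out; omega⟩⟩
    infer_instance
  exact ENNReal.toReal_pos (by simp [-Measure.toSphere_apply_univ]) (measure_ne_top _ _)

end Polar

/-! ### One-dimensional inequalities along rays -/

section Ray

/-- The function `tanh (κ log r)`, written so that it extends continuously to `r = 0`. -/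
def logTanh (κ r : ℝ) : ℝ := (r ^ (2 * κ) - 1) / (r ^ (2 * κ) + 1)

theorem continuousOn_logTanh {κ : ℝ} (hκ : 0 < κ) : ContinuousOn (logTanh κ) (Set.Ici 0) := by
  have h := Real.continuous_rpow_const (q := 2 * κ) (by positivity)
  refine ContinuousOn.div (by fun_prop) (by fun_prop) fun r hr => ?_
  have := Real.rpow_nonneg (Set.mem_Ici.1 hr) (2 * κ)
  positivity

theorem hasDerivAt_logTanh (κ : ℝ) {r : ℝ} (hr : 0 < r) :
    HasDerivAt (logTanh κ) (κ * (1 - logTanh κ r ^ 2) / r) r := by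
  have h1 : HasDerivAt (fun r : ℝ => r ^ (2 * κ)) (2 * κ * r ^ (2 * κ - 1)) r :=
    Real.hasDerivAt_rpow_const (Or.inl hr.ne')
  have hp := Real.rpow_pos_of_pos hr (2 * κ)
  have h2 := (h1.sub_const 1).div (h1.add_const 1) (by positivity)
  refine h2.congr_deriv ?_
  rw [Real.rpow_sub hr, Real.rpow_one, logTanh]
  field_simp
  ring

theorem logTanh_lt_one (κ : ℝ) {r : ℝ} (hr : 0 ≤ r) : logTanh κ r < 1 := by
  have := Real.rpow_nonneg hr (2 * κ)
  rw [logTanh, div_lt_one (by positivity)]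
  linarith

theorem neg_one_le_logTanh (κ : ℝ) {r : ℝ} (hr : 0 ≤ r) : -1 ≤ logTanh κ r := by
  have := Real.rpow_nonneg hr (2 * κ)
  rw [logTanh, le_div_iff₀ (by positivity)]
  linarith

theorem logTanh_one (κ : ℝ) : logTanh κ 1 = 0 := by simp [logTanh]

theorem logTanh_mono {κ : ℝ} (hκ : 0 < κ) {a b : ℝ} (ha : 0 ≤ a) (hab : a ≤ b) :
    logTanh κ a ≤ logTanh κ b := by
  have h1 := Real.rpow_nonneg ha (2 * κ)
  have h2 := Real.rpow_le_rpow ha hab (z := 2 * κ) (by positivity)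
  rw [logTanh, logTanh, div_le_div_iff₀ (by positivity) (by linarith)]
  nlinarith

theorem logTanh_pos {κ : ℝ} (hκ : 0 < κ) {r : ℝ} (hr : 1 < r) : 0 < logTanh κ r := by
  have h2 := Real.one_lt_rpow hr (z := 2 * κ) (by positivity)
  exact div_pos (by linarith) (by linarith)

theorem logTanh_inv (κ : ℝ) {r : ℝ} (hr : 0 < r) : logTanh κ r⁻¹ = -logTanh κ r := by
  have hp := Real.rpow_pos_of_pos hr (2 * κ)
  rw [logTanh, logTanh, Real.inv_rpow hr.le]
  field_simp
  ring

/-- A weighted Hardy inequality on an interval: a solution `G` of the Riccati inequality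
`q ≤ -(N-2) G - r G' - G^2` (here `G'` stands for `r` times the derivative of `G`) gives
`∫ q c² r^{N-3} ≤ ∫ c'² r^{N-1}` for functions `c` vanishing at the end points, the end point `0`
being exempt. -/
theorem ray_inequality {N : ℕ} (hN : 3 ≤ N) {c c' G G' q : ℝ → ℝ} {a b : ℝ} (ha : 0 ≤ a)
    (hab : a ≤ b) (hc : ∀ r ∈ Set.Icc a b, HasDerivAt c (c' r) r)
    (hc' : ContinuousOn c' (Set.Icc a b)) (hG : ContinuousOn G (Set.Icc a b))
    (hG' : ∀ r ∈ Set.Ioo a b, HasDerivAt G (G' r / r) r) (hq : ContinuousOn q (Set.Icc a b))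
    (hqG : ∀ r ∈ Set.Ioo a b, q r ≤ -((N : ℝ) - 2) * G r - G' r - G r ^ 2)
    (ha0 : a = 0 ∨ c a = 0) (hb0 : c b = 0) :
    ∫ r in a..b, q r * c r ^ 2 * r ^ (N - 3) ≤ ∫ r in a..b, c' r ^ 2 * r ^ (N - 1) := by
  obtain ⟨n, rfl⟩ : ∃ n, N = n + 3 := ⟨N - 3, by omega⟩
  have hcc : ContinuousOn c (Set.Icc a b) := fun r hr => (hc r hr).continuousAt.continuousWithinAt
  have i1 : ContinuousOn (fun r => c' r ^ 2 * r ^ (n + 2)) (Set.Icc a b) := by fun_prop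
  have i2 : ContinuousOn (fun r => q r * c r ^ 2 * r ^ n) (Set.Icc a b) := by fun_prop
  have key := intervalIntegral.sub_le_integral_of_hasDeriv_right_of_le
    (g := fun r => c r ^ 2 * G r * r ^ (n + 1))
    (g' := fun r => (2 * c r * c' r * G r + c r ^ 2 * (G' r / r)) * r ^ (n + 1)
      + c r ^ 2 * G r * ((n + 1) * r ^ n))
    (φ := fun r => c' r ^ 2 * r ^ (n + 2) - q r * c r ^ 2 * r ^ n) hab (by fun_prop)
    (fun r hr => ?_) ((i1.sub i2).integrableOn_compact isCompact_Icc) (fun r hr => ?_)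
  · have e1 : c a ^ 2 * G a * a ^ (n + 1) = 0 := by
      rcases ha0 with h | h <;> simp [h]
    rw [hb0, e1, intervalIntegral.integral_sub (i1.intervalIntegrable_of_Icc hab)
      (i2.intervalIntegrable_of_Icc hab)] at key
    simp only [Nat.add_sub_cancel, show n + 3 - 1 = n + 2 from rfl]
    linarith
  · have h1 := hc r (Set.Ioo_subset_Icc_self hr)
    have h2 := hG' r hr
    refine HasDerivAt.hasDerivWithinAt ?_
    refine (((h1.pow 2).mul h2).mul (hasDerivAt_pow (n + 1) r)).congr_deriv ?_
    push_cast
    simp only [Pi.mul_apply, Pi.pow_apply]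
    ring
  · have hr0 : 0 < r := ha.trans_lt hr.1
    have h1 := hqG r hr
    push_cast at h1
    have hp : 0 ≤ r ^ n := by positivity
    have e : (2 * c r * c' r * G r + c r ^ 2 * (G' r / r)) * r ^ (n + 1)
      + c r ^ 2 * G r * ((n + 1) * r ^ n) = r ^ n * (2 * c r * (c' r * r) * G r + c r ^ 2 * G' r
        + c r ^ 2 * G r * (n + 1)) := by
      field_simp
      ring
    have e2 : c' r ^ 2 * r ^ (n + 2) - q r * c r ^ 2 * r ^ n
      = r ^ n * ((c' r * r) ^ 2 - q r * c r ^ 2) := by ring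
    simp only [e, e2]
    refine mul_le_mul_of_nonneg_left ?_ hp
    nlinarith [sq_nonneg (c' r * r - c r * G r), mul_le_mul_of_nonneg_left h1 (sq_nonneg (c r))]

/-- The weighted Hardy inequality with `G = -(N-2)/2 + κ g(tanh (κ log r))`. -/
theorem ray_inequality_logTanh {N : ℕ} (hN : 3 ≤ N) {κ : ℝ} (hκ : 0 < κ) {c c' g g' q : ℝ → ℝ}
    {a b : ℝ} (ha : 0 ≤ a)
    (hab : a ≤ b) (hc : ∀ r ∈ Set.Icc a b, HasDerivAt c (c' r) r)
    (hc' : ContinuousOn c' (Set.Icc a b))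
    (hg : ∀ r ∈ Set.Icc a b, HasDerivAt g (g' (logTanh κ r)) (logTanh κ r))
    (hq : ContinuousOn q (Set.Icc a b))
    (hqG : ∀ r ∈ Set.Ioo a b, q r ≤ hardyConst N - κ ^ 2 * (g (logTanh κ r) ^ 2
      + (1 - logTanh κ r ^ 2) * g' (logTanh κ r)))
    (ha0 : a = 0 ∨ c a = 0) (hb0 : c b = 0) :
    ∫ r in a..b, q r * c r ^ 2 * r ^ (N - 3) ≤ ∫ r in a..b, c' r ^ 2 * r ^ (N - 1) := by
  have hsub : Set.Icc a b ⊆ Set.Ici 0 := fun r hr => ha.trans hr.1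
  refine ray_inequality hN (G := fun r => -(((N : ℝ) - 2) / 2) + κ * g (logTanh κ r))
    (G' := fun r => κ * (g' (logTanh κ r) * (κ * (1 - logTanh κ r ^ 2))))
    ha hab hc hc' ?_ ?_ hq ?_ ha0 hb0
  · have hgc : ContinuousOn (fun r => g (logTanh κ r)) (Set.Icc a b) := fun r hr =>
      (hg r hr).continuousAt.comp_continuousWithinAt
        ((continuousOn_logTanh hκ).mono hsub r hr)
    exact (continuousOn_const.mul hgc).const_add _
  · intro r hr
    have hr0 : 0 < r := ha.trans_lt hr.1
    have h1 := (hg r (Set.Ioo_subset_Icc_self hr)).comp r (hasDerivAt_logTanh κ hr0)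
    refine ((h1.const_mul κ).const_add _).congr_deriv ?_
    ring
  · intro r hr
    refine (hqG r hr).trans (le_of_eq ?_)
    unfold hardyConst
    ring

end Ray

/-! ### Hardy's inequality and the embeddings of `D^{1,2}` -/

section Hardy

variable {N : ℕ}

theorem integrable_integral_ray {k : Sph N → ℝ → ℝ} {R : ℝ} (hR : 0 ≤ R)
    (hk : ContinuousOn (Function.uncurry k) (Set.univ ×ˢ Set.Icc 0 R)) :
    Integrable (fun w => ∫ r in (0 : ℝ)..R, k w r) (sphMeas N) := by
  have := (integrable_prod_of_continuous hk).integral_prod_left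
  simp only [intervalIntegral.integral_of_le hR]
  exact this

theorem IsTest.exists_radius {φ : E N → ℝ} (h : IsTest φ) :
    ∃ R > 0, ∀ x, R ≤ ‖x‖ → φ x = 0 ∧ ∇ φ x = 0 := by
  obtain ⟨R, hR, hsub⟩ := h.2.isCompact.isBounded.subset_ball_lt 0 (0 : E N)
  refine ⟨R, hR, fun x hx => ?_⟩
  have hx' : x ∉ tsupport φ := fun hm => by
    have := hsub hm
    rw [mem_ball_zero_iff] at this
    linarith
  refine ⟨image_eq_zero_of_notMem_tsupport hx', ?_⟩
  have := image_eq_zero_of_notMem_tsupport (f := fderiv ℝ φ)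
    (fun hm => hx' (tsupport_fderiv_subset ℝ hm))
  simp [gradient, this]

theorem hasDerivAt_ray {φ : E N → ℝ} {x : E N} {r : ℝ} (h : DifferentiableAt ℝ φ (r • x)) :
    HasDerivAt (fun r : ℝ => φ (r • x)) (inner ℝ (∇ φ (r • x)) x) r := by
  have h1 : HasDerivAt (fun r : ℝ => r • x) x r := by
    simpa using (hasDerivAt_id r).smul_const x
  have h2 := h.hasGradientAt.hasFDerivAt.comp_hasDerivAt r h1
  exact h2

theorem norm_sq_eq_integral {F : Type*} [NormedAddCommGroup F] [InnerProductSpace ℝ F]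
    (f : Lp F 2 (volume : Measure (E N))) : ‖f‖ ^ 2 = ∫ x, ‖f x‖ ^ 2 := by
  rw [← real_inner_self_eq_norm_sq, L2.inner_def]
  simp

variable [hN : Fact (3 ≤ N)]

theorem hardyConst_pos : 0 < hardyConst N := by
  have h3 : (3 : ℝ) ≤ N := by exact_mod_cast hN.out
  unfold hardyConst
  have : 0 < (N : ℝ) - 2 := by linarith
  positivity

theorem pow_split {r : ℝ} (hr : r ≠ 0) (y : ℝ) : r ^ (N - 1) * (y / r ^ 2) = y * r ^ (N - 3) := by
  obtain ⟨n, rfl⟩ : ∃ n, N = n + 3 := ⟨N - 3, by have := hN.out; omega⟩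
  simp only [Nat.add_sub_cancel, show n + 3 - 1 = n + 2 from rfl]
  field_simp
  ring

/-- Hardy's inequality for test functions. -/
theorem IsTest.hardy {φ : E N → ℝ} (h : IsTest φ) :
    Integrable (fun x => φ x ^ 2 / ‖x‖ ^ 2) ∧
      hardyConst N * ∫ x, φ x ^ 2 / ‖x‖ ^ 2 ≤ ∫ x, ‖∇ φ x‖ ^ 2 := by
  obtain ⟨R, hR, h0⟩ := h.exists_radius
  have hφ := h.1.continuous
  have hg := continuous_gradient h.contDiff_one
  have h1 := integral_polar_of_continuous (N := N) (f := fun x => φ x ^ 2 / ‖x‖ ^ 2)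
    (k := fun w r => φ (r • (w : E N)) ^ 2 * r ^ (N - 3)) hR.le
    (by
      refine Measurable.aestronglyMeasurable ?_
      have := hφ.measurable
      fun_prop)
    (by
      apply Continuous.continuousOn
      unfold Function.uncurry
      fun_prop)
    (fun w r hr _ => by
      rw [norm_smul_sph hr.le, pow_split hr.ne'])
    (fun x hx => by simp [(h0 x hx.le).1])
  have h2 := integral_polar_of_continuous (N := N) (f := fun x => ‖∇ φ x‖ ^ 2)
    (k := fun w r => ‖∇ φ (r • (w : E N))‖ ^ 2 * r ^ (N - 1)) hR.le
    (by fun_prop)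
    (by
      apply Continuous.continuousOn
      unfold Function.uncurry
      fun_prop)
    (fun w r hr _ => by ring)
    (fun x hx => by simp [(h0 x hx.le).2])
  refine ⟨h1.1, ?_⟩
  rw [h1.2, h2.2, ← integral_const_mul]
  refine integral_mono ?_ ?_ fun w => ?_
  · refine Integrable.const_mul (integrable_integral_ray hR.le ?_) _
    apply Continuous.continuousOn
    unfold Function.uncurry
    fun_prop
  · refine integrable_integral_ray hR.le ?_
    apply Continuous.continuousOn
    unfold Function.uncurry
    fun_prop
  · simp only
    rw [← intervalIntegral.integral_const_mul]
    have h3 := ray_inequality_logTanh hN.out (κ := 1) one_pos (c := fun r => φ (r • (w : E N)))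
      (c' := fun r => inner ℝ (∇ φ (r • (w : E N))) (w : E N)) (g := fun _ => 0) (g' := fun _ => 0)
      (q := fun _ => hardyConst N) (a := 0) (b := R) le_rfl hR.le
      (fun r _ => hasDerivAt_ray (h.contDiff_one.differentiable (by simp) _))
      (by fun_prop) (fun _ _ => hasDerivAt_const _ _) continuousOn_const
      (fun _ _ => by simp) (Or.inl rfl) (h0 _ (norm_smul_sph hR.le w).ge).1
    simp only [← mul_assoc]
    refine h3.trans ?_
    refine intervalIntegral.integral_mono_on hR.le ?_ ?_ fun r hr => ?_
    · exact (by fun_prop : Continuous fun r : ℝ =>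
        (inner ℝ (∇ φ (r • (w : E N))) (w : E N)) ^ 2 * r ^ (N - 1)).intervalIntegrable _ _
    · exact (by fun_prop : Continuous fun r : ℝ =>
        ‖∇ φ (r • (w : E N))‖ ^ 2 * r ^ (N - 1)).intervalIntegrable _ _
    · refine mul_le_mul_of_nonneg_right ?_ (pow_nonneg hr.1 _)
      have := abs_real_inner_le_norm (∇ φ (r • (w : E N))) (w : E N)
      rw [norm_sph, mul_one] at this
      exact sq_le_sq' (by linarith [neg_abs_le (inner ℝ (∇ φ (r • (w : E N))) (w : E N))])
        (by linarith [le_abs_self (inner ℝ (∇ φ (r • (w : E N))) (w : E N))])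

theorem D12.hardy_eLpNorm (u : D12 N) : eLpNorm (fun x => u x / ‖x‖) 2 volume
    ≤ ENNReal.ofReal ((√(hardyConst N))⁻¹ * ‖u‖) := by
  obtain ⟨φ, h0, h1⟩ := u.exists_test_tendsto
  obtain ⟨ns, hns, hae⟩ := D12.exists_subseq_ae h1
  have hL := hardyConst_pos (N := N)
  have hm : ∀ φ, IsTest φ → AEStronglyMeasurable (fun x : E N => φ x / ‖x‖) volume := fun φ hφ =>
    (hφ.1.continuous.measurable.div measurable_norm).aestronglyMeasurable
  have hle : ∀ φ (hφ : IsTest φ), eLpNorm (fun x : E N => φ x / ‖x‖) 2 volume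
      ≤ ENNReal.ofReal ((√(hardyConst N))⁻¹ * ‖hφ.toD12‖) := by
    intro φ hφ
    obtain ⟨hi, hh⟩ := hφ.hardy
    have e1 : eLpNorm (∇ φ) 2 volume = ENNReal.ofReal ‖hφ.toD12‖ := by
      rw [← D12.eLpNorm_grad, hφ.grad_toD12]
      exact eLpNorm_congr_ae (hφ.memLp_gradient 2).coeFn_toLp.symm
    have e2 : MemLp (fun x : E N => φ x / ‖x‖) 2 volume := by
      rw [memLp_two_iff_integrable_sq (hm φ hφ)]
      simpa only [div_pow] using hi
    rw [MemLp.eLpNorm_eq_integral_rpow_norm (by norm_num) (by norm_num)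
      (hφ.memLp_gradient 2)] at e1
    rw [MemLp.eLpNorm_eq_integral_rpow_norm (by norm_num) (by norm_num) e2]
    rw [ENNReal.ofReal_eq_ofReal_iff (by positivity) (norm_nonneg _)] at e1
    rw [← e1]
    apply ENNReal.ofReal_le_ofReal
    simp only [ENNReal.toReal_ofNat, Real.rpow_two, Real.norm_eq_abs, sq_abs, div_pow,
      ← one_div, ← Real.sqrt_eq_rpow]
    rw [one_div_mul_eq_div, le_div_iff₀ (Real.sqrt_pos.2 hL), ← Real.sqrt_mul (by positivity)]
    apply Real.sqrt_le_sqrt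
    linarith
  have h2 : ∀ᵐ x : E N, ∀ k, (h0 k).toD12 x = φ k x := ae_all_iff.2 fun k => (h0 k).coe_toD12
  have h3 : ∀ᵐ x : E N, Tendsto (fun k => φ (ns k) x / ‖x‖) atTop (𝓝 (u x / ‖x‖)) := by
    filter_upwards [hae, h2] with x hx hx2
    simp only [hx2] at hx
    exact hx.div_const _
  have h4 := Lp.eLpNorm_lim_le_liminf_eLpNorm (p := 2) (fun k => hm _ (h0 (ns k))) _ h3
  refine h4.trans ?_
  have h5 : Tendsto (fun k => ENNReal.ofReal ((√(hardyConst N))⁻¹ * ‖(h0 (ns k)).toD12‖)) atTop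
      (𝓝 (ENNReal.ofReal ((√(hardyConst N))⁻¹ * ‖u‖))) :=
    ENNReal.tendsto_ofReal (((h1.comp hns.tendsto_atTop).norm).const_mul _)
  rw [← h5.liminf_eq]
  exact liminf_le_liminf (Eventually.of_forall fun k => hle _ _)

theorem D12.memLp_div_norm (u : D12 N) : MemLp (fun x => u x / ‖x‖) 2 volume :=
  ⟨(u.aestronglyMeasurable.aemeasurable.div measurable_norm.aemeasurable).aestronglyMeasurable,
    u.hardy_eLpNorm.trans_lt ENNReal.ofReal_lt_top⟩

variable (N) in
/-- The map `u ↦ u / |x|` from `D^{1,2}` to `L^2`, bounded by Hardy's inequality. -/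
def hardyMap : D12 N →L[ℝ] Lp ℝ 2 (volume : Measure (E N)) :=
  LinearMap.mkContinuous
    { toFun := fun u => u.memLp_div_norm.toLp _
      map_add' := fun u v => by
        rw [← MemLp.toLp_add]
        apply MemLp.toLp_congr
        filter_upwards [D12.coe_add u v] with x hx
        simp only [Pi.add_apply, hx, add_div]
      map_smul' := fun c u => by
        rw [RingHom.id_apply, ← MemLp.toLp_const_smul]
        apply MemLp.toLp_congr
        filter_upwards [D12.coe_smul c u] with x hx
        simp only [Pi.smul_apply, hx, smul_eq_mul, mul_div_assoc] }
    (√(hardyConst N))⁻¹ fun u => by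
      simp only [LinearMap.coe_mk, AddHom.coe_mk, Lp.norm_toLp]
      exact ENNReal.toReal_le_of_le_ofReal (by positivity) u.hardy_eLpNorm

theorem coe_hardyMap (u : D12 N) : hardyMap N u =ᵐ[volume] fun x => u x / ‖x‖ :=
  u.memLp_div_norm.coeFn_toLp

/-- Hardy's inequality on `D^{1,2}`. -/
theorem hardy_inequality (u : D12 N) : hardyConst N * ‖hardyMap N u‖ ^ 2 ≤ ‖u‖ ^ 2 := by
  have hL := hardyConst_pos (N := N)
  have h : ‖hardyMap N u‖ ≤ (√(hardyConst N))⁻¹ * ‖u‖ :=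
    by
      have := ENNReal.toReal_le_of_le_ofReal (by positivity) u.hardy_eLpNorm
      rwa [← Lp.norm_toLp _ u.memLp_div_norm] at this
  have hs := Real.sqrt_pos.2 hL
  rw [inv_mul_eq_div, le_div_iff₀ hs] at h
  calc hardyConst N * ‖hardyMap N u‖ ^ 2 = (‖hardyMap N u‖ * √(hardyConst N)) ^ 2 := by
        rw [mul_pow, Real.sq_sqrt hL.le, mul_comm]
    _ ≤ ‖u‖ ^ 2 := by gcongr

theorem hardyMap_norm_sq (u : D12 N) : ‖hardyMap N u‖ ^ 2 = ∫ x, u x ^ 2 / ‖x‖ ^ 2 := by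
  rw [norm_sq_eq_integral]
  refine integral_congr_ae ?_
  filter_upwards [coe_hardyMap u] with x hx
  rw [hx, Real.norm_eq_abs, sq_abs, div_pow]

theorem D12.integrable_div_norm_sq (u : D12 N) : Integrable fun x => u x ^ 2 / ‖x‖ ^ 2 := by
  have := u.memLp_div_norm.integrable_sq
  simpa only [div_pow] using this

theorem normSq_eq (lam : ℝ) (u : D12 N) :
    normSq lam u = ‖u‖ ^ 2 - lam * ‖hardyMap N u‖ ^ 2 := by
  rw [hardyMap_norm_sq, D12.norm_def, norm_sq_eq_integral, normSq]

theorem normSq_smul (lam t : ℝ) (u : D12 N) : normSq lam (t • u) = t ^ 2 * normSq lam u := by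
  simp only [normSq_eq, map_smul, norm_smul, mul_pow, Real.norm_eq_abs, sq_abs]
  ring

theorem continuous_normSq (lam : ℝ) : Continuous (normSq (N := N) lam) := by
  have : normSq (N := N) lam = fun u => ‖u‖ ^ 2 - lam * ‖hardyMap N u‖ ^ 2 :=
    funext (normSq_eq lam)
  rw [this]; fun_prop

/-- For `λ < Λ_N` the form `‖u‖_λ^2` is equivalent to the squared norm. -/
theorem normSq_coercive {lam : ℝ} (h0 : 0 ≤ lam) (u : D12 N) :
    (1 - lam / hardyConst N) * ‖u‖ ^ 2 ≤ normSq lam u := by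
  have hL := hardyConst_pos (N := N)
  have h1 := mul_le_mul_of_nonneg_left (hardy_inequality u) (div_nonneg h0 hL.le)
  rw [normSq_eq]
  have e : lam / hardyConst N * (hardyConst N * ‖hardyMap N u‖ ^ 2)
      = lam * ‖hardyMap N u‖ ^ 2 := by field_simp
  nlinarith

theorem normSq_le {lam : ℝ} (h0 : 0 ≤ lam) (u : D12 N) : normSq lam u ≤ ‖u‖ ^ 2 := by
  rw [normSq_eq]
  nlinarith [sq_nonneg ‖hardyMap N u‖]

/-! ### The critical integral -/

theorem two_lt_critExp {s : ℝ} (hs : s < 2) : 2 < critExp N s := by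
  have h3 : (3 : ℝ) ≤ N := by exact_mod_cast hN.out
  unfold critExp
  rw [lt_div_iff₀ (by linarith)]
  linarith

theorem critExp_zero_rpow_integrable (u : D12 N) : Integrable fun x => |u x| ^ critExp N 0 := by
  have h := critExp_zero_pos hN.out
  have := u.memLp.integrable_norm_rpow (by simpa using h) (by simp)
  rw [ENNReal.toReal_ofReal h.le] at this
  exact this

/-- The interpolation `|u|^{2*_s} / |x|^s = (u²/|x|²)^{s/2} (|u|^{2*})^{1-s/2}`, followed by
Young's inequality. -/
theorem crit_pointwise {s : ℝ} (hs : 0 < s) (hs2 : s < 2) (y : ℝ) {r : ℝ} (hr : 0 ≤ r) :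
    |y| ^ critExp N s / r ^ s ≤ y ^ 2 / r ^ 2 + |y| ^ critExp N 0 := by
  have h3 : (3 : ℝ) ≤ N := by exact_mod_cast hN.out
  have ha : 0 ≤ y ^ 2 / r ^ 2 := by positivity
  have hb : 0 ≤ |y| ^ critExp N 0 := by positivity
  have h1 := Real.geom_mean_le_arith_mean2_weighted (w₁ := s / 2) (w₂ := 1 - s / 2)
    (p₁ := y ^ 2 / r ^ 2) (p₂ := |y| ^ critExp N 0) (by linarith) (by linarith) ha hb (by ring)
  have e : (y ^ 2 / r ^ 2) ^ (s / 2) * (|y| ^ critExp N 0) ^ (1 - s / 2)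
      = |y| ^ critExp N s / r ^ s := by
    rw [← sq_abs y, ← div_pow, ← Real.rpow_natCast, ← Real.rpow_mul (by positivity),
      ← Real.rpow_mul (by positivity), Real.div_rpow (by positivity) hr]
    have e1 : ((2 : ℕ) : ℝ) * (s / 2) = s := by push_cast; ring
    rw [e1, div_mul_eq_mul_div]
    congr 1
    rcases eq_or_ne (|y|) 0 with h | h
    · rw [h, Real.zero_rpow hs.ne', zero_mul, Real.zero_rpow]
      linarith [two_lt_critExp (N := N) hs2]
    · rw [← Real.rpow_add (by positivity)]
      congr 1
      unfold critExp
      have : (N : ℝ) - 2 ≠ 0 := by linarith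
      field_simp
      ring
  rw [e] at h1
  refine h1.trans ?_
  nlinarith

theorem D12.integrable_crit {s : ℝ} (hs : 0 < s) (hs2 : s < 2) (u : D12 N) :
    Integrable fun x => |u x| ^ critExp N s / ‖x‖ ^ s := by
  refine (u.integrable_div_norm_sq.add (critExp_zero_rpow_integrable u)).mono ?_ ?_
  · have := u.aestronglyMeasurable.aemeasurable
    exact (AEMeasurable.div (by fun_prop) (by fun_prop)).aestronglyMeasurable
  · refine Eventually.of_forall fun x => ?_
    rw [Real.norm_of_nonneg (by positivity)]
    exact (crit_pointwise hs hs2 _ (norm_nonneg _)).trans (le_abs_self _)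

theorem critInt_nonneg (s : ℝ) (u : D12 N) : 0 ≤ critInt s u :=
  integral_nonneg fun x => by positivity

theorem critInt_smul {s t : ℝ} (ht : 0 ≤ t) (u : D12 N) :
    critInt s (t • u) = t ^ critExp N s * critInt s u := by
  rw [critInt, critInt, ← integral_const_mul]
  refine integral_congr_ae ?_
  filter_upwards [D12.coe_smul t u] with x hx
  rw [hx, abs_mul, abs_of_nonneg ht, Real.mul_rpow ht (abs_nonneg _), mul_div_assoc]

theorem critInt_zero {s : ℝ} (hs2 : s < 2) : critInt s (0 : D12 N) = 0 := by
  have := critInt_smul (s := s) le_rfl (0 : D12 N)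
  rw [zero_smul, Real.zero_rpow (by linarith [two_lt_critExp (N := N) hs2]), zero_mul] at this
  exact this

/-- The Hardy-Sobolev inequality, with some constant. -/
theorem critInt_le {s : ℝ} (hs : 0 < s) (hs2 : s < 2) :
    ∃ C > 0, ∀ u : D12 N, critInt s u ≤ C * ‖u‖ ^ critExp N s := by
  obtain ⟨K, hK⟩ := D12.sobolev N
  have hL := hardyConst_pos (N := N)
  have hp0 := critExp_zero_pos hN.out
  have hp := two_lt_critExp (N := N) hs2
  have h1 : ∀ u : D12 N, ‖u‖ = 1 → critInt s u ≤ (hardyConst N)⁻¹ + (K : ℝ) ^ critExp N 0 := by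
    intro u hu
    have h2 : ∫ x, |u x| ^ critExp N 0 ≤ (K : ℝ) ^ critExp N 0 := by
      have h := hK u
      rw [hu, ENNReal.ofReal_one, mul_one, MemLp.eLpNorm_eq_integral_rpow_norm
        (by simpa using hp0) (by simp) u.memLp, ENNReal.toReal_ofReal hp0.le] at h
      have h5 : 0 ≤ ∫ x, ‖u x‖ ^ critExp N 0 := integral_nonneg fun x => by positivity
      rw [← ENNReal.ofReal_coe_nnreal, ENNReal.ofReal_le_ofReal_iff K.coe_nonneg] at h
      have := Real.rpow_le_rpow (by positivity) h hp0.le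
      rwa [← Real.rpow_mul h5, inv_mul_cancel₀ hp0.ne', Real.rpow_one] at this
    have h3 : ∫ x, u x ^ 2 / ‖x‖ ^ 2 ≤ (hardyConst N)⁻¹ := by
      have h := hardy_inequality u
      rw [hu, hardyMap_norm_sq] at h
      rw [← one_div, le_div_iff₀ hL]
      linarith
    calc critInt s u ≤ ∫ x, (u x ^ 2 / ‖x‖ ^ 2 + |u x| ^ critExp N 0) :=
          integral_mono (u.integrable_crit hs hs2)
            (u.integrable_div_norm_sq.add (critExp_zero_rpow_integrable u))
            fun x => crit_pointwise hs hs2 _ (norm_nonneg _)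
      _ = (∫ x, u x ^ 2 / ‖x‖ ^ 2) + ∫ x, |u x| ^ critExp N 0 :=
          integral_add u.integrable_div_norm_sq (critExp_zero_rpow_integrable u)
      _ ≤ _ := add_le_add h3 h2
  refine ⟨(hardyConst N)⁻¹ + (K : ℝ) ^ critExp N 0, by positivity, fun u => ?_⟩
  rcases eq_or_ne u 0 with rfl | hu
  · rw [critInt_zero hs2, norm_zero, Real.zero_rpow (by linarith), mul_zero]
  · have hn : ‖u‖ ≠ 0 := norm_ne_zero_iff.2 hu
    have h2 := h1 (‖u‖⁻¹ • u) (by rw [norm_smul, norm_inv, norm_norm, inv_mul_cancel₀ hn])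
    rw [critInt_smul (by positivity), Real.inv_rpow (norm_nonneg _), inv_mul_le_iff₀
      (by positivity), mul_comm] at h2
    exact h2

end Hardy

/-! ### Functions smooth away from the origin belong to `D^{1,2}` -/

section Cutoff

variable {N : ℕ}

theorem hasGradientAt_comp {f : E N → ℝ} {v x : E N} {g : ℝ → ℝ} {d : ℝ}
    (hf : HasGradientAt f v x) (hg : HasDerivAt g d (f x)) :
    HasGradientAt (fun y => g (f y)) (d • v) x := by
  rw [hasGradientAt_iff_hasFDerivAt] at hf ⊢
  refine (hg.comp_hasFDerivAt x hf).congr_fderiv ?_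
  simp

theorem hasGradientAt_mul {f g : E N → ℝ} {v w x : E N}
    (hf : HasGradientAt f v x) (hg : HasGradientAt g w x) :
    HasGradientAt (fun y => f y * g y) (f x • w + g x • v) x := by
  rw [hasGradientAt_iff_hasFDerivAt] at hf hg ⊢
  refine (hf.mul hg).congr_fderiv ?_
  simp

theorem hasGradientAt_norm_sq (x : E N) : HasGradientAt (fun y : E N => ‖y‖ ^ 2) ((2 : ℝ) • x) x := by
  rw [hasGradientAt_iff_hasFDerivAt]
  refine (hasStrictFDerivAt_norm_sq x).hasFDerivAt.congr_fderiv ?_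
  ext y
  simp

theorem hasGradientAt_norm {x : E N} (hx : x ≠ 0) :
    HasGradientAt (fun y : E N => ‖y‖) (‖x‖⁻¹ • x) x := by
  have hn : ‖x‖ ≠ 0 := norm_ne_zero_iff.2 hx
  have h := hasGradientAt_comp (hasGradientAt_norm_sq x)
    (Real.hasDerivAt_sqrt (pow_ne_zero 2 hn))
  have e : (fun y : E N => √(‖y‖ ^ 2)) = fun y => ‖y‖ := by
    funext y; exact Real.sqrt_sq (norm_nonneg y)
  rw [e, Real.sqrt_sq (norm_nonneg x), smul_smul] at h
  convert h using 2
  field_simp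

/-- Dominated convergence in `L^q`. -/
theorem tendsto_eLpNorm_of_dominated {X F : Type*} [MeasurableSpace X] {μ : Measure X}
    [NormedAddCommGroup F] {q : ℝ≥0∞} (hq0 : q ≠ 0) (hq : q ≠ ⊤) {f : ℕ → X → F} {g : X → ℝ}
    (hf : ∀ n, AEStronglyMeasurable (f n) μ) (hg : MemLp g q μ)
    (hfg : ∀ n, ∀ᵐ x ∂μ, ‖f n x‖ ≤ g x) (h0 : ∀ᵐ x ∂μ, Tendsto (fun n => f n x) atTop (𝓝 0)) :
    Tendsto (fun n => eLpNorm (f n) q μ) atTop (𝓝 0) := by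
  have hqr : 0 < q.toReal := ENNReal.toReal_pos hq0 hq
  simp only [eLpNorm_eq_lintegral_rpow_enorm_toReal hq0 hq]
  have h1 : Tendsto (fun n => ∫⁻ x, ‖f n x‖ₑ ^ q.toReal ∂μ) atTop (𝓝 (∫⁻ _, 0 ∂μ)) := by
    refine tendsto_lintegral_of_dominated_convergence' (fun x => ‖g x‖ₑ ^ q.toReal)
      (fun n => (hf n).enorm.pow_const _) (fun n => ?_) ?_ ?_
    · filter_upwards [hfg n] with x hx
      refine ENNReal.rpow_le_rpow ?_ hqr.le
      exact enorm_le_iff_norm_le.2 (hx.trans (le_abs_self _))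
    · exact (lintegral_rpow_enorm_lt_top_of_eLpNorm_lt_top hq0 hq hg.2).ne
    · filter_upwards [h0] with x hx
      have h3 : Tendsto (fun n => ‖f n x‖ₑ) atTop (𝓝 0) := by simpa using hx.enorm
      have := (ENNReal.continuous_rpow_const (y := q.toReal)).tendsto 0 |>.comp h3
      simpa [Function.comp_def, ENNReal.zero_rpow_of_pos hqr] using this
  have h2 := (ENNReal.continuous_rpow_const (y := 1 / q.toReal)).tendsto 0 |>.comp
    (by simpa using h1)
  simpa [Function.comp_def, ENNReal.zero_rpow_of_pos (inv_pos.2 hqr)] using h2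

theorem deriv_smoothTransition : (∃ L > 0, ∀ t, |deriv Real.smoothTransition t| ≤ L) ∧
    ∀ t, t ∉ Set.Icc (0 : ℝ) 1 → deriv Real.smoothTransition t = 0 := by
  have h0 : ∀ t, t ∉ Set.Icc (0 : ℝ) 1 → deriv Real.smoothTransition t = 0 := by
    intro t ht
    rcases lt_or_ge t 0 with h | h
    · have : Real.smoothTransition =ᶠ[𝓝 t] fun _ => 0 := by
        filter_upwards [Iio_mem_nhds h] with y hy
        exact Real.smoothTransition.zero_of_nonpos (le_of_lt hy)
      rw [this.deriv_eq, deriv_const]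
    · have h1 : 1 < t := by
        by_contra hc
        exact ht ⟨h, not_lt.1 hc⟩
      have : Real.smoothTransition =ᶠ[𝓝 t] fun _ => 1 := by
        filter_upwards [Ioi_mem_nhds h1] with y hy
        exact Real.smoothTransition.one_of_one_le (le_of_lt hy)
      rw [this.deriv_eq, deriv_const]
  refine ⟨?_, h0⟩
  have hc : Continuous (deriv Real.smoothTransition) :=
    (Real.smoothTransition.contDiff (n := 1)).continuous_deriv (by simp)
  obtain ⟨L, hL⟩ := isCompact_Icc.exists_bound_of_continuousOn (s := Set.Icc (0 : ℝ) 1)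
    hc.continuousOn
  refine ⟨max L 1, by positivity, fun t => ?_⟩
  by_cases ht : t ∈ Set.Icc (0 : ℝ) 1
  · exact (hL t ht).trans (le_max_left _ _)
  · rw [h0 t ht, abs_zero]; positivity

/-- The smooth cut-off function, equal to `1` for `2/k² ≤ |x|² ≤ k²` and vanishing outside
`1/k² < |x|² < 2k²`. -/
def cutoff (k : ℝ) (x : E N) : ℝ :=
  Real.smoothTransition (k ^ 2 * ‖x‖ ^ 2 - 1) * Real.smoothTransition (2 - ‖x‖ ^ 2 / k ^ 2)

theorem contDiff_cutoff (k : ℝ) : ContDiff ℝ ∞ (cutoff (N := N) k) := by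
  have h1 : ContDiff ℝ ∞ Real.smoothTransition := Real.smoothTransition.contDiff
  have h2 : ContDiff ℝ ∞ fun x : E N => ‖x‖ ^ 2 := contDiff_norm_sq ℝ
  unfold cutoff
  exact (h1.comp ((contDiff_const.mul h2).sub contDiff_const)).mul
    (h1.comp (contDiff_const.sub (h2.div_const _)))

theorem cutoff_nonneg (k : ℝ) (x : E N) : 0 ≤ cutoff k x :=
  mul_nonneg (Real.smoothTransition.nonneg _) (Real.smoothTransition.nonneg _)

theorem cutoff_le_one (k : ℝ) (x : E N) : cutoff k x ≤ 1 :=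
  mul_le_one₀ (Real.smoothTransition.le_one _) (Real.smoothTransition.nonneg _)
    (Real.smoothTransition.le_one _)

theorem cutoff_eq_zero {k : ℝ} {x : E N} (h : k ^ 2 * ‖x‖ ^ 2 ≤ 1) : cutoff k x = 0 := by
  rw [cutoff, Real.smoothTransition.zero_of_nonpos (by linarith), zero_mul]

theorem cutoff_eq_zero' {k : ℝ} (hk : 0 < k) {x : E N} (h : 2 * k ^ 2 ≤ ‖x‖ ^ 2) :
    cutoff k x = 0 := by
  have : 2 ≤ ‖x‖ ^ 2 / k ^ 2 := (le_div_iff₀ (by positivity)).2 h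
  rw [cutoff, Real.smoothTransition.zero_of_nonpos (x := 2 - _) (by linarith), mul_zero]

theorem cutoff_eq_one {k : ℝ} (hk : 0 < k) {x : E N} (h : 2 ≤ k ^ 2 * ‖x‖ ^ 2)
    (h' : ‖x‖ ^ 2 ≤ k ^ 2) : cutoff k x = 1 := by
  have : ‖x‖ ^ 2 / k ^ 2 ≤ 1 := (div_le_one (by positivity)).2 h'
  rw [cutoff, Real.smoothTransition.one_of_one_le (by linarith),
    Real.smoothTransition.one_of_one_le (by linarith), mul_one]

theorem isTest_cutoff_mul {u : E N → ℝ} (hu : ∀ x, x ≠ 0 → ContDiffAt ℝ ∞ u x) {k : ℝ}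
    (hk : 0 < k) : IsTest fun x => cutoff k x * u x := by
  refine ⟨?_, ?_⟩
  · rw [contDiff_iff_contDiffAt]
    intro x
    rcases eq_or_ne x 0 with rfl | hx
    · have hev : (fun x : E N => cutoff k x * u x) =ᶠ[𝓝 0] fun _ => 0 := by
        have h1 : ∀ᶠ x : E N in 𝓝 0, k ^ 2 * ‖x‖ ^ 2 < 1 := by
          have : Continuous fun x : E N => k ^ 2 * ‖x‖ ^ 2 := by fun_prop
          exact this.continuousAt.eventually_lt_const (by simp)
        filter_upwards [h1] with x hx
        rw [cutoff_eq_zero hx.le, zero_mul]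
      exact contDiffAt_const.congr_of_eventuallyEq hev
    · exact (contDiff_cutoff k).contDiffAt.mul (hu x hx)
  · refine HasCompactSupport.intro (isCompact_closedBall (0 : E N) (2 * k)) fun x hx => ?_
    rw [mem_closedBall_zero_iff, not_le] at hx
    rw [cutoff_eq_zero' hk (by nlinarith), zero_mul]

/-- The gradient of the cut-off function is bounded by a multiple of `1 / |x|`, uniformly in the
scale. -/
theorem exists_cutoff_gradient_bound : ∃ L, ∀ k > 0, ∀ x : E N, x ≠ 0 →
    ‖∇ (cutoff k) x‖ ≤ L / ‖x‖ := by
  obtain ⟨⟨L, hL, hb⟩, h0⟩ := deriv_smoothTransition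
  refine ⟨8 * L, fun k hk x hx => ?_⟩
  have hx0 : 0 < ‖x‖ := norm_pos_iff.2 hx
  have hS : ∀ t, HasDerivAt Real.smoothTransition (deriv Real.smoothTransition t) t := fun t =>
    ((Real.smoothTransition.contDiff (n := 1)).differentiable (by simp) t).hasDerivAt
  have g1 := hasGradientAt_comp (hasGradientAt_norm_sq x) (((hasDerivAt_id _).const_mul (k ^ 2)
    |>.sub_const 1) : HasDerivAt (fun t => k ^ 2 * t - 1) _ _)
  have g2 := hasGradientAt_comp (hasGradientAt_norm_sq x) (((hasDerivAt_id _).div_const (k ^ 2)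
    |>.const_sub 2) : HasDerivAt (fun t => 2 - t / k ^ 2) _ _)
  have g := hasGradientAt_mul (hasGradientAt_comp g1 (hS _)) (hasGradientAt_comp g2 (hS _))
  have e : ∇ (cutoff k) x = _ := g.gradient
  rw [e]
  have n1 : ∀ t, ‖Real.smoothTransition t‖ ≤ 1 := fun t => by
    rw [Real.norm_of_nonneg (Real.smoothTransition.nonneg _)]
    exact Real.smoothTransition.le_one _
  have k1 : ‖deriv Real.smoothTransition (k ^ 2 * ‖x‖ ^ 2 - 1) • (k ^ 2 * 1) • (2 : ℝ) • x‖
      ≤ 4 * L / ‖x‖ := by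
    simp only [norm_smul, Real.norm_eq_abs]
    rw [le_div_iff₀ hx0]
    by_cases ht : k ^ 2 * ‖x‖ ^ 2 - 1 ∈ Set.Icc (0 : ℝ) 1
    · have h1 := hb (k ^ 2 * ‖x‖ ^ 2 - 1)
      have h2 := ht.2
      rw [abs_of_nonneg (show 0 ≤ k ^ 2 * 1 by positivity), abs_of_pos (two_pos (α := ℝ))]
      have h3 : 0 ≤ k ^ 2 * ‖x‖ ^ 2 := by positivity
      nlinarith [mul_le_mul h1 (show k ^ 2 * ‖x‖ ^ 2 ≤ 2 by linarith) h3 hL.le]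
    · rw [h0 _ ht, abs_zero]; simp; positivity
  have k2 : ‖deriv Real.smoothTransition (2 - ‖x‖ ^ 2 / k ^ 2) • (-(1 / k ^ 2)) • (2 : ℝ) • x‖
      ≤ 4 * L / ‖x‖ := by
    simp only [norm_smul, Real.norm_eq_abs]
    rw [le_div_iff₀ hx0]
    by_cases ht : 2 - ‖x‖ ^ 2 / k ^ 2 ∈ Set.Icc (0 : ℝ) 1
    · have h1 := hb (2 - ‖x‖ ^ 2 / k ^ 2)
      have h2 := ht.1
      rw [abs_neg, abs_of_nonneg (show 0 ≤ 1 / k ^ 2 by positivity), abs_of_pos (two_pos (α := ℝ))]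
      have h3 : 0 ≤ ‖x‖ ^ 2 / k ^ 2 := by positivity
      have h4 := mul_le_mul h1 (show ‖x‖ ^ 2 / k ^ 2 ≤ 2 by linarith) h3 hL.le
      calc _ = 2 * (|deriv Real.smoothTransition (2 - ‖x‖ ^ 2 / k ^ 2)| * (‖x‖ ^ 2 / k ^ 2)) := by
            ring
        _ ≤ _ := by linarith
    · rw [h0 _ ht, abs_zero]; simp; positivity
  refine (norm_add_le _ _).trans ?_
  rw [norm_smul (Real.smoothTransition _), norm_smul (Real.smoothTransition _)]
  have t1 := mul_le_mul (n1 (k ^ 2 * ‖x‖ ^ 2 - 1)) k2 (norm_nonneg _) zero_le_one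
  have t2 := mul_le_mul (n1 (2 - ‖x‖ ^ 2 / k ^ 2)) k1 (norm_nonneg _) zero_le_one
  refine (add_le_add t1 t2).trans (le_of_eq ?_)
  ring

variable [hN : Fact (3 ≤ N)]

theorem nontrivial_E : Nontrivial (E N) := by
  have : Nonempty (Fin N) := ⟨⟨0, by have := hN.out; omega⟩⟩
  infer_instance

variable (N) in
theorem ae_ne_zero : ∀ᵐ x : E N, x ≠ 0 := by
  have := nontrivial_E (N := N)
  exact Measure.ae_ne volume 0

theorem isTestLimit_of_punctured {u : E N → ℝ} (hu : ∀ x, x ≠ 0 → ContDiffAt ℝ ∞ u x)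
    (h1 : MemLp u (ENNReal.ofReal (critExp N 0)) volume)
    (h2 : MemLp (fun x => u x / ‖x‖) 2 volume) (h3 : MemLp (∇ u) 2 volume) :
    IsTestLimit u (∇ u) := by
  have hn0 := critExp_zero_pos hN.out
  obtain ⟨L, hL⟩ := exists_cutoff_gradient_bound (N := N)
  have ht : ∀ n : ℕ, IsTest fun x => cutoff ((n : ℝ) + 1) x * u x := fun n =>
    isTest_cutoff_mul hu (by positivity)
  have hgrad : ∀ k > 0, ∀ x : E N, x ≠ 0 → ∇ (fun x => cutoff k x * u x) x
      = cutoff k x • ∇ u x + u x • ∇ (cutoff k) x := fun k hk x hx =>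
    (hasGradientAt_mul (((contDiff_cutoff k).differentiable (by simp) x).hasGradientAt)
      (((hu x hx).differentiableAt (by simp)).hasGradientAt)).gradient
  have hev : ∀ x : E N, x ≠ 0 → ∀ᶠ n : ℕ in atTop, ∀ᶠ y in 𝓝 x, cutoff ((n : ℝ) + 1) y = 1 := by
    intro x hx
    have hx0 : 0 < ‖x‖ := norm_pos_iff.2 hx
    have c1 : Tendsto (fun n : ℕ => ((n : ℝ) + 1)) atTop atTop :=
      tendsto_atTop_add_const_right _ _ tendsto_natCast_atTop_atTop
    filter_upwards [c1.eventually_gt_atTop (2 / ‖x‖), c1.eventually_gt_atTop ‖x‖] with n h4 h5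
    rw [div_lt_iff₀ hx0] at h4
    have c2 : ∀ᶠ y : E N in 𝓝 x, 2 < ((n : ℝ) + 1) * ‖y‖ := by
      have : Continuous fun y : E N => ((n : ℝ) + 1) * ‖y‖ := by fun_prop
      exact this.continuousAt.eventually_const_lt h4
    have c3 : ∀ᶠ y : E N in 𝓝 x, ‖y‖ < (n : ℝ) + 1 :=
      continuous_norm.continuousAt.eventually_lt_const h5
    filter_upwards [c2, c3] with y h6 h7
    refine cutoff_eq_one (by positivity) ?_ (by gcongr)
    rw [← mul_pow]; nlinarith
  refine ⟨fun n x => cutoff ((n : ℝ) + 1) x * u x, ht, ?_, ?_⟩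
  · refine tendsto_eLpNorm_of_dominated (by simpa using hn0) (by simp) (fun n => ?_)
      h1.norm (fun n => ?_) ?_
    · exact (ht n).1.continuous.aestronglyMeasurable.sub h1.1
    · refine Eventually.of_forall fun x => ?_
      have e : cutoff ((n : ℝ) + 1) x * u x - u x = -((1 - cutoff ((n : ℝ) + 1) x) * u x) := by ring
      rw [e, norm_neg, norm_mul, Real.norm_of_nonneg (by linarith [cutoff_le_one ((n : ℝ) + 1) x])]
      exact mul_le_of_le_one_left (norm_nonneg _) (by linarith [cutoff_nonneg ((n : ℝ) + 1) x])
    · filter_upwards [ae_ne_zero N] with x hx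
      refine tendsto_const_nhds.congr' ?_
      filter_upwards [hev x hx] with n hn
      rw [hn.self_of_nhds]; ring
  · refine tendsto_eLpNorm_of_dominated (by simp) (by simp) (fun n => ?_)
      (g := fun x => ‖∇ u x‖ + |L| * ‖u x / ‖x‖‖) (h3.norm.add (h2.norm.const_mul _))
      (fun n => ?_) ?_
    · exact ((ht n).memLp_gradient 2).1.sub h3.1
    · filter_upwards [ae_ne_zero N] with x hx
      have hx0 : 0 < ‖x‖ := norm_pos_iff.2 hx
      rw [hgrad _ (by positivity) x hx]
      have e : cutoff ((n : ℝ) + 1) x • ∇ u x + u x • ∇ (cutoff ((n : ℝ) + 1)) x - ∇ u x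
          = -((1 - cutoff ((n : ℝ) + 1) x) • ∇ u x) + u x • ∇ (cutoff ((n : ℝ) + 1)) x := by
        rw [sub_smul, one_smul]; abel
      rw [e]
      refine (norm_add_le _ _).trans (add_le_add ?_ ?_)
      · rw [norm_neg, norm_smul,
          Real.norm_of_nonneg (by linarith [cutoff_le_one ((n : ℝ) + 1) x])]
        exact mul_le_of_le_one_left (norm_nonneg _) (by linarith [cutoff_nonneg ((n : ℝ) + 1) x])
      · rw [norm_smul, norm_div, norm_norm]
        have := hL ((n : ℝ) + 1) (by positivity) x hx
        calc ‖u x‖ * ‖∇ (cutoff ((n : ℝ) + 1)) x‖ ≤ ‖u x‖ * (|L| / ‖x‖) := by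
              gcongr
              exact this.trans (by gcongr; exact le_abs_self _)
          _ = _ := by ring
    · filter_upwards [ae_ne_zero N] with x hx
      refine tendsto_const_nhds.congr' ?_
      filter_upwards [hev x hx] with n hn
      have : (cutoff ((n : ℝ) + 1) : E N → ℝ) =ᶠ[𝓝 x] fun _ => 1 := hn
      have e : ∇ (cutoff ((n : ℝ) + 1)) x = 0 := by
        rw [this.gradient.self_of_nhds]; exact hasGradientAt_const x (1 : ℝ) |>.gradient
      rw [hgrad _ (by positivity) x hx, hn.self_of_nhds, e]
      simp

end Cutoff

/-! ### The radial profile -/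

section Profile

variable {N : ℕ}

variable (N) in
/-- The rate `κ` at which the profile decays in the logarithmic variable `log |x|`. -/
def rate (lam s : ℝ) : ℝ := (2 - s) / ((N : ℝ) - 2) * √(hardyConst N - lam)

variable (N) in
/-- The power `m = (N-2)/(2-s)` of the profile. -/
def power (s : ℝ) : ℝ := ((N : ℝ) - 2) / (2 - s)

/-- `2 cosh (κ log r)`. -/
def logCosh (κ r : ℝ) : ℝ := r ^ κ + r ^ (-κ)

variable (N) in
/-- The normalizing constant of the profile. -/
def profileConst (lam s : ℝ) : ℝ := aConst N lam s ^ (((N : ℝ) - 2) / (2 * (2 - s)))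

variable (N) in
/-- The profile as a function of the radius. In the Emden-Fowler variable `t = log r` it is
`r^{-(N-2)/2}` times a power of `2 cosh (κ t)`. -/
def profile (lam s r : ℝ) : ℝ :=
  profileConst N lam s * r ^ (-(((N : ℝ) - 2) / 2)) * logCosh (rate N lam s) r ^ (-power N s)

variable (N) in
/-- The potential `z^{2*_s-2} r^{2-s}` of the linearization at the profile. -/
def potential (lam s r : ℝ) : ℝ :=
  rate N lam s ^ 2 * (power N s * (power N s + 1)) * (1 - logTanh (rate N lam s) r ^ 2)

theorem logCosh_pos (κ : ℝ) {r : ℝ} (hr : 0 < r) : 0 < logCosh κ r := by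
  unfold logCosh; positivity

theorem logCosh_inv (κ : ℝ) {r : ℝ} (hr : 0 < r) : logCosh κ r⁻¹ = logCosh κ r := by
  rw [logCosh, logCosh, Real.inv_rpow hr.le, Real.inv_rpow hr.le, ← Real.rpow_neg hr.le,
    ← Real.rpow_neg hr.le, neg_neg, add_comm]

theorem one_sub_logTanh_sq (κ : ℝ) {r : ℝ} (hr : 0 < r) :
    1 - logTanh κ r ^ 2 = 4 / logCosh κ r ^ 2 := by
  have h := Real.rpow_pos_of_pos hr κ
  rw [logTanh, logCosh, mul_comm 2 κ, Real.rpow_mul hr.le, Real.rpow_two, Real.rpow_neg hr.le]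
  field_simp
  ring

theorem hasDerivAt_logCosh (κ : ℝ) {r : ℝ} (hr : 0 < r) :
    HasDerivAt (logCosh κ) (κ * logTanh κ r * logCosh κ r / r) r := by
  have h := Real.rpow_pos_of_pos hr κ
  have h1 : HasDerivAt (fun r : ℝ => r ^ κ) (κ * r ^ (κ - 1)) r :=
    Real.hasDerivAt_rpow_const (Or.inl hr.ne')
  have h2 : HasDerivAt (fun r : ℝ => r ^ (-κ)) (-κ * r ^ (-κ - 1)) r :=
    Real.hasDerivAt_rpow_const (Or.inl hr.ne')
  refine (h1.add h2).congr_deriv ?_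
  rw [logTanh, logCosh, mul_comm 2 κ, Real.rpow_mul hr.le, Real.rpow_two, Real.rpow_sub hr,
    Real.rpow_sub hr, Real.rpow_neg hr.le, Real.rpow_one]
  field_simp
  ring

theorem continuousOn_logCosh (κ : ℝ) : ContinuousOn (logCosh κ) (Set.Ioi 0) := fun _ hr =>
  (hasDerivAt_logCosh κ hr).continuousAt.continuousWithinAt

theorem two_le_logCosh (κ : ℝ) {r : ℝ} (hr : 0 < r) : 2 ≤ logCosh κ r := by
  have h := Real.rpow_pos_of_pos hr κ
  rw [logCosh, Real.rpow_neg hr.le]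
  have : r ^ κ * (r ^ κ)⁻¹ = 1 := mul_inv_cancel₀ h.ne'
  nlinarith [sq_nonneg (r ^ κ - (r ^ κ)⁻¹), inv_pos.2 h]

theorem measurable_logCosh (κ : ℝ) : Measurable (logCosh κ) := by
  unfold logCosh; fun_prop

theorem measurable_logTanh (κ : ℝ) : Measurable (logTanh κ) := by
  unfold logTanh; fun_prop

/-- The logarithmic derivative `r z'(r) / z(r)` of the profile. -/
def profileLog (N : ℕ) (lam s r : ℝ) : ℝ :=
  -(((N : ℝ) - 2) / 2) - rate N lam s * power N s * logTanh (rate N lam s) r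

theorem hasDerivAt_profile (lam s : ℝ) {r : ℝ} (hr : 0 < r) :
    HasDerivAt (profile N lam s) (profile N lam s r * profileLog N lam s r / r) r := by
  have hb := logCosh_pos (rate N lam s) hr
  have h1 : HasDerivAt (fun r : ℝ => r ^ (-(((N : ℝ) - 2) / 2)))
      (-(((N : ℝ) - 2) / 2) * r ^ (-(((N : ℝ) - 2) / 2) - 1)) r :=
    Real.hasDerivAt_rpow_const (Or.inl hr.ne')
  have h2 := (hasDerivAt_logCosh (rate N lam s) hr).rpow_const (p := -power N s) (Or.inl hb.ne')
  refine ((h1.const_mul (profileConst N lam s)).mul h2).congr_deriv ?_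
  rw [Real.rpow_sub hr, Real.rpow_one, Real.rpow_sub hb, Real.rpow_one, profile, profileLog]
  field_simp
  ring

theorem hasDerivAt_profileLog (lam s : ℝ) {r : ℝ} (hr : 0 < r) :
    HasDerivAt (profileLog N lam s)
      (-(rate N lam s ^ 2 * power N s * (1 - logTanh (rate N lam s) r ^ 2)) / r) r := by
  refine (((hasDerivAt_logTanh (rate N lam s) hr).const_mul
    (rate N lam s * power N s)).const_sub _).congr_deriv ?_
  ring

theorem contDiffAt_profile (lam s : ℝ) {x : E N} (hx : x ≠ 0) :
    ContDiffAt ℝ ∞ (fun y : E N => profile N lam s ‖y‖) x := by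
  have hr : 0 < ‖x‖ := norm_pos_iff.2 hx
  have h1 : ContDiffAt ℝ ∞ (fun y : E N => ‖y‖) x := contDiffAt_norm ℝ hx
  have h2 : ∀ a : ℝ, ContDiffAt ℝ ∞ (fun y : E N => ‖y‖ ^ a) x := fun a =>
    h1.rpow_const_of_ne hr.ne'
  have hb := logCosh_pos (rate N lam s) hr
  exact (contDiffAt_const.mul (h2 _)).mul (((h2 _).add (h2 _)).rpow_const_of_ne hb.ne')

theorem measurable_profile (lam s : ℝ) : Measurable (profile N lam s) := by
  have := measurable_logCosh (rate N lam s)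
  unfold profile; fun_prop

theorem gradient_profile (lam s : ℝ) {x : E N} (hx : x ≠ 0) :
    ∇ (fun y : E N => profile N lam s ‖y‖) x
      = (profile N lam s ‖x‖ * profileLog N lam s ‖x‖ / ‖x‖ ^ 2) • x := by
  have hr : 0 < ‖x‖ := norm_pos_iff.2 hx
  rw [(hasGradientAt_comp (hasGradientAt_norm hx) (hasDerivAt_profile lam s hr)).gradient, smul_smul]
  congr 1
  field_simp

variable [hN : Fact (3 ≤ N)]

theorem natCast_three_le : (3 : ℝ) ≤ N := by exact_mod_cast hN.out

theorem sqrt_hardyConst : √(hardyConst N) = ((N : ℝ) - 2) / 2 := by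
  have h3 := natCast_three_le (N := N)
  have : hardyConst N = (((N : ℝ) - 2) / 2) ^ 2 := by unfold hardyConst; ring
  rw [this, Real.sqrt_sq (by linarith)]

theorem rate_pos {lam s : ℝ} (hlam : lam < hardyConst N) (hs : s < 2) : 0 < rate N lam s := by
  have h3 := natCast_three_le (N := N)
  have : 0 < √(hardyConst N - lam) := Real.sqrt_pos.2 (by linarith)
  exact mul_pos (div_pos (by linarith) (by linarith)) this

theorem power_pos {s : ℝ} (hs : s < 2) : 0 < power N s := by
  have h3 := natCast_three_le (N := N)
  exact div_pos (by linarith) (by linarith)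

theorem rate_mul_power {lam s : ℝ} (hs : s < 2) :
    rate N lam s * power N s = √(hardyConst N - lam) := by
  have h3 := natCast_three_le (N := N)
  have h1 : (N : ℝ) - 2 ≠ 0 := by linarith
  have h2 : 2 - s ≠ 0 := by linarith
  unfold rate power
  field_simp

theorem rate_sq_mul_power_sq {lam s : ℝ} (hlam : lam < hardyConst N) (hs : s < 2) :
    rate N lam s ^ 2 * power N s ^ 2 = hardyConst N - lam := by
  rw [← mul_pow, rate_mul_power hs, Real.sq_sqrt (by linarith)]

theorem critExp_sub_two {s : ℝ} (hs : s < 2) : critExp N s - 2 = 2 / power N s := by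
  have h3 := natCast_three_le (N := N)
  have h1 : (N : ℝ) - 2 ≠ 0 := by linarith
  have h2 : 2 - s ≠ 0 := by linarith
  unfold critExp power
  field_simp
  ring

theorem aConst_eq {lam s : ℝ} (hlam : lam < hardyConst N) (hs : s < 2) :
    aConst N lam s = 4 * (rate N lam s ^ 2 * (power N s * (power N s + 1))) := by
  have h3 := natCast_three_le (N := N)
  have h1 : (N : ℝ) - 2 ≠ 0 := by linarith
  have h2 : 2 - s ≠ 0 := by linarith
  have e : rate N lam s ^ 2 * (power N s * (power N s + 1))
      = (rate N lam s ^ 2 * power N s ^ 2) * (1 + 1 / power N s) := by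
    have := (power_pos (N := N) hs).ne'
    field_simp
  rw [e, rate_sq_mul_power_sq hlam hs, aConst, sqrt_hardyConst, power]
  field_simp
  ring

theorem aConst_pos {lam s : ℝ} (hlam : lam < hardyConst N) (hs : s < 2) : 0 < aConst N lam s := by
  have := rate_pos hlam hs
  have := power_pos (N := N) hs
  rw [aConst_eq hlam hs]; positivity

theorem profileConst_pos {lam s : ℝ} (hlam : lam < hardyConst N) (hs : s < 2) :
    0 < profileConst N lam s := Real.rpow_pos_of_pos (aConst_pos hlam hs) _

theorem profile_pos {lam s : ℝ} (hlam : lam < hardyConst N) (hs : s < 2) {r : ℝ} (hr : 0 < r) :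
    0 < profile N lam s r := by
  have := profileConst_pos hlam hs
  have := logCosh_pos (rate N lam s) hr
  unfold profile; positivity

theorem zOne_eq {lam s : ℝ} (hs : s < 2) {x : E N} (hx : x ≠ 0) :
    zOne N lam s x = profile N lam s ‖x‖ := by
  have h3 := natCast_three_le (N := N)
  have hr : 0 < ‖x‖ := norm_pos_iff.2 hx
  have h1 : (N : ℝ) - 2 ≠ 0 := by linarith
  have h2 : 2 - s ≠ 0 := by linarith
  have ea : aExp N lam = ((N : ℝ) - 2) / 2 - rate N lam s * power N s := by
    rw [aExp, rate_mul_power hs, sqrt_hardyConst]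
  have e2 : (2 - s) * (1 - 2 / ((N : ℝ) - 2) * aExp N lam) = 2 * rate N lam s := by
    rw [ea, power]; field_simp; ring
  have hk := Real.rpow_pos_of_pos hr (rate N lam s)
  have e3 : 1 + ‖x‖ ^ (2 * rate N lam s) = ‖x‖ ^ rate N lam s * logCosh (rate N lam s) ‖x‖ := by
    rw [logCosh, mul_comm 2, Real.rpow_mul hr.le, Real.rpow_two, Real.rpow_neg hr.le]
    field_simp
    ring
  have hb := logCosh_pos (rate N lam s) hr
  rw [zOne, e2, e3, profile, profileConst, ← power, Real.mul_rpow hk.le hb.le, ← Real.rpow_mul hr.le,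
    ea, ← mul_assoc, ← Real.rpow_add hr, sub_add_cancel, Real.rpow_neg hr.le, Real.rpow_neg hb.le,
    div_eq_mul_inv, mul_inv, mul_assoc]

theorem profile_rpow_mul {lam s : ℝ} (hlam : lam < hardyConst N) (hs : s < 2) {r : ℝ} (hr : 0 < r) :
    profile N lam s r ^ (critExp N s - 2) * r ^ (2 - s) = potential N lam s r := by
  have h3 := natCast_three_le (N := N)
  have h1 : (N : ℝ) - 2 ≠ 0 := by linarith
  have h2 : 2 - s ≠ 0 := by linarith
  have hb := logCosh_pos (rate N lam s) hr
  have hm := (power_pos (N := N) hs).ne'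
  have hA := aConst_pos hlam hs
  have hC := profileConst_pos hlam hs
  rw [critExp_sub_two hs, profile, Real.mul_rpow (by positivity) (by positivity),
    Real.mul_rpow (by positivity) (by positivity), profileConst, ← Real.rpow_mul hA.le,
    ← Real.rpow_mul hr.le, ← Real.rpow_mul hb.le]
  have e1 : ((N : ℝ) - 2) / (2 * (2 - s)) * (2 / power N s) = 1 := by
    unfold power; field_simp
  have e2 : -(((N : ℝ) - 2) / 2) * (2 / power N s) = -(2 - s) := by
    unfold power; field_simp
  have e3 : -power N s * (2 / power N s) = -2 := by field_simp
  have hp := Real.rpow_pos_of_pos hr (2 - s)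
  rw [e1, e2, e3, Real.rpow_one, Real.rpow_neg hr.le, Real.rpow_neg hb.le, Real.rpow_two,
    potential, one_sub_logTanh_sq _ hr, aConst_eq hlam hs]
  field_simp

theorem abs_profileLog_le {lam s r : ℝ} (hlam : lam < hardyConst N) (hs : s < 2) (hr : 0 ≤ r) :
    |profileLog N lam s r| ≤ ((N : ℝ) - 2) / 2 + rate N lam s * power N s := by
  have h3 := natCast_three_le (N := N)
  have hm := power_pos (N := N) hs
  have hk := rate_pos hlam hs
  have h1 := logTanh_lt_one (rate N lam s) hr
  have h2 := neg_one_le_logTanh (rate N lam s) hr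
  have h4 : 0 < rate N lam s * power N s := by positivity
  rw [profileLog, abs_le]
  constructor <;> nlinarith

/-- The radial form of the equation `-Δz = (λ + V) z / |x|²`, with `V` the potential. -/
theorem hasDerivAt_flux {lam s : ℝ} (hlam : lam < hardyConst N) (hs : s < 2) {r : ℝ} (hr : 0 < r) :
    HasDerivAt (fun r => r ^ (N - 2) * (profile N lam s r * profileLog N lam s r))
      (-((lam + potential N lam s r) * profile N lam s r * r ^ (N - 3))) r := by
  have h1 := (hasDerivAt_pow (N - 2) r).mul
    ((hasDerivAt_profile (N := N) lam s hr).mul (hasDerivAt_profileLog (N := N) lam s hr))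
  refine h1.congr_deriv ?_
  simp only [Pi.mul_apply]
  have e := rate_sq_mul_power_sq (N := N) hlam hs
  have e2 : lam = hardyConst N - rate N lam s ^ 2 * power N s ^ 2 := by linarith
  set k := rate N lam s with hk
  set m := power N s with hm
  rw [potential, ← hk, ← hm, profileLog, ← hk, ← hm]
  set z := profile N lam s r
  set y := logTanh k r
  have e3 : lam = ((N : ℝ) - 2) ^ 2 / 4 - k ^ 2 * m ^ 2 := by rw [e2, hardyConst]
  clear_value z y k m
  rw [e3]
  obtain ⟨n, rfl⟩ : ∃ n, N = n + 3 := ⟨N - 3, by have := hN.out; omega⟩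
  simp only [Nat.add_sub_cancel, show n + 3 - 2 = n + 1 from rfl]
  push_cast
  field_simp
  ring

theorem integrable_logCosh {κ σ : ℝ} (hκ : 0 < κ) (hσ : 0 < σ) :
    Integrable fun x : E N => ‖x‖ ^ (-(N : ℝ)) * logCosh κ ‖x‖ ^ (-σ) := by
  rw [integrable_radial_iff (g := fun r => r ^ (-(N : ℝ)) * logCosh κ r ^ (-σ))]
  have hm : Measurable fun r : ℝ => r ^ (N - 1) * (r ^ (-(N : ℝ)) * logCosh κ r ^ (-σ)) := by
    have := measurable_logCosh κ
    fun_prop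
  have e : ∀ r : ℝ, 0 < r → r ^ (N - 1) * (r ^ (-(N : ℝ)) * logCosh κ r ^ (-σ))
      = r⁻¹ * logCosh κ r ^ (-σ) := fun r hr => by
    have : 1 ≤ N := by have := hN.out; omega
    rw [← mul_assoc, ← Real.rpow_natCast, ← Real.rpow_add hr, ← Real.rpow_neg_one]
    congr 2
    push_cast [this]
    ring
  have hbd : ∀ (r a : ℝ), 0 < r → 0 < a → a ≤ logCosh κ r → logCosh κ r ^ (-σ) ≤ a ^ (-σ) :=
    fun r a hr ha hle => Real.rpow_le_rpow_of_nonpos ha hle (by linarith)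
  rw [← Set.Ioc_union_Ioi_eq_Ioi zero_le_one, integrableOn_union]
  constructor
  · have h1 : IntegrableOn (fun r : ℝ => r ^ (-1 + κ * σ)) (Set.Ioc 0 1) := by
      have := intervalIntegral.intervalIntegrable_rpow' (a := 0) (b := 1) (r := -1 + κ * σ)
        (by nlinarith [mul_pos hκ hσ])
      rwa [intervalIntegrable_iff_integrableOn_Ioc_of_le zero_le_one] at this
    refine Integrable.mono' h1 hm.aestronglyMeasurable ?_
    filter_upwards [ae_restrict_mem measurableSet_Ioc] with r hr
    rw [e r hr.1, Real.norm_of_nonneg (by have := logCosh_pos κ hr.1; have := hr.1; positivity),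
      Real.rpow_add hr.1, Real.rpow_neg_one]
    refine mul_le_mul_of_nonneg_left ((hbd r (r ^ (-κ)) hr.1 (Real.rpow_pos_of_pos hr.1 _) ?_).trans
      (le_of_eq ?_)) (inv_nonneg.2 hr.1.le)
    · exact le_add_of_nonneg_left (Real.rpow_nonneg hr.1.le _)
    · rw [← Real.rpow_mul hr.1.le]; congr 1; ring
  · have h1 : IntegrableOn (fun r : ℝ => r ^ (-1 + -(κ * σ))) (Set.Ioi 1) :=
      integrableOn_Ioi_rpow_of_lt (by nlinarith [mul_pos hκ hσ]) one_pos
    refine Integrable.mono' h1 hm.aestronglyMeasurable ?_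
    filter_upwards [ae_restrict_mem measurableSet_Ioi] with r hr
    have hr0 : 0 < r := one_pos.trans hr
    rw [e r hr0, Real.norm_of_nonneg (by have := logCosh_pos κ hr0; positivity),
      Real.rpow_add hr0, Real.rpow_neg_one]
    refine mul_le_mul_of_nonneg_left ((hbd r (r ^ κ) hr0 (Real.rpow_pos_of_pos hr0 _) ?_).trans
      (le_of_eq ?_)) (inv_nonneg.2 hr0.le)
    · exact le_add_of_nonneg_right (Real.rpow_nonneg hr0.le _)
    · rw [← Real.rpow_mul hr0.le]; congr 1; ring

theorem profile_rpow {lam s : ℝ} (hlam : lam < hardyConst N) (hs : s < 2) (q : ℝ) {r : ℝ}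
    (hr : 0 < r) : profile N lam s r ^ q = profileConst N lam s ^ q *
      (r ^ (-(((N : ℝ) - 2) / 2 * q)) * logCosh (rate N lam s) r ^ (-(power N s * q))) := by
  have hb := logCosh_pos (rate N lam s) hr
  have hC := profileConst_pos hlam hs
  rw [profile, Real.mul_rpow (by positivity) (by positivity), Real.mul_rpow hC.le (by positivity),
    ← Real.rpow_mul hr.le, ← Real.rpow_mul hb.le, neg_mul, neg_mul, mul_assoc]

theorem integrable_profile_rpow {lam s q t : ℝ} (hlam : lam < hardyConst N) (hs : s < 2)
    (hq : 0 < q) (ht : ((N : ℝ) - 2) / 2 * q + t = N) :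
    Integrable fun x : E N => profile N lam s ‖x‖ ^ q / ‖x‖ ^ t := by
  refine ((integrable_logCosh (N := N) (rate_pos hlam hs)
    (mul_pos (power_pos (N := N) hs) hq)).const_mul (profileConst N lam s ^ q)).congr ?_
  filter_upwards [ae_ne_zero N] with x hx
  have hr : 0 < ‖x‖ := norm_pos_iff.2 hx
  have e : -(N : ℝ) = -(((N : ℝ) - 2) / 2 * q) + -t := by linarith
  rw [profile_rpow hlam hs q hr, e, Real.rpow_add hr, Real.rpow_neg hr.le t]
  ring

theorem memLp_profile_crit {lam s : ℝ} (hlam : lam < hardyConst N) (hs : s < 2) :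
    MemLp (fun x : E N => profile N lam s ‖x‖) (ENNReal.ofReal (critExp N 0)) volume := by
  have h3 := natCast_three_le (N := N)
  have hp := critExp_zero_pos hN.out
  have h1 : (N : ℝ) - 2 ≠ 0 := by linarith
  have hm : AEStronglyMeasurable (fun x : E N => profile N lam s ‖x‖) volume :=
    ((measurable_profile lam s).comp measurable_norm).aestronglyMeasurable
  rw [← integrable_norm_rpow_iff hm (by simpa using hp) (by simp), ENNReal.toReal_ofReal hp.le]
  refine (integrable_profile_rpow hlam hs hp (t := 0) ?_).congr ?_
  · unfold critExp; field_simp; ring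
  · filter_upwards [ae_ne_zero N] with x hx
    have hr : 0 < ‖x‖ := norm_pos_iff.2 hx
    rw [Real.norm_of_nonneg (profile_pos hlam hs hr).le, Real.rpow_zero, div_one]

theorem memLp_profile_div {lam s : ℝ} (hlam : lam < hardyConst N) (hs : s < 2) :
    MemLp (fun x : E N => profile N lam s ‖x‖ / ‖x‖) 2 volume := by
  have hm : AEStronglyMeasurable (fun x : E N => profile N lam s ‖x‖ / ‖x‖) volume :=
    (((measurable_profile lam s).comp measurable_norm).div measurable_norm).aestronglyMeasurable
  rw [memLp_two_iff_integrable_sq hm]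
  refine (integrable_profile_rpow hlam hs two_pos (t := 2) (by ring)).congr ?_
  filter_upwards with x
  rw [div_pow, Real.rpow_two, Real.rpow_two]

theorem memLp_gradient_profile {lam s : ℝ} (hlam : lam < hardyConst N) (hs : s < 2) :
    MemLp (∇ fun x : E N => profile N lam s ‖x‖) 2 volume := by
  have hc : ContinuousOn (∇ fun x : E N => profile N lam s ‖x‖) {0}ᶜ := by
    intro x hx
    have : ContinuousAt (fderiv ℝ fun x : E N => profile N lam s ‖x‖) x :=
      ((contDiffAt_profile lam s hx).fderiv_right (m := 0) (by simp)).continuousAt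
    exact ((InnerProductSpace.toDual ℝ (E N)).symm.continuous.continuousAt.comp
      this).continuousWithinAt
  have hm : AEStronglyMeasurable (∇ fun x : E N => profile N lam s ‖x‖) volume := by
    have := nontrivial_E (N := N)
    have h := hc.aestronglyMeasurable (measurableSet_singleton (0 : E N)).compl
      (μ := (volume : Measure (E N)))
    rwa [restrict_compl_singleton] at h
  refine ((memLp_profile_div hlam hs).norm.const_mul
    (((N : ℝ) - 2) / 2 + rate N lam s * power N s)).mono hm ?_
  filter_upwards [ae_ne_zero N] with x hx
  have hr : 0 < ‖x‖ := norm_pos_iff.2 hx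
  have h1 := abs_profileLog_le hlam hs hr.le
  rw [gradient_profile lam s hx, norm_smul, norm_mul, norm_norm, norm_div, norm_mul, norm_pow,
    norm_norm, norm_div, norm_norm, Real.norm_eq_abs (profileLog N lam s ‖x‖)]
  calc _ = |profileLog N lam s ‖x‖| * (‖profile N lam s ‖x‖‖ / ‖x‖) := by field_simp
    _ ≤ _ := by
      gcongr
      exact h1.trans (le_abs_self _)

theorem isTestLimit_profile {lam s : ℝ} (hlam : lam < hardyConst N) (hs : s < 2) :
    IsTestLimit (fun x : E N => profile N lam s ‖x‖) (∇ fun x : E N => profile N lam s ‖x‖) :=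
  isTestLimit_of_punctured (fun _ hx => contDiffAt_profile lam s hx) (memLp_profile_crit hlam hs)
    (memLp_profile_div hlam hs) (memLp_gradient_profile hlam hs)

end Profile

/-! ### The Euler-Lagrange equation of the profile -/

section Euler

variable {N : ℕ}

theorem real_inner_eq_mul (a b : ℝ) : inner ℝ a b = a * b := by
  simp [mul_comm]

theorem potential_nonneg' {lam s : ℝ} (hm : 0 ≤ power N s) {r : ℝ} (hr : 0 ≤ r) :
    0 ≤ potential N lam s r := by
  have h1 := logTanh_lt_one (rate N lam s) hr
  have h2 := neg_one_le_logTanh (rate N lam s) hr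
  have : 0 ≤ 1 - logTanh (rate N lam s) r ^ 2 := by nlinarith
  unfold potential
  positivity

theorem abs_potential_le (lam s : ℝ) {r : ℝ} (hr : 0 ≤ r) :
    |potential N lam s r| ≤ |rate N lam s ^ 2 * (power N s * (power N s + 1))| := by
  have h1 := logTanh_lt_one (rate N lam s) hr
  have h2 := neg_one_le_logTanh (rate N lam s) hr
  have h3 : 0 ≤ 1 - logTanh (rate N lam s) r ^ 2 := by nlinarith
  rw [potential, abs_mul]
  refine mul_le_of_le_one_right (abs_nonneg _) ?_
  rw [abs_of_nonneg h3]
  nlinarith [sq_nonneg (logTanh (rate N lam s) r)]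

theorem measurable_potential (lam s : ℝ) : Measurable (potential N lam s) := by
  have := measurable_logTanh (rate N lam s)
  unfold potential; fun_prop

variable [hN : Fact (3 ≤ N)]

theorem potential_nonneg {lam s : ℝ} (hs : s < 2) {r : ℝ} (hr : 0 ≤ r) :
    0 ≤ potential N lam s r := potential_nonneg' (power_pos hs).le hr

theorem D12.memLp_potMap (lam s : ℝ) (u : D12 N) :
    MemLp (fun x => √(potential N lam s ‖x‖) * (u x / ‖x‖)) 2 volume := by
  have hm : Measurable fun x : E N => √(potential N lam s ‖x‖) := by
    have := measurable_potential (N := N) lam s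
    fun_prop
  refine (u.memLp_div_norm.const_mul
    (√|rate N lam s ^ 2 * (power N s * (power N s + 1))|)).mono
    (hm.aestronglyMeasurable.mul u.memLp_div_norm.1) (Eventually.of_forall fun x => ?_)
  rw [norm_mul, norm_mul, Real.norm_of_nonneg (Real.sqrt_nonneg _),
    Real.norm_of_nonneg (Real.sqrt_nonneg _)]
  gcongr
  exact (le_abs_self _).trans (abs_potential_le lam s (norm_nonneg x))

theorem D12.norm_toLp_potMap_le (lam s : ℝ) (u : D12 N) :
    ‖(u.memLp_potMap lam s).toLp _‖
      ≤ √|rate N lam s ^ 2 * (power N s * (power N s + 1))| * ‖hardyMap N u‖ := by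
  refine Lp.norm_le_mul_norm_of_ae_le_mul ?_
  filter_upwards [(u.memLp_potMap lam s).coeFn_toLp, coe_hardyMap u] with x h1 h2
  rw [h1, h2, norm_mul, Real.norm_of_nonneg (Real.sqrt_nonneg _)]
  gcongr
  exact (le_abs_self _).trans (abs_potential_le lam s (norm_nonneg x))

variable (N) in
/-- The map `u ↦ √V u / |x|` from `D^{1,2}` to `L^2`, with `V` the potential of the
linearization. -/
def potMap (lam s : ℝ) : D12 N →L[ℝ] Lp ℝ 2 (volume : Measure (E N)) :=
  LinearMap.mkContinuous
    { toFun := fun u => (u.memLp_potMap lam s).toLp _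
      map_add' := fun u v => by
        rw [← MemLp.toLp_add]
        apply MemLp.toLp_congr
        filter_upwards [D12.coe_add u v] with x hx
        simp only [Pi.add_apply, hx, add_div, mul_add]
      map_smul' := fun c u => by
        rw [RingHom.id_apply, ← MemLp.toLp_const_smul]
        apply MemLp.toLp_congr
        filter_upwards [D12.coe_smul c u] with x hx
        simp only [Pi.smul_apply, hx, smul_eq_mul]
        ring }
    (√|rate N lam s ^ 2 * (power N s * (power N s + 1))| * ‖hardyMap N‖) fun u =>
      (u.norm_toLp_potMap_le lam s).trans (by
        rw [mul_assoc]
        exact mul_le_mul_of_nonneg_left ((hardyMap N).le_opNorm u) (Real.sqrt_nonneg _))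

theorem coe_potMap (lam s : ℝ) (u : D12 N) :
    potMap N lam s u =ᵐ[volume] fun x => √(potential N lam s ‖x‖) * (u x / ‖x‖) :=
  (u.memLp_potMap lam s).coeFn_toLp

theorem inner_potMap {lam s : ℝ} (hs : s < 2) (u v : D12 N) :
    inner ℝ (potMap N lam s u) (potMap N lam s v)
      = ∫ x, potential N lam s ‖x‖ * (u x / ‖x‖) * (v x / ‖x‖) := by
  rw [L2.inner_def]
  refine integral_congr_ae ?_
  filter_upwards [coe_potMap lam s u, coe_potMap lam s v] with x h1 h2
  have := Real.mul_self_sqrt (potential_nonneg (N := N) (lam := lam) hs (norm_nonneg x))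
  simp only [h1, h2, real_inner_eq_mul]
  linear_combination (u x / ‖x‖) * (v x / ‖x‖) * this

theorem integrable_potMap {lam s : ℝ} (hs : s < 2) (u v : D12 N) :
    Integrable fun x => potential N lam s ‖x‖ * (u x / ‖x‖) * (v x / ‖x‖) := by
  refine (L2.integrable_inner (𝕜 := ℝ) (potMap N lam s u) (potMap N lam s v)).congr ?_
  filter_upwards [coe_potMap lam s u, coe_potMap lam s v] with x h1 h2
  have := Real.mul_self_sqrt (potential_nonneg (N := N) (lam := lam) hs (norm_nonneg x))
  simp only [h1, h2, real_inner_eq_mul]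
  linear_combination (u x / ‖x‖) * (v x / ‖x‖) * this

/-- The profile, as an element of `D^{1,2}`. -/
def profileD {lam s : ℝ} (hlam : lam < hardyConst N) (hs : s < 2) : D12 N :=
  D12.ofLimit (fun x : E N => profile N lam s ‖x‖) (∇ fun x : E N => profile N lam s ‖x‖)
    ((measurable_profile lam s).comp measurable_norm).aestronglyMeasurable
    (memLp_gradient_profile hlam hs) (isTestLimit_profile hlam hs)

theorem coe_profileD {lam s : ℝ} (hlam : lam < hardyConst N) (hs : s < 2) :
    profileD hlam hs =ᵐ[volume] fun x : E N => profile N lam s ‖x‖ := D12.coe_ofLimit _ _ _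

theorem profileD_pos {lam s : ℝ} (hlam : lam < hardyConst N) (hs : s < 2) :
    ∀ᵐ x, 0 < profileD hlam hs x := by
  filter_upwards [coe_profileD hlam hs, ae_ne_zero N] with x hx h0
  rw [hx]
  exact profile_pos hlam hs (norm_pos_iff.2 h0)

theorem continuousWithinAt_flux {lam s : ℝ} (hlam : lam < hardyConst N) (hs : s < 2) :
    ContinuousWithinAt (fun r => r ^ (N - 2) * (profile N lam s r * profileLog N lam s r))
      (Set.Ici 0) 0 := by
  have h3 := natCast_three_le (N := N)
  have hz : (0 : ℝ) ^ (N - 2) * (profile N lam s 0 * profileLog N lam s 0) = 0 := by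
    rw [zero_pow (by have := hN.out; omega), zero_mul]
  rw [ContinuousWithinAt, hz]
  set K := profileConst N lam s * (((N : ℝ) - 2) / 2 + rate N lam s * power N s)
  have hC := profileConst_pos hlam hs
  have hb : Tendsto (fun r : ℝ => K * r ^ (((N : ℝ) - 2) / 2)) (𝓝[Set.Ici 0] 0) (𝓝 0) := by
    have h1 : ContinuousAt (fun r : ℝ => K * r ^ (((N : ℝ) - 2) / 2)) 0 :=
      (Real.continuousAt_rpow_const 0 _ (Or.inr (by linarith))).const_mul K |>.congr
        (Eventually.of_forall fun _ => rfl)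
    have h2 := h1.tendsto
    rw [Real.zero_rpow (by linarith), mul_zero] at h2
    exact h2.mono_left nhdsWithin_le_nhds
  refine squeeze_zero_norm' ?_ hb
  filter_upwards [self_mem_nhdsWithin] with r hr
  rcases eq_or_lt_of_le (Set.mem_Ici.1 hr) with h | h
  · rw [← h, hz, norm_zero, Real.zero_rpow (by linarith), mul_zero]
  · have hlc := two_le_logCosh (rate N lam s) h
    have h4 : logCosh (rate N lam s) r ^ (-power N s) ≤ 1 :=
      Real.rpow_le_one_of_one_le_of_nonpos (by linarith) (by linarith [power_pos (N := N) hs])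
    have h5 := abs_profileLog_le hlam hs h.le
    have h6 : r ^ (N - 2) * r ^ (-(((N : ℝ) - 2) / 2)) = r ^ (((N : ℝ) - 2) / 2) := by
      rw [← Real.rpow_natCast, ← Real.rpow_add h]
      congr 1
      push_cast [show 2 ≤ N by have := hN.out; omega]
      ring
    rw [norm_mul, norm_mul, Real.norm_of_nonneg (profile_pos hlam hs h).le,
      Real.norm_of_nonneg (by positivity), Real.norm_eq_abs, profile]
    have h7 : 0 ≤ logCosh (rate N lam s) r ^ (-power N s) :=
      Real.rpow_nonneg (by linarith) _
    calc r ^ (N - 2) * (profileConst N lam s * r ^ (-(((N : ℝ) - 2) / 2)) *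
          logCosh (rate N lam s) r ^ (-power N s) * |profileLog N lam s r|)
        = profileConst N lam s * (r ^ (N - 2) * r ^ (-(((N : ℝ) - 2) / 2))) *
          logCosh (rate N lam s) r ^ (-power N s) * |profileLog N lam s r| := by ring
      _ ≤ profileConst N lam s * r ^ (((N : ℝ) - 2) / 2) * 1 *
          (((N : ℝ) - 2) / 2 + rate N lam s * power N s) := by
          rw [h6]; gcongr
      _ = _ := by simp only [K]; ring

/-- The equation `-Δz = (λ + V) z / |x|²`, tested against a test function. -/
theorem euler_test {lam s : ℝ} (hlam : lam < hardyConst N) (hs : s < 2) {ψ : E N → ℝ}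
    (hψ : IsTest ψ)
    (hf : Integrable fun x : E N => inner ℝ (∇ (fun y : E N => profile N lam s ‖y‖) x) (∇ ψ x)
      - (lam + potential N lam s ‖x‖) * (profile N lam s ‖x‖ / ‖x‖) * (ψ x / ‖x‖)) :
    ∫ x : E N, (inner ℝ (∇ (fun y : E N => profile N lam s ‖y‖) x) (∇ ψ x)
      - (lam + potential N lam s ‖x‖) * (profile N lam s ‖x‖ / ‖x‖) * (ψ x / ‖x‖)) = 0 := by
  obtain ⟨R, hR, h0⟩ := hψ.exists_radius
  have hi := (integrable_iff_polar hf.1).1 hf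
  rw [integral_polar hf.1, integral_prod _ hi]
  refine integral_eq_zero_of_ae ?_
  filter_upwards [hi.prod_right_ae] with w hw
  set F : ℝ → ℝ := fun r => r ^ (N - 2) * (profile N lam s r * profileLog N lam s r)
  have hψd : ∀ r : ℝ, HasDerivAt (fun r : ℝ => ψ (r • (w : E N)))
      (inner ℝ (∇ ψ (r • (w : E N))) (w : E N)) r := fun r =>
    hasDerivAt_ray (hψ.contDiff_one.differentiable (by simp) _)
  have hd : ∀ r ∈ Set.Ioi (0 : ℝ), HasDerivAt (fun r => F r * ψ (r • (w : E N)))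
      (r ^ (N - 1) * (inner ℝ (∇ (fun y : E N => profile N lam s ‖y‖) (r • (w : E N)))
        (∇ ψ (r • (w : E N))) - (lam + potential N lam s ‖r • (w : E N)‖) *
          (profile N lam s ‖r • (w : E N)‖ / ‖r • (w : E N)‖) *
          (ψ (r • (w : E N)) / ‖r • (w : E N)‖))) r := by
    intro r hr
    have hr0 : 0 < r := hr
    have hne : r • (w : E N) ≠ 0 := by
      rw [← norm_ne_zero_iff, norm_smul_sph hr0.le]; exact hr0.ne'
    refine ((hasDerivAt_flux hlam hs hr0).mul (hψd r)).congr_deriv ?_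
    rw [gradient_profile lam s hne, norm_smul_sph hr0.le, inner_smul_left, inner_smul_left,
      real_inner_comm (w : E N)]
    simp only [RCLike.conj_to_real]
    obtain ⟨n, rfl⟩ : ∃ n, N = n + 3 := ⟨N - 3, by have := hN.out; omega⟩
    simp only [Nat.add_sub_cancel, show n + 3 - 2 = n + 1 from rfl,
      show n + 3 - 1 = n + 2 from rfl]
    field_simp
    ring
  have hlim : Tendsto (fun r => F r * ψ (r • (w : E N))) atTop (𝓝 0) := by
    refine tendsto_const_nhds.congr' ?_
    filter_upwards [eventually_ge_atTop R] with r hr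
    rw [(h0 _ (by rw [norm_smul_sph (hR.le.trans hr)]; exact hr)).1, mul_zero]
  have hc : ContinuousWithinAt (fun r => F r * ψ (r • (w : E N))) (Set.Ici 0) 0 :=
    (continuousWithinAt_flux hlam hs).mul (hψd 0).continuousAt.continuousWithinAt
  rw [integral_Ioi_of_hasDerivAt_of_tendsto hc hd hw hlim]
  simp only [F]
  rw [zero_pow (by have := hN.out; omega)]
  simp

/-- The Euler-Lagrange equation of the profile on `D^{1,2}`. -/
theorem euler {lam s : ℝ} (hlam : lam < hardyConst N) (hs : s < 2) (ψ : D12 N) :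
    inner ℝ (D12.grad N (profileD hlam hs)) (D12.grad N ψ)
      = lam * inner ℝ (hardyMap N (profileD hlam hs)) (hardyMap N ψ)
        + inner ℝ (potMap N lam s (profileD hlam hs)) (potMap N lam s ψ) := by
  have hgc : Continuous (D12.grad N) := (D12.gradₗᵢ N).continuous
  refine D12.dense_test (P := fun ψ : D12 N =>
    inner ℝ (D12.grad N (profileD hlam hs)) (D12.grad N ψ)
      = lam * inner ℝ (hardyMap N (profileD hlam hs)) (hardyMap N ψ)
        + inner ℝ (potMap N lam s (profileD hlam hs)) (potMap N lam s ψ)) ?_ ?_ ψ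
  · exact isClosed_eq (by fun_prop) (by fun_prop)
  · intro φ hφ
    have i1 := L2.integrable_inner (𝕜 := ℝ) (D12.grad N (profileD hlam hs))
      (D12.grad N hφ.toD12)
    have i2 := L2.integrable_inner (𝕜 := ℝ) (hardyMap N (profileD hlam hs))
      (hardyMap N hφ.toD12)
    have i3 := L2.integrable_inner (𝕜 := ℝ) (potMap N lam s (profileD hlam hs))
      (potMap N lam s hφ.toD12)
    have e : (fun x => inner ℝ (D12.grad N (profileD hlam hs) x) (D12.grad N hφ.toD12 x)
        - (lam * inner ℝ (hardyMap N (profileD hlam hs) x) (hardyMap N hφ.toD12 x)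
        + inner ℝ (potMap N lam s (profileD hlam hs) x) (potMap N lam s hφ.toD12 x)))
        =ᵐ[volume] fun x => inner ℝ (∇ (fun y : E N => profile N lam s ‖y‖) x) (∇ φ x)
      - (lam + potential N lam s ‖x‖) * (profile N lam s ‖x‖ / ‖x‖) * (φ x / ‖x‖) := by
      filter_upwards [(memLp_gradient_profile (N := N) hlam hs).coeFn_toLp,
        (hφ.memLp_gradient 2).coeFn_toLp, coe_hardyMap (profileD hlam hs), coe_hardyMap hφ.toD12,
        coe_potMap lam s (profileD hlam hs), coe_potMap lam s hφ.toD12, coe_profileD hlam hs,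
        hφ.coe_toD12] with x h1 h2 h3 h4 h5 h6 h7 h8
      have := Real.mul_self_sqrt (potential_nonneg (N := N) (lam := lam) hs (norm_nonneg x))
      rw [h3, h4, h5, h6, h7, h8]
      rw [← h1, ← h2]
      simp only [real_inner_eq_mul]
      have e1 : D12.grad N (profileD hlam hs) = (memLp_gradient_profile hlam hs).toLp _ := rfl
      have e2 : D12.grad N hφ.toD12 = (hφ.memLp_gradient 2).toLp _ := rfl
      rw [e1, e2]
      linear_combination -(profile N lam s ‖x‖ / ‖x‖) * (φ x / ‖x‖) * this
    have i4 : Integrable fun x => lam * inner ℝ (hardyMap N (profileD hlam hs) x)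
        (hardyMap N hφ.toD12 x) + inner ℝ (potMap N lam s (profileD hlam hs) x)
        (potMap N lam s hφ.toD12 x) := (i2.const_mul lam).add i3
    have hi := (i1.sub i4).congr e
    have key := euler_test hlam hs hφ hi
    rw [← integral_congr_ae e, integral_sub i1 i4,
      integral_add (i2.const_mul lam) i3, integral_const_mul] at key
    rw [L2.inner_def, L2.inner_def, L2.inner_def]
    linarith

theorem crit_eq_potential {lam s : ℝ} (hlam : lam < hardyConst N) (hs : s < 2) {r : ℝ} (hr : 0 < r) :
    profile N lam s r ^ (critExp N s - 2) / r ^ s = potential N lam s r / r ^ 2 := by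
  rw [← profile_rpow_mul hlam hs hr, Real.rpow_sub hr, Real.rpow_two]
  field_simp

theorem critInt_profileD {lam s : ℝ} (hlam : lam < hardyConst N) (hs : s < 2) :
    critInt s (profileD (N := N) hlam hs) = ‖potMap N lam s (profileD hlam hs)‖ ^ 2 := by
  rw [← real_inner_self_eq_norm_sq, inner_potMap hs, critInt]
  refine integral_congr_ae ?_
  filter_upwards [coe_profileD hlam hs, ae_ne_zero N] with x hx h0
  have hr : 0 < ‖x‖ := norm_pos_iff.2 h0
  have hz := profile_pos hlam hs hr
  have h := crit_eq_potential hlam hs hr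
  have e : profile N lam s ‖x‖ ^ critExp N s
      = profile N lam s ‖x‖ ^ (critExp N s - 2) * profile N lam s ‖x‖ ^ 2 := by
    rw [← Real.rpow_two, ← Real.rpow_add hz]; congr 1; ring
  rw [hx, abs_of_pos hz, e, mul_div_right_comm, h]
  field_simp

theorem normSq_profileD {lam s : ℝ} (hlam : lam < hardyConst N) (hs : s < 2) :
    normSq lam (profileD (N := N) hlam hs) = critInt s (profileD (N := N) hlam hs) := by
  have h := euler hlam hs (profileD (N := N) hlam hs)
  rw [real_inner_self_eq_norm_sq, real_inner_self_eq_norm_sq, real_inner_self_eq_norm_sq,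
    ← D12.norm_def] at h
  rw [critInt_profileD, normSq_eq]
  linarith

end Euler

/-! ### Wirtinger's inequality and the circle -/

section Circle

/-- Wirtinger's inequality for a function vanishing at the ends of an interval of length `L`. -/
theorem wirtinger_dirichlet {h h' : ℝ → ℝ} {a L : ℝ} (hL : 0 < L)
    (hd : ∀ t, HasDerivAt h (h' t) t) (hc : Continuous h') (h0 : h a = 0) (h1 : h (a + L) = 0) :
    (Real.pi / L) ^ 2 * ∫ t in a..(a + L), h t ^ 2 ≤ ∫ t in a..(a + L), h' t ^ 2 := by
  have hcont : Continuous h := continuous_iff_continuousAt.2 fun t => (hd t).continuousAt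
  have hI : IntervalIntegrable (fun t => h t ^ 2) volume a (a + L) :=
    (hcont.pow 2).intervalIntegrable _ _
  have hI' : IntervalIntegrable (fun t => h' t ^ 2) volume a (a + L) :=
    (hc.pow 2).intervalIntegrable _ _
  -- a Riccati solution of frequency slightly below `π / L` is regular on the whole interval
  have key : ∀ c ∈ Set.Ioo 0 (Real.pi / L),
      c ^ 2 * ∫ t in a..(a + L), h t ^ 2 ≤ ∫ t in a..(a + L), h' t ^ 2 := by
    intro c hcI
    have hcos : ∀ t ∈ Set.Icc a (a + L), Real.cos (c * (t - (a + L / 2))) ≠ 0 := by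
      intro t ht
      refine (Real.cos_pos_of_mem_Ioo ⟨?_, ?_⟩).ne'
      all_goals
        have h3 : c * L < Real.pi := by
          have := hcI.2; rwa [lt_div_iff₀ hL] at this
        have h4 := hcI.1
        have h5 := ht.1
        have h6 := ht.2
        nlinarith
    have hT : ∀ t ∈ Set.Icc a (a + L), HasDerivAt (fun t => Real.tan (c * (t - (a + L / 2))))
        (1 / Real.cos (c * (t - (a + L / 2))) ^ 2 * c) t := by
      intro t ht
      have h3 : HasDerivAt (fun t => c * (t - (a + L / 2))) c t := by
        simpa using ((hasDerivAt_id t).sub_const (a + L / 2)).const_mul c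
      exact (Real.hasDerivAt_tan (hcos t ht)).comp t h3
    have hF := intervalIntegral.sub_le_integral_of_hasDeriv_right_of_le
      (g := fun t => -(c * (h t ^ 2 * Real.tan (c * (t - (a + L / 2))))))
      (φ := fun t => h' t ^ 2 - c ^ 2 * h t ^ 2) (a := a) (b := a + L) (by linarith)
      (g' := fun t => -(c * (2 * h t * h' t * Real.tan (c * (t - (a + L / 2)))
        + h t ^ 2 * (1 / Real.cos (c * (t - (a + L / 2))) ^ 2 * c)))) ?_ ?_ ?_ ?_
    · simp only [h0, h1] at hF
      rw [intervalIntegral.integral_sub hI' (hI.const_mul _),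
        intervalIntegral.integral_const_mul] at hF
      simp at hF
      linarith
    · exact fun t ht => ((((hd t).continuousAt.pow 2).mul (hT t ht).continuousAt).const_mul c
        |>.neg).continuousWithinAt
    · intro t ht
      refine HasDerivAt.hasDerivWithinAt ?_
      refine ((((hd t).pow 2).mul (hT t (Set.Ioo_subset_Icc_self ht))).const_mul c).neg.congr_deriv ?_
      simp
    · exact ((hc.pow 2).sub ((hcont.pow 2).const_mul _)).continuousOn.integrableOn_compact
        isCompact_Icc
    · intro t ht
      have h3 := hcos t (Set.Ioo_subset_Icc_self ht)
      have h4 : 1 / Real.cos (c * (t - (a + L / 2))) ^ 2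
          = 1 + Real.tan (c * (t - (a + L / 2))) ^ 2 := by
        rw [one_div, ← Real.inv_one_add_tan_sq h3, inv_inv]
      simp only [h4]
      nlinarith [sq_nonneg (h' t + c * h t * Real.tan (c * (t - (a + L / 2))))]
  have hpos : 0 < Real.pi / L := div_pos Real.pi_pos hL
  have hlim : Tendsto (fun c : ℝ => c ^ 2 * ∫ t in a..(a + L), h t ^ 2)
      (𝓝[<] (Real.pi / L)) (𝓝 ((Real.pi / L) ^ 2 * ∫ t in a..(a + L), h t ^ 2)) := by
    have : Continuous fun c : ℝ => c ^ 2 * ∫ t in a..(a + L), h t ^ 2 := by fun_prop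
    exact this.continuousAt.mono_left nhdsWithin_le_nhds
  refine le_of_tendsto hlim ?_
  filter_upwards [Ioo_mem_nhdsLT hpos] with c hc
  exact key c hc

/-- Wirtinger's inequality for a function with `h (t + L) = - h t`. -/
theorem wirtinger_antiperiodic {h h' : ℝ → ℝ} {L : ℝ} (hL : 0 < L)
    (hd : ∀ t, HasDerivAt h (h' t) t) (hc : Continuous h') (ha : ∀ t, h (t + L) = -h t) :
    (Real.pi / L) ^ 2 * ∫ t in (0 : ℝ)..L, h t ^ 2 ≤ ∫ t in (0 : ℝ)..L, h' t ^ 2 := by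
  have hcont : Continuous h := continuous_iff_continuousAt.2 fun t => (hd t).continuousAt
  have ha' : ∀ t, h' (t + L) = -h' t := by
    intro t
    have h1 : HasDerivAt (fun t => h (t + L)) (h' (t + L)) t := (hd (t + L)).comp_add_const t L
    have h2 : HasDerivAt (fun t => h (t + L)) (-h' t) t := by
      simp only [ha]; exact (hd t).neg
    exact h1.unique h2
  have p1 : Function.Periodic (fun t => h t ^ 2) L := fun t => by simp [ha]
  have p2 : Function.Periodic (fun t => h' t ^ 2) L := fun t => by simp [ha']
  obtain ⟨a, -, hz⟩ : ∃ a ∈ Set.uIcc 0 L, h a = 0 := by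
    refine intermediate_value_uIcc hcont.continuousOn ?_
    have h2 : h L = -h 0 := by simpa using ha 0
    rw [Set.mem_uIcc, h2]
    rcases le_total 0 (h 0) with h | h
    · right; constructor <;> linarith
    · left; constructor <;> linarith
  have key := wirtinger_dirichlet hL hd hc hz (by rw [ha, hz, neg_zero])
  have e1 := p1.intervalIntegral_add_eq a 0
  have e2 := p2.intervalIntegral_add_eq a 0
  rw [zero_add] at e1 e2
  rwa [e1, e2] at key

theorem integral_double {f : ℝ → ℝ} (hf : Continuous f) (L : ℝ) :
    ∫ t in (0 : ℝ)..(2 * L), f t = ∫ t in (0 : ℝ)..L, (f t + f (t + L)) := by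
  rw [intervalIntegral.integral_add (hf.intervalIntegrable _ _)
    ((by fun_prop : Continuous fun t => f (t + L)).intervalIntegrable _ _),
    intervalIntegral.integral_comp_add_right, zero_add, ← two_mul,
    intervalIntegral.integral_add_adjacent_intervals (hf.intervalIntegrable _ _)
    (hf.intervalIntegrable _ _)]

/-- The inequality on the circle behind the Gaussian Poincaré inequality. The `k`-th Fourier mode
contributes `2 (1 - cos (k π / 2)) ≤ 2 k²`. -/
theorem circle_inequality {g g' : ℝ → ℝ} (hd : ∀ t, HasDerivAt g (g' t) t) (hc : Continuous g')
    (hp : ∀ t, g (t + 2 * Real.pi) = g t) :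
    ∫ t in (0 : ℝ)..(2 * Real.pi), (g (t + Real.pi / 2) - g t) ^ 2
      ≤ 2 * ∫ t in (0 : ℝ)..(2 * Real.pi), g' t ^ 2 := by
  have hg : Continuous g := continuous_iff_continuousAt.2 fun t => (hd t).continuousAt
  have hp' : ∀ t, g' (t + 2 * Real.pi) = g' t := by
    intro t
    have h1 := (hd (t + 2 * Real.pi)).comp_add_const t (2 * Real.pi)
    simp only [hp] at h1
    exact h1.unique (hd t)
  have hshift : ∀ c t, HasDerivAt (fun t => g (t + c)) (g' (t + c)) t := fun c t =>
    (hd (t + c)).comp_add_const t c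
  set π := Real.pi with hπ
  have hπ0 : 0 < π := Real.pi_pos
  -- the odd and the even part under the half turn
  set A : ℝ → ℝ := fun t => (g t - g (t + π)) / 2 with hA
  set B : ℝ → ℝ := fun t => (g t + g (t + π)) / 2 with hB
  set A' : ℝ → ℝ := fun t => (g' t - g' (t + π)) / 2 with hA'
  set B' : ℝ → ℝ := fun t => (g' t + g' (t + π)) / 2 with hB'
  have dA : ∀ t, HasDerivAt A (A' t) t := fun t => ((hd t).sub (hshift π t)).div_const 2
  have dB : ∀ t, HasDerivAt B (B' t) t := fun t => ((hd t).add (hshift π t)).div_const 2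
  have cA : Continuous A := by fun_prop
  have cB : Continuous B := by fun_prop
  have cA' : Continuous A' := by fun_prop
  have cB' : Continuous B' := by fun_prop
  have aA : ∀ t, A (t + π) = -A t := fun t => by
    simp only [hA]; rw [add_assoc, ← two_mul, hp]; ring
  have aB : ∀ t, B (t + π) = B t := fun t => by
    simp only [hB]; rw [add_assoc, ← two_mul, hp]; ring
  have aB' : ∀ t, B' (t + π) = B' t := fun t => by
    simp only [hB']; rw [add_assoc, ← two_mul, hp']; ring
  have eL : ∫ t in (0 : ℝ)..(2 * π), (g (t + π / 2) - g t) ^ 2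
      = 2 * ((∫ t in (0 : ℝ)..π, (A (t + π / 2) - A t) ^ 2)
        + ∫ t in (0 : ℝ)..π, (B (t + π / 2) - B t) ^ 2) := by
    rw [integral_double (by fun_prop), ← intervalIntegral.integral_add
      (Continuous.intervalIntegrable (by fun_prop) _ _)
      (Continuous.intervalIntegrable (by fun_prop) _ _), ← intervalIntegral.integral_const_mul]
    refine intervalIntegral.integral_congr fun t _ => ?_
    simp only [hA, hB]
    rw [show t + π + π / 2 = t + π / 2 + π by ring]
    ring
  have eR : ∫ t in (0 : ℝ)..(2 * π), g' t ^ 2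
      = 2 * ((∫ t in (0 : ℝ)..π, A' t ^ 2) + ∫ t in (0 : ℝ)..π, B' t ^ 2) := by
    rw [integral_double (by fun_prop), ← intervalIntegral.integral_add
      (Continuous.intervalIntegrable (by fun_prop) _ _)
      (Continuous.intervalIntegrable (by fun_prop) _ _), ← intervalIntegral.integral_const_mul]
    refine intervalIntegral.integral_congr fun t _ => ?_
    simp only [hA', hB']
    ring
  have shift : ∀ f : ℝ → ℝ, Function.Periodic f π →
      ∫ t in (0 : ℝ)..π, f (t + π / 2) = ∫ t in (0 : ℝ)..π, f t := by
    intro f hf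
    rw [intervalIntegral.integral_comp_add_right, zero_add, add_comm π,
      hf.intervalIntegral_add_eq (π / 2) 0, zero_add]
  have hAodd : ∫ t in (0 : ℝ)..π, (A (t + π / 2) - A t) ^ 2 ≤ 2 * ∫ t in (0 : ℝ)..π, A' t ^ 2 := by
    have hW := wirtinger_antiperiodic hπ0 dA cA' aA
    rw [← hπ, div_self hπ0.ne', one_pow, one_mul] at hW
    have hcross : ∫ t in (0 : ℝ)..π, A t * A (t + π / 2) = 0 := by
      have : π = 2 * (π / 2) := by ring
      conv_lhs => rw [this]
      rw [integral_double (by fun_prop)]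
      have : ∀ t, A t * A (t + 2 * (π / 2) / 2) + A (t + π / 2) * A (t + π / 2 + 2 * (π / 2) / 2) = 0 := by
        intro t
        rw [show t + π / 2 + 2 * (π / 2) / 2 = t + π by ring, aA,
          show t + 2 * (π / 2) / 2 = t + π / 2 by ring]
        ring
      simp only [this, intervalIntegral.integral_zero]
    have hs := shift (fun t => A t ^ 2) fun t => by simp [aA]
    have e : ∫ t in (0 : ℝ)..π, (A (t + π / 2) - A t) ^ 2
        = (∫ t in (0 : ℝ)..π, A (t + π / 2) ^ 2) + (∫ t in (0 : ℝ)..π, A t ^ 2)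
          - 2 * ∫ t in (0 : ℝ)..π, A t * A (t + π / 2) := by
      rw [← intervalIntegral.integral_const_mul, ← intervalIntegral.integral_add
        (Continuous.intervalIntegrable (by fun_prop) _ _)
        (Continuous.intervalIntegrable (by fun_prop) _ _), ← intervalIntegral.integral_sub
        (Continuous.intervalIntegrable (by fun_prop) _ _)
        (Continuous.intervalIntegrable (by fun_prop) _ _)]
      refine intervalIntegral.integral_congr fun t _ => ?_
      ring
    rw [e, hs, hcross]
    linarith
  have hBeven : ∫ t in (0 : ℝ)..π, (B (t + π / 2) - B t) ^ 2 ≤ 2 * ∫ t in (0 : ℝ)..π, B' t ^ 2 := by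
    have hW := wirtinger_antiperiodic (h := fun t => B (t + π / 2) - B t)
      (h' := fun t => B' (t + π / 2) - B' t) (L := π / 2) (by positivity)
      (fun t => ((dB (t + π / 2)).comp_add_const t (π / 2)).sub (dB t)) (by fun_prop)
      (fun t => by
        rw [show t + π / 2 + π / 2 = t + π by ring, aB]; ring)
    rw [← hπ, show π / (π / 2) = 2 by field_simp] at hW
    have d1 : ∫ t in (0 : ℝ)..π, (B (t + π / 2) - B t) ^ 2
        = 2 * ∫ t in (0 : ℝ)..(π / 2), (B (t + π / 2) - B t) ^ 2 := by
      have := integral_double (f := fun t => (B (t + π / 2) - B t) ^ 2) (by fun_prop) (π / 2)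
      rw [show 2 * (π / 2) = π by ring] at this
      rw [this, ← intervalIntegral.integral_const_mul]
      refine intervalIntegral.integral_congr fun t _ => ?_
      rw [show t + π / 2 + π / 2 = t + π by ring, aB]; ring
    have d2 : ∫ t in (0 : ℝ)..π, (B' (t + π / 2) - B' t) ^ 2
        = 2 * ∫ t in (0 : ℝ)..(π / 2), (B' (t + π / 2) - B' t) ^ 2 := by
      have := integral_double (f := fun t => (B' (t + π / 2) - B' t) ^ 2) (by fun_prop) (π / 2)
      rw [show 2 * (π / 2) = π by ring] at this
      rw [this, ← intervalIntegral.integral_const_mul]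
      refine intervalIntegral.integral_congr fun t _ => ?_
      rw [show t + π / 2 + π / 2 = t + π by ring, aB']; ring
    have hs := shift (fun t => B' t ^ 2) fun t => by simp [aB']
    have e : ∫ t in (0 : ℝ)..π, (B' (t + π / 2) - B' t) ^ 2
        ≤ 2 * (∫ t in (0 : ℝ)..π, B' (t + π / 2) ^ 2) + 2 * ∫ t in (0 : ℝ)..π, B' t ^ 2 := by
      rw [← intervalIntegral.integral_const_mul, ← intervalIntegral.integral_const_mul,
        ← intervalIntegral.integral_add
        (Continuous.intervalIntegrable (by fun_prop) _ _)
        (Continuous.intervalIntegrable (by fun_prop) _ _)]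
      refine intervalIntegral.integral_mono_on hπ0.le
        (Continuous.intervalIntegrable (by fun_prop) _ _)
        (Continuous.intervalIntegrable (by fun_prop) _ _) fun t _ => ?_
      nlinarith [sq_nonneg (B' (t + π / 2) + B' t)]
    have hn : 0 ≤ ∫ t in (0 : ℝ)..π, B' t ^ 2 :=
      intervalIntegral.integral_nonneg hπ0.le fun t _ => sq_nonneg _
    rw [hs] at e
    linarith
  rw [eL, eR]
  linarith

end Circle

/-! ### The sharp Poincaré inequality on the sphere, from the Gaussian one -/

section Sphere

variable {N : ℕ}

/-- The standard Gaussian measure of `ℝ^N`. -/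
abbrev gauss (N : ℕ) : Measure (E N) := ProbabilityTheory.stdGaussian (E N)

theorem exists_gauss_eq_withDensity : ∃ c : ℝ, 0 < c ∧
    gauss N = volume.withDensity fun x => ENNReal.ofReal (c * Real.exp (-(1 / 2) * ‖x‖ ^ 2)) := by
  have h0 := GaussianFourier.integral_rexp_neg_mul_sq_norm (V := E N) (b := 1 / 2) (by norm_num)
  set K : ℝ := ∫ x : E N, Real.exp (-(1 / 2) * ‖x‖ ^ 2) with hK
  have hKpos : 0 < K := by rw [h0]; positivity
  have hi : Integrable fun x : E N => Real.exp (-(1 / 2) * ‖x‖ ^ 2) := by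
    by_contra hcon
    exact hKpos.ne' (hK.trans (integral_undef hcon))
  have hfin : IsFiniteMeasure (volume.withDensity
      fun x : E N => ENNReal.ofReal (K⁻¹ * Real.exp (-(1 / 2) * ‖x‖ ^ 2))) :=
    isFiniteMeasure_withDensity_ofReal (hi.const_mul _).2
  refine ⟨K⁻¹, inv_pos.2 hKpos, Measure.ext_of_charFun ?_⟩
  funext t
  rw [ProbabilityTheory.charFun_stdGaussian, charFun_apply,
    integral_withDensity_eq_integral_toReal_smul (by fun_prop) (by simp)]
  have h1 := GaussianFourier.integral_cexp_neg_mul_sq_norm_add (V := E N) (b := 1 / 2)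
    (by norm_num) Complex.I t
  have h2 := GaussianFourier.integral_cexp_neg_mul_sq_norm_add (V := E N) (b := 1 / 2)
    (by norm_num) 0 0
  have h3 : (K : ℂ) = ∫ x : E N, Complex.exp (-(1 / 2) * ‖x‖ ^ 2) := by
    rw [hK, ← integral_complex_ofReal]
    refine integral_congr_ae (Eventually.of_forall fun x => ?_)
    push_cast; rfl
  have h4 : ∫ x : E N, (ENNReal.ofReal (K⁻¹ * Real.exp (-(1 / 2) * ‖x‖ ^ 2))).toReal •
      Complex.exp (inner ℝ x t * Complex.I)
      = (K : ℂ)⁻¹ * ∫ x : E N, Complex.exp (-(1 / 2) * ‖x‖ ^ 2 + Complex.I * inner ℝ t x) := by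
    rw [← integral_const_mul]
    refine integral_congr_ae (Eventually.of_forall fun x => ?_)
    simp only
    rw [ENNReal.toReal_ofReal (by positivity), Complex.real_smul, Complex.exp_add,
      real_inner_comm, mul_comm Complex.I]
    push_cast
    ring
  simp only [add_zero, inner_zero_left, Complex.ofReal_zero, mul_zero, norm_zero,
    ne_eq, OfNat.ofNat_ne_zero, not_false_eq_true, zero_pow, zero_div, Complex.exp_zero,
    mul_one] at h2
  rw [← h3] at h2
  rw [h4, h1, ← h2]
  have hK0 : (K : ℂ) ≠ 0 := by exact_mod_cast hKpos.ne'
  rw [← mul_assoc, inv_mul_cancel₀ hK0, one_mul, Complex.I_sq]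
  congr 1
  ring

theorem gauss_absolutelyContinuous : gauss N ≪ volume := by
  obtain ⟨c, -, h⟩ := exists_gauss_eq_withDensity (N := N)
  rw [h]
  exact withDensity_absolutelyContinuous _ _

/-- The rotation of a pair of vectors by the angle `θ`. -/
def gaussRot (θ : ℝ) (q : E N × E N) : E N × E N :=
  (Real.cos θ • q.1 + Real.sin θ • q.2, -Real.sin θ • q.1 + Real.cos θ • q.2)

theorem measurable_gaussRot : Measurable fun z : ℝ × (E N × E N) => gaussRot z.1 z.2 := by
  simp only [gaussRot]; fun_prop

theorem measurePreserving_gaussRot (θ : ℝ) : MeasurePreserving (gaussRot (N := N) θ)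
    ((gauss N).prod (gauss N)) ((gauss N).prod (gauss N)) where
  measurable := by unfold gaussRot; fun_prop
  map_eq := ProbabilityTheory.IsGaussian.map_rotation_eq_self (μ := gauss N)
    ProbabilityTheory.integral_id_stdGaussian θ

theorem integrable_inner_sq (a : E N) :
    Integrable (fun y => inner ℝ a y ^ 2) (gauss N) :=
  ((ProbabilityTheory.IsGaussian.memLp_id (gauss N) 2 (by simp)).const_inner a).integrable_sq

theorem integral_inner_sq (a : E N) : ∫ y, inner ℝ a y ^ 2 ∂(gauss N) = ‖a‖ ^ 2 := by
  have h := ProbabilityTheory.variance_dual_stdGaussian (E := E N) (innerSL ℝ a)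
  rw [ProbabilityTheory.variance_of_integral_eq_zero (by fun_prop)
    (ProbabilityTheory.integral_strongDual_stdGaussian _), innerSL_apply_norm] at h
  simpa using h

theorem norm_sq_eq_sum (y : E N) :
    ‖y‖ ^ 2 = ∑ i, inner ℝ (EuclideanSpace.single i (1 : ℝ)) y ^ 2 := by
  rw [EuclideanSpace.norm_sq_eq]
  refine Finset.sum_congr rfl fun i _ => ?_
  rw [EuclideanSpace.inner_single_left]
  simp

theorem integral_norm_sq_gauss : ∫ y : E N, ‖y‖ ^ 2 ∂(gauss N) = N := by
  simp only [norm_sq_eq_sum]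
  rw [integral_finsetSum _ fun i _ => integrable_inner_sq _]
  simp [integral_inner_sq]

variable [hN : Fact (3 ≤ N)]

/-- The norm and the direction of a Gaussian vector are independent, and the direction is
uniformly distributed. -/
theorem integral_gauss_polar {g : ℝ → ℝ} {k : E N → ℝ} (hg : Measurable g) (hk : Measurable k) :
    (sphMeas N).real Set.univ * ∫ x, g ‖x‖ * k (‖x‖⁻¹ • x) ∂(gauss N)
      = (∫ w : Sph N, k (w : E N) ∂(sphMeas N)) * ∫ x, g ‖x‖ ∂(gauss N) := by
  obtain ⟨c, hc, h⟩ := exists_gauss_eq_withDensity (N := N)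
  have key : ∀ k : E N → ℝ, Measurable k → ∫ x, g ‖x‖ * k (‖x‖⁻¹ • x) ∂(gauss N)
      = (∫ w : Sph N, k (w : E N) ∂(sphMeas N)) * ∫ r in Set.Ioi (0 : ℝ),
        r ^ (N - 1) * (c * Real.exp (-(1 / 2) * r ^ 2) * g r) := by
    intro k hk
    rw [h, integral_withDensity_eq_integral_toReal_smul (by fun_prop) (by simp),
      integral_polar (by
        refine Measurable.aestronglyMeasurable ?_
        simp only [smul_eq_mul]
        fun_prop), ← integral_prod_mul]
    refine integral_congr_ae ?_
    have : ∀ᵐ q : Sph N × ℝ ∂((sphMeas N).prod (volume.restrict (Set.Ioi 0))), 0 < q.2 :=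
      Measure.quasiMeasurePreserving_snd.ae (ae_restrict_mem measurableSet_Ioi)
    filter_upwards [this] with q hq
    rw [norm_smul_sph hq.le, ENNReal.toReal_ofReal (by positivity), smul_smul,
      inv_mul_cancel₀ hq.ne', one_smul, smul_eq_mul]
    ring
  have k1 := key (fun _ => 1) measurable_const
  simp only [mul_one, integral_const, smul_eq_mul] at k1
  rw [k1, key k hk]
  ring

/-- Two independent Gaussian vectors are almost surely linearly independent. -/
theorem ae_gauss_pair : ∀ᵐ q : E N × E N ∂((gauss N).prod (gauss N)),
    (inner ℝ q.1 q.2) ^ 2 ≠ ‖q.1‖ ^ 2 * ‖q.2‖ ^ 2 := by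
  have hm : MeasurableSet {q : E N × E N | ¬ (inner ℝ q.1 q.2) ^ 2 ≠ ‖q.1‖ ^ 2 * ‖q.2‖ ^ 2} := by
    simp only [not_not]
    exact measurableSet_eq_fun (by fun_prop) (by fun_prop)
  rw [ae_iff, Measure.measure_prod_null hm]
  filter_upwards [gauss_absolutelyContinuous.ae_le (ae_ne_zero N)] with x hx
  refine gauss_absolutelyContinuous (measure_mono_null (t := (Submodule.span ℝ {x} : Set (E N)))
    ?_ (Measure.addHaar_submodule volume _ ?_))
  · intro y hy
    simp only [Set.mem_preimage, Set.mem_ofPred_eq, not_not] at hy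
    have hn : ‖x‖ ^ 2 ≠ 0 := by simpa using hx
    have h1 : y = ((inner ℝ x y) / ‖x‖ ^ 2) • x := by
      rw [← sub_eq_zero, ← norm_eq_zero, ← sq_eq_zero_iff, norm_sub_sq_real, inner_smul_right,
        norm_smul, mul_pow, Real.norm_eq_abs, sq_abs, real_inner_comm]
      field_simp
      rw [real_inner_comm] at hy
      linarith
    rw [h1]
    exact Submodule.smul_mem _ _ (Submodule.mem_span_singleton_self x)
  · intro htop
    have h1 := finrank_span_le_card (R := ℝ) ({x} : Set (E N))
    rw [htop, finrank_top, finrank_euclideanSpace] at h1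
    have := hN.out
    simp at h1
    omega

/-- The Gaussian Poincaré inequality, in the form obtained by integrating `circle_inequality` over
the rotations of a pair of independent Gaussian vectors. -/
theorem gauss_pair_inequality {F : E N → ℝ} {V : E N → E N} (hF : Measurable F)
    (hV : Measurable V) (hgrad : ∀ x ≠ 0, HasGradientAt F (V x) x)
    (hVc : ∀ x ≠ 0, ContinuousAt V x) :
    ∫⁻ q : E N × E N, ENNReal.ofReal ((F q.2 - F q.1) ^ 2) ∂((gauss N).prod (gauss N))
      ≤ 2 * ∫⁻ q : E N × E N, ENNReal.ofReal ((inner ℝ (V q.1) q.2) ^ 2)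
        ∂((gauss N).prod (gauss N)) := by
  have hq0 := ae_gauss_pair (N := N)
  set μ := (gauss N).prod (gauss N) with hμ
  have hRm := measurable_gaussRot (N := N)
  have hrot := measurePreserving_gaussRot (N := N)
  rw [← hμ] at hrot
  have hfin : SFinite μ := by rw [hμ]; infer_instance
  clear_value μ
  set R : ℝ → E N × E N → E N × E N := gaussRot with hR
  have avg : ∀ Φ : E N × E N → ℝ≥0∞, Measurable Φ →
      ENNReal.ofReal (2 * Real.pi) * ∫⁻ q, Φ q ∂μ
        = ∫⁻ q, ∫⁻ θ in Set.Ioc 0 (2 * Real.pi), Φ (R θ q) ∂volume ∂μ := by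
    intro Φ hΦ
    rw [lintegral_lintegral_swap]
    · simp_rw [fun θ => (hrot θ).lintegral_comp hΦ]
      rw [lintegral_const, Measure.restrict_apply_univ, Real.volume_Ioc, sub_zero, mul_comm]
    · exact (hΦ.comp (hRm.comp measurable_swap)).aemeasurable
  have hΦ : Measurable fun q : E N × E N => ENNReal.ofReal ((F q.2 - F q.1) ^ 2) := by fun_prop
  have hΨ : Measurable fun q : E N × E N => ENNReal.ofReal ((inner ℝ (V q.1) q.2) ^ 2) := by
    have : Measurable fun q : E N × E N => inner ℝ (V q.1) q.2 :=
      (hV.comp measurable_fst).inner measurable_snd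
    fun_prop
  have hπ : ENNReal.ofReal (2 * Real.pi) ≠ 0 := by
    simp [Real.pi_pos]
  refine (ENNReal.mul_le_mul_iff_right hπ ENNReal.ofReal_ne_top).1 ?_
  rw [avg _ hΦ, mul_left_comm, avg _ hΨ, ← lintegral_const_mul' _ _ (by norm_num)]
  refine lintegral_mono_ae ?_
  filter_upwards [hq0] with q hq
  have hne : ∀ θ, (R θ q).1 ≠ 0 := by
    intro θ h0
    simp only [hR, gaussRot] at h0
    have e1 : Real.cos θ * ‖q.1‖ ^ 2 + Real.sin θ * inner ℝ q.1 q.2 = 0 := by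
      have := congrArg (fun v => inner ℝ q.1 v) h0
      simpa [inner_add_right, inner_smul_right, real_inner_self_eq_norm_sq] using this
    have e2 : Real.cos θ * inner ℝ q.1 q.2 + Real.sin θ * ‖q.2‖ ^ 2 = 0 := by
      have := congrArg (fun v => inner ℝ q.2 v) h0
      simpa [inner_add_right, inner_smul_right, real_inner_self_eq_norm_sq,
        real_inner_comm q.1 q.2] using this
    have e3 := Real.sin_sq_add_cos_sq θ
    apply hq
    have d1 : Real.cos θ * (‖q.1‖ ^ 2 * ‖q.2‖ ^ 2 - inner ℝ q.1 q.2 ^ 2) = 0 := by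
      linear_combination ‖q.2‖ ^ 2 * e1 - inner ℝ q.1 q.2 * e2
    have d2 : Real.sin θ * (‖q.1‖ ^ 2 * ‖q.2‖ ^ 2 - inner ℝ q.1 q.2 ^ 2) = 0 := by
      linear_combination ‖q.1‖ ^ 2 * e2 - inner ℝ q.1 q.2 * e1
    have d3 : (‖q.1‖ ^ 2 * ‖q.2‖ ^ 2 - inner ℝ q.1 q.2 ^ 2) = 0 := by
      linear_combination Real.cos θ * d1 + Real.sin θ * d2
        - (‖q.1‖ ^ 2 * ‖q.2‖ ^ 2 - inner ℝ q.1 q.2 ^ 2) * e3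
    linarith
  have hR2 : ∀ θ, (R (θ + Real.pi / 2) q).1 = (R θ q).2 := by
    intro θ
    simp [hR, gaussRot, Real.cos_add_pi_div_two, Real.sin_add_pi_div_two]
  have hRd : ∀ θ, HasDerivAt (fun θ => (R θ q).1) (R θ q).2 θ := by
    intro θ
    simp only [hR, gaussRot]
    exact ((Real.hasDerivAt_cos θ).smul_const q.1).add ((Real.hasDerivAt_sin θ).smul_const q.2)
  have hRc : Continuous fun θ => (R θ q).1 := by simp only [hR, gaussRot]; fun_prop
  have hRc' : Continuous fun θ => (R θ q).2 := by simp only [hR, gaussRot]; fun_prop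
  have hd : ∀ θ, HasDerivAt (fun θ => F (R θ q).1) (inner ℝ (V (R θ q).1) (R θ q).2) θ := by
    intro θ
    have h1 := (hasGradientAt_iff_hasFDerivAt.1 (hgrad _ (hne θ))).comp_hasDerivAt θ (hRd θ)
    rw [InnerProductSpace.toDual_apply_apply] at h1
    exact h1
  have hcont : Continuous fun θ => inner ℝ (V (R θ q).1) (R θ q).2 := by
    refine Continuous.inner (continuous_iff_continuousAt.2 fun θ => ?_) hRc'
    exact (hVc _ (hne θ)).comp (f := fun θ => (R θ q).1) hRc.continuousAt
  have hFc : Continuous fun θ => F (R θ q).1 :=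
    continuous_iff_continuousAt.2 fun θ => (hd θ).continuousAt
  have key := circle_inequality hd hcont (fun t => by simp [hR, gaussRot])
  simp only [hR2] at key
  have hFc2 : Continuous fun θ => F (R θ q).2 := by
    simp only [← hR2]; exact hFc.comp (continuous_id.add continuous_const)
  have hpos : (0 : ℝ) ≤ 2 * Real.pi := by positivity
  rw [intervalIntegral.integral_of_le hpos, intervalIntegral.integral_of_le hpos] at key
  have key2 := ENNReal.ofReal_le_ofReal key
  rw [ENNReal.ofReal_mul (by norm_num), ENNReal.ofReal_ofNat] at key2
  rw [← ofReal_integral_eq_lintegral_ofReal, ← ofReal_integral_eq_lintegral_ofReal]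
  · exact key2
  · exact (hcont.pow 2).integrableOn_Ioc
  · exact Eventually.of_forall fun _ => sq_nonneg _
  · exact ((hFc2.sub hFc).pow 2).integrableOn_Ioc
  · exact Eventually.of_forall fun _ => sq_nonneg _

/-- **The sharp Poincaré inequality on the unit sphere**, for the restriction of a function of
class `C¹` to the sphere of radius `r`: the spectral gap is `N - 1`. It is the Gaussian Poincaré
inequality for the function that is homogeneous of degree one. -/
theorem sphere_poincare {φ : E N → ℝ} (hφ : ContDiff ℝ 1 φ) (r M : ℝ)
    (hM : ∫ w : Sph N, (φ (r • (w : E N)) - M) ∂(sphMeas N) = 0) :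
    ((N : ℝ) - 1) * ∫ w : Sph N, (φ (r • (w : E N)) - M) ^ 2 ∂(sphMeas N)
      ≤ r ^ 2 * ∫ w : Sph N, (‖∇ φ (r • (w : E N))‖ ^ 2
        - inner ℝ (∇ φ (r • (w : E N))) (w : E N) ^ 2) ∂(sphMeas N) := by
  have hG := continuous_gradient hφ
  have hφc := hφ.continuous
  set k : E N → ℝ := fun u => φ (r • u) - M with hk
  set T : E N → E N := fun u => k u • u
    + r • (∇ φ (r • u) - inner ℝ (∇ φ (r • u)) u • u) with hT
  set κ : E N → ℝ := fun u => k u ^ 2 + r ^ 2 * (‖∇ φ (r • u)‖ ^ 2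
    - inner ℝ (∇ φ (r • u)) u ^ 2) with hκ
  have kc : Continuous k := by fun_prop
  have Tc : Continuous T := by fun_prop
  have κc : Continuous κ := by fun_prop
  have hdir : ∀ x : E N, x ≠ 0 → ‖‖x‖⁻¹ • x‖ = 1 := fun x hx => by
    rw [norm_smul, norm_inv, norm_norm, inv_mul_cancel₀ (norm_ne_zero_iff.2 hx)]
  have hTκ : ∀ u : E N, ‖u‖ = 1 → ‖T u‖ ^ 2 = κ u := by
    intro u hu
    have h1 : inner ℝ u u = 1 := by rw [real_inner_self_eq_norm_sq, hu, one_pow]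
    rw [← real_inner_self_eq_norm_sq]
    simp only [hT, hκ, inner_add_left, inner_add_right, real_inner_smul_left, inner_smul_right,
      inner_sub_left, inner_sub_right, h1, real_inner_self_eq_norm_sq,
      real_inner_comm (∇ φ (r • u)) u]
    ring
  set F : E N → ℝ := fun x => ‖x‖ * k (‖x‖⁻¹ • x) with hF
  set V : E N → E N := fun x => T (‖x‖⁻¹ • x) with hV
  have dm : Measurable fun x : E N => ‖x‖⁻¹ • x := by fun_prop
  have Fm : Measurable F := measurable_norm.mul (kc.measurable.comp dm)
  have Vm : Measurable V := Tc.measurable.comp dm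
  have hgrad : ∀ x ≠ 0, HasGradientAt F (V x) x := by
    intro x hx
    have hn : ‖x‖ ≠ 0 := norm_ne_zero_iff.2 hx
    have g1 := hasGradientAt_norm hx
    have g2 := hasGradientAt_comp g1 (hasDerivAt_inv hn)
    have f3 := ((hasGradientAt_iff_hasFDerivAt.1 g2).smul (hasFDerivAt_id x)).const_smul r
    have f4 := (hasGradientAt_iff_hasFDerivAt.1
      ((hφ.differentiable (by simp) (r • ‖x‖⁻¹ • x)).hasGradientAt)).comp x f3
    have f5 := (hasGradientAt_iff_hasFDerivAt.1 g1).mul (f4.sub_const M)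
    rw [hasGradientAt_iff_hasFDerivAt]
    refine HasFDerivAt.congr_fderiv (f := F) f5 ?_
    ext y
    simp [hV, hT, hk]
    field_simp
    ring
  have hVc : ∀ x ≠ 0, ContinuousAt V x := by
    intro x hx
    have : ContinuousAt (fun x : E N => ‖x‖⁻¹ • x) x :=
      (continuous_norm.continuousAt.inv₀ (norm_ne_zero_iff.2 hx)).smul continuousAt_id
    exact Tc.continuousAt.comp this
  obtain ⟨C, hC⟩ := (isCompact_closedBall (0 : E N) 1).exists_bound_of_continuousOn kc.continuousOn
  obtain ⟨C', hC'⟩ := (isCompact_closedBall (0 : E N) 1).exists_bound_of_continuousOn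
    κc.continuousOn
  have hball : ∀ x : E N, ‖x‖⁻¹ • x ∈ Metric.closedBall (0 : E N) 1 := by
    intro x
    by_cases hx : x = 0
    · simp [hx]
    · simp [norm_smul, hx]
  have hae : ∀ᵐ x ∂(gauss N), x ≠ 0 := gauss_absolutelyContinuous.ae_le (ae_ne_zero N)
  have FL : MemLp F 2 (gauss N) := by
    refine MemLp.of_le_mul (g := fun x : E N => x) (c := C)
      (ProbabilityTheory.IsGaussian.memLp_id (gauss N) 2 (by simp)) Fm.aestronglyMeasurable
      (Eventually.of_forall fun x => ?_)
    rw [hF, norm_mul, norm_norm, mul_comm]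
    exact mul_le_mul_of_nonneg_right (hC _ (hball x)) (norm_nonneg _)
  have FI : Integrable F (gauss N) := FL.integrable (by norm_num)
  have F2 : Integrable (fun x => F x ^ 2) (gauss N) := FL.integrable_sq
  have κI : Integrable (fun x => κ (‖x‖⁻¹ • x)) (gauss N) := by
    refine Integrable.of_bound (κc.measurable.comp dm).aestronglyMeasurable C'
      (Eventually.of_forall fun x => hC' _ (hball x))
  have S0 := sphMeas_pos (N := N)
  have eF : ∫ x, F x ∂(gauss N) = 0 := by
    have h := integral_gauss_polar (N := N) (g := id) (k := k) measurable_id kc.measurable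
    rw [show ∫ w : Sph N, k (w : E N) ∂(sphMeas N) = 0 from hM, zero_mul] at h
    exact (mul_eq_zero.1 h).resolve_left S0.ne'
  have eF2 : (sphMeas N).real Set.univ * ∫ x, F x ^ 2 ∂(gauss N)
      = (∫ w : Sph N, k (w : E N) ^ 2 ∂(sphMeas N)) * N := by
    have h := integral_gauss_polar (N := N) (g := fun t => t ^ 2) (k := fun u => k u ^ 2)
      (by fun_prop) (kc.measurable.pow_const 2)
    rw [integral_norm_sq_gauss] at h
    rw [← h]
    simp only [hF, mul_pow]
  have eκ : (sphMeas N).real Set.univ * ∫ x, κ (‖x‖⁻¹ • x) ∂(gauss N)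
      = ∫ w : Sph N, κ (w : E N) ∂(sphMeas N) := by
    have h := integral_gauss_polar (N := N) (g := fun _ => 1) (k := κ)
      (by fun_prop) κc.measurable
    simpa using h
  have hpair := gauss_pair_inequality Fm Vm hgrad hVc
  have eR : ∫⁻ q : E N × E N, ENNReal.ofReal ((inner ℝ (V q.1) q.2) ^ 2)
      ∂((gauss N).prod (gauss N)) = ENNReal.ofReal (∫ x, κ (‖x‖⁻¹ • x) ∂(gauss N)) := by
    have hm : Measurable fun q : E N × E N => inner ℝ (V q.1) q.2 :=
      (Vm.comp measurable_fst).inner measurable_snd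
    rw [lintegral_prod _ (by fun_prop), ofReal_integral_eq_lintegral_ofReal κI]
    · refine lintegral_congr_ae ?_
      filter_upwards [hae] with x hx
      rw [← ofReal_integral_eq_lintegral_ofReal (integrable_inner_sq _)
        (Eventually.of_forall fun _ => sq_nonneg _), integral_inner_sq, ← hTκ _ (hdir x hx)]
    · filter_upwards [hae] with x hx
      rw [← hTκ _ (hdir x hx)]
      exact sq_nonneg _
  have eL : ∫⁻ q : E N × E N, ENNReal.ofReal ((F q.2 - F q.1) ^ 2)
      ∂((gauss N).prod (gauss N)) = ENNReal.ofReal (2 * ∫ x, F x ^ 2 ∂(gauss N)) := by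
    have i1 : Integrable (fun q : E N × E N => F q.1 ^ 2) ((gauss N).prod (gauss N)) :=
      F2.comp_fst _
    have i2 : Integrable (fun q : E N × E N => F q.2 ^ 2) ((gauss N).prod (gauss N)) :=
      F2.comp_snd _
    have i3 : Integrable (fun q : E N × E N => F q.1 * F q.2) ((gauss N).prod (gauss N)) :=
      FI.mul_prod FI
    have e : ∀ q : E N × E N, (F q.2 - F q.1) ^ 2 = F q.1 ^ 2 + F q.2 ^ 2 - 2 * (F q.1 * F q.2) :=
      fun q => by ring
    have i4 : Integrable (fun q : E N × E N => F q.1 ^ 2 + F q.2 ^ 2 - 2 * (F q.1 * F q.2))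
      ((gauss N).prod (gauss N)) := (i1.add i2).sub (i3.const_mul 2)
    have i5 : Integrable (fun q : E N × E N => F q.1 ^ 2 + F q.2 ^ 2)
      ((gauss N).prod (gauss N)) := i1.add i2
    simp only [e]
    rw [← ofReal_integral_eq_lintegral_ofReal i4]
    · rw [integral_sub i5 (i3.const_mul 2), integral_add i1 i2, integral_const_mul,
        integral_prod_mul, eF, integral_fun_fst (fun x => F x ^ 2),
        integral_fun_snd (fun x => F x ^ 2)]
      simp [two_mul]
    · refine Eventually.of_forall fun q => ?_
      simp only [Pi.zero_apply, ← e]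
      exact sq_nonneg _
  rw [eL, eR] at hpair
  have hκ0 : 0 ≤ ∫ x, κ (‖x‖⁻¹ • x) ∂(gauss N) := by
    refine integral_nonneg_of_ae ?_
    filter_upwards [hae] with x hx
    rw [← hTκ _ (hdir x hx)]
    exact sq_nonneg _
  have hfin : 2 * ∫ x, F x ^ 2 ∂(gauss N) ≤ 2 * ∫ x, κ (‖x‖⁻¹ • x) ∂(gauss N) := by
    refine (ENNReal.ofReal_le_ofReal_iff (by positivity)).1 ?_
    rw [ENNReal.ofReal_mul (q := ∫ x, κ (‖x‖⁻¹ • x) ∂(gauss N)) (by norm_num), ENNReal.ofReal_ofNat]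
    exact hpair
  have hfin2 : (sphMeas N).real Set.univ * ∫ x, F x ^ 2 ∂(gauss N)
      ≤ (sphMeas N).real Set.univ * ∫ x, κ (‖x‖⁻¹ • x) ∂(gauss N) :=
    mul_le_mul_of_nonneg_left (by linarith) S0.le
  rw [eF2, eκ] at hfin2
  have hval : Continuous (Subtype.val : Sph N → E N) := continuous_subtype_val
  have ci : ∀ f : Sph N → ℝ, Continuous f → Integrable f (sphMeas N) := fun f hf =>
    hf.integrable_of_hasCompactSupport (HasCompactSupport.of_compactSpace f)
  simp only [hκ] at hfin2
  rw [integral_add (ci _ (by fun_prop)) (ci _ (by fun_prop)), integral_const_mul] at hfin2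
  linarith

end Sphere

/-! ### The linearized radial operator along rays -/

section Coercive

/-- The Riccati solution used on the half-line `y ≥ y₀`. With `ε = 0` it corresponds to the kernel
element generated by dilations; the term in `ε` gives a strict inequality. -/
theorem riccati_right {m ε y₀ y : ℝ} (hm : 0 < m) (hε : 0 ≤ ε) (h0 : 0 < y₀) (hεy : ε ≤ m * y₀ ^ 3)
    (hy : y₀ ≤ y) (hy1 : y ≤ 1) :
    m * ε ≤ m ^ 2 - (-((m + 1) * y) + 1 / y + ε / y ^ 2) ^ 2
      - (1 - y ^ 2) * (-(m + 1) - 1 / y ^ 2 - 2 * ε / y ^ 3 + (m + 1) * (m + 2)) := by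
  have hy0 : 0 < y := h0.trans_le hy
  have e : m ^ 2 - (-((m + 1) * y) + 1 / y + ε / y ^ 2) ^ 2
      - (1 - y ^ 2) * (-(m + 1) - 1 / y ^ 2 - 2 * ε / y ^ 3 + (m + 1) * (m + 2))
      = ε / y * (2 * m - ε / y ^ 3) := by
    field_simp
    ring
  rw [e]
  have h1 : ε / y ^ 3 ≤ m := by
    rw [div_le_iff₀ (by positivity)]
    exact hεy.trans (by gcongr)
  have h2 : ε ≤ ε / y := by
    rw [le_div_iff₀ hy0]
    exact mul_le_of_le_one_right hε hy1
  calc m * ε = ε * m := mul_comm _ _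
    _ ≤ ε / y * (2 * m - ε / y ^ 3) := mul_le_mul h2 (by linarith) hm.le (by positivity)

theorem hasDerivAt_riccati (a ε : ℝ) {y : ℝ} (hy : y ≠ 0) :
    HasDerivAt (fun y => -(a * y) + 1 / y + ε / y ^ 2) (-a - 1 / y ^ 2 - 2 * ε / y ^ 3) y := by
  have h := ((((hasDerivAt_id y).const_mul a).neg).add ((hasDerivAt_const y (1 : ℝ)).div
    (hasDerivAt_id y) hy)).add ((hasDerivAt_const y ε).div ((hasDerivAt_id y).pow 2)
      (pow_ne_zero 2 hy))
  refine HasDerivAt.congr_deriv (f := fun y => -(a * y) + 1 / y + ε / y ^ 2) h ?_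
  simp
  field_simp
  ring

theorem hasDerivAt_neg_mul (a y : ℝ) : HasDerivAt (fun y => -(a * y)) (-a) y := by
  have h := ((hasDerivAt_id y).const_mul a).neg
  rw [mul_one] at h
  exact h

set_option maxHeartbeats 800000 in
/-- The inequality on a ray for a function with one zero on each side of `r = 1`. It is the sum of
three weighted Hardy inequalities, one between each pair of consecutive zeros (and end points): the
singularity at `y = 0` of the Riccati solution used for `r ≥ r₂` and, reflected, for `r ≤ r₁`, lies
in the gap between the zeros, and there, `y` being small, a linear function is good enough. -/
theorem ray_coercive {N : ℕ} (hN : 3 ≤ N) {κ m lam δ ε ρ : ℝ} (hκ : 0 < κ) (hm : 0 < m)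
    (hL : κ ^ 2 * m ^ 2 = hardyConst N - lam) (hρ : 1 < ρ)
    (hρ2 : logTanh κ (ρ ^ 2) ≤ 1 / (2 * ((m + 1) * (m + 2) + 1)))
    (hε : 0 ≤ ε) (hερ : ε ≤ m * logTanh κ ρ ^ 3) (hδ : δ ≤ κ ^ 2 * (m * ε)) (hδ2 : δ ≤ κ ^ 2 / 2)
    {c c' : ℝ → ℝ} {R r₁ r₂ : ℝ} (hR : ρ ^ 2 ≤ R)
    (hr₁ : r₁ ∈ Set.Icc (ρ ^ 2)⁻¹ ρ⁻¹) (hr₂ : r₂ ∈ Set.Icc ρ (ρ ^ 2))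
    (hc : ∀ r, HasDerivAt c (c' r) r) (hc' : Continuous c')
    (h₁ : c r₁ = 0) (h₂ : c r₂ = 0) (hRc : c R = 0) :
    ∫ r in (0 : ℝ)..R, (lam + κ ^ 2 * ((m + 1) * (m + 2)) * (1 - logTanh κ r ^ 2) + δ) * c r ^ 2
      * r ^ (N - 3) ≤ ∫ r in (0 : ℝ)..R, c' r ^ 2 * r ^ (N - 1) := by
  set q : ℝ → ℝ := fun r => lam + κ ^ 2 * ((m + 1) * (m + 2)) * (1 - logTanh κ r ^ 2) + δ with hq
  have hρ0 : 0 < ρ := one_pos.trans hρ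
  have hρi : ρ⁻¹ < 1 := inv_lt_one_of_one_lt₀ hρ
  have p1 : 0 < r₁ := lt_of_lt_of_le (by positivity) hr₁.1
  have p2 : r₁ ≤ r₂ := hr₁.2.trans (hρi.le.trans (hρ.le.trans hr₂.1))
  have p3 : r₂ ≤ R := hr₂.2.trans hR
  have y0 := logTanh_pos hκ hρ
  have hK : 0 < (m + 1) * (m + 2) + 1 := by positivity
  set K := (m + 1) * (m + 2) + 1 with hKdef
  have qc : ContinuousOn q (Set.Ici 0) := by
    have := continuousOn_logTanh hκ
    fun_prop
  have cc : Continuous c := continuous_iff_continuousAt.2 fun r => (hc r).continuousAt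
  have key : ∀ r, κ ^ 2 * m ^ 2 = hardyConst N - lam → ∀ G G' : ℝ,
      δ ≤ κ ^ 2 * (m ^ 2 - G ^ 2 - (1 - logTanh κ r ^ 2) * (G' + (m + 1) * (m + 2))) →
      q r ≤ hardyConst N - κ ^ 2 * (G ^ 2 + (1 - logTanh κ r ^ 2) * G') := by
    intro r _ G G' h
    simp only [hq]
    nlinarith
  have hl1 : logTanh κ r₁ ≤ -logTanh κ ρ := by
    rw [← logTanh_inv κ hρ0]; exact logTanh_mono hκ p1.le hr₁.2
  have hl2 : logTanh κ ρ ≤ logTanh κ r₂ := logTanh_mono hκ hρ0.le hr₂.1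
  have hl1' : -(1 / (2 * K)) ≤ logTanh κ r₁ := by
    have := logTanh_mono hκ (by positivity) hr₁.1
    rw [logTanh_inv κ (by positivity)] at this
    linarith
  have hl2' : logTanh κ r₂ ≤ 1 / (2 * K) := (logTanh_mono hκ (by linarith) hr₂.2).trans hρ2
  -- for `r ≤ r₁` the Riccati solution is reflected by `y ↦ -y`, which changes the sign of `ε`
  have left := ray_inequality_logTanh hN hκ (c := c) (c' := c') (q := q) (a := 0) (b := r₁)
    (g := fun y => -((m + 1) * y) + 1 / y + -ε / y ^ 2)
    (g' := fun y => -(m + 1) - 1 / y ^ 2 - 2 * -ε / y ^ 3) le_rfl p1.le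
    (fun r _ => hc r) hc'.continuousOn
    (fun r hr => by
      have hy : logTanh κ r < 0 := by
        have := logTanh_mono hκ hr.1 hr.2
        linarith
      exact hasDerivAt_riccati (m + 1) (-ε) hy.ne)
    (qc.mono fun r hr => hr.1)
    (fun r hr => by
      refine key r hL _ _ ?_
      have h1 : logTanh κ r ≤ -logTanh κ ρ := (logTanh_mono hκ hr.1.le hr.2.le).trans hl1
      have h2 := neg_one_le_logTanh κ hr.1.le
      set y := logTanh κ r
      have h3 := riccati_right (y := -y) hm hε y0 hερ (by linarith) (by linarith)
      have h4 : m * ε ≤ m ^ 2 - (-((m + 1) * y) + 1 / y + -ε / y ^ 2) ^ 2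
          - (1 - y ^ 2) * (-(m + 1) - 1 / y ^ 2 - 2 * -ε / y ^ 3 + (m + 1) * (m + 2)) := by
        have hy' : y ≠ 0 := by
          have : y < 0 := by linarith
          exact this.ne
        refine h3.trans (le_of_eq ?_)
        field_simp
        ring
      exact hδ.trans (mul_le_mul_of_nonneg_left h4 (sq_nonneg _)))
    (Or.inl rfl) h₁
  have right := ray_inequality_logTanh hN hκ (c := c) (c' := c') (q := q) (a := r₂) (b := R)
    (g := fun y => -((m + 1) * y) + 1 / y + ε / y ^ 2)
    (g' := fun y => -(m + 1) - 1 / y ^ 2 - 2 * ε / y ^ 3) (p1.le.trans p2) p3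
    (fun r _ => hc r) hc'.continuousOn
    (fun r hr => by
      have hy : 0 < logTanh κ r := by
        have := logTanh_mono hκ (p1.le.trans p2) hr.1
        linarith
      exact hasDerivAt_riccati (m + 1) ε hy.ne')
    (qc.mono fun r hr => (p1.le.trans p2).trans hr.1)
    (fun r hr => by
      refine key r hL _ _ ?_
      have h0 : 0 ≤ r := (p1.le.trans p2).trans hr.1.le
      have h1 : logTanh κ ρ ≤ logTanh κ r := hl2.trans (logTanh_mono hκ (p1.le.trans p2) hr.1.le)
      have h2 := (logTanh_lt_one κ h0).le
      have h3 := riccati_right hm hε y0 hερ h1 h2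
      exact hδ.trans (mul_le_mul_of_nonneg_left h3 (sq_nonneg _)))
    (Or.inr h₂) hRc
  -- for `r₁ ≤ r ≤ r₂` the slope `-K` beats the potential, while `(K y)²` stays small
  have mid := ray_inequality_logTanh hN hκ (c := c) (c' := c') (q := q) (a := r₁) (b := r₂)
    (g := fun y => -(K * y)) (g' := fun _ => -K) p1.le p2
    (fun r _ => hc r) hc'.continuousOn
    (fun r hr => hasDerivAt_neg_mul K _)
    (qc.mono fun r hr => p1.le.trans hr.1)
    (fun r hr => by
      refine key r hL _ _ ?_
      have h1 := (logTanh_mono hκ p1.le hr.1.le)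
      have h2 := (logTanh_mono hκ (p1.le.trans hr.1.le) hr.2.le)
      set y := logTanh κ r
      have h3 : |K * y| ≤ 1 / 2 := by
        rw [abs_mul, abs_of_pos hK]
        have : |y| ≤ 1 / (2 * K) := abs_le.2 ⟨by linarith, by linarith⟩
        calc K * |y| ≤ K * (1 / (2 * K)) := by gcongr
          _ = 1 / 2 := by field_simp
      have h4 : (K * y) ^ 2 ≤ 1 / 4 := by
        rw [← sq_abs]; nlinarith [abs_nonneg (K * y)]
      have h5 : y ^ 2 ≤ 1 / 4 := by
        have hK1 : 1 ≤ K := by rw [hKdef]; nlinarith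
        have : y ^ 2 ≤ (K * y) ^ 2 := by
          rw [mul_pow]
          exact le_mul_of_one_le_left (sq_nonneg y) (one_le_pow₀ hK1)
        linarith
      refine hδ2.trans ?_
      rw [div_eq_mul_inv]
      refine mul_le_mul_of_nonneg_left ?_ (sq_nonneg _)
      have : -K + (m + 1) * (m + 2) = -1 := by rw [hKdef]; ring
      rw [this]
      nlinarith)
    (Or.inr h₁) h₂
  have iq : ∀ a b, 0 ≤ a → a ≤ b → IntervalIntegrable (fun r => q r * c r ^ 2 * r ^ (N - 3))
      volume a b := by
    intro a b ha hab
    refine ContinuousOn.intervalIntegrable ?_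
    rw [Set.uIcc_of_le hab]
    have := qc.mono (fun r hr => ha.trans hr.1 : Set.Icc a b ⊆ Set.Ici 0)
    fun_prop
  have ic : ∀ a b, IntervalIntegrable (fun r => c' r ^ 2 * r ^ (N - 1)) volume a b := fun a b =>
    Continuous.intervalIntegrable (by fun_prop) _ _
  rw [← intervalIntegral.integral_add_adjacent_intervals (iq 0 r₁ le_rfl p1.le)
      (iq r₁ R p1.le (p2.trans p3)),
    ← intervalIntegral.integral_add_adjacent_intervals (iq r₁ r₂ p1.le p2)
      (iq r₂ R (p1.le.trans p2) p3),
    ← intervalIntegral.integral_add_adjacent_intervals (ic 0 r₁) (ic r₁ R),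
    ← intervalIntegral.integral_add_adjacent_intervals (ic r₁ r₂) (ic r₂ R)]
  linarith

/-- The inequality on a ray for functions orthogonal to the radial ones: these have the additional
term `N - 1` from the sphere, which makes up for the negative ground state of the radial operator
(the ground state is `cosh^{-(m+1)}`, hence `g(y) = -(m+1) y`), and no zero is needed. -/
theorem ray_coercive_nonradial {N : ℕ} (hN : 3 ≤ N) {κ m lam δ : ℝ} (hκ : 0 < κ)
    (hL : κ ^ 2 * m ^ 2 = hardyConst N - lam) (hδ : δ ≤ (N : ℝ) - 1 - κ ^ 2 * (2 * m + 1))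
    {c c' : ℝ → ℝ} {R : ℝ} (hR : 0 ≤ R) (hc : ∀ r, HasDerivAt c (c' r) r) (hc' : Continuous c')
    (hRc : c R = 0) :
    ∫ r in (0 : ℝ)..R, (lam + κ ^ 2 * ((m + 1) * (m + 2)) * (1 - logTanh κ r ^ 2) + δ
      - ((N : ℝ) - 1)) * c r ^ 2 * r ^ (N - 3) ≤ ∫ r in (0 : ℝ)..R, c' r ^ 2 * r ^ (N - 1) := by
  refine ray_inequality_logTanh hN hκ (g := fun y => -((m + 1) * y)) (g' := fun _ => -(m + 1))
    le_rfl hR (fun r _ => hc r) hc'.continuousOn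
    (fun r hr => hasDerivAt_neg_mul (m + 1) _)
    ?_ (fun r hr => ?_) (Or.inl rfl) hRc
  · have := (continuousOn_logTanh hκ).mono (fun r hr => hr.1 : Set.Icc 0 R ⊆ Set.Ici 0)
    fun_prop
  · have e : hardyConst N - κ ^ 2 * ((-((m + 1) * logTanh κ r)) ^ 2
        + (1 - logTanh κ r ^ 2) * -(m + 1))
        = lam + κ ^ 2 * m ^ 2 - κ ^ 2 * (m + 1) ^ 2
          + κ ^ 2 * ((m + 1) * (m + 2)) * (1 - logTanh κ r ^ 2) := by
      rw [hL]; ring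
    rw [e]
    linarith

end Coercive

/-! ### Splitting a function into its spherical mean and the deviation from it -/

section SphereMean

variable {N : ℕ}

theorem integrable_sph {f : Sph N → ℝ} (hf : Continuous f) : Integrable f (sphMeas N) :=
  hf.integrable_of_hasCompactSupport (HasCompactSupport.of_compactSpace f)

theorem integral_sph_swap {k : Sph N → ℝ → ℝ} {R : ℝ} (hR : 0 ≤ R)
    (hk : ContinuousOn (Function.uncurry k) (Set.univ ×ˢ Set.Icc 0 R)) :
    ∫ w, ∫ r in (0 : ℝ)..R, k w r ∂volume ∂(sphMeas N)
      = ∫ r in (0 : ℝ)..R, ∫ w, k w r ∂(sphMeas N) := by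
  simp only [intervalIntegral.integral_of_le hR]
  exact integral_integral_swap (integrable_prod_of_continuous hk)

theorem continuous_sphIntegral {f : ℝ → Sph N → ℝ} (hf : Continuous (Function.uncurry f)) :
    Continuous fun r => ∫ w, f r w ∂(sphMeas N) := by
  have := continuous_parametric_integral_of_continuous (μ := sphMeas N) hf isCompact_univ
  simpa using this

theorem hasDerivAt_sphIntegral {f f' : ℝ → Sph N → ℝ} (hf : Continuous (Function.uncurry f))
    (hf' : Continuous (Function.uncurry f')) (hd : ∀ r w, HasDerivAt (fun r => f r w) (f' r w) r)
    (r : ℝ) : HasDerivAt (fun r => ∫ w, f r w ∂(sphMeas N)) (∫ w, f' r w ∂(sphMeas N)) r := by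
  obtain ⟨C, hC⟩ := ((isCompact_closedBall r 1).prod (isCompact_univ (X := Sph N))
    ).exists_bound_of_continuousOn hf'.continuousOn
  refine (hasDerivAt_integral_of_dominated_loc_of_deriv_le (μ := sphMeas N) (bound := fun _ => C)
    (Metric.closedBall_mem_nhds r one_pos) (Eventually.of_forall fun t => ?_) ?_ ?_ ?_
    (integrable_const _) ?_).2
  · exact (hf.comp (by fun_prop : Continuous fun w : Sph N => (t, w))).aestronglyMeasurable
  · exact integrable_sph (hf.comp (by fun_prop : Continuous fun w : Sph N => (r, w)))
  · exact (hf'.comp (by fun_prop : Continuous fun w : Sph N => (r, w))).aestronglyMeasurable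
  · exact Eventually.of_forall fun w t ht => hC (t, w) ⟨ht, Set.mem_univ _⟩
  · exact Eventually.of_forall fun w t _ => hd t w

/-- The decomposition of a square integral into the mean and the deviation from it. -/
theorem integral_sq_decomp {f : Sph N → ℝ} (hf : Continuous f) {M : ℝ}
    (hM : ∫ w, f w ∂(sphMeas N) = (sphMeas N).real Set.univ * M) :
    ∫ w, f w ^ 2 ∂(sphMeas N)
      = (sphMeas N).real Set.univ * M ^ 2 + ∫ w, (f w - M) ^ 2 ∂(sphMeas N) := by
  have e : ∀ w, (f w - M) ^ 2 = f w ^ 2 - 2 * M * f w + M ^ 2 := fun w => by ring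
  simp only [e]
  rw [integral_add (integrable_sph (by fun_prop)) (integrable_sph (by fun_prop)),
    integral_sub (integrable_sph (by fun_prop)) (integrable_sph (by fun_prop)),
    integral_const_mul, hM, integral_const, smul_eq_mul]
  ring

variable [hN : Fact (3 ≤ N)]

set_option maxHeartbeats 2000000 in
/-- Positivity of the second variation on a test function: the spherical mean is controlled on the
three intervals between its zeros, the deviation from the mean by the spectral gap of the
sphere. -/
theorem IsTest.second_variation {κ m lam δ ε ρ : ℝ} (hκ : 0 < κ) (hm : 0 < m)
    (hL : κ ^ 2 * m ^ 2 = hardyConst N - lam) (hρ : 1 < ρ)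
    (hρ2 : logTanh κ (ρ ^ 2) ≤ 1 / (2 * ((m + 1) * (m + 2) + 1)))
    (hε : 0 ≤ ε) (hερ : ε ≤ m * logTanh κ ρ ^ 3) (hδ : δ ≤ κ ^ 2 * (m * ε)) (hδ2 : δ ≤ κ ^ 2 / 2)
    (hδ3 : δ ≤ (N : ℝ) - 1 - κ ^ 2 * (2 * m + 1))
    {φ : E N → ℝ} (h : IsTest φ)
    (h₁ : ∃ r ∈ Set.Icc (ρ ^ 2)⁻¹ ρ⁻¹, ∫ w : Sph N, φ (r • (w : E N)) ∂(sphMeas N) = 0)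
    (h₂ : ∃ r ∈ Set.Icc ρ (ρ ^ 2), ∫ w : Sph N, φ (r • (w : E N)) ∂(sphMeas N) = 0) :
    ∫ x, (lam + κ ^ 2 * ((m + 1) * (m + 2)) * (1 - logTanh κ ‖x‖ ^ 2) + δ) * (φ x ^ 2 / ‖x‖ ^ 2)
      ≤ ∫ x, ‖∇ φ x‖ ^ 2 := by
  obtain ⟨R₀, hR₀, h0⟩ := h.exists_radius
  set R := max R₀ (ρ ^ 2) with hRdef
  have hR : 0 < R := hR₀.trans_le (le_max_left _ _)
  have h0 : ∀ x, R ≤ ‖x‖ → φ x = 0 ∧ ∇ φ x = 0 := fun x hx => h0 x ((le_max_left _ _).trans hx)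
  have hφ := h.1.continuous
  have hg := continuous_gradient h.contDiff_one
  have qc : ContinuousOn (fun r : ℝ => lam + κ ^ 2 * ((m + 1) * (m + 2)) * (1 - logTanh κ r ^ 2) + δ)
      (Set.Ici 0) := by
    have := continuousOn_logTanh hκ
    fun_prop
  have qm : Measurable fun r : ℝ =>
      lam + κ ^ 2 * ((m + 1) * (m + 2)) * (1 - logTanh κ r ^ 2) + δ := by
    have := measurable_logTanh κ
    fun_prop
  have ray_rad := fun (c c' : ℝ → ℝ) (r₁ r₂ : ℝ) => ray_coercive hN.out hκ hm hL hρ hρ2 hε hερ hδ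
    hδ2 (c := c) (c' := c') (R := R) (r₁ := r₁) (r₂ := r₂)
  have ray_non := fun (c c' : ℝ → ℝ) => ray_coercive_nonradial hN.out hκ hL hδ3
    (c := c) (c' := c') hR.le
  set q : ℝ → ℝ := fun r => lam + κ ^ 2 * ((m + 1) * (m + 2)) * (1 - logTanh κ r ^ 2) + δ with hq
  have hqx : ∀ x : E N, lam + κ ^ 2 * ((m + 1) * (m + 2)) * (1 - logTanh κ ‖x‖ ^ 2) + δ = q ‖x‖ :=
    fun x => rfl
  have hqr : ∀ r : ℝ, lam + κ ^ 2 * ((m + 1) * (m + 2)) * (1 - logTanh κ r ^ 2) + δ = q r :=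
    fun x => rfl
  simp only [hqx]
  simp only [hqr] at ray_rad ray_non
  clear_value q
  have qc2 : ContinuousOn (fun z : Sph N × ℝ => q z.2) (Set.univ ×ˢ Set.Icc 0 R) :=
    qc.comp continuousOn_snd fun z hz => hz.2.1
  have qc3 : ContinuousOn q (Set.Icc 0 R) := qc.mono fun r hr => hr.1
  set S := (sphMeas N).real Set.univ with hS
  have S0 : 0 < S := sphMeas_pos
  -- the spherical mean and its derivative
  set D : ℝ → Sph N → ℝ := fun r w => inner ℝ (∇ φ (r • (w : E N))) (w : E N) with hD
  set B : ℝ → ℝ := fun r => S⁻¹ * ∫ w : Sph N, φ (r • (w : E N)) ∂(sphMeas N) with hB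
  set B' : ℝ → ℝ := fun r => S⁻¹ * ∫ w : Sph N, D r w ∂(sphMeas N) with hB'
  have cφ : Continuous (Function.uncurry fun (r : ℝ) (w : Sph N) => φ (r • (w : E N))) := by
    unfold Function.uncurry; fun_prop
  have cD : Continuous (Function.uncurry D) := by
    unfold Function.uncurry; fun_prop
  have dφ : ∀ r (w : Sph N), HasDerivAt (fun r : ℝ => φ (r • (w : E N))) (D r w) r := fun r w =>
    hasDerivAt_ray (h.contDiff_one.differentiable (by simp) _)
  have dB : ∀ r, HasDerivAt B (B' r) r := fun r => (hasDerivAt_sphIntegral cφ cD dφ r).const_mul _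
  have cB' : Continuous B' := continuous_const.mul (continuous_sphIntegral cD)
  have cB : Continuous B := continuous_iff_continuousAt.2 fun r => (dB r).continuousAt
  have hBR : B R = 0 := by
    simp only [hB]
    simp [fun w : Sph N => (h0 _ (norm_smul_sph hR.le w).ge).1]
  have hMφ : ∀ r, ∫ w : Sph N, φ (r • (w : E N)) ∂(sphMeas N) = S * B r := fun r => by
    simp only [hB]; rw [mul_inv_cancel_left₀ S0.ne']
  have hMD : ∀ r, ∫ w : Sph N, D r w ∂(sphMeas N) = S * B' r := fun r => by
    simp only [hB']; rw [mul_inv_cancel_left₀ S0.ne']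
  have kc1 : ContinuousOn (Function.uncurry fun (w : Sph N) (r : ℝ) =>
      q r * φ (r • (w : E N)) ^ 2 * r ^ (N - 3)) (Set.univ ×ˢ Set.Icc 0 R) := by
    change ContinuousOn (fun z : Sph N × ℝ => q z.2 * φ (z.2 • (z.1 : E N)) ^ 2 * z.2 ^ (N - 3)) _
    exact (qc2.mul (Continuous.continuousOn (by fun_prop))).mul
      (Continuous.continuousOn (by fun_prop))
  have kc2 : Continuous (Function.uncurry fun (w : Sph N) (r : ℝ) =>
      ‖∇ φ (r • (w : E N))‖ ^ 2 * r ^ (N - 1)) := by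
    unfold Function.uncurry
    fun_prop
  have e1 := integral_polar_of_continuous (N := N) (f := fun x => q ‖x‖ * (φ x ^ 2 / ‖x‖ ^ 2))
    (k := fun w r => q r * φ (r • (w : E N)) ^ 2 * r ^ (N - 3)) hR.le
    (by
      refine Measurable.aestronglyMeasurable ?_
      have := hφ.measurable
      fun_prop)
    kc1
    (fun w r hr _ => by
      rw [norm_smul_sph hr.le, mul_left_comm, pow_split hr.ne', mul_assoc])
    (fun x hx => by simp [(h0 x hx.le).1])
  have e2 := integral_polar_of_continuous (N := N) (f := fun x => ‖∇ φ x‖ ^ 2)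
    (k := fun w r => ‖∇ φ (r • (w : E N))‖ ^ 2 * r ^ (N - 1)) hR.le
    (by fun_prop)
    kc2.continuousOn
    (fun w r hr _ => by ring)
    (fun x hx => by simp [(h0 x hx.le).2])
  rw [e1.2, e2.2, integral_sph_swap hR.le kc1, integral_sph_swap hR.le kc2.continuousOn]
  -- the radial part
  have hrad : ∫ r in (0 : ℝ)..R, q r * B r ^ 2 * r ^ (N - 3)
      ≤ ∫ r in (0 : ℝ)..R, B' r ^ 2 * r ^ (N - 1) := by
    obtain ⟨r₁, hr₁, z₁⟩ := h₁
    obtain ⟨r₂, hr₂, z₂⟩ := h₂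
    exact ray_rad B B' r₁ r₂ (le_max_right _ _) hr₁ hr₂ dB cB' (by simp [hB, z₁]) (by simp [hB, z₂])
      hBR
  -- the deviation from the mean
  have hdev : ∫ r in (0 : ℝ)..R, ∫ w : Sph N, (q r - ((N : ℝ) - 1)) * (φ (r • (w : E N)) - B r) ^ 2
      * r ^ (N - 3) ∂(sphMeas N)
      ≤ ∫ r in (0 : ℝ)..R, ∫ w : Sph N, (D r w - B' r) ^ 2 * r ^ (N - 1) ∂(sphMeas N) := by
    have cD' : Continuous fun z : Sph N × ℝ => D z.2 z.1 := cD.comp continuous_swap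
    have c1 : ContinuousOn (Function.uncurry fun (w : Sph N) (r : ℝ) =>
        (q r - ((N : ℝ) - 1)) * (φ (r • (w : E N)) - B r) ^ 2 * r ^ (N - 3))
        (Set.univ ×ˢ Set.Icc 0 R) := by
      change ContinuousOn (fun z : Sph N × ℝ =>
        (q z.2 - ((N : ℝ) - 1)) * (φ (z.2 • (z.1 : E N)) - B z.2) ^ 2 * z.2 ^ (N - 3)) _
      exact ((qc2.sub continuousOn_const).mul (Continuous.continuousOn (by fun_prop))).mul
        (Continuous.continuousOn (by fun_prop))
    have c2 : ContinuousOn (Function.uncurry fun (w : Sph N) (r : ℝ) =>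
        (D r w - B' r) ^ 2 * r ^ (N - 1)) (Set.univ ×ˢ Set.Icc 0 R) := by
      change ContinuousOn (fun z : Sph N × ℝ => (D z.2 z.1 - B' z.2) ^ 2 * z.2 ^ (N - 1)) _
      exact Continuous.continuousOn (by fun_prop)
    rw [← integral_sph_swap hR.le c1, ← integral_sph_swap hR.le c2]
    refine integral_mono (integrable_integral_ray hR.le c1) (integrable_integral_ray hR.le c2)
      fun w => ?_
    refine ray_non (fun r => φ (r • (w : E N)) - B r) (fun r => D r w - B' r)
      (fun r => (dφ r w).sub (dB r)) ?_ ?_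
    · exact (cD.comp (by fun_prop : Continuous fun r : ℝ => (r, w))).sub cB'
    · beta_reduce
      rw [hBR, (h0 _ (norm_smul_sph hR.le w).ge).1, sub_zero]
  have I1 : IntervalIntegrable (fun r => S * (q r * B r ^ 2 * r ^ (N - 3))) volume 0 R := by
    refine ContinuousOn.intervalIntegrable ?_
    rw [Set.uIcc_of_le hR.le]; fun_prop
  have I2 : IntervalIntegrable (fun r => S * (B' r ^ 2 * r ^ (N - 1))) volume 0 R :=
    Continuous.intervalIntegrable (by fun_prop) _ _
  have cdev : Continuous fun r => ∫ w : Sph N, (φ (r • (w : E N)) - B r) ^ 2 ∂(sphMeas N) :=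
    continuous_sphIntegral (f := fun (r : ℝ) (w : Sph N) => (φ (r • (w : E N)) - B r) ^ 2)
      (by unfold Function.uncurry; fun_prop)
  have cdev' : Continuous fun r => ∫ w : Sph N, (D r w - B' r) ^ 2 ∂(sphMeas N) :=
    continuous_sphIntegral (f := fun (r : ℝ) (w : Sph N) => (D r w - B' r) ^ 2)
      (by unfold Function.uncurry at cD ⊢; fun_prop)
  have ctan : Continuous fun r => ∫ w : Sph N, ‖∇ φ (r • (w : E N))‖ ^ 2 ∂(sphMeas N) :=
    continuous_sphIntegral (f := fun (r : ℝ) (w : Sph N) => ‖∇ φ (r • (w : E N))‖ ^ 2)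
      (by unfold Function.uncurry; fun_prop)
  simp only [integral_mul_const, integral_const_mul] at hdev ⊢
  have J1 : IntervalIntegrable (fun r => (q r - ((N : ℝ) - 1))
      * (∫ w : Sph N, (φ (r • (w : E N)) - B r) ^ 2 ∂(sphMeas N)) * r ^ (N - 3)) volume 0 R := by
    refine ContinuousOn.intervalIntegrable ?_
    rw [Set.uIcc_of_le hR.le]
    exact ((qc3.sub continuousOn_const).mul cdev.continuousOn).mul
      (continuous_pow (N - 3)).continuousOn
  have J2 : IntervalIntegrable (fun r =>
      (∫ w : Sph N, (D r w - B' r) ^ 2 ∂(sphMeas N)) * r ^ (N - 1)) volume 0 R :=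
    (cdev'.mul (continuous_pow (N - 1))).intervalIntegrable _ _
  have J3 : IntervalIntegrable (fun r => ((N : ℝ) - 1)
      * (∫ w : Sph N, (φ (r • (w : E N)) - B r) ^ 2 ∂(sphMeas N)) * r ^ (N - 3)) volume 0 R :=
    ((continuous_const.mul cdev).mul (continuous_pow (N - 3))).intervalIntegrable _ _
  calc ∫ r in (0 : ℝ)..R, q r * (∫ w : Sph N, φ (r • (w : E N)) ^ 2 ∂(sphMeas N)) * r ^ (N - 3)
      = ∫ r in (0 : ℝ)..R, (S * (q r * B r ^ 2 * r ^ (N - 3))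
        + ((q r - ((N : ℝ) - 1)) * (∫ w : Sph N, (φ (r • (w : E N)) - B r) ^ 2 ∂(sphMeas N))
          * r ^ (N - 3)
        + ((N : ℝ) - 1) * (∫ w : Sph N, (φ (r • (w : E N)) - B r) ^ 2 ∂(sphMeas N))
          * r ^ (N - 3))) := by
        refine intervalIntegral.integral_congr fun r _ => ?_
        rw [integral_sq_decomp (by fun_prop) (hMφ r)]
        ring
    _ = S * (∫ r in (0 : ℝ)..R, q r * B r ^ 2 * r ^ (N - 3))
        + ((∫ r in (0 : ℝ)..R, (q r - ((N : ℝ) - 1))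
          * (∫ w : Sph N, (φ (r • (w : E N)) - B r) ^ 2 ∂(sphMeas N)) * r ^ (N - 3))
        + ∫ r in (0 : ℝ)..R, ((N : ℝ) - 1)
          * (∫ w : Sph N, (φ (r • (w : E N)) - B r) ^ 2 ∂(sphMeas N)) * r ^ (N - 3)) := by
        rw [intervalIntegral.integral_add I1 (J1.add J3), intervalIntegral.integral_add J1 J3,
          intervalIntegral.integral_const_mul]
    _ ≤ S * (∫ r in (0 : ℝ)..R, B' r ^ 2 * r ^ (N - 1))
        + ((∫ r in (0 : ℝ)..R, (∫ w : Sph N, (D r w - B' r) ^ 2 ∂(sphMeas N)) * r ^ (N - 1))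
        + ∫ r in (0 : ℝ)..R, ((N : ℝ) - 1)
          * (∫ w : Sph N, (φ (r • (w : E N)) - B r) ^ 2 ∂(sphMeas N)) * r ^ (N - 3)) := by
        gcongr
    _ = ∫ r in (0 : ℝ)..R, (S * (B' r ^ 2 * r ^ (N - 1))
        + ((∫ w : Sph N, (D r w - B' r) ^ 2 ∂(sphMeas N)) * r ^ (N - 1)
        + ((N : ℝ) - 1) * (∫ w : Sph N, (φ (r • (w : E N)) - B r) ^ 2 ∂(sphMeas N))
          * r ^ (N - 3))) := by
        rw [intervalIntegral.integral_add I2 (J2.add J3), intervalIntegral.integral_add J2 J3,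
          intervalIntegral.integral_const_mul]
    _ ≤ _ := by
        refine intervalIntegral.integral_mono_on hR.le (I2.add (J2.add J3))
          ((ctan.mul (continuous_pow (N - 1))).intervalIntegrable _ _) fun r hr => ?_
        have cDr : Continuous (D r) := cD.comp (by fun_prop : Continuous fun w : Sph N => (r, w))
        have h3 := sphere_poincare h.contDiff_one r (B r) (by
          rw [integral_sub (integrable_sph (by fun_prop)) (integrable_const _), hMφ r]
          simp [hS])
        rw [integral_sub (integrable_sph (by fun_prop)) (integrable_sph (by fun_prop)),
          integral_sq_decomp cDr (hMD r)] at h3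
        have h4 := mul_le_mul_of_nonneg_right h3 (pow_nonneg hr.1 (N - 3))
        have e : r ^ (N - 1) = r ^ 2 * r ^ (N - 3) := by
          rw [← pow_add]; congr 1; have := hN.out; omega
        rw [e]
        linarith

end SphereMean

/-! ### The shell functionals and coercivity on their kernel -/

section Shell

variable {N : ℕ}

/-- A finite-codimensional closed subspace meets a dense subspace in
a dense subset. -/
theorem exists_tendsto_of_finite_codim {X F : Type*} [NormedAddCommGroup X] [NormedSpace ℝ X]
    [NormedAddCommGroup F] [NormedSpace ℝ F] [FiniteDimensional ℝ F] {T : Submodule ℝ X}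
    (L : X →L[ℝ] F) {b : X} (hb : L b = 0) {f : ℕ → X} (hf : ∀ n, f n ∈ T)
    (hlim : Tendsto f atTop (𝓝 b)) :
    ∃ g : ℕ → X, (∀ n, g n ∈ T ∧ L (g n) = 0) ∧ Tendsto g atTop (𝓝 b) := by
  set G : T →ₗ[ℝ] F := L.toLinearMap.comp T.subtype with hG
  obtain ⟨σ, hσ⟩ := G.rangeRestrict.exists_rightInverse_of_surjective G.range_rangeRestrict
  have hσ' : ∀ y, G (σ y) = (y : F) := fun y => by
    have := LinearMap.congr_fun hσ y
    exact congrArg Subtype.val this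
  set τ : LinearMap.range G →ₗ[ℝ] X := T.subtype.comp σ with hτ
  have hτc : Continuous τ := τ.continuous_of_finiteDimensional
  set s : ℕ → LinearMap.range G := fun n => ⟨L (f n), ⟨⟨f n, hf n⟩, rfl⟩⟩ with hs
  have hs0 : Tendsto s atTop (𝓝 0) := by
    rw [tendsto_subtype_rng]
    have := (L.continuous.tendsto b).comp hlim
    rw [hb] at this
    exact this
  refine ⟨fun n => f n - τ (s n), fun n => ⟨T.sub_mem (hf n) (σ (s n)).2, ?_⟩, ?_⟩
  · have : L (τ (s n)) = L (f n) := hσ' (s n)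
    rw [map_sub, this, sub_self]
  · have := hlim.sub ((hτc.tendsto 0).comp hs0)
    simpa using this

/-- The function `|x|^{-N/2}` on the spherical shell `a ≤ |x| ≤ b`, and zero elsewhere. The power is
such that the dilations of `L²` only change the shell. -/
def shellFun (N : ℕ) (a b : ℝ) (x : E N) : ℝ :=
  (Set.Icc a b).indicator (fun r => r ^ (-((N : ℝ) / 2))) ‖x‖

theorem measurable_shellFun (a b : ℝ) : Measurable (shellFun N a b) := by
  unfold shellFun
  have : Measurable ((Set.Icc a b).indicator fun r : ℝ => r ^ (-((N : ℝ) / 2))) :=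
    (by fun_prop : Measurable fun r : ℝ => r ^ (-((N : ℝ) / 2))).indicator measurableSet_Icc
  exact this.comp measurable_norm

theorem memLp_shellFun {a : ℝ} (ha : 0 < a) (b : ℝ) : MemLp (shellFun N a b) 2 volume := by
  have h1 : MemLp ((Metric.closedBall (0 : E N) b).indicator fun _ => a ^ (-((N : ℝ) / 2))) 2
      volume := memLp_indicator_const 2 measurableSet_closedBall _
        (Or.inr measure_closedBall_lt_top.ne)
  refine h1.mono (measurable_shellFun a b).aestronglyMeasurable (Eventually.of_forall fun x => ?_)
  unfold shellFun
  by_cases hx : ‖x‖ ∈ Set.Icc a b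
  · rw [Set.indicator_of_mem hx, Set.indicator_of_mem (by simpa using hx.2)]
    have h0 : 0 < ‖x‖ := ha.trans_le hx.1
    rw [Real.norm_of_nonneg (by positivity), Real.norm_of_nonneg (by positivity)]
    exact Real.rpow_le_rpow_of_nonpos ha hx.1 (by simp; positivity)
  · rw [Set.indicator_of_notMem hx, norm_zero]
    exact norm_nonneg _

variable [hN : Fact (3 ≤ N)]

theorem IsTest.toD12_add {φ ψ : E N → ℝ} (hφ : IsTest φ) (hψ : IsTest ψ) :
    ∃ h : IsTest (fun x => φ x + ψ x), h.toD12 = hφ.toD12 + hψ.toD12 := by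
  have h : IsTest (fun x => φ x + ψ x) := ⟨hφ.1.add hψ.1, hφ.2.add hψ.2⟩
  refine ⟨h, D12.grad_injective ?_⟩
  rw [map_add, h.grad_toD12, hφ.grad_toD12, hψ.grad_toD12, ← MemLp.toLp_add]
  refine MemLp.toLp_congr _ _ (Eventually.of_forall fun x => ?_)
  exact gradient_add hφ.contDiff_one hψ.contDiff_one x

theorem IsTest.toD12_smul {φ : E N → ℝ} (hφ : IsTest φ) (c : ℝ) :
    ∃ h : IsTest (fun x => c * φ x), h.toD12 = c • hφ.toD12 := by
  have h : IsTest (fun x => c * φ x) := ⟨contDiff_const.mul hφ.1, hφ.2.mul_left⟩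
  refine ⟨h, D12.grad_injective ?_⟩
  rw [map_smul, h.grad_toD12, hφ.grad_toD12, ← MemLp.toLp_const_smul]
  refine MemLp.toLp_congr _ _ (Eventually.of_forall fun x => ?_)
  exact gradient_smul hφ.contDiff_one c x

variable (N) in
/-- The test functions, as a subspace of `D^{1,2}`. -/
def testSubmodule : Submodule ℝ (D12 N) where
  carrier := {u | ∃ (φ : E N → ℝ) (h : IsTest φ), h.toD12 = u}
  add_mem' := by
    rintro _ _ ⟨φ, hφ, rfl⟩ ⟨ψ, hψ, rfl⟩
    exact ⟨_, hφ.toD12_add hψ⟩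
  zero_mem' := by
    have h : IsTest (fun _ : E N => (0 : ℝ)) := ⟨contDiff_const, HasCompactSupport.zero⟩
    obtain ⟨h', e⟩ := h.toD12_smul 0
    exact ⟨_, h', by rw [e, zero_smul]⟩
  smul_mem' := by
    rintro c _ ⟨φ, hφ, rfl⟩
    exact ⟨_, hφ.toD12_smul c⟩

/-- The functional `u ↦ ∫_{a ≤ |x| ≤ b} u |x|^{-(N+2)/2}`. -/
def shell {a : ℝ} (ha : 0 < a) (b : ℝ) : D12 N →L[ℝ] ℝ :=
  (innerSL ℝ ((memLp_shellFun (N := N) ha b).toLp _)).comp (hardyMap N)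

theorem shell_apply {a : ℝ} (ha : 0 < a) (b : ℝ) (u : D12 N) :
    shell ha b u = ∫ x, shellFun N a b x * (u x / ‖x‖) := by
  have : shell ha b u = inner ℝ ((memLp_shellFun (N := N) ha b).toLp _) (hardyMap N u) := rfl
  rw [this, L2.inner_def]
  refine integral_congr_ae ?_
  filter_upwards [(memLp_shellFun (N := N) ha b).coeFn_toLp, coe_hardyMap u] with x h1 h2
  rw [h1, h2, real_inner_eq_mul]

theorem shell_polar {a b : ℝ} (ha : 0 < a) (hab : a ≤ b) {u : D12 N} {f : E N → ℝ}
    (hf : Measurable f) (hu : u =ᵐ[volume] f) :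
    shell ha b u = ∫ r in a..b, r ^ ((N : ℝ) / 2 - 2)
      * ∫ w : Sph N, f (r • (w : E N)) ∂(sphMeas N) := by
  have hm : Measurable fun x => shellFun N a b x * (f x / ‖x‖) :=
    (measurable_shellFun a b).mul (hf.div measurable_norm)
  have h1 : shell ha b u = ∫ x, shellFun N a b x * (f x / ‖x‖) := by
    rw [shell_apply]
    refine integral_congr_ae ?_
    filter_upwards [hu] with x hx
    rw [hx]
  have hi : Integrable fun x => shellFun N a b x * (f x / ‖x‖) := by
    have h2 : MemLp (fun x => f x / ‖x‖) 2 volume := by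
      refine (u.memLp_div_norm).ae_eq ?_
      filter_upwards [hu] with x hx
      rw [hx]
    exact (memLp_shellFun ha b).integrable_mul h2
  have hsub : Set.Icc a b ⊆ Set.Ioi (0 : ℝ) := fun r hr => ha.trans_le hr.1
  rw [h1, integral_polar hm.aestronglyMeasurable, integral_prod_symm _
    ((integrable_iff_polar hm.aestronglyMeasurable).1 hi), intervalIntegral.integral_of_le hab,
    ← integral_Icc_eq_integral_Ioc,
    ← Set.inter_eq_self_of_subset_right hsub,
    ← setIntegral_indicator measurableSet_Icc]
  refine setIntegral_congr_fun measurableSet_Ioi fun r hr => ?_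
  have hr : 0 < r := hr
  simp only [shellFun, norm_smul_sph hr.le]
  by_cases hr2 : r ∈ Set.Icc a b
  · simp only [Set.indicator_of_mem hr2]
    rw [← integral_const_mul]
    refine integral_congr_ae (Eventually.of_forall fun w => ?_)
    simp only
    have e : r ^ ((N : ℝ) / 2 - 2) = r ^ (N - 1) * r ^ (-((N : ℝ) / 2)) / r := by
      rw [← Real.rpow_natCast, ← Real.rpow_add hr, ← Real.rpow_sub_one hr.ne',
        Nat.cast_sub (by have := hN.out; omega)]
      congr 1
      push_cast
      ring
    rw [e]
    ring
  · simp [Set.indicator_of_notMem hr2]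

/-- A function annihilated by a shell functional has a spherical mean that vanishes somewhere in the
shell. -/
theorem exists_zero_of_shell {a b : ℝ} (ha : 0 < a) (hab : a < b) {φ : E N → ℝ} (h : IsTest φ)
    (h0 : shell ha b h.toD12 = 0) :
    ∃ r ∈ Set.Icc a b, ∫ w : Sph N, φ (r • (w : E N)) ∂(sphMeas N) = 0 := by
  have hφ := h.1.continuous
  rw [shell_polar ha hab.le hφ.measurable h.coe_toD12] at h0
  have hc : Continuous fun r : ℝ => ∫ w : Sph N, φ (r • (w : E N)) ∂(sphMeas N) :=
    continuous_sphIntegral (f := fun (r : ℝ) (w : Sph N) => φ (r • (w : E N)))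
      (by unfold Function.uncurry; fun_prop)
  set B : ℝ → ℝ := fun r : ℝ => ∫ w : Sph N, φ (r • (w : E N)) ∂(sphMeas N) with hB
  have hw : ContinuousOn (fun r : ℝ => r ^ ((N : ℝ) / 2 - 2)) (Set.Icc a b) := fun r hr =>
    (Real.continuousAt_rpow_const _ _ (Or.inl (ha.trans_le hr.1).ne')).continuousWithinAt
  have pos : ∀ F : ℝ → ℝ, Continuous F → (∀ r ∈ Set.Icc a b, 0 < F r) →
      0 < ∫ r in a..b, r ^ ((N : ℝ) / 2 - 2) * F r := by
    intro F hF hp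
    refine intervalIntegral.intervalIntegral_pos_of_pos_on ?_ (fun r hr => ?_) hab
    · refine ContinuousOn.intervalIntegrable ?_
      rw [Set.uIcc_of_le hab.le]
      exact hw.mul hF.continuousOn
    · exact mul_pos (Real.rpow_pos_of_pos (ha.trans hr.1) _) (hp r (Set.Ioo_subset_Icc_self hr))
  by_contra! hne
  have hsign : (∀ r ∈ Set.Icc a b, 0 < B r) ∨ ∀ r ∈ Set.Icc a b, B r < 0 := by
    by_contra! hcon
    obtain ⟨⟨r₁, h1, h1'⟩, r₂, h2, h2'⟩ := hcon
    obtain ⟨r, hr, hr0⟩ := isPreconnected_Icc.intermediate_value h1 h2 hc.continuousOn ⟨h1', h2'⟩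
    exact hne r hr hr0
  rcases hsign with hs | hs
  · exact (pos B hc hs).ne' h0
  · have := pos (fun r => -B r) hc.neg fun r hr => neg_pos.2 (hs r hr)
    simp only [mul_neg, intervalIntegral.integral_neg] at this
    linarith

/-- The second variation of the functional `‖u‖_λ²/2 - (∫ |u|^{2*_s} / |x|^s) / 2*_s` at the
profile. -/
def secondVar (lam s : ℝ) (b : D12 N) : ℝ :=
  normSq lam b - (critExp N s - 1) * ‖potMap N lam s b‖ ^ 2

theorem continuous_secondVar (lam s : ℝ) : Continuous (secondVar (N := N) lam s) := by
  unfold secondVar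
  have := continuous_normSq (N := N) lam
  fun_prop

theorem critExp_sub_one_mul_potential {lam s r : ℝ} (hs : s < 2) :
    (critExp N s - 1) * potential N lam s r = rate N lam s ^ 2
      * ((power N s + 1) * (power N s + 2)) * (1 - logTanh (rate N lam s) r ^ 2) := by
  have hm := power_pos (N := N) hs
  have h1 : critExp N s - 1 = (power N s + 2) / power N s := by
    have := critExp_sub_two (N := N) hs
    field_simp at this ⊢
    linarith
  rw [h1, potential]
  field_simp

/-- The angular modes are not in resonance: the first nonzero eigenvalue `N - 1` of the sphere
exceeds the modulus `κ² (2m + 1)` of the ground state energy of the radial operator. Here `λ > 0`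
and `s > 0` are used; for `λ = 0`, `s = 0` there is equality, due to the translations. -/
theorem spectral_gap {lam s : ℝ} (hlam0 : 0 < lam) (hlam : lam < hardyConst N) (hs0 : 0 < s)
    (hs : s < 2) : rate N lam s ^ 2 * (2 * power N s + 1) < (N : ℝ) - 1 := by
  have h3 := natCast_three_le (N := N)
  have hm := power_pos (N := N) hs
  have h1 := rate_sq_mul_power_sq hlam hs
  have h2 : ((N : ℝ) - 2) / 2 < power N s := by
    unfold power
    exact div_lt_div_of_pos_left (by linarith) (by linarith) (by linarith)
  have h4 : rate N lam s ^ 2 * power N s ^ 2 < (((N : ℝ) - 2) / 2) ^ 2 := by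
    rw [h1]; unfold hardyConst; linarith
  set m := power N s
  set n := ((N : ℝ) - 2) / 2 with hn
  have hn0 : 0 < n := by rw [hn]; linarith
  have e : (N : ℝ) - 1 = 2 * n + 1 := by rw [hn]; ring
  rw [e]
  have h5 : rate N lam s ^ 2 * (2 * m + 1) * m ^ 2 < (2 * n + 1) * m ^ 2 := by
    calc rate N lam s ^ 2 * (2 * m + 1) * m ^ 2
        = rate N lam s ^ 2 * m ^ 2 * (2 * m + 1) := by ring
      _ < n ^ 2 * (2 * m + 1) := mul_lt_mul_of_pos_right h4 (by linarith)
      _ ≤ (2 * n + 1) * m ^ 2 := by nlinarith [mul_pos hn0 hm]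
  exact lt_of_mul_lt_mul_right h5 (by positivity)

/-- The second variation controls the Hardy term on the test functions annihilated by the two
shell functionals. -/
theorem IsTest.secondVar_ge {lam s : ℝ} (hlam0 : 0 < lam) (hlam : lam < hardyConst N) (hs0 : 0 < s)
    (hs : s < 2) : ∃ (ρ : ℝ) (h₁ : 0 < (ρ ^ 2)⁻¹) (h₂ : 0 < ρ), 1 < ρ ∧ ∃ δ > 0,
      ∀ φ (hφ : IsTest φ), shell (N := N) h₁ ρ⁻¹ hφ.toD12 = 0 →
        shell (N := N) h₂ (ρ ^ 2) hφ.toD12 = 0 →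
        δ * ‖hardyMap N hφ.toD12‖ ^ 2 ≤ secondVar lam s hφ.toD12 := by
  have hκ := rate_pos hlam hs
  have hm := power_pos (N := N) hs
  have hgap := spectral_gap hlam0 hlam hs0 hs
  have hL := rate_sq_mul_power_sq hlam hs
  have hpot := fun r => critExp_sub_one_mul_potential (N := N) (lam := lam) (r := r) hs
  set κ := rate N lam s with hκd
  set m := power N s with hmd
  obtain ⟨ρ, hρ1, hρ2⟩ : ∃ ρ : ℝ, 1 < ρ ∧
      logTanh κ (ρ ^ 2) ≤ 1 / (2 * ((m + 1) * (m + 2) + 1)) := by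
    have h1 : ContinuousAt (fun ρ : ℝ => logTanh κ (ρ ^ 2)) 1 := by
      refine ContinuousAt.comp (g := logTanh κ) (f := fun ρ : ℝ => ρ ^ 2) ?_ (by fun_prop)
      exact (hasDerivAt_logTanh κ (by norm_num)).continuousAt
    have h2 : ∀ᶠ ρ in 𝓝 (1 : ℝ), logTanh κ (ρ ^ 2) < 1 / (2 * ((m + 1) * (m + 2) + 1)) := by
      refine h1.eventually_lt continuousAt_const ?_
      rw [one_pow, logTanh_one]
      positivity
    obtain ⟨ρ, h3, h4⟩ := ((h2.filter_mono nhdsWithin_le_nhds).and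
      (self_mem_nhdsWithin : Set.Ioi (1 : ℝ) ∈ 𝓝[>] 1)).exists
    exact ⟨ρ, h4, h3.le⟩
  have hρ0 : 0 < ρ := one_pos.trans hρ1
  have y0 := logTanh_pos hκ hρ1
  set ε := m * logTanh κ ρ ^ 3 with hε
  have hε0 : 0 < ε := by positivity
  set δ := min (min (κ ^ 2 * (m * ε)) (κ ^ 2 / 2)) ((N : ℝ) - 1 - κ ^ 2 * (2 * m + 1)) with hδ
  have hδ0 : 0 < δ := lt_min (lt_min (by positivity) (by positivity)) (by linarith)
  refine ⟨ρ, by positivity, hρ0, hρ1, δ, hδ0, fun φ hφ z₁ z₂ => ?_⟩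
  have key := hφ.second_variation hκ hm hL hρ1 hρ2 hε0.le le_rfl
    ((min_le_left _ _).trans (min_le_left _ _)) ((min_le_left _ _).trans (min_le_right _ _))
    (min_le_right _ _)
    (exists_zero_of_shell _ ((inv_lt_inv₀ (by positivity) hρ0).2 (by nlinarith)) hφ z₁)
    (exists_zero_of_shell _ (by nlinarith) hφ z₂)
  rw [← hδ] at key
  have e1 : ‖hφ.toD12‖ ^ 2 = ∫ x, ‖∇ φ x‖ ^ 2 := by
    rw [D12.norm_def, norm_sq_eq_integral, hφ.grad_toD12]
    refine integral_congr_ae ?_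
    filter_upwards [(hφ.memLp_gradient 2).coeFn_toLp] with x hx
    rw [hx]
  have e2 := hardyMap_norm_sq hφ.toD12
  have e3 : ‖potMap N lam s hφ.toD12‖ ^ 2
      = ∫ x, potential N lam s ‖x‖ * (hφ.toD12 x ^ 2 / ‖x‖ ^ 2) := by
    rw [← real_inner_self_eq_norm_sq, inner_potMap hs]
    refine integral_congr_ae (Eventually.of_forall fun x => ?_)
    simp only
    ring
  have i2 := hφ.toD12.integrable_div_norm_sq
  have i3 : Integrable fun x => potential N lam s ‖x‖ * (hφ.toD12 x ^ 2 / ‖x‖ ^ 2) := by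
    refine (integrable_potMap (lam := lam) hs hφ.toD12 hφ.toD12).congr
      (Eventually.of_forall fun x => ?_)
    simp only
    ring
  have e4 : ∫ x, (lam + κ ^ 2 * ((m + 1) * (m + 2)) * (1 - logTanh κ ‖x‖ ^ 2) + δ)
      * (φ x ^ 2 / ‖x‖ ^ 2) = (lam + δ) * ‖hardyMap N hφ.toD12‖ ^ 2
        + (critExp N s - 1) * ‖potMap N lam s hφ.toD12‖ ^ 2 := by
    rw [e2, e3, ← integral_const_mul, ← integral_const_mul, ← integral_add (i2.const_mul _)
      (i3.const_mul _)]
    refine integral_congr_ae ?_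
    filter_upwards [hφ.coe_toD12] with x hx
    rw [hx, ← hpot]
    ring
  rw [secondVar, normSq_eq, e1]
  linarith

/-- **Coercivity of the second variation** on the common kernel of the two shell functionals. -/
theorem secondVar_coercive {lam s : ℝ} (hlam0 : 0 < lam) (hlam : lam < hardyConst N) (hs0 : 0 < s)
    (hs : s < 2) : ∃ (ρ : ℝ) (h₁ : 0 < (ρ ^ 2)⁻¹) (h₂ : 0 < ρ), 1 < ρ ∧ ∃ c > 0,
      ∀ b : D12 N, shell h₁ ρ⁻¹ b = 0 → shell h₂ (ρ ^ 2) b = 0 →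
        c * ‖b‖ ^ 2 ≤ secondVar lam s b := by
  obtain ⟨ρ, h₁, h₂, hρ, δ, hδ, key⟩ := IsTest.secondVar_ge (N := N) hlam0 hlam hs0 hs
  set K := lam + (critExp N s - 1) * |rate N lam s ^ 2 * (power N s * (power N s + 1))| with hK
  have hp := two_lt_critExp (N := N) hs
  have hK0 : 0 < K := by
    have : 0 ≤ (critExp N s - 1) * |rate N lam s ^ 2 * (power N s * (power N s + 1))| :=
      mul_nonneg (by linarith) (abs_nonneg _)
    linarith
  have hpot : ∀ b : D12 N, ‖potMap N lam s b‖ ^ 2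
      ≤ |rate N lam s ^ 2 * (power N s * (power N s + 1))| * ‖hardyMap N b‖ ^ 2 := by
    intro b
    have h := D12.norm_toLp_potMap_le lam s b
    have h' : ‖potMap N lam s b‖ ^ 2 ≤ (√|rate N lam s ^ 2 * (power N s * (power N s + 1))|
        * ‖hardyMap N b‖) ^ 2 := pow_le_pow_left₀ (norm_nonneg _) h 2
    rwa [mul_pow, Real.sq_sqrt (abs_nonneg _)] at h'
  have hlow : ∀ b : D12 N, ‖b‖ ^ 2 - K * ‖hardyMap N b‖ ^ 2 ≤ secondVar lam s b := by
    intro b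
    rw [secondVar, normSq_eq, hK]
    have := mul_le_mul_of_nonneg_left (hpot b) (by linarith : 0 ≤ critExp N s - 1)
    linarith
  refine ⟨ρ, h₁, h₂, hρ, (1 + K / δ)⁻¹, by positivity, fun b z₁ z₂ => ?_⟩
  obtain ⟨φ, hφ, hlim⟩ := b.exists_test_tendsto
  obtain ⟨g, hg, hglim⟩ := exists_tendsto_of_finite_codim (T := testSubmodule N)
    ((shell h₁ ρ⁻¹).prod (shell h₂ (ρ ^ 2))) (b := b) (by simp [z₁, z₂])
    (fun n => ⟨_, hφ n, rfl⟩) hlim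
  refine le_of_tendsto_of_tendsto' (((hglim.norm).pow 2).const_mul _)
    (((continuous_secondVar lam s).tendsto b).comp hglim) fun n => ?_
  obtain ⟨⟨ψ, hψ, hψg⟩, hL⟩ := hg n
  simp only [Function.comp_apply, ← hψg] at hL ⊢
  have hL1 := congrArg Prod.fst hL
  have hL2 := congrArg Prod.snd hL
  have k1 := key ψ hψ hL1 hL2
  have k2 := hlow hψ.toD12
  rw [inv_mul_le_iff₀ (by positivity)]
  have k3 := mul_le_mul_of_nonneg_left k1 (by positivity : 0 ≤ K / δ)
  have e : K / δ * (δ * ‖hardyMap N hψ.toD12‖ ^ 2) = K * ‖hardyMap N hψ.toD12‖ ^ 2 := by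
    field_simp
  rw [e] at k3
  linarith

end Shell

/-! ### Dilations -/

section Dilation

variable {N : ℕ}

theorem map_smul_volume {c : ℝ} (hc : c ≠ 0) :
    (volume : Measure (E N)).map (fun x => c • x) = ENNReal.ofReal |(c ^ N)⁻¹| • volume := by
  have := Measure.map_addHaar_smul (volume : Measure (E N)) hc
  rwa [finrank_euclideanSpace, Fintype.card_fin] at this

theorem quasiMeasurePreserving_smul_E {c : ℝ} (hc : c ≠ 0) :
    Measure.QuasiMeasurePreserving (fun x : E N => c • x) volume volume :=
  ⟨by fun_prop, by rw [map_smul_volume hc]; exact Measure.smul_absolutelyContinuous⟩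

theorem integral_comp_smul_E (c : ℝ) (f : E N → ℝ) :
    ∫ x, f (c • x) = |(c ^ N)⁻¹| * ∫ x, f x := by
  have := Measure.integral_comp_smul (volume : Measure (E N)) f c
  rwa [finrank_euclideanSpace, Fintype.card_fin, smul_eq_mul] at this

theorem eLpNorm_comp_smul_E {F : Type*} [NormedAddCommGroup F] {c : ℝ} (hc : c ≠ 0) (p : ℝ≥0∞) :
    ∃ C : ℝ≥0, ∀ f : E N → F, eLpNorm (fun x => f (c • x)) p volume
      = C * eLpNorm f p volume := by
  refine ⟨(Real.toNNReal |(c ^ N)⁻¹|) ^ (1 / p).toReal, fun f => ?_⟩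
  have h1 := (measurableEmbedding_const_smul₀ hc : MeasurableEmbedding fun x : E N => c • x)
    |>.eLpNorm_map_measure (g := f) (p := p) (μ := volume)
  have h0 : ENNReal.ofReal |(c ^ N)⁻¹| ≠ 0 := by
    simp only [ne_eq, ENNReal.ofReal_eq_zero, not_le]
    exact abs_pos.2 (inv_ne_zero (pow_ne_zero _ hc))
  rw [map_smul_volume hc, eLpNorm_smul_measure_of_ne_zero h0, ENNReal.ofReal] at h1
  rw [show (fun x => f (c • x)) = f ∘ fun x => c • x from rfl, ← h1, smul_eq_mul,
    ENNReal.coe_rpow_of_nonneg _ ENNReal.toReal_nonneg]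

theorem memLp_comp_smul_E {F : Type*} [NormedAddCommGroup F] {c : ℝ} (hc : c ≠ 0) {p : ℝ≥0∞}
    {f : E N → F} (hf : MemLp f p volume) : MemLp (fun x => f (c • x)) p volume := by
  refine ⟨hf.1.comp_quasiMeasurePreserving (quasiMeasurePreserving_smul_E hc), ?_⟩
  obtain ⟨C, hC⟩ := eLpNorm_comp_smul_E (N := N) (F := F) hc p
  rw [hC]
  exact ENNReal.mul_lt_top ENNReal.coe_lt_top hf.2

theorem IsTest.dilate {φ : E N → ℝ} (h : IsTest φ) (k : ℝ) {c : ℝ} (hc : c ≠ 0) :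
    IsTest fun x => k * φ (c • x) :=
  ⟨contDiff_const.mul (h.1.comp (contDiff_const_smul c)),
    (h.2.comp_homeomorph (Homeomorph.smulOfNeZero c hc)).mul_left⟩

theorem gradient_dilate {φ : E N → ℝ} (h : ContDiff ℝ 1 φ) (k c : ℝ) (x : E N) :
    ∇ (fun x => k * φ (c • x)) x = (k * c) • ∇ φ (c • x) := by
  have h1 := hasGradientAt_iff_hasFDerivAt.1
    ((h.differentiable (by simp) (c • x)).hasGradientAt)
  have h2 := (h1.comp x ((hasFDerivAt_id x).const_smul c)).const_mul k
  refine HasGradientAt.gradient ?_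
  rw [hasGradientAt_iff_hasFDerivAt]
  refine h2.congr_fderiv ?_
  ext y
  simp [mul_assoc]

theorem IsTestLimit.dilate {u : E N → ℝ} {G : E N → E N} (h : IsTestLimit u G) (k : ℝ) {c : ℝ}
    (hc : c ≠ 0) : IsTestLimit (fun x => k * u (c • x)) (fun x => (k * c) • G (c • x)) := by
  obtain ⟨φ, h0, h1, h2⟩ := h
  have key : ∀ {F : Type} [NormedAddCommGroup F] [NormedSpace ℝ F] (a : ℝ) (p : ℝ≥0∞)
      (f : ℕ → E N → F), Tendsto (fun n => eLpNorm (f n) p volume) atTop (𝓝 0) →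
      Tendsto (fun n => eLpNorm (fun x => a • f n (c • x)) p volume) atTop (𝓝 0) := by
    intro F _ _ a p f hf
    obtain ⟨C, hC⟩ := eLpNorm_comp_smul_E (N := N) (F := F) hc p
    have e : ∀ n, eLpNorm (fun x => a • f n (c • x)) p volume
        = ‖a‖ₑ * (C * eLpNorm (f n) p volume) := by
      intro n
      rw [← hC, ← eLpNorm_const_smul]
      rfl
    simp only [e]
    have h3 := ENNReal.Tendsto.const_mul (a := ‖a‖ₑ)
      (ENNReal.Tendsto.const_mul (a := (C : ℝ≥0∞)) hf (Or.inr ENNReal.coe_ne_top))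
      (Or.inr enorm_ne_top)
    simpa using h3
  refine ⟨fun n x => k * φ n (c • x), fun n => (h0 n).dilate k hc, ?_, ?_⟩
  · refine (key k _ _ h1).congr fun n => ?_
    congr 1
    funext x
    rw [smul_sub, smul_eq_mul, smul_eq_mul]
  · refine (key (k * c) _ _ h2).congr fun n => ?_
    congr 1
    funext x
    rw [gradient_dilate (h0 n).contDiff_one, smul_sub]

theorem integral_comp_inv_smul {μ : ℝ} (hμ : 0 < μ) (f : E N → ℝ) :
    ∫ x, f (μ⁻¹ • x) = μ ^ (N : ℝ) * ∫ x, f x := by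
  rw [integral_comp_smul_E, inv_pow, inv_inv, abs_of_pos (by positivity), Real.rpow_natCast]

variable [hN : Fact (3 ≤ N)]

theorem memLp_grad_dilate (k : ℝ) {c : ℝ} (hc : c ≠ 0) (u : D12 N) :
    MemLp (fun x => k • D12.grad N u (c • x)) 2 volume :=
  (memLp_comp_smul_E hc (Lp.memLp (D12.grad N u))).const_smul k

/-- The dilation `u ↦ μ^{-(N-2)/2} u(·/μ)` of `D^{1,2}`, as a function. -/
def dilFun {μ : ℝ} (hμ : 0 < μ) (u : D12 N) : D12 N :=
  D12.ofLimit (fun x => μ ^ (-(((N : ℝ) - 2) / 2)) * u (μ⁻¹ • x))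
    (fun x => (μ ^ (-(((N : ℝ) - 2) / 2)) * μ⁻¹) • D12.grad N u (μ⁻¹ • x))
    ((u.aestronglyMeasurable.comp_quasiMeasurePreserving
      (quasiMeasurePreserving_smul_E (inv_ne_zero hμ.ne'))).const_mul _)
    (memLp_grad_dilate _ (inv_ne_zero hμ.ne') u)
    (u.isTestLimit.dilate _ (inv_ne_zero hμ.ne'))

theorem coe_dilFun {μ : ℝ} (hμ : 0 < μ) (u : D12 N) :
    dilFun hμ u =ᵐ[volume] fun x => μ ^ (-(((N : ℝ) - 2) / 2)) * u (μ⁻¹ • x) :=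
  D12.coe_ofLimit _ _ _

theorem grad_dilFun {μ : ℝ} (hμ : 0 < μ) (u : D12 N) : D12.grad N (dilFun hμ u) =ᵐ[volume]
    fun x => (μ ^ (-(((N : ℝ) - 2) / 2)) * μ⁻¹) • D12.grad N u (μ⁻¹ • x) := by
  rw [dilFun, D12.grad_ofLimit]
  exact MemLp.coeFn_toLp _

/-- The dilation `u ↦ μ^{-(N-2)/2} u(·/μ)` of `D^{1,2}`. -/
def dil {μ : ℝ} (hμ : 0 < μ) : D12 N →ₗ[ℝ] D12 N where
  toFun := dilFun hμ
  map_add' u v := by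
    have hq := quasiMeasurePreserving_smul_E (N := N) (inv_ne_zero hμ.ne')
    refine D12.ext_ae ?_ ?_
    · filter_upwards [coe_dilFun hμ (u + v), coe_dilFun hμ u, coe_dilFun hμ v,
        D12.coe_add (dilFun hμ u) (dilFun hμ v), hq.ae (D12.coe_add u v)] with x h1 h2 h3 h4 h5
      rw [h1, h4, h2, h3, h5, mul_add]
    · rw [map_add]
      filter_upwards [grad_dilFun hμ (u + v), grad_dilFun hμ u, grad_dilFun hμ v,
        Lp.coeFn_add (D12.grad N (dilFun hμ u)) (D12.grad N (dilFun hμ v)),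
        hq.ae (Lp.coeFn_add (D12.grad N u) (D12.grad N v))] with x h1 h2 h3 h4 h5
      rw [h1, h4, Pi.add_apply, h2, h3, map_add, h5, Pi.add_apply, smul_add]
  map_smul' a u := by
    have hq := quasiMeasurePreserving_smul_E (N := N) (inv_ne_zero hμ.ne')
    rw [RingHom.id_apply]
    refine D12.ext_ae ?_ ?_
    · filter_upwards [coe_dilFun hμ (a • u), coe_dilFun hμ u,
        D12.coe_smul a (dilFun hμ u), hq.ae (D12.coe_smul a u)] with x h1 h2 h4 h5
      rw [h1, h4, h2, h5, mul_left_comm]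
    · rw [map_smul]
      filter_upwards [grad_dilFun hμ (a • u), grad_dilFun hμ u,
        Lp.coeFn_smul a (D12.grad N (dilFun hμ u)),
        hq.ae (Lp.coeFn_smul a (D12.grad N u))] with x h1 h2 h4 h5
      rw [h1, h4, Pi.smul_apply, h2, map_smul, h5, Pi.smul_apply, smul_comm]

theorem coe_dil {μ : ℝ} (hμ : 0 < μ) (u : D12 N) :
    dil hμ u =ᵐ[volume] fun x => μ ^ (-(((N : ℝ) - 2) / 2)) * u (μ⁻¹ • x) :=
  coe_dilFun hμ u

theorem grad_dil {μ : ℝ} (hμ : 0 < μ) (u : D12 N) : D12.grad N (dil hμ u) =ᵐ[volume]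
    fun x => (μ ^ (-(((N : ℝ) - 2) / 2)) * μ⁻¹) • D12.grad N u (μ⁻¹ • x) :=
  grad_dilFun hμ u

theorem norm_dil {μ : ℝ} (hμ : 0 < μ) (u : D12 N) : ‖dil hμ u‖ = ‖u‖ := by
  have h : ‖dil hμ u‖ ^ 2 = ‖u‖ ^ 2 := by
    rw [D12.norm_def, D12.norm_def u, norm_sq_eq_integral, norm_sq_eq_integral]
    have e : ∫ x, ‖D12.grad N (dil hμ u) x‖ ^ 2
        = ∫ x, (fun y => μ ^ (-(N : ℝ)) * ‖D12.grad N u y‖ ^ 2) (μ⁻¹ • x) := by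
      refine integral_congr_ae ?_
      filter_upwards [grad_dil hμ u] with x hx
      rw [hx, norm_smul, mul_pow, Real.norm_of_nonneg (by positivity),
        ← div_eq_mul_inv, ← Real.rpow_sub_one hμ.ne', ← Real.rpow_natCast, ← Real.rpow_mul hμ.le]
      congr 2
      push_cast
      ring
    refine e.trans ((integral_comp_inv_smul hμ fun y : E N =>
    μ ^ (-(N : ℝ)) * ‖D12.grad N u y‖ ^ 2).trans ?_)
    rw [integral_const_mul, ← mul_assoc, ← Real.rpow_add hμ]
    simp
  exact (pow_left_inj₀ (norm_nonneg _) (norm_nonneg _) two_ne_zero).1 h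

theorem dil_dil_inv {μ : ℝ} (hμ : 0 < μ) (u : D12 N) :
    dil hμ (dil (inv_pos.2 hμ) u) = u := by
  have hq := quasiMeasurePreserving_smul_E (N := N) (inv_ne_zero hμ.ne')
  refine D12.ext_ae ?_ ?_
  · filter_upwards [coe_dil hμ (dil (inv_pos.2 hμ) u), hq.ae (coe_dil (inv_pos.2 hμ) u)]
      with x h1 h2
    rw [h1, h2, inv_inv, smul_smul, mul_inv_cancel₀ hμ.ne', one_smul, ← mul_assoc,
      Real.inv_rpow hμ.le, mul_inv_cancel₀ (by positivity), one_mul]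
  · filter_upwards [grad_dil hμ (dil (inv_pos.2 hμ) u), hq.ae (grad_dil (inv_pos.2 hμ) u)]
      with x h1 h2
    rw [h1, h2, inv_inv, smul_smul, smul_smul, mul_inv_cancel₀ hμ.ne', one_smul,
      Real.inv_rpow hμ.le]
    have : μ ^ (-(((N : ℝ) - 2) / 2)) ≠ 0 := by positivity
    field_simp
    simp

theorem hardyMap_dil {μ : ℝ} (hμ : 0 < μ) (u : D12 N) :
    ‖hardyMap N (dil hμ u)‖ ^ 2 = ‖hardyMap N u‖ ^ 2 := by
  rw [hardyMap_norm_sq, hardyMap_norm_sq]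
  have e : ∫ x, dil hμ u x ^ 2 / ‖x‖ ^ 2
      = ∫ x, (fun y => μ ^ (-(N : ℝ)) * (u y ^ 2 / ‖y‖ ^ 2)) (μ⁻¹ • x) := by
    refine integral_congr_ae ?_
    filter_upwards [coe_dil hμ u] with x hx
    have e2 : μ ^ (-(N : ℝ)) = (μ ^ (-(((N : ℝ) - 2) / 2))) ^ 2 / μ ^ 2 := by
      rw [← Real.rpow_natCast, ← Real.rpow_mul hμ.le, ← Real.rpow_natCast μ 2,
        ← Real.rpow_sub hμ]
      congr 1
      push_cast
      ring
    rw [hx, norm_smul, e2, Real.norm_of_nonneg (by positivity)]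
    field_simp
  refine e.trans ((integral_comp_inv_smul hμ fun y : E N =>
    μ ^ (-(N : ℝ)) * (u y ^ 2 / ‖y‖ ^ 2)).trans ?_)
  rw [integral_const_mul, ← mul_assoc, ← Real.rpow_add hμ]
  simp

theorem normSq_dil {μ : ℝ} (hμ : 0 < μ) (lam : ℝ) (u : D12 N) :
    normSq lam (dil hμ u) = normSq lam u := by
  rw [normSq_eq, normSq_eq, norm_dil, hardyMap_dil]

theorem critInt_dil {μ : ℝ} (hμ : 0 < μ) (s : ℝ) (u : D12 N) :
    critInt s (dil hμ u) = critInt s u := by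
  have h3 := natCast_three_le (N := N)
  unfold critInt
  have e : ∫ x, |dil hμ u x| ^ critExp N s / ‖x‖ ^ s
      = ∫ x, (fun y => μ ^ (-(N : ℝ)) * (|u y| ^ critExp N s / ‖y‖ ^ s)) (μ⁻¹ • x) := by
    refine integral_congr_ae ?_
    filter_upwards [coe_dil hμ u, ae_ne_zero N] with x hx hx0
    have hn : 0 < ‖x‖ := norm_pos_iff.2 hx0
    have e2 : μ ^ (-(N : ℝ)) = (μ ^ (-(((N : ℝ) - 2) / 2))) ^ critExp N s / μ ^ s := by
      rw [← Real.rpow_mul hμ.le, ← Real.rpow_sub hμ]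
      congr 1
      unfold critExp
      have : (N : ℝ) - 2 ≠ 0 := by linarith
      field_simp
      ring
    rw [hx, norm_smul, e2, Real.norm_of_nonneg (by positivity), abs_mul,
      abs_of_pos (by positivity), Real.mul_rpow (by positivity) (abs_nonneg _),
      Real.mul_rpow (by positivity) hn.le, Real.inv_rpow hμ.le]
    field_simp
  refine e.trans ((integral_comp_inv_smul hμ fun y : E N =>
    μ ^ (-(N : ℝ)) * (|u y| ^ critExp N s / ‖y‖ ^ s)).trans ?_)
  rw [integral_const_mul, ← mul_assoc, ← Real.rpow_add hμ]
  simp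

end Dilation

/-! ### The single functional near the profile -/

section Taylor

/-- The second order expansion of `|1 + y|^p`, with a remainder controlled for all `y`. -/
theorem abs_one_add_rpow_le {p η : ℝ} (hp : 2 < p) (hη : 0 < η) : ∃ C > 0, ∀ y : ℝ,
    |1 + y| ^ p ≤ 1 + p * y + (p * (p - 1) / 2 + η) * y ^ 2 + C * |y| ^ p := by
  -- the derivative of the remainder is `o(y)`
  have hd0 : HasDerivAt (fun y : ℝ => (1 + y) ^ (p - 1)) (p - 1) 0 := by
    have h := ((hasDerivAt_id (0 : ℝ)).const_add 1).rpow_const (p := p - 1)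
      (Or.inl (by norm_num))
    simpa using h
  have hlo := (hasDerivAt_iff_isLittleO.1 hd0).def (c := 2 * η / p) (by positivity)
  obtain ⟨δ, hδ, hball⟩ := Metric.eventually_nhds_iff.1 hlo
  set d := min (δ / 2) (1 / 2) with hd
  have hd1 : 0 < d := lt_min (by positivity) (by norm_num)
  have hdδ : d < δ := (min_le_left _ _).trans_lt (by linarith)
  have hdh : d ≤ 1 / 2 := min_le_right _ _
  -- near zero
  have near : ∀ y : ℝ, |y| ≤ d →
      |1 + y| ^ p ≤ 1 + p * y + (p * (p - 1) / 2 + η) * y ^ 2 := by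
    intro y hy
    have hy' := abs_le.1 hy
    set R : ℝ → ℝ := fun y => 1 + p * y + (p * (p - 1) / 2 + η) * y ^ 2 - (1 + y) ^ p with hR
    have hder : ∀ x ∈ Set.Icc (-d) d, HasDerivAt R
        (p + (p * (p - 1) / 2 + η) * (2 * x) - p * (1 + x) ^ (p - 1)) x := by
      intro x hx
      have h1 : (1 : ℝ) + x ≠ 0 := by
        have := hx.1
        intro h0; linarith
      have h2 := ((hasDerivAt_id x).const_add 1).rpow_const (p := p) (Or.inl h1)
      have h3 := ((((hasDerivAt_id x).const_mul p).const_add 1).add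
        (((hasDerivAt_id x).pow 2).const_mul (p * (p - 1) / 2 + η))).sub h2
      refine HasDerivAt.congr_deriv (f := R) h3 ?_
      simp
    have hb : ∀ x ∈ Set.Icc (-d) d, |(1 + x) ^ (p - 1) - 1 - (p - 1) * x| ≤ 2 * η / p * |x| := by
      intro x hx
      have := hball (y := x) (by
        rw [Real.dist_eq, sub_zero]
        exact (abs_le.2 hx).trans_lt hdδ)
      simpa [mul_comm] using this
    have hR0 : R 0 = 0 := by simp [hR]
    have hsgn : 0 ≤ R y := by
      have hp0 : 0 < p := by linarith
      rcases le_total 0 y with h0 | h0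
      · have hmono : MonotoneOn R (Set.Icc 0 d) := by
          refine monotoneOn_of_hasDerivWithinAt_nonneg (convex_Icc _ _)
            (fun x hx => (hder x ⟨by linarith [hx.1], hx.2⟩).continuousAt.continuousWithinAt)
            (fun x hx => (hder x ?_).hasDerivWithinAt) fun x hx => ?_
          · rw [interior_Icc] at hx; exact ⟨by linarith [hx.1], hx.2.le⟩
          · rw [interior_Icc] at hx
            have h5 := (abs_le.1 (hb x ⟨by linarith [hx.1], hx.2.le⟩)).2
            rw [abs_of_pos hx.1] at h5
            have h6 := mul_le_mul_of_nonneg_left h5 hp0.le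
            have e : p * (2 * η / p * x) = 2 * η * x := by field_simp
            rw [e] at h6
            linarith
        have := hmono (Set.left_mem_Icc.2 hd1.le) ⟨h0, hy'.2⟩ h0
        rwa [hR0] at this
      · have hmono : AntitoneOn R (Set.Icc (-d) 0) := by
          refine antitoneOn_of_hasDerivWithinAt_nonpos (convex_Icc _ _)
            (fun x hx => (hder x ⟨hx.1, by linarith [hx.2]⟩).continuousAt.continuousWithinAt)
            (fun x hx => (hder x ?_).hasDerivWithinAt) fun x hx => ?_
          · rw [interior_Icc] at hx; exact ⟨hx.1.le, by linarith [hx.2]⟩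
          · rw [interior_Icc] at hx
            have h5 := (abs_le.1 (hb x ⟨hx.1.le, by linarith [hx.2]⟩)).1
            rw [abs_of_neg hx.2] at h5
            have h6 := mul_le_mul_of_nonneg_left h5 hp0.le
            have e : p * -(2 * η / p * -x) = 2 * η * x := by field_simp
            rw [e] at h6
            linarith
        have := hmono ⟨hy'.1, h0⟩ (Set.right_mem_Icc.2 (by linarith)) h0
        rwa [hR0] at this
    rw [abs_of_nonneg (by linarith : 0 ≤ 1 + y)]
    simp only [hR] at hsgn
    linarith
  refine ⟨(1 / d + 1) ^ p + p * d ^ (1 - p), by positivity, fun y => ?_⟩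
  have hyp : 0 ≤ |y| ^ p := by positivity
  rcases le_total |y| d with hy | hy
  · have h1 := near y hy
    have h2 : 0 ≤ ((1 / d + 1) ^ p + p * d ^ (1 - p)) * |y| ^ p := by positivity
    linarith
  · have hy0 : 0 < |y| := hd1.trans_le hy
    have h1 : |1 + y| ^ p ≤ (1 / d + 1) ^ p * |y| ^ p := by
      rw [← Real.mul_rpow (by positivity) hy0.le]
      refine Real.rpow_le_rpow (abs_nonneg _) ?_ (by linarith)
      have h3 : 1 ≤ |y| / d := by rwa [le_div_iff₀ hd1, one_mul]
      calc |1 + y| ≤ 1 + |y| := by simpa using abs_add_le 1 y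
        _ ≤ (1 / d + 1) * |y| := by rw [add_mul, one_mul, one_div_mul_eq_div]; linarith
    have h2 : |y| ≤ d ^ (1 - p) * |y| ^ p := by
      have h3 : |y| = |y| ^ (1 - p) * |y| ^ p := by
        rw [← Real.rpow_add hy0]; simp
      conv_lhs => rw [h3]
      exact mul_le_mul_of_nonneg_right (Real.rpow_le_rpow_of_nonpos hd1 hy (by linarith)) hyp
    have h4 : -(p * y) ≤ p * (d ^ (1 - p) * |y| ^ p) := by
      have := neg_le_abs y
      nlinarith
    have h5 : 0 ≤ (p * (p - 1) / 2 + η) * y ^ 2 := by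
      have : 0 ≤ p * (p - 1) := by nlinarith
      positivity
    nlinarith

theorem abs_add_rpow_le {p η : ℝ} (hp : 2 < p) (hη : 0 < η) : ∃ C > 0, ∀ z y : ℝ, 0 < z →
    |z + y| ^ p ≤ z ^ p + p * (z ^ (p - 2) * z * y) + (p * (p - 1) / 2 + η) * (z ^ (p - 2) * y ^ 2)
      + C * |y| ^ p := by
  obtain ⟨C, hC, h⟩ := abs_one_add_rpow_le hp hη
  refine ⟨C, hC, fun z y hz => ?_⟩
  have h1 := mul_le_mul_of_nonneg_left (h (y / z)) (by positivity : 0 ≤ z ^ p)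
  have e1 : z ^ p * |1 + y / z| ^ p = |z + y| ^ p := by
    rw [← Real.mul_rpow hz.le (abs_nonneg _)]
    congr 1
    rw [← abs_of_pos hz, ← abs_mul, abs_of_pos hz]
    congr 1
    field_simp
  have e2 : z ^ p = z ^ (p - 2) * z ^ 2 := by
    rw [← Real.rpow_natCast, ← Real.rpow_add hz]; congr 1; push_cast; ring
  have e3 : z ^ p * |y / z| ^ p = |y| ^ p := by
    rw [← Real.mul_rpow hz.le (abs_nonneg _), abs_div, abs_of_pos hz]
    congr 1
    field_simp
  rw [e1] at h1
  refine h1.trans (le_of_eq ?_)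
  calc z ^ p * (1 + p * (y / z) + (p * (p - 1) / 2 + η) * (y / z) ^ 2 + C * |y / z| ^ p)
      = z ^ p + p * (z ^ p * (y / z)) + (p * (p - 1) / 2 + η) * (z ^ p * (y / z) ^ 2)
        + C * (z ^ p * |y / z| ^ p) := by ring
    _ = _ := by
      rw [e3, e2]
      field_simp

theorem integral_linear_combination {X : Type*} [MeasurableSpace X] {μ : Measure X}
    {f g h k : X → ℝ} (hf : Integrable f μ) (hg : Integrable g μ) (hh : Integrable h μ)
    (hk : Integrable k μ) (a b c : ℝ) : ∫ x, (f x + a * g x + b * h x + c * k x) ∂μ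
      = ∫ x, f x ∂μ + a * ∫ x, g x ∂μ + b * ∫ x, h x ∂μ + c * ∫ x, k x ∂μ := by
  rw [integral_add (by fun_prop) (by fun_prop), integral_add (by fun_prop) (by fun_prop),
    integral_add (by fun_prop) (by fun_prop), integral_const_mul, integral_const_mul,
    integral_const_mul]

end Taylor

section Single

variable {N : ℕ} [hN : Fact (3 ≤ N)]

/-- The energy of a single component, decoupled from the other one. -/
def single (lam s : ℝ) (v : D12 N) : ℝ := normSq lam v / 2 - critInt s v / critExp N s

theorem normSq_add (lam : ℝ) (u v : D12 N) : normSq lam (u + v) = normSq lam u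
    + 2 * (inner ℝ (D12.grad N u) (D12.grad N v) - lam * inner ℝ (hardyMap N u) (hardyMap N v))
    + normSq lam v := by
  rw [normSq_eq, normSq_eq, normSq_eq, D12.norm_def, D12.norm_def u, D12.norm_def v, map_add,
    map_add, norm_add_sq_real, norm_add_sq_real]
  ring

theorem potMap_norm_sq_le {lam s : ℝ} (b : D12 N) : ‖potMap N lam s b‖ ^ 2
    ≤ |rate N lam s ^ 2 * (power N s * (power N s + 1))| / hardyConst N * ‖b‖ ^ 2 := by
  have h := D12.norm_toLp_potMap_le lam s b
  have h' : ‖potMap N lam s b‖ ^ 2 ≤ (√|rate N lam s ^ 2 * (power N s * (power N s + 1))|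
      * ‖hardyMap N b‖) ^ 2 := pow_le_pow_left₀ (norm_nonneg _) h 2
  rw [mul_pow, Real.sq_sqrt (abs_nonneg _)] at h'
  refine h'.trans ?_
  rw [div_mul_eq_mul_div, mul_div_assoc]
  refine mul_le_mul_of_nonneg_left ?_ (abs_nonneg _)
  rw [le_div_iff₀ hardyConst_pos, mul_comm]
  exact hardy_inequality b

/-- The second order expansion of the critical integral at the profile, as an upper bound. -/
theorem critInt_add_le {lam s η : ℝ} (hlam : lam < hardyConst N) (hs0 : 0 < s) (hs : s < 2)
    (hη : 0 < η) : ∃ C > 0, ∀ b : D12 N, critInt s (profileD hlam hs + b)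
      ≤ critInt s (profileD (N := N) hlam hs)
        + critExp N s * inner ℝ (potMap N lam s (profileD hlam hs)) (potMap N lam s b)
        + (critExp N s * (critExp N s - 1) / 2 + η) * ‖potMap N lam s b‖ ^ 2
        + C * critInt s b := by
  obtain ⟨C, hC, h⟩ := abs_add_rpow_le (two_lt_critExp (N := N) hs) hη
  refine ⟨C, hC, fun b => ?_⟩
  have key : ∀ z y P r : ℝ, 0 < z → 0 < r → z ^ (critExp N s - 2) / r ^ s = P / r ^ 2 →
      |z + y| ^ critExp N s / r ^ s ≤ |z| ^ critExp N s / r ^ s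
        + critExp N s * (P * (z / r) * (y / r))
        + (critExp N s * (critExp N s - 1) / 2 + η) * (P * (y / r) * (y / r))
        + C * (|y| ^ critExp N s / r ^ s) := by
    intro z y P r hz hr hP
    have h6 := div_le_div_of_nonneg_right (h z y hz) (Real.rpow_nonneg hr.le s)
    refine h6.trans (le_of_eq ?_)
    have e1 : P * (z / r) * (y / r) = z ^ (critExp N s - 2) / r ^ s * (z * y) := by
      rw [hP]; field_simp
    have e2 : P * (y / r) * (y / r) = z ^ (critExp N s - 2) / r ^ s * y ^ 2 := by
      rw [hP]; field_simp
    rw [abs_of_pos hz, e1, e2]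
    ring
  set z : D12 N := profileD hlam hs with hz
  have i1 := z.integrable_crit hs0 hs
  have i2 := integrable_potMap (lam := lam) hs z b
  have i3 := integrable_potMap (lam := lam) hs b b
  have i4 := b.integrable_crit hs0 hs
  rw [← real_inner_self_eq_norm_sq (potMap N lam s b), inner_potMap hs, inner_potMap hs]
  unfold critInt
  refine (integral_mono_ae ((z + b).integrable_crit hs0 hs)
    (((i1.add (i2.const_mul _)).add (i3.const_mul _)).add (i4.const_mul _)) ?_).trans_eq
    (integral_linear_combination i1 i2 i3 i4 (critExp N s)
      (critExp N s * (critExp N s - 1) / 2 + η) C)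
  filter_upwards [D12.coe_add z b, profileD_pos (N := N) hlam hs, ae_ne_zero N,
    coe_profileD (N := N) hlam hs] with x h1 h2 h3 h4
  have hx : 0 < ‖x‖ := norm_pos_iff.2 h3
  have h5 := crit_eq_potential (N := N) hlam hs hx
  rw [← h4, ← hz] at h5
  rw [← hz] at h2
  have h6 := key _ (b x) _ _ h2 hx h5
  rw [h1]
  exact h6

theorem single_add_ge {lam s η : ℝ} (hlam : lam < hardyConst N) (hs0 : 0 < s) (hs : s < 2)
    (hη : 0 < η) : ∃ C > 0, ∀ b : D12 N,
      single lam s (profileD (N := N) hlam hs) + secondVar lam s b / 2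
        - η * ‖potMap N lam s b‖ ^ 2 - C * ‖b‖ ^ critExp N s
        ≤ single lam s (profileD hlam hs + b) := by
  have hp := two_lt_critExp (N := N) hs
  have hp0 : 0 < critExp N s := by linarith
  obtain ⟨C, hC, h⟩ := critInt_add_le (N := N) (η := critExp N s * η) hlam hs0 hs (by positivity)
  obtain ⟨K, hK, hcrit⟩ := critInt_le (N := N) hs0 hs
  refine ⟨C * K / critExp N s, by positivity, fun b => ?_⟩
  have h1 := h b
  have h2 := mul_le_mul_of_nonneg_left (hcrit b) hC.le
  have h3 := div_le_div_of_nonneg_right (h1.trans (add_le_add_right h2 _)) hp0.le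
  unfold single secondVar
  rw [normSq_add, euler, add_sub_cancel_left]
  have e : (critInt s (profileD (N := N) hlam hs)
      + critExp N s * inner ℝ (potMap N lam s (profileD hlam hs)) (potMap N lam s b)
      + (critExp N s * (critExp N s - 1) / 2 + critExp N s * η) * ‖potMap N lam s b‖ ^ 2
      + C * (K * ‖b‖ ^ critExp N s)) / critExp N s
      = critInt s (profileD (N := N) hlam hs) / critExp N s
        + inner ℝ (potMap N lam s (profileD hlam hs)) (potMap N lam s b)
        + ((critExp N s - 1) / 2 + η) * ‖potMap N lam s b‖ ^ 2
        + C * K / critExp N s * ‖b‖ ^ critExp N s := by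
    field_simp
  rw [e] at h3
  linarith

/-- The profile is a strict local minimum of the single functional in the directions annihilated
by two shell functionals. -/
theorem single_strict_min {lam s : ℝ} (hlam0 : 0 < lam) (hlam : lam < hardyConst N) (hs0 : 0 < s)
    (hs : s < 2) : ∃ (ρ : ℝ) (h₁ : 0 < (ρ ^ 2)⁻¹) (h₂ : 0 < ρ), 1 < ρ ∧ ∃ c > 0, ∃ ε > 0,
      ∀ b : D12 N, shell h₁ ρ⁻¹ b = 0 → shell h₂ (ρ ^ 2) b = 0 → ‖b‖ < ε →
        single lam s (profileD (N := N) hlam hs) + c * ‖b‖ ^ 2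
          ≤ single lam s (profileD hlam hs + b) := by
  obtain ⟨ρ, h₁, h₂, hρ, c, hc, hco⟩ := secondVar_coercive (N := N) hlam0 hlam hs0 hs
  set K := |rate N lam s ^ 2 * (power N s * (power N s + 1))| / hardyConst N with hK
  have hK0 : 0 ≤ K := div_nonneg (abs_nonneg _) hardyConst_pos.le
  have hη : 0 < c / (8 * (K + 1)) := by positivity
  obtain ⟨C, hC, h⟩ := single_add_ge (N := N) hlam hs0 hs hη
  have hp := two_lt_critExp (N := N) hs
  have hlim : Tendsto (fun t : ℝ => C * t ^ (critExp N s - 2)) (𝓝 0) (𝓝 0) := by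
    have : ContinuousAt (fun t : ℝ => C * t ^ (critExp N s - 2)) 0 :=
      (Real.continuousAt_rpow_const 0 _ (Or.inr (by linarith))).const_mul C
    have h2 := this.tendsto
    rwa [Real.zero_rpow (by linarith), mul_zero] at h2
  obtain ⟨ε, hε, hball⟩ := Metric.eventually_nhds_iff.1
    (hlim.eventually (gt_mem_nhds (by positivity : 0 < c / 8)))
  refine ⟨ρ, h₁, h₂, hρ, c / 4, by positivity, ε, hε, fun b z₁ z₂ hb => ?_⟩
  have k1 := hco b z₁ z₂
  have k2 := h b
  have k3 := potMap_norm_sq_le (lam := lam) (s := s) b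
  rw [← hK] at k3
  have k4 : C * ‖b‖ ^ critExp N s ≤ c / 8 * ‖b‖ ^ 2 := by
    rcases (norm_nonneg b).eq_or_lt with h0 | h0
    · rw [← h0, Real.zero_rpow (by linarith)]; simp
    · have h5 := hball (y := ‖b‖) (by rwa [Real.dist_eq, sub_zero, abs_of_pos h0])
      have e : ‖b‖ ^ critExp N s = ‖b‖ ^ (critExp N s - 2) * ‖b‖ ^ 2 := by
        rw [← Real.rpow_natCast ‖b‖ 2, ← Real.rpow_add h0]; congr 1; push_cast; ring
      rw [e, ← mul_assoc]
      exact mul_le_mul_of_nonneg_right h5.le (sq_nonneg _)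
  have k5 : c / (8 * (K + 1)) * ‖potMap N lam s b‖ ^ 2 ≤ c / 8 * ‖b‖ ^ 2 := by
    calc c / (8 * (K + 1)) * ‖potMap N lam s b‖ ^ 2
        ≤ c / (8 * (K + 1)) * (K * ‖b‖ ^ 2) := mul_le_mul_of_nonneg_left k3 hη.le
      _ ≤ c / (8 * (K + 1)) * ((K + 1) * ‖b‖ ^ 2) := by gcongr; linarith
      _ = c / 8 * ‖b‖ ^ 2 := by field_simp
  linarith

end Single

/-! ### Continuity of the dilations at the profile -/

section LocalMin

variable {N : ℕ}

/-- The dilated profile: the factor `|x|^{-(N-2)/2}` is invariant under the dilations, so only the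
argument of the hyperbolic cosine changes. -/
theorem profile_dilate_eq {lam s μ r : ℝ} (hμ : 0 < μ) (hr : 0 < r) :
    μ ^ (-(((N : ℝ) - 2) / 2)) * profile N lam s (μ⁻¹ * r)
      = profileConst N lam s * r ^ (-(((N : ℝ) - 2) / 2))
        * logCosh (rate N lam s) (r / μ) ^ (-power N s) := by
  unfold profile
  rw [Real.mul_rpow (by positivity) hr.le, Real.inv_rpow hμ.le, inv_mul_eq_div]
  have : μ ^ (-(((N : ℝ) - 2) / 2)) ≠ 0 := by positivity
  field_simp

variable [hN : Fact (3 ≤ N)]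

theorem coe_dil_profileD {lam s μ : ℝ} (hlam : lam < hardyConst N) (hs : s < 2) (hμ : 0 < μ) :
    dil hμ (profileD (N := N) hlam hs) =ᵐ[volume] fun x => profileConst N lam s
      * ‖x‖ ^ (-(((N : ℝ) - 2) / 2)) * logCosh (rate N lam s) (‖x‖ / μ) ^ (-power N s) := by
  filter_upwards [coe_dil hμ (profileD (N := N) hlam hs), ae_ne_zero N,
    (quasiMeasurePreserving_smul_E (inv_ne_zero hμ.ne')).ae (coe_profileD (N := N) hlam hs)]
    with x h1 h2 h3
  rw [h1, h3, norm_smul, norm_inv, Real.norm_of_nonneg hμ.le,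
    profile_dilate_eq hμ (norm_pos_iff.2 h2)]

theorem tendsto_inner_potMap_dil {lam s : ℝ} (hlam : lam < hardyConst N) (hs : s < 2)
    {μ : ℕ → ℝ} (hμ : ∀ n, 0 < μ n) (hlim : Tendsto μ atTop (𝓝 1)) :
    Tendsto (fun n => inner ℝ (potMap N lam s (profileD hlam hs))
      (potMap N lam s (dil (hμ n) (profileD hlam hs)))) atTop
      (𝓝 (inner ℝ (potMap N lam s (profileD hlam hs)) (potMap N lam s (profileD hlam hs)))) := by
  have hm := power_pos (N := N) hs
  have hκ := rate_pos hlam hs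
  have hC := profileConst_pos (N := N) hlam hs
  set κ := rate N lam s with hκd
  set m := power N s with hmd
  set C := profileConst N lam s with hCd
  simp only [inner_potMap hs]
  refine tendsto_integral_of_dominated_convergence
    (fun x => 4 * (κ ^ 2 * (m * (m + 1))) * C ^ 2 * (‖x‖ ^ (-(N : ℝ)) * logCosh κ ‖x‖ ^ (-(m + 2))))
    (fun n => (integrable_potMap hs _ _).aestronglyMeasurable)
    ((integrable_logCosh hκ (by linarith)).const_mul _) (fun n => ?_) ?_
  · filter_upwards [coe_dil_profileD hlam hs (hμ n), coe_profileD (N := N) hlam hs, ae_ne_zero N]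
      with x h1 h2 h3
    have hx : 0 < ‖x‖ := norm_pos_iff.2 h3
    have hc := logCosh_pos κ hx
    have hc2 : 1 ≤ logCosh κ (‖x‖ / μ n) := by
      have := two_le_logCosh κ (div_pos hx (hμ n)); linarith
    have hl : logCosh κ (‖x‖ / μ n) ^ (-m) ≤ 1 := Real.rpow_le_one_of_one_le_of_nonpos hc2 (by linarith)
    have hl0 : 0 ≤ logCosh κ (‖x‖ / μ n) ^ (-m) := Real.rpow_nonneg (by linarith) _
    rw [h1, h2, ← hκd, ← hmd, ← hCd]
    have e1 : potential N lam s ‖x‖ = 4 * (κ ^ 2 * (m * (m + 1))) * logCosh κ ‖x‖ ^ (-2 : ℝ) := by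
      unfold potential
      rw [one_sub_logTanh_sq _ hx, ← hκd, ← hmd, Real.rpow_neg hc.le]
      have : logCosh κ ‖x‖ ^ (2 : ℝ) = logCosh κ ‖x‖ ^ 2 := by
        rw [← Real.rpow_natCast]; norm_num
      rw [this]; ring
    have e2 : logCosh κ ‖x‖ ^ (-(m + 2)) = logCosh κ ‖x‖ ^ (-2 : ℝ) * logCosh κ ‖x‖ ^ (-m) := by
      rw [← Real.rpow_add hc]; congr 1; ring
    have e3 : ‖x‖ ^ (-(N : ℝ)) = (‖x‖ ^ (-(((N : ℝ) - 2) / 2)) / ‖x‖) ^ 2 := by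
      rw [← Real.rpow_sub_one hx.ne', ← Real.rpow_natCast, ← Real.rpow_mul hx.le]
      congr 1; push_cast; ring
    have e4 : profile N lam s ‖x‖ = C * ‖x‖ ^ (-(((N : ℝ) - 2) / 2)) * logCosh κ ‖x‖ ^ (-m) := rfl
    have hp2 : 0 < logCosh κ ‖x‖ ^ (-2 : ℝ) := by positivity
    have hpm : 0 < logCosh κ ‖x‖ ^ (-m) := by positivity
    have hpx : 0 < ‖x‖ ^ (-(((N : ℝ) - 2) / 2)) := by positivity
    rw [e1, e2, e3, e4]
    rw [Real.norm_of_nonneg (by positivity)]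
    calc 4 * (κ ^ 2 * (m * (m + 1))) * logCosh κ ‖x‖ ^ (-2 : ℝ)
          * (C * ‖x‖ ^ (-(((N : ℝ) - 2) / 2)) * logCosh κ ‖x‖ ^ (-m) / ‖x‖)
          * (C * ‖x‖ ^ (-(((N : ℝ) - 2) / 2)) * logCosh κ (‖x‖ / μ n) ^ (-m) / ‖x‖)
        = 4 * (κ ^ 2 * (m * (m + 1))) * C ^ 2 * ((‖x‖ ^ (-(((N : ℝ) - 2) / 2)) / ‖x‖) ^ 2
          * (logCosh κ ‖x‖ ^ (-2 : ℝ) * logCosh κ ‖x‖ ^ (-m)))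
          * logCosh κ (‖x‖ / μ n) ^ (-m) := by ring
      _ ≤ _ := mul_le_of_le_one_right (by positivity) hl
  · have hall := ae_all_iff.2 fun n => coe_dil_profileD (N := N) hlam hs (hμ n)
    filter_upwards [hall, coe_profileD (N := N) hlam hs, ae_ne_zero N] with x h1 h2 h3
    have hx : 0 < ‖x‖ := norm_pos_iff.2 h3
    refine Tendsto.mul tendsto_const_nhds (Tendsto.div_const ?_ _)
    simp only [h1]
    rw [h2]
    have e4 : profile N lam s ‖x‖ = C * ‖x‖ ^ (-(((N : ℝ) - 2) / 2)) * logCosh κ ‖x‖ ^ (-m) := rfl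
    rw [e4]
    refine Tendsto.const_mul _ ?_
    have h5 : Tendsto (fun n => ‖x‖ / μ n) atTop (𝓝 ‖x‖) := by
      have h := (tendsto_const_nhds (x := ‖x‖)).div hlim one_ne_zero
      rw [div_one] at h
      exact h
    have h6 : ContinuousAt (logCosh κ) ‖x‖ := (hasDerivAt_logCosh κ hx).continuousAt
    exact (h6.rpow_const (Or.inl (logCosh_pos κ hx).ne')).tendsto.comp h5

/-- The dilations act continuously at the profile. By the Euler-Lagrange equation,
`‖z_μ - z‖_λ² = 2 ‖z‖_λ² - 2 ∫ V z z_μ / |x|²`, and dominated convergence applies to the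
integral. -/
theorem dil_profileD_near {lam s : ℝ} (hlam0 : 0 < lam) (hlam : lam < hardyConst N) (hs : s < 2)
    {ε : ℝ} (hε : 0 < ε) : ∃ η > 0, ∀ (μ : ℝ) (hμ : 0 < μ), |μ - 1| < η →
      ‖dil hμ (profileD (N := N) hlam hs) - profileD hlam hs‖ < ε := by
  by_contra! hcon
  choose! f hf0 hf1 hf2 using fun n : ℕ => hcon (1 / ((n : ℝ) + 1)) (by positivity)
  have hlim : Tendsto f atTop (𝓝 1) := by
    rw [tendsto_iff_dist_tendsto_zero]
    refine squeeze_zero (fun _ => dist_nonneg) (fun n => ?_)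
      tendsto_one_div_add_atTop_nhds_zero_nat
    rw [Real.dist_eq]
    exact (hf1 n).le
  have h1 := tendsto_inner_potMap_dil (N := N) hlam hs hf0 hlim
  set z : D12 N := profileD hlam hs with hz
  have hq : 0 < 1 - lam / hardyConst N := by
    rw [sub_pos, div_lt_one hardyConst_pos]; exact hlam
  have e : ∀ n, normSq lam (dil (hf0 n) z - z) = 2 * normSq lam z
      - 2 * inner ℝ (potMap N lam s z) (potMap N lam s (dil (hf0 n) z)) := by
    intro n
    have h2 := normSq_add lam (dil (hf0 n) z - z) z
    have h3 := euler (N := N) hlam hs (dil (hf0 n) z)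
    have h4 := euler (N := N) hlam hs z
    rw [← hz] at h3 h4
    rw [sub_add_cancel, map_sub, map_sub, inner_sub_left, inner_sub_left, normSq_dil,
      real_inner_comm (D12.grad N z) (D12.grad N (dil (hf0 n) z)),
      real_inner_comm (hardyMap N z) (hardyMap N (dil (hf0 n) z)), h3, h4] at h2
    have h5 : normSq lam z = inner ℝ (potMap N lam s z) (potMap N lam s z) := by
      rw [real_inner_self_eq_norm_sq, hz, normSq_profileD, critInt_profileD]
    linarith
  have h5 : normSq lam z = inner ℝ (potMap N lam s z) (potMap N lam s z) := by
    rw [real_inner_self_eq_norm_sq, hz, normSq_profileD, critInt_profileD]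
  have h6 : Tendsto (fun n => normSq lam (dil (hf0 n) z - z)) atTop (𝓝 0) := by
    simp only [e]
    have h7 := (h1.const_mul 2).const_sub (2 * normSq lam z)
    rw [← h5, sub_self] at h7
    exact h7
  have h8 : ∀ n, (1 - lam / hardyConst N) * ε ^ 2 ≤ normSq lam (dil (hf0 n) z - z) := fun n =>
    (mul_le_mul_of_nonneg_left (pow_le_pow_left₀ hε.le (hf2 n) 2) hq.le).trans
      (normSq_coercive hlam0.le _)
  have h9 := ge_of_tendsto' h6 h8
  have : 0 < (1 - lam / hardyConst N) * ε ^ 2 := by positivity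
  linarith

/-- A shell functional of a dilated function is the functional of the original function for the
dilated shell. -/
theorem shell_dil {a b μ : ℝ} (ha : 0 < a) (hμ : 0 < μ) (v : D12 N) :
    shell ha b (dil hμ v) = ∫ x, shellFun N (a / μ) (b / μ) x * (v x / ‖x‖) := by
  rw [shell_apply]
  have h : ∫ x, shellFun N a b x * (dil hμ v x / ‖x‖)
      = ∫ x, (fun y => μ ^ (-(N : ℝ)) * (shellFun N (a / μ) (b / μ) y * (v y / ‖y‖))) (μ⁻¹ • x) := by
    refine integral_congr_ae ?_
    filter_upwards [coe_dil hμ v, ae_ne_zero N] with x h1 h2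
    have hx : 0 < ‖x‖ := norm_pos_iff.2 h2
    rw [h1]
    have e1 : ‖μ⁻¹ • x‖ = μ⁻¹ * ‖x‖ := by
      rw [norm_smul, norm_inv, Real.norm_of_nonneg hμ.le]
    have e2 : shellFun N (a / μ) (b / μ) (μ⁻¹ • x) = μ ^ ((N : ℝ) / 2) * shellFun N a b x := by
      unfold shellFun
      rw [e1]
      by_cases hx2 : ‖x‖ ∈ Set.Icc a b
      · have hx3 : μ⁻¹ * ‖x‖ ∈ Set.Icc (a / μ) (b / μ) := by
          rw [inv_mul_eq_div]
          exact ⟨by gcongr; exact hx2.1, by gcongr; exact hx2.2⟩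
        rw [Set.indicator_of_mem hx2, Set.indicator_of_mem hx3,
          Real.mul_rpow (by positivity) hx.le, Real.inv_rpow hμ.le, ← Real.rpow_neg hμ.le, neg_neg]
      · have hx3 : μ⁻¹ * ‖x‖ ∉ Set.Icc (a / μ) (b / μ) := by
          rw [inv_mul_eq_div]
          intro h4
          exact hx2 ⟨(div_le_div_iff_of_pos_right hμ).1 h4.1,
            (div_le_div_iff_of_pos_right hμ).1 h4.2⟩
        rw [Set.indicator_of_notMem hx2, Set.indicator_of_notMem hx3, mul_zero]
    rw [e2, e1]
    have e3 : μ ^ (-(N : ℝ)) * μ ^ ((N : ℝ) / 2) * μ = μ ^ (-(((N : ℝ) - 2) / 2)) := by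
      rw [← Real.rpow_add hμ, ← Real.rpow_add_one hμ.ne']
      congr 1; ring
    rw [← e3]
    field_simp
  refine h.trans ((integral_comp_inv_smul hμ fun y : E N =>
    μ ^ (-(N : ℝ)) * (shellFun N (a / μ) (b / μ) y * (v y / ‖y‖))).trans ?_)
  rw [integral_const_mul, ← mul_assoc, ← Real.rpow_add hμ]
  simp

theorem continuousOn_shell_dil {a b : ℝ} (ha : 0 < a) (v : D12 N) :
    ContinuousOn (fun μ : ℝ => ∫ x, shellFun N (a / μ) (b / μ) x * (v x / ‖x‖)) (Set.Ioi 0) := by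
  intro μ₀ hμ₀
  have hμ₀ : 0 < μ₀ := hμ₀
  refine ContinuousAt.continuousWithinAt ?_
  set A := a / (2 * μ₀) with hA
  set B := |b| / (μ₀ / 2) with hB
  have hA0 : 0 < A := by positivity
  refine continuousAt_of_dominated (bound := fun x => |shellFun N A B x * (v x / ‖x‖)|) ?_ ?_
    ((memLp_shellFun hA0 B).integrable_mul v.memLp_div_norm).abs ?_
  · refine Eventually.of_forall fun μ => ?_
    exact (measurable_shellFun _ _).aestronglyMeasurable.mul
      v.memLp_div_norm.aestronglyMeasurable
  · have hnear : ∀ᶠ μ in 𝓝 μ₀, μ ∈ Set.Ioo (μ₀ / 2) (2 * μ₀) :=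
      Ioo_mem_nhds (by linarith) (by linarith)
    filter_upwards [hnear] with μ hμ
    refine Eventually.of_forall fun x => ?_
    have hμ0 : 0 < μ := by linarith [hμ.1]
    rw [Real.norm_eq_abs, abs_mul, abs_mul]
    refine mul_le_mul_of_nonneg_right ?_ (abs_nonneg _)
    unfold shellFun
    by_cases hx : ‖x‖ ∈ Set.Icc (a / μ) (b / μ)
    · have hx2 : ‖x‖ ∈ Set.Icc A B := by
        refine ⟨le_trans ?_ hx.1, hx.2.trans ?_⟩
        · exact div_le_div_of_nonneg_left ha.le hμ0 hμ.2.le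
        · exact (div_le_div_of_nonneg_right (le_abs_self b) hμ0.le).trans
            (div_le_div_of_nonneg_left (abs_nonneg b) (by linarith) hμ.1.le)
      rw [Set.indicator_of_mem hx, Set.indicator_of_mem hx2]
    · rw [Set.indicator_of_notMem hx, abs_zero]
      exact abs_nonneg _
  · have hne : ∀ t : ℝ, t ≠ 0 → ∀ᵐ x : E N, ‖x‖ ≠ t := by
      intro t ht
      have h1 := Measure.addHaar_sphere_of_ne_zero (volume : Measure (E N)) 0 ht
      rw [ae_iff]
      convert h1 using 2
      ext x
      simp
    have hb : ∀ᵐ x : E N, ‖x‖ ≠ b / μ₀ := by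
      rcases eq_or_ne b 0 with h0 | h0
      · filter_upwards [ae_ne_zero N] with x hx
        rw [h0, zero_div]
        exact norm_ne_zero_iff.2 hx
      · exact hne _ (by positivity)
    filter_upwards [hne (a / μ₀) (by positivity), hb] with x h1 h2
    refine ContinuousAt.mul ?_ continuousAt_const
    unfold shellFun
    have ca : ContinuousAt (fun μ : ℝ => a / μ) μ₀ := continuousAt_const.div continuousAt_id hμ₀.ne'
    have cb : ContinuousAt (fun μ : ℝ => b / μ) μ₀ := continuousAt_const.div continuousAt_id hμ₀.ne'
    have hev : ∀ᶠ μ in 𝓝 μ₀, (‖x‖ ∈ Set.Icc (a / μ) (b / μ) ↔ ‖x‖ ∈ Set.Icc (a / μ₀) (b / μ₀)) := by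
      have f1 : ∀ᶠ μ in 𝓝 μ₀, (a / μ ≤ ‖x‖ ↔ a / μ₀ ≤ ‖x‖) := by
        rcases lt_or_gt_of_ne h1 with h | h
        · filter_upwards [continuousAt_const.eventually_lt ca h] with μ hμ
          exact iff_of_false (not_le.2 hμ) (not_le.2 h)
        · filter_upwards [ca.eventually_lt continuousAt_const h] with μ hμ
          exact iff_of_true hμ.le h.le
      have f2 : ∀ᶠ μ in 𝓝 μ₀, (‖x‖ ≤ b / μ ↔ ‖x‖ ≤ b / μ₀) := by
        rcases lt_or_gt_of_ne h2 with h | h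
        · filter_upwards [continuousAt_const.eventually_lt cb h] with μ hμ
          exact iff_of_true hμ.le h.le
        · filter_upwards [cb.eventually_lt continuousAt_const h] with μ hμ
          exact iff_of_false (not_le.2 hμ) (not_le.2 h)
      filter_upwards [f1, f2] with μ g1 g2
      rw [Set.mem_Icc, Set.mem_Icc, g1, g2]
    refine continuousAt_const.congr (f := fun _ : ℝ =>
      (Set.Icc (a / μ₀) (b / μ₀)).indicator (fun r => r ^ (-((N : ℝ) / 2))) ‖x‖) ?_
    filter_upwards [hev] with μ hμ
    by_cases h : ‖x‖ ∈ Set.Icc (a / μ₀) (b / μ₀)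
    · rw [Set.indicator_of_mem h, Set.indicator_of_mem (hμ.2 h)]
    · rw [Set.indicator_of_notMem h, Set.indicator_of_notMem (fun h' => h (hμ.1 h'))]

/-- The shell functionals of the dilated profile. -/
theorem shell_dil_profileD {lam s a b μ : ℝ} (hlam : lam < hardyConst N) (hs : s < 2) (ha : 0 < a)
    (hab : a ≤ b) (hμ : 0 < μ) : shell ha b (dil hμ (profileD (N := N) hlam hs))
      = (sphMeas N).real Set.univ * profileConst N lam s
        * ∫ r in a..b, logCosh (rate N lam s) (r / μ) ^ (-power N s) / r := by
  have hm : Measurable fun x : E N => profileConst N lam s * ‖x‖ ^ (-(((N : ℝ) - 2) / 2))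
      * logCosh (rate N lam s) (‖x‖ / μ) ^ (-power N s) := by
    have := measurable_logCosh (rate N lam s)
    fun_prop
  rw [shell_polar ha hab hm (coe_dil_profileD hlam hs hμ), ← intervalIntegral.integral_const_mul]
  refine intervalIntegral.integral_congr fun r hr => ?_
  rw [Set.uIcc_of_le hab] at hr
  have hr0 : 0 < r := ha.trans_le hr.1
  simp only [norm_smul_sph hr0.le, integral_const, smul_eq_mul]
  have e : r ^ ((N : ℝ) / 2 - 2) * r ^ (-(((N : ℝ) - 2) / 2)) = 1 / r := by
    rw [← Real.rpow_add hr0, show (N : ℝ) / 2 - 2 + -(((N : ℝ) - 2) / 2) = -1 by ring,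
      Real.rpow_neg_one, one_div]
  calc _ = (sphMeas N).real Set.univ * profileConst N lam s
        * (r ^ ((N : ℝ) / 2 - 2) * r ^ (-(((N : ℝ) - 2) / 2)))
        * logCosh (rate N lam s) (r / μ) ^ (-power N s) := by ring
    _ = _ := by rw [e]; ring

end LocalMin

/-! ### Local minimality of the profile for the single functional -/

section IntermediateValue

theorem logCosh_div_lt_logCosh_mul {κ r μ : ℝ} (hκ : 0 < κ) (hr : 1 < r) (hμ : 1 < μ) :
    logCosh κ (r / μ) < logCosh κ (r * μ) := by
  have hr0 : 0 < r := by linarith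
  have hμ0 : 0 < μ := by linarith
  unfold logCosh
  rw [Real.div_rpow hr0.le hμ0.le, Real.div_rpow hr0.le hμ0.le, Real.mul_rpow hr0.le hμ0.le,
    Real.mul_rpow hr0.le hμ0.le, Real.rpow_neg hr0.le, Real.rpow_neg hμ0.le]
  have h1 : 1 < r ^ κ := Real.one_lt_rpow hr hκ
  have h2 : 1 < μ ^ κ := Real.one_lt_rpow hμ hκ
  set x := r ^ κ
  set y := μ ^ κ
  have h3 : x⁻¹ < x := (inv_lt_one_of_one_lt₀ h1).trans h1
  have h4 : y⁻¹ < y := (inv_lt_one_of_one_lt₀ h2).trans h2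
  have h5 := mul_pos (sub_pos.2 h3) (sub_pos.2 h4)
  have e : x⁻¹ / y⁻¹ = x⁻¹ * y := by rw [div_inv_eq_mul]
  rw [e, div_eq_mul_inv]
  linarith

theorem continuousOn_logCosh_rpow_div (κ σ : ℝ) {c : ℝ} (hc : 0 < c) :
    ContinuousOn (fun r => logCosh κ (r * c) ^ σ / r) (Set.Ioi 0) := by
  refine ContinuousOn.div ?_ continuousOn_id fun r hr => (ne_of_gt hr)
  refine ContinuousOn.rpow_const ?_ fun r hr => Or.inl (logCosh_pos κ (mul_pos hr hc)).ne'
  exact (continuousOn_logCosh κ).comp (continuousOn_id.mul continuousOn_const)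
    fun r hr => mul_pos hr hc

theorem integral_logCosh_inv {κ σ ρ μ : ℝ} (hρ : 1 < ρ) (hμ : 0 < μ) :
    ∫ r in (ρ ^ 2)⁻¹..ρ⁻¹, logCosh κ (r / μ) ^ σ / r
      = ∫ r in ρ..ρ ^ 2, logCosh κ (r * μ) ^ σ / r := by
  have hρ0 : 0 < ρ := by linarith
  have hle : ρ ≤ ρ ^ 2 := by nlinarith
  have hpos : ∀ r ∈ Set.uIcc ρ (ρ ^ 2), 0 < r := fun r hr => by
    rw [Set.uIcc_of_le hle] at hr; exact hρ0.trans_le hr.1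
  have h := intervalIntegral.integral_comp_mul_deriv' (a := ρ) (b := ρ ^ 2) (f := fun r => r⁻¹)
    (f' := fun r => -(r ^ 2)⁻¹) (g := fun r => logCosh κ (r / μ) ^ σ / r)
    (fun r hr => hasDerivAt_inv (hpos r hr).ne')
    (ContinuousOn.neg (ContinuousOn.inv₀ (by fun_prop) fun r hr => (pow_pos (hpos r hr) 2).ne'))
    ((continuousOn_logCosh_rpow_div κ σ (inv_pos.2 hμ)).mono (by
      rintro _ ⟨r, hr, rfl⟩
      exact inv_pos.2 (hpos r hr)))
  rw [intervalIntegral.integral_symm, ← h, ← intervalIntegral.integral_neg]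
  refine intervalIntegral.integral_congr fun r hr => ?_
  have hr0 := hpos r hr
  have e : logCosh κ (r⁻¹ / μ) = logCosh κ (r * μ) := by
    rw [← logCosh_inv κ (mul_pos hr0 hμ)]; congr 1; field_simp
  simp only [Function.comp_apply, e]
  field_simp

theorem intervalIntegrable_logCosh (κ σ : ℝ) {ρ c : ℝ} (hρ : 1 < ρ) (hc : 0 < c) :
    IntervalIntegrable (fun r => logCosh κ (r * c) ^ σ / r) volume ρ (ρ ^ 2) := by
  refine ContinuousOn.intervalIntegrable ((continuousOn_logCosh_rpow_div κ σ hc).mono fun r hr => ?_)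
  rw [Set.uIcc_of_le (by nlinarith)] at hr
  exact (by linarith : (0 : ℝ) < ρ).trans_le hr.1

theorem integral_logCosh_mul_lt {κ σ ρ μ : ℝ} (hκ : 0 < κ) (hσ : 0 < σ) (hρ : 1 < ρ)
    (hμ : 1 < μ) : ∫ r in ρ..ρ ^ 2, logCosh κ (r * μ) ^ (-σ) / r
      < ∫ r in ρ..ρ ^ 2, logCosh κ (r / μ) ^ (-σ) / r := by
  have hμ0 : 0 < μ := by linarith
  have hlt : ρ < ρ ^ 2 := by nlinarith
  refine intervalIntegral.integral_lt_integral_of_continuousOn_of_le_of_exists_lt hlt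
    ((continuousOn_logCosh_rpow_div κ (-σ) hμ0).mono fun r hr =>
      (by linarith : (0 : ℝ) < ρ).trans_le hr.1)
    ((continuousOn_logCosh_rpow_div κ (-σ) (inv_pos.2 hμ0)).mono fun r hr =>
      (by linarith : (0 : ℝ) < ρ).trans_le hr.1) (fun r hr => ?_)
    ⟨ρ, Set.left_mem_Icc.2 hlt.le, ?_⟩
  · have hr1 : 1 < r := hρ.trans hr.1
    refine div_le_div_of_nonneg_right ?_ (by linarith)
    exact Real.rpow_le_rpow_of_nonpos (logCosh_pos κ (by positivity))
      (logCosh_div_lt_logCosh_mul hκ hr1 hμ).le (by linarith)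
  · refine div_lt_div_of_pos_right ?_ (by linarith)
    exact Real.rpow_lt_rpow_of_neg (logCosh_pos κ (by positivity))
      (logCosh_div_lt_logCosh_mul hκ hρ hμ) (by linarith)

variable {N : ℕ} [hN : Fact (3 ≤ N)]

/-- The difference of two shell functionals, placed symmetrically with respect to the unit sphere,
detects the dilation parameter: it has the sign of `μ - 1`. -/
theorem shell_dil_profileD_lt {lam s ρ μ : ℝ} (hlam : lam < hardyConst N) (hs : s < 2) (hρ : 1 < ρ)
    (h₁ : 0 < (ρ ^ 2)⁻¹) (h₂ : 0 < ρ) (hμ : 0 < μ) :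
    (1 < μ → shell h₁ ρ⁻¹ (dil hμ (profileD (N := N) hlam hs))
      < shell h₂ (ρ ^ 2) (dil hμ (profileD hlam hs))) ∧
    (μ < 1 → shell h₂ (ρ ^ 2) (dil hμ (profileD (N := N) hlam hs))
      < shell h₁ ρ⁻¹ (dil hμ (profileD hlam hs))) := by
  have hlt : ρ < ρ ^ 2 := by nlinarith
  have hK : 0 < (sphMeas N).real Set.univ * profileConst N lam s :=
    mul_pos sphMeas_pos (profileConst_pos hlam hs)
  have hinv : (ρ ^ 2)⁻¹ ≤ ρ⁻¹ := inv_anti₀ h₂ hlt.le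
  rw [shell_dil_profileD hlam hs h₁ hinv hμ, shell_dil_profileD hlam hs h₂ hlt.le hμ,
    integral_logCosh_inv hρ hμ]
  refine ⟨fun h => mul_lt_mul_of_pos_left
    (integral_logCosh_mul_lt (rate_pos hlam hs) (power_pos (N := N) hs) hρ h) hK,
    fun h => mul_lt_mul_of_pos_left ?_ hK⟩
  have h3 := integral_logCosh_mul_lt (rate_pos hlam hs) (power_pos (N := N) hs) hρ
    (one_lt_inv_iff₀.2 ⟨hμ, h⟩)
  simpa only [← div_eq_mul_inv, div_inv_eq_mul] using h3

theorem dil_one (u : D12 N) : dil one_pos u = u := by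
  refine D12.ext_ae ?_ ?_
  · filter_upwards [coe_dil one_pos u] with x hx
    rw [hx]; simp
  · filter_upwards [grad_dil one_pos u] with x hx
    rw [hx]; simp

theorem shell_profileD {lam s ρ : ℝ} (hlam : lam < hardyConst N) (hs : s < 2) (hρ : 1 < ρ)
    (h₁ : 0 < (ρ ^ 2)⁻¹) (h₂ : 0 < ρ) :
    shell h₁ ρ⁻¹ (profileD (N := N) hlam hs) = shell h₂ (ρ ^ 2) (profileD (N := N) hlam hs) ∧
      0 < shell h₂ (ρ ^ 2) (profileD (N := N) hlam hs) := by
  have hlt : ρ < ρ ^ 2 := by nlinarith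
  have hK : 0 < (sphMeas N).real Set.univ * profileConst N lam s :=
    mul_pos sphMeas_pos (profileConst_pos hlam hs)
  have hinv : (ρ ^ 2)⁻¹ ≤ ρ⁻¹ := inv_anti₀ h₂ hlt.le
  rw [← dil_one (profileD (N := N) hlam hs), shell_dil_profileD hlam hs h₁ hinv one_pos,
    shell_dil_profileD hlam hs h₂ hlt.le one_pos,
    integral_logCosh_inv hρ one_pos]
  simp only [mul_one, div_one, true_and]
  refine mul_pos hK (intervalIntegral.intervalIntegral_pos_of_pos_on ?_ (fun r hr => ?_) hlt)
  · simpa using intervalIntegrable_logCosh (rate N lam s) (-power N s) hρ one_pos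
  · have hr0 : 0 < r := h₂.trans hr.1
    exact div_pos (Real.rpow_pos_of_pos (logCosh_pos _ hr0) _) hr0

theorem single_dil {lam s μ : ℝ} (hμ : 0 < μ) (v : D12 N) :
    single lam s (dil hμ v) = single lam s v := by
  unfold single
  rw [normSq_dil, critInt_dil]

/-- The profile is a minimum of the decoupled functional among nearby functions, up to a
multiplicative constant. A function near the profile is first dilated, so that it has equal
integrals over the two shells (intermediate value theorem), and then multiplied by a constant, so
that these agree with those of the profile; the difference is then in the space on which the second
variation is coercive. -/
theorem single_local_min {lam s : ℝ} (hlam0 : 0 < lam) (hlam : lam < hardyConst N) (hs0 : 0 < s)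
    (hs : s < 2) : ∃ ε > 0, ∀ v : D12 N, ‖v - profileD hlam hs‖ < ε →
      ∃ t : ℝ, 1 / 2 ≤ t ∧ t ≤ 2 ∧
        single lam s (profileD (N := N) hlam hs) ≤ single lam s (t • v) := by
  obtain ⟨ρ, h₁, h₂, hρ, c, hc, ε₀, hε₀, hmin⟩ := single_strict_min (N := N) hlam0 hlam hs0 hs
  set z : D12 N := profileD hlam hs with hz
  set L₁ : D12 N →L[ℝ] ℝ := shell h₁ ρ⁻¹ with hL₁
  set L₂ : D12 N →L[ℝ] ℝ := shell h₂ (ρ ^ 2) with hL₂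
  obtain ⟨hℓ1, hℓ⟩ := shell_profileD (N := N) hlam hs hρ h₁ h₂
  rw [← hz, ← hL₁, ← hL₂] at hℓ1
  rw [← hz, ← hL₂] at hℓ
  set ℓ := L₂ z with hℓd
  -- `δ` bounds the distance of the dilated function to the profile
  set M := ‖L₂‖ with hM
  set K := 2 + 2 * M / ℓ * ‖z‖ with hK
  have hM0 : 0 ≤ M := norm_nonneg _
  have hK0 : 0 < K := by positivity
  obtain ⟨δ, hδ, hδ1, hδ2⟩ : ∃ δ > 0, M * δ ≤ ℓ / 2 ∧ K * δ < ε₀ := by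
    refine ⟨min (ℓ / (2 * (M + 1))) (ε₀ / (2 * K)), by positivity, ?_, ?_⟩
    · calc M * _ ≤ (M + 1) * (ℓ / (2 * (M + 1))) := by
            gcongr
            · linarith
            · exact min_le_left _ _
        _ = ℓ / 2 := by field_simp
    · calc K * _ ≤ K * (ε₀ / (2 * K)) := by gcongr; exact min_le_right _ _
        _ = ε₀ / 2 := by field_simp
        _ < ε₀ := by linarith
  obtain ⟨η', hη', hnear⟩ := dil_profileD_near (N := N) hlam0 hlam hs (half_pos hδ)
  set η := min (η' / 2) (1 / 2) with hη
  have hη0 : 0 < η := by positivity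
  have hη1 : η ≤ 1 / 2 := min_le_right _ _
  have hη2 : η < η' := (min_le_left _ _).trans_lt (by linarith)
  have hμ0 : 0 < 1 - η := by linarith
  have hμ1 : 0 < 1 + η := by linarith
  have hd1 := (shell_dil_profileD_lt (N := N) hlam hs hρ h₁ h₂ hμ1).1 (by linarith)
  have hd0 := (shell_dil_profileD_lt (N := N) hlam hs hρ h₁ h₂ hμ0).2 (by linarith)
  rw [← hz, ← hL₁, ← hL₂] at hd1 hd0
  set g₁ := (L₂ - L₁) (dil hμ1 z) with hg₁
  set g₀ := (L₁ - L₂) (dil hμ0 z) with hg₀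
  have hg₁0 : 0 < g₁ := by simp only [hg₁, sub_apply]; linarith
  have hg₀0 : 0 < g₀ := by simp only [hg₀, sub_apply]; linarith
  have hbd : ∀ (L : D12 N →L[ℝ] ℝ) {μ : ℝ} (hμ : 0 < μ) (v : D12 N),
      L (dil hμ z) - ‖L‖ * ‖v - z‖ ≤ L (dil hμ v) := by
    intro L μ hμ v
    have h1 := (le_abs_self _).trans (L.le_opNorm (dil hμ (z - v)))
    rw [norm_dil, norm_sub_rev, map_sub, map_sub] at h1
    linarith
  refine ⟨min (δ / 2) (min (g₁ / (‖L₂ - L₁‖ + 1)) (g₀ / (‖L₁ - L₂‖ + 1))), by positivity,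
    fun v hv => ?_⟩
  have hv1 : ‖v - z‖ < δ / 2 := hv.trans_le (min_le_left _ _)
  have hv2 : 0 < (L₂ - L₁) (dil hμ1 v) := by
    have h1 : ‖v - z‖ < g₁ / (‖L₂ - L₁‖ + 1) :=
      hv.trans_le ((min_le_right _ _).trans (min_le_left _ _))
    rw [lt_div_iff₀ (by positivity)] at h1
    have h2 := hbd (L₂ - L₁) hμ1 v
    rw [← hg₁] at h2
    have h3 := norm_nonneg (v - z)
    nlinarith
  have hv3 : 0 < (L₁ - L₂) (dil hμ0 v) := by
    have h1 : ‖v - z‖ < g₀ / (‖L₁ - L₂‖ + 1) :=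
      hv.trans_le ((min_le_right _ _).trans (min_le_right _ _))
    rw [lt_div_iff₀ (by positivity)] at h1
    have h2 := hbd (L₁ - L₂) hμ0 v
    rw [← hg₀] at h2
    have h3 := norm_nonneg (v - z)
    nlinarith
  rw [sub_apply, hL₁, hL₂, shell_dil, shell_dil] at hv2 hv3
  obtain ⟨μ, hμ, hμeq⟩ := intermediate_value_Icc (a := 1 - η) (b := 1 + η) (by linarith)
    (((continuousOn_shell_dil (b := ρ ^ 2) h₂ v).sub (continuousOn_shell_dil (b := ρ⁻¹) h₁ v)).mono
      fun μ hμ => hμ0.trans_le hμ.1)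
    ⟨by simp only [Pi.sub_apply]; linarith, hv2.le⟩
  have hμp : 0 < μ := hμ0.trans_le hμ.1
  simp only [Pi.sub_apply] at hμeq
  rw [← shell_dil h₂ hμp, ← shell_dil h₁ hμp, ← hL₁, ← hL₂] at hμeq
  set v' := dil hμp v with hv'
  have hd : ‖v' - z‖ < δ := by
    have h1 := hnear μ hμp ((abs_le.2 ⟨by linarith [hμ.1], by linarith [hμ.2]⟩ : |μ - 1| ≤ η).trans_lt
      hη2)
    rw [← hz] at h1
    calc ‖v' - z‖ = ‖dil hμp (v - z) + (dil hμp z - z)‖ := by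
          rw [map_sub, hv']; congr 1; abel
      _ ≤ ‖v - z‖ + ‖dil hμp z - z‖ := (norm_add_le _ _).trans (by rw [norm_dil])
      _ < δ := by linarith
  have hLd : |L₂ v' - ℓ| ≤ M * ‖v' - z‖ := by
    have := L₂.le_opNorm (v' - z)
    rwa [map_sub, Real.norm_eq_abs] at this
  have hLd2 : M * ‖v' - z‖ ≤ M * δ := by gcongr
  have hLv := abs_le.1 (hLd.trans hLd2)
  have hLpos : ℓ / 2 ≤ L₂ v' := by linarith [hLv.1]
  have hLp : 0 < L₂ v' := by linarith
  set t := ℓ / L₂ v' with ht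
  have ht2 : t ≤ 2 := by rw [ht, div_le_iff₀ hLp]; linarith
  have ht1 : 1 / 2 ≤ t := by rw [ht, le_div_iff₀ hLp]; linarith [hLv.2]
  have htL : t * L₂ v' = ℓ := by rw [ht]; field_simp
  refine ⟨t, ht1, ht2, ?_⟩
  have hb := hmin (t • v' - z)
    (by rw [map_sub, map_smul, smul_eq_mul, ← sub_eq_zero.1 hμeq, htL, hℓ1]; simp)
    (by rw [map_sub, map_smul, smul_eq_mul, htL, hℓd]; simp) ?_
  · rw [add_sub_cancel, hv', ← map_smul, single_dil] at hb
    have : 0 ≤ c * ‖dil hμp (t • v) - z‖ ^ 2 := by positivity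
    linarith
  · have h1 : |t - 1| ≤ 2 * M / ℓ * δ := by
      have e : t - 1 = (ℓ - L₂ v') / L₂ v' := by rw [ht]; field_simp
      rw [e, abs_div, abs_of_pos hLp, div_le_iff₀ hLp, abs_sub_comm]
      calc |L₂ v' - ℓ| ≤ M * δ := hLd.trans hLd2
        _ = 2 * M / ℓ * δ * (ℓ / 2) := by field_simp
        _ ≤ _ := by gcongr
    calc ‖t • v' - z‖ = ‖t • (v' - z) + (t - 1) • z‖ := by
          rw [smul_sub, sub_smul, one_smul]; congr 1; abel
      _ ≤ t * ‖v' - z‖ + |t - 1| * ‖z‖ := by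
          refine (norm_add_le _ _).trans (le_of_eq ?_)
          rw [norm_smul, norm_smul, Real.norm_of_nonneg (by linarith : 0 ≤ t), Real.norm_eq_abs]
      _ ≤ 2 * δ + 2 * M / ℓ * δ * ‖z‖ := by gcongr
      _ = K * δ := by rw [hK]; ring
      _ < ε₀ := hδ2

end IntermediateValue

/-! ### The coupling term -/

section Coupling

theorem abs_sub_rpow_le {α : ℝ} (hα : 0 ≤ α) (a b : ℝ) :
    |a - b| ^ α ≤ 2 ^ α * (|a| ^ α + |b| ^ α) := by
  have key : ∀ x y : ℝ, 0 ≤ x → x ≤ y → (x + y) ^ α ≤ 2 ^ α * (x ^ α + y ^ α) := by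
    intro x y hx hxy
    calc (x + y) ^ α ≤ (2 * y) ^ α :=
          Real.rpow_le_rpow (by linarith) (by linarith) hα
      _ = 2 ^ α * y ^ α := Real.mul_rpow (by norm_num) (hx.trans hxy)
      _ ≤ _ := by
          gcongr
          have := Real.rpow_nonneg hx α
          linarith
  refine (Real.rpow_le_rpow (abs_nonneg _) (abs_sub a b) hα).trans ?_
  rcases le_total |a| |b| with h | h
  · exact key _ _ (abs_nonneg _) h
  · have := key _ _ (abs_nonneg _) h
    rw [add_comm |b|, add_comm (|b| ^ α)] at this
    exact this

theorem rpow_mul_rpow_le_add {x y α β : ℝ} (hx : 0 ≤ x) (hy : 0 ≤ y) (hα : 0 < α) (hβ : 0 < β) :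
    x ^ α * y ^ β ≤ x ^ (α + β) + y ^ (α + β) := by
  rcases le_total x y with h | h
  · calc x ^ α * y ^ β ≤ y ^ α * y ^ β := by gcongr
      _ = y ^ (α + β) := (Real.rpow_add_of_nonneg hy hα.le hβ.le).symm
      _ ≤ _ := le_add_of_nonneg_left (Real.rpow_nonneg hx _)
  · calc x ^ α * y ^ β ≤ x ^ α * x ^ β := by gcongr
      _ = x ^ (α + β) := (Real.rpow_add_of_nonneg hx hα.le hβ.le).symm
      _ ≤ _ := le_add_of_nonneg_right (Real.rpow_nonneg hy _)

variable {N : ℕ} [hN : Fact (3 ≤ N)] {s α β : ℝ} {h : E N → ℝ}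

/-- The coupling integral. -/
def coupling (s α β : ℝ) (h : E N → ℝ) (u v : D12 N) : ℝ := ∫ x, couplingFun s α β h u v x

theorem couplingFun_symm (u v : D12 N) :
    couplingFun s α β h u v = couplingFun s β α h v u := by
  funext x
  unfold couplingFun
  rw [mul_comm (|u x| ^ α)]

theorem aestronglyMeasurable_couplingFun (hh : AEStronglyMeasurable h volume) (u v : D12 N) :
    AEStronglyMeasurable (couplingFun s α β h u v) volume := by
  have hu := u.aestronglyMeasurable.aemeasurable
  have hv := v.aestronglyMeasurable.aemeasurable
  have hh' := hh.aemeasurable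
  refine AEMeasurable.aestronglyMeasurable ?_
  have hn : AEMeasurable (fun x : E N => ‖x‖ ^ s) volume :=
    (measurable_norm.pow_const s).aemeasurable
  have hu' : AEMeasurable (fun x => |u x|) volume := hu.norm
  have hv' : AEMeasurable (fun x => |v x|) volume := hv.norm
  exact (hh'.mul ((hu'.pow_const α).mul (hv'.pow_const β))).div hn

theorem couplingFun_nonneg (h0 : 0 ≤ᵐ[volume] h) (u v : D12 N) :
    0 ≤ᵐ[volume] couplingFun s α β h u v := by
  filter_upwards [h0] with x hx
  exact div_nonneg (mul_nonneg hx (mul_nonneg (Real.rpow_nonneg (abs_nonneg _) _)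
    (Real.rpow_nonneg (abs_nonneg _) _))) (Real.rpow_nonneg (norm_nonneg _) _)

theorem coupling_nonneg (h0 : 0 ≤ᵐ[volume] h) (u v : D12 N) : 0 ≤ coupling s α β h u v :=
  integral_nonneg_of_ae (couplingFun_nonneg h0 u v)

/-- In the critical case the coupling term is integrable by Young's inequality. -/
theorem integrable_couplingFun_of_critical (hs0 : 0 < s) (hs : s < 2) (hα : 0 < α) (hβ : 0 < β)
    (hαβ : α + β = critExp N s) (hh : MemLp h ⊤ volume) (u v : D12 N) :
    Integrable (couplingFun s α β h u v) := by
  have hg := ((D12.integrable_crit hs0 hs u).add (D12.integrable_crit hs0 hs v)).const_mul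
    (eLpNorm h ⊤ volume).toReal
  refine hg.mono' (aestronglyMeasurable_couplingFun hh.1 u v) ?_
  filter_upwards [ae_le_eLpNormEssSup (f := h) (μ := volume)] with x hx
  have hM : |h x| ≤ (eLpNorm h ⊤ volume).toReal := by
    rw [eLpNorm_exponent_top]
    have := ENNReal.toReal_mono (by simpa using hh.2.ne) hx
    simpa using this
  have hy := rpow_mul_rpow_le_add (abs_nonneg (u x)) (abs_nonneg (v x)) hα hβ
  have h1 : 0 ≤ |u x| ^ α * |v x| ^ β := by positivity
  have h2 : 0 ≤ ‖x‖ ^ s := by positivity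
  rw [hαβ] at hy
  unfold couplingFun
  rw [Real.norm_eq_abs, abs_div, abs_mul, abs_of_nonneg h1, abs_of_nonneg h2]
  calc |h x| * (|u x| ^ α * |v x| ^ β) / ‖x‖ ^ s
      ≤ (eLpNorm h ⊤ volume).toReal * (|u x| ^ critExp N s + |v x| ^ critExp N s) / ‖x‖ ^ s := by
        gcongr
    _ = _ := by simp only [Pi.add_apply]; ring

theorem coupling_smul {a b : ℝ} (ha : 0 ≤ a) (hb : 0 ≤ b) (u v : D12 N) :
    coupling s α β h (a • u) (b • v) = a ^ α * b ^ β * coupling s α β h u v := by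
  unfold coupling
  rw [← integral_const_mul]
  refine integral_congr_ae ?_
  filter_upwards [D12.coe_smul a u, D12.coe_smul b v] with x h1 h2
  have key : ∀ y z y' z' : ℝ, y' = a * y → z' = b * z →
      h x * (|y'| ^ α * |z'| ^ β) / ‖x‖ ^ s
        = a ^ α * b ^ β * (h x * (|y| ^ α * |z| ^ β) / ‖x‖ ^ s) := by
    rintro y z _ _ rfl rfl
    rw [abs_mul, abs_mul, abs_of_nonneg ha, abs_of_nonneg hb,
      Real.mul_rpow ha (abs_nonneg _), Real.mul_rpow hb (abs_nonneg _)]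
    ring
  exact key _ _ _ _ h1 h2

theorem coupling_zero_left (hα : α ≠ 0) (v : D12 N) : coupling s α β h 0 v = 0 := by
  have := coupling_smul (s := s) (α := α) (β := β) (h := h) le_rfl zero_le_one (0 : D12 N) v
  rwa [zero_smul, one_smul, Real.zero_rpow hα, zero_mul, zero_mul] at this

theorem coupling_zero_right (hβ : β ≠ 0) (u : D12 N) : coupling s α β h u 0 = 0 := by
  have := coupling_smul (s := s) (α := α) (β := β) (h := h) zero_le_one le_rfl u (0 : D12 N)
  rwa [zero_smul, one_smul, Real.zero_rpow hβ, mul_zero, zero_mul] at this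

/-- The sublevel sets of the coupling integral are closed, by Fatou's lemma. -/
theorem isClosed_lintegral_couplingFun_le (hα : 0 < α) (hβ : 0 < β)
    (hh : AEStronglyMeasurable h volume) (c : ℝ≥0∞) :
    IsClosed {p : DD N | ∫⁻ x, ENNReal.ofReal (couplingFun s α β h p.1 p.2 x) ≤ c} := by
  refine IsSeqClosed.isClosed fun q p hq hlim => ?_
  obtain ⟨ns, hns, h1⟩ := D12.exists_subseq_ae ((continuous_fst.tendsto p).comp hlim)
  obtain ⟨ms, hms, h2⟩ := D12.exists_subseq_ae
    (((continuous_snd.tendsto p).comp hlim).comp hns.tendsto_atTop)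
  have hae : ∀ᵐ x, Tendsto (fun k => ENNReal.ofReal
      (couplingFun s α β h (q (ns (ms k))).1 (q (ns (ms k))).2 x)) atTop
      (𝓝 (ENNReal.ofReal (couplingFun s α β h p.1 p.2 x))) := by
    filter_upwards [h1, h2] with x hx1 hx2
    have hx3 := hx1.comp hms.tendsto_atTop
    refine (ENNReal.continuous_ofReal.tendsto _).comp ?_
    exact ((hx3.abs.rpow_const (Or.inr hα.le)).mul
      (hx2.abs.rpow_const (Or.inr hβ.le))).const_mul (h x) |>.div_const _
  calc ∫⁻ x, ENNReal.ofReal (couplingFun s α β h p.1 p.2 x)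
      = ∫⁻ x, liminf (fun k => ENNReal.ofReal
          (couplingFun s α β h (q (ns (ms k))).1 (q (ns (ms k))).2 x)) atTop := by
        refine lintegral_congr_ae ?_
        filter_upwards [hae] with x hx
        exact hx.liminf_eq.symm
    _ ≤ liminf (fun k => ∫⁻ x, ENNReal.ofReal
          (couplingFun s α β h (q (ns (ms k))).1 (q (ns (ms k))).2 x)) atTop :=
        lintegral_liminf_le' fun k =>
          (aestronglyMeasurable_couplingFun hh _ _).aemeasurable.ennreal_ofReal
    _ ≤ c := by
        refine liminf_le_of_frequently_le' (Eventually.frequently (Eventually.of_forall fun k => ?_))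
        exact hq _

/-- Integrability of the coupling term for all pairs implies that it is bounded, by Baire's
theorem. -/
theorem exists_coupling_le (hα : 0 < α) (hβ : 0 < β) (hh : AEStronglyMeasurable h volume)
    (h0 : 0 ≤ᵐ[volume] h) (hint : ∀ u v : D12 N, Integrable (couplingFun s α β h u v)) :
    ∃ C > 0, ∀ u v : D12 N, coupling s α β h u v ≤ C * (‖u‖ ^ α * ‖v‖ ^ β) := by
  have hU : ⋃ n : ℕ, {p : DD N | ∫⁻ x, ENNReal.ofReal (couplingFun s α β h p.1 p.2 x) ≤ n}
      = Set.univ := by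
    refine Set.eq_univ_of_forall fun p => Set.mem_iUnion.2 ?_
    obtain ⟨n, hn⟩ := ENNReal.exists_nat_gt (hint p.1 p.2).lintegral_lt_top.ne
    exact ⟨n, hn.le⟩
  obtain ⟨n, p, hp⟩ := nonempty_interior_of_iUnion_of_closed
    (fun n : ℕ => isClosed_lintegral_couplingFun_le (s := s) hα hβ hh n) hU
  obtain ⟨r, hr, hball⟩ := Metric.isOpen_iff.1 isOpen_interior p hp
  have hbd : ∀ u v : D12 N, ‖u - p.1‖ < r → ‖v - p.2‖ < r → coupling s α β h u v ≤ n := by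
    intro u v hu hv
    have h1 : (u, v) ∈ Metric.ball p r := by
      rw [Metric.mem_ball, Prod.dist_eq, dist_eq_norm, dist_eq_norm]
      exact max_lt hu hv
    have h2 : (u, v) ∈ {p : DD N | ∫⁻ x, ENNReal.ofReal (couplingFun s α β h p.1 p.2 x) ≤ n} :=
      interior_subset (hball h1)
    replace h2 : ∫⁻ x, ENNReal.ofReal (couplingFun s α β h u v x) ≤ n := h2
    unfold coupling
    rw [integral_eq_lintegral_of_nonneg_ae (couplingFun_nonneg h0 u v)
      (aestronglyMeasurable_couplingFun hh u v)]
    exact ENNReal.toReal_le_of_le_ofReal (Nat.cast_nonneg n) (by simpa using h2)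
  set K := 2 ^ α * 2 ^ β * (4 * (n : ℝ)) with hK
  -- `u = (u₀ + u) - u₀` transfers the bound from a ball around `p` to a ball around the origin
  have hloc : ∀ u v : D12 N, ‖u‖ < r → ‖v‖ < r → coupling s α β h u v ≤ K := by
    intro u v hu hv
    have i1 := hint (p.1 + u) (p.2 + v)
    have i2 := hint (p.1 + u) p.2
    have i3 := hint p.1 (p.2 + v)
    have i4 := hint p.1 p.2
    have b1 := hbd (p.1 + u) (p.2 + v) (by simpa using hu) (by simpa using hv)
    have b2 := hbd (p.1 + u) p.2 (by simpa using hu) (by simpa using hr)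
    have b3 := hbd p.1 (p.2 + v) (by simpa using hr) (by simpa using hv)
    have b4 := hbd p.1 p.2 (by simpa using hr) (by simpa using hr)
    have hle : coupling s α β h u v ≤ 2 ^ α * 2 ^ β * (coupling s α β h (p.1 + u) (p.2 + v)
        + coupling s α β h (p.1 + u) p.2 + coupling s α β h p.1 (p.2 + v)
        + coupling s α β h p.1 p.2) := by
      have hsum := integral_linear_combination i1 i2 i3 i4 1 1 1
      simp only [one_mul] at hsum
      unfold coupling
      rw [← hsum, ← integral_const_mul]
      refine integral_mono_ae (hint u v) ((((i1.add i2).add i3).add i4).const_mul _) ?_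
      filter_upwards [h0, D12.coe_add p.1 u, D12.coe_add p.2 v] with x hx e1 e2
      have key : ∀ y y₀ y₁ z z₀ z₁ c n : ℝ, 0 ≤ c → 0 ≤ n → y₁ = y₀ + y → z₁ = z₀ + z →
          c * (|y| ^ α * |z| ^ β) / n ≤ 2 ^ α * 2 ^ β * (c * (|y₁| ^ α * |z₁| ^ β) / n
            + c * (|y₁| ^ α * |z₀| ^ β) / n + c * (|y₀| ^ α * |z₁| ^ β) / n
            + c * (|y₀| ^ α * |z₀| ^ β) / n) := by
        rintro y y₀ _ z z₀ _ c n hc hn rfl rfl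
        have k1 := abs_sub_rpow_le hα.le (y₀ + y) y₀
        have k2 := abs_sub_rpow_le hβ.le (z₀ + z) z₀
        rw [add_sub_cancel_left] at k1 k2
        have k3 := mul_le_mul k1 k2 (by positivity) (by positivity)
        calc c * (|y| ^ α * |z| ^ β) / n
            ≤ c * (2 ^ α * (|y₀ + y| ^ α + |y₀| ^ α)
              * (2 ^ β * (|z₀ + z| ^ β + |z₀| ^ β))) / n :=
              div_le_div_of_nonneg_right (mul_le_mul_of_nonneg_left k3 hc) hn
          _ = _ := by ring
      exact key _ _ _ _ _ _ _ _ hx (by positivity) e1 e2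
    refine hle.trans (mul_le_mul_of_nonneg_left ?_ (by positivity))
    linarith
  have hK0 : 0 ≤ K := by positivity
  refine ⟨(K + 1) * ((2 / r) ^ α * (2 / r) ^ β), by positivity, fun u v => ?_⟩
  rcases eq_or_ne u 0 with rfl | hu
  · rw [coupling_zero_left hα.ne', norm_zero, Real.zero_rpow hα.ne']; simp
  rcases eq_or_ne v 0 with rfl | hv
  · rw [coupling_zero_right hβ.ne', norm_zero, Real.zero_rpow hβ.ne']; simp
  have hu0 := norm_pos_iff.2 hu
  have hv0 := norm_pos_iff.2 hv
  have hn : ∀ w : D12 N, 0 < ‖w‖ → ‖(r / 2 / ‖w‖) • w‖ < r := by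
    intro w hw
    rw [norm_smul, Real.norm_of_nonneg (by positivity)]
    field_simp
    linarith
  have h1 := hloc _ _ (hn u hu0) (hn v hv0)
  have h2 := coupling_smul (s := s) (α := α) (β := β) (h := h)
    (by positivity : 0 ≤ ‖u‖ * (2 / r)) (by positivity : 0 ≤ ‖v‖ * (2 / r))
    ((r / 2 / ‖u‖) • u) ((r / 2 / ‖v‖) • v)
  have e : ∀ w : D12 N, 0 < ‖w‖ → (‖w‖ * (2 / r)) • (r / 2 / ‖w‖) • w = w := by
    intro w hw
    rw [smul_smul]
    have : ‖w‖ * (2 / r) * (r / 2 / ‖w‖) = 1 := by field_simp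
    rw [this, one_smul]
  rw [e u hu0, e v hv0, Real.mul_rpow hu0.le (by positivity), Real.mul_rpow hv0.le (by positivity)]
    at h2
  rw [h2]
  calc _ ≤ ‖u‖ ^ α * (2 / r) ^ α * (‖v‖ ^ β * (2 / r) ^ β) * (K + 1) := by gcongr; linarith
    _ = _ := by ring

/-- The coupling integral of two positive functions is positive, as `h` is not zero. -/
theorem coupling_pos (h0 : 0 ≤ᵐ[volume] h) (h_ne : ¬ h =ᵐ[volume] 0) {u v : D12 N}
    (hint : Integrable (couplingFun s α β h u v)) (hu : ∀ᵐ x, 0 < u x) (hv : ∀ᵐ x, 0 < v x) :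
    0 < coupling s α β h u v := by
  refine (coupling_nonneg h0 u v).lt_of_ne fun heq => h_ne ?_
  have h1 := (integral_eq_zero_iff_of_nonneg_ae (couplingFun_nonneg h0 u v) hint).1 heq.symm
  filter_upwards [h1, hu, hv, ae_ne_zero N] with x hx hux hvx hx0
  have hpos : 0 < ‖x‖ := norm_pos_iff.2 hx0
  unfold couplingFun at hx
  have h2 : |u x| ^ α * |v x| ^ β ≠ 0 := by
    rw [abs_of_pos hux, abs_of_pos hvx]; positivity
  have h3 : ‖x‖ ^ s ≠ 0 := by positivity
  simpa [h2, h3] using hx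

end Coupling

/-! ### Derivatives at the profile -/

section Derivatives

theorem hasFDerivAt_of_abs_le_rpow {X : Type*} [NormedAddCommGroup X] [NormedSpace ℝ X]
    {f : X → ℝ} {L : X →L[ℝ] ℝ} {x : X} {C q : ℝ} (hq : 1 < q)
    (h : ∀ b, ‖b‖ ≤ 1 → |f (x + b) - f x - L b| ≤ C * ‖b‖ ^ q) : HasFDerivAt f L x := by
  rw [hasFDerivAt_iff_isLittleO_nhds_zero]
  have h1 : (fun b : X => f (x + b) - f x - L b) =O[𝓝 0] fun b => ‖b‖ ^ q := by
    refine Asymptotics.IsBigO.of_bound C ?_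
    filter_upwards [Metric.closedBall_mem_nhds (0 : X) one_pos] with b hb
    rw [Real.norm_eq_abs, Real.norm_of_nonneg (by positivity)]
    exact h b (by simpa using hb)
  refine h1.trans_isLittleO ?_
  rw [Asymptotics.isLittleO_iff]
  intro c hc
  have h2 : ContinuousAt (fun b : X => ‖b‖ ^ (q - 1)) 0 :=
    continuous_norm.continuousAt.rpow_const (Or.inr (by linarith))
  have h3 : Tendsto (fun b : X => ‖b‖ ^ (q - 1)) (𝓝 0) (𝓝 0) := by
    have := h2.tendsto
    rwa [norm_zero, Real.zero_rpow (by linarith)] at this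
  filter_upwards [h3.eventually (gt_mem_nhds hc)] with b hb
  rw [Real.norm_of_nonneg (by positivity)]
  rcases eq_or_ne b 0 with rfl | hb0
  · rw [norm_zero, Real.zero_rpow (by linarith)]; simp
  · have hpos := norm_pos_iff.2 hb0
    have e : ‖b‖ ^ q = ‖b‖ ^ (q - 1) * ‖b‖ := by
      rw [← Real.rpow_add_one hpos.ne']; congr 1; ring
    rw [e]
    gcongr

theorem rpow_add_mul_le_abs_add_rpow {p z y : ℝ} (hp : 1 ≤ p) (hz : 0 < z) :
    z ^ p + p * (z ^ (p - 2) * z * y) ≤ |z + y| ^ p := by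
  have h1 : 1 + p * (y / z) ≤ |1 + y / z| ^ p := by
    rcases le_total (-1) (y / z) with h | h
    · rw [abs_of_nonneg (by linarith)]
      exact one_add_mul_self_le_rpow_one_add h hp
    · have : 0 ≤ |1 + y / z| ^ p := by positivity
      nlinarith
  have h2 := mul_le_mul_of_nonneg_left h1 (Real.rpow_nonneg hz.le p)
  rw [← Real.mul_rpow hz.le (abs_nonneg _)] at h2
  have e1 : z * |1 + y / z| = |z + y| := by
    rw [← abs_of_pos hz, ← abs_mul, abs_of_pos hz]; congr 1; field_simp
  have e2 : z ^ p = z ^ (p - 2) * z ^ 2 := by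
    rw [← Real.rpow_natCast z 2, ← Real.rpow_add hz]; congr 1; push_cast; ring
  rw [e1] at h2
  refine le_trans (le_of_eq ?_) h2
  rw [e2]
  field_simp

variable {N : ℕ} [hN : Fact (3 ≤ N)]

/-- Convexity of the critical integral at the profile. -/
theorem critInt_add_ge {lam s : ℝ} (hlam : lam < hardyConst N) (hs0 : 0 < s) (hs : s < 2)
    (b : D12 N) : critInt s (profileD (N := N) hlam hs)
        + critExp N s * inner ℝ (potMap N lam s (profileD hlam hs)) (potMap N lam s b)
      ≤ critInt s (profileD hlam hs + b) := by
  have hp := two_lt_critExp (N := N) hs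
  have key : ∀ z y P r : ℝ, 0 < z → 0 < r → z ^ (critExp N s - 2) / r ^ s = P / r ^ 2 →
      |z| ^ critExp N s / r ^ s + critExp N s * (P * (z / r) * (y / r))
        ≤ |z + y| ^ critExp N s / r ^ s := by
    intro z y P r hz hr hP
    have h6 := div_le_div_of_nonneg_right
      (rpow_add_mul_le_abs_add_rpow (y := y) (by linarith : 1 ≤ critExp N s) hz)
      (Real.rpow_nonneg hr.le s)
    refine le_trans (le_of_eq ?_) h6
    have e1 : P * (z / r) * (y / r) = z ^ (critExp N s - 2) / r ^ s * (z * y) := by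
      rw [hP]; field_simp
    rw [abs_of_pos hz, e1]
    ring
  set z : D12 N := profileD hlam hs with hz
  have i1 := z.integrable_crit hs0 hs
  have i2 := integrable_potMap (lam := lam) hs z b
  rw [inner_potMap hs]
  unfold critInt
  rw [← integral_const_mul, ← integral_add i1 (i2.const_mul _)]
  refine integral_mono_ae (i1.add (i2.const_mul _)) ((z + b).integrable_crit hs0 hs) ?_
  filter_upwards [D12.coe_add z b, profileD_pos (N := N) hlam hs, ae_ne_zero N,
    coe_profileD (N := N) hlam hs] with x h1 h2 h3 h4
  have hx : 0 < ‖x‖ := norm_pos_iff.2 h3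
  have h5 := crit_eq_potential (N := N) hlam hs hx
  rw [← h4, ← hz] at h5
  rw [← hz] at h2
  have h6 := key _ (b x) _ _ h2 hx h5
  rw [h1]
  exact h6

theorem hasFDerivAt_critInt {lam s : ℝ} (hlam : lam < hardyConst N) (hs0 : 0 < s) (hs : s < 2) :
    HasFDerivAt (critInt s) (critExp N s • (innerSL ℝ (potMap N lam s (profileD hlam hs))).comp
      (potMap N lam s)) (profileD (N := N) hlam hs) := by
  have hp := two_lt_critExp (N := N) hs
  obtain ⟨C, hC, h⟩ := critInt_add_le (N := N) hlam hs0 hs one_pos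
  obtain ⟨K, hK, hcrit⟩ := critInt_le (N := N) hs0 hs
  refine hasFDerivAt_of_abs_le_rpow (q := 2) (C := (critExp N s * (critExp N s - 1) / 2 + 1)
    * (|rate N lam s ^ 2 * (power N s * (power N s + 1))| / hardyConst N) + C * K) (by norm_num)
    fun b hb => ?_
  have h1 := h b
  have h2 := critInt_add_ge (N := N) hlam hs0 hs b
  have h3 := potMap_norm_sq_le (lam := lam) (s := s) b
  have h4 : ‖b‖ ^ critExp N s ≤ ‖b‖ ^ 2 := by
    rw [← Real.rpow_natCast ‖b‖ 2]
    exact Real.rpow_le_rpow_of_exponent_ge' (norm_nonneg b) hb (by norm_num)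
      (by push_cast; exact hp.le)
  have h5 : C * critInt s b ≤ C * K * ‖b‖ ^ 2 := by
    rw [mul_assoc]
    exact mul_le_mul_of_nonneg_left ((hcrit b).trans (mul_le_mul_of_nonneg_left h4 hK.le)) hC.le
  have h6 : 0 ≤ critExp N s * (critExp N s - 1) / 2 + 1 := by nlinarith
  have h7 := mul_le_mul_of_nonneg_left h3 h6
  have h8 : ‖b‖ ^ (2 : ℝ) = ‖b‖ ^ 2 := by norm_num
  have e : (critExp N s • (innerSL ℝ (potMap N lam s (profileD hlam hs))).comp
      (potMap N lam s)) b
      = critExp N s * inner ℝ (potMap N lam s (profileD hlam hs)) (potMap N lam s b) := rfl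
  rw [e, h8, abs_of_nonneg (by linarith)]
  linarith

theorem hasFDerivAt_critInt_zero {s : ℝ} (hs0 : 0 < s) (hs : s < 2) :
    HasFDerivAt (critInt s) (0 : D12 N →L[ℝ] ℝ) 0 := by
  obtain ⟨K, hK, hcrit⟩ := critInt_le (N := N) hs0 hs
  refine hasFDerivAt_of_abs_le_rpow (q := critExp N s) (C := K)
    (by linarith [two_lt_critExp (N := N) hs]) fun b hb => ?_
  rw [zero_add, critInt_zero hs, sub_zero, zero_apply, sub_zero, abs_of_nonneg (critInt_nonneg s b)]
  exact hcrit b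

/-- The derivative of the quadratic form `normSq`. -/
theorem hasFDerivAt_normSq {lam : ℝ} (h0 : 0 < lam) (hlam : lam < hardyConst N) (u : D12 N) :
    HasFDerivAt (normSq lam) ((2 : ℝ) • ((innerSL ℝ (D12.grad N u)).comp
      (D12.gradₗᵢ N).toContinuousLinearMap
      - lam • (innerSL ℝ (hardyMap N u)).comp (hardyMap N))) u := by
  refine hasFDerivAt_of_abs_le_rpow (q := 2) (C := 1) (by norm_num) fun b _ => ?_
  have e : ((2 : ℝ) • ((innerSL ℝ (D12.grad N u)).comp (D12.gradₗᵢ N).toContinuousLinearMap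
      - lam • (innerSL ℝ (hardyMap N u)).comp (hardyMap N))) b
      = 2 * (inner ℝ (D12.grad N u) (D12.grad N b)
        - lam * inner ℝ (hardyMap N u) (hardyMap N b)) := rfl
  have h8 : ‖b‖ ^ (2 : ℝ) = ‖b‖ ^ 2 := by norm_num
  have hc := normSq_coercive h0.le b
  have hpos : 0 ≤ (1 - lam / hardyConst N) * ‖b‖ ^ 2 := by
    refine mul_nonneg ?_ (sq_nonneg _)
    rw [sub_nonneg, div_le_one hardyConst_pos]
    exact hlam.le
  rw [normSq_add, e, h8, one_mul, add_sub_assoc, add_sub_assoc]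
  have hle := normSq_le h0.le b
  rw [abs_of_nonneg (by linarith)]
  linarith

theorem hasFDerivAt_single {lam s : ℝ} (h0 : 0 < lam) (hlam : lam < hardyConst N) (hs0 : 0 < s)
    (hs : s < 2) : HasFDerivAt (single lam s) (0 : D12 N →L[ℝ] ℝ) (profileD (N := N) hlam hs) := by
  have hp := two_lt_critExp (N := N) hs
  have h := ((hasFDerivAt_normSq h0 hlam (profileD (N := N) hlam hs)).mul_const (2 : ℝ)⁻¹).sub
    ((hasFDerivAt_critInt (N := N) hlam hs0 hs).mul_const (critExp N s)⁻¹)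
  refine (h.congr_fderiv ?_)
  ext b
  have e := euler (N := N) hlam hs b
  have h1 : (2 : ℝ)⁻¹ * (2 * (inner ℝ (D12.grad N (profileD hlam hs)) (D12.grad N b)
        - lam * inner ℝ (hardyMap N (profileD hlam hs)) (hardyMap N b)))
      - (critExp N s)⁻¹ * (critExp N s
        * inner ℝ (potMap N lam s (profileD hlam hs)) (potMap N lam s b)) = 0 := by
    rw [e]
    field_simp
    ring
  exact h1

theorem hasFDerivAt_single_zero {lam s : ℝ} (h0 : 0 < lam) (hlam : lam < hardyConst N)
    (hs0 : 0 < s) (hs : s < 2) : HasFDerivAt (single lam s) (0 : D12 N →L[ℝ] ℝ) 0 := by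
  have h := ((hasFDerivAt_normSq (N := N) h0 hlam 0).mul_const (2 : ℝ)⁻¹).sub
    ((hasFDerivAt_critInt_zero (N := N) hs0 hs).mul_const (critExp N s)⁻¹)
  refine h.congr_fderiv ?_
  ext b
  simp

/-- The dilations as continuous linear maps. -/
def dilCLM {μ : ℝ} (hμ : 0 < μ) : D12 N →L[ℝ] D12 N :=
  (dil hμ).mkContinuous 1 fun u => by rw [norm_dil, one_mul]

theorem dil_inv_dil {μ : ℝ} (hμ : 0 < μ) (u : D12 N) : dil (inv_pos.2 hμ) (dil hμ u) = u := by
  have h : ∀ (c : ℝ) (hc : 0 < c), c = μ → dil (inv_pos.2 hμ) (dil hc u) = u →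
      dil (inv_pos.2 hμ) (dil hμ u) = u := by
    rintro c hc rfl h; exact h
  exact h _ (inv_pos.2 (inv_pos.2 hμ)) (inv_inv μ) (dil_dil_inv (inv_pos.2 hμ) u)

theorem hasFDerivAt_single_dil {lam s μ : ℝ} (hμ : 0 < μ) (h0 : 0 < lam) (hlam : lam < hardyConst N)
    (hs0 : 0 < s) (hs : s < 2) :
    HasFDerivAt (single lam s) (0 : D12 N →L[ℝ] ℝ) (dil hμ (profileD (N := N) hlam hs)) := by
  have h1 := hasFDerivAt_single (N := N) h0 hlam hs0 hs
  rw [← dil_inv_dil hμ (profileD (N := N) hlam hs)] at h1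
  have h2 := HasFDerivAt.comp (dil hμ (profileD (N := N) hlam hs)) h1
    (dilCLM (N := N) (inv_pos.2 hμ)).hasFDerivAt
  rw [ContinuousLinearMap.zero_comp] at h2
  exact h2.congr_of_eventuallyEq (Eventually.of_forall fun v => (single_dil _ v).symm)

theorem differentiableAt_critInt_dil {lam s μ : ℝ} (hμ : 0 < μ) (hlam : lam < hardyConst N)
    (hs0 : 0 < s) (hs : s < 2) :
    DifferentiableAt ℝ (critInt s) (dil hμ (profileD (N := N) hlam hs)) := by
  have h1 := hasFDerivAt_critInt (N := N) hlam hs0 hs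
  rw [← dil_inv_dil hμ (profileD (N := N) hlam hs)] at h1
  have h2 := HasFDerivAt.comp (dil hμ (profileD (N := N) hlam hs)) h1
    (dilCLM (N := N) (inv_pos.2 hμ)).hasFDerivAt
  exact (h2.congr_of_eventuallyEq
    (Eventually.of_forall fun v => (critInt_dil _ s v).symm)).differentiableAt

theorem profileD_ne_zero {lam s : ℝ} (hlam : lam < hardyConst N) (hs : s < 2) :
    profileD (N := N) hlam hs ≠ 0 := by
  intro h
  have h1 := profileD_pos (N := N) hlam hs
  rw [h] at h1
  have := nontrivial_E (N := N)
  obtain ⟨x, hx1, hx2⟩ := (h1.and (D12.coe_zero N)).exists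
  rw [hx2] at hx1
  exact lt_irrefl _ hx1

theorem dil_profileD_pos {lam s μ : ℝ} (hμ : 0 < μ) (hlam : lam < hardyConst N) (hs : s < 2) :
    ∀ᵐ x, 0 < dil hμ (profileD (N := N) hlam hs) x := by
  filter_upwards [coe_dil_profileD (N := N) hlam hs hμ, ae_ne_zero N] with x hx h0
  have hpos : 0 < ‖x‖ := norm_pos_iff.2 h0
  have h1 := logCosh_pos (rate N lam s) (div_pos hpos hμ)
  have h2 := profileConst_pos (N := N) hlam hs
  rw [hx]
  positivity

/-- There is a direction along which the decoupled functional strictly increases at the profile: a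
test function concentrated near the origin is in the kernel of the shell functionals. -/
theorem exists_single_lt {lam s : ℝ} (hlam0 : 0 < lam) (hlam : lam < hardyConst N) (hs0 : 0 < s)
    (hs : s < 2) : ∃ b : D12 N, ∃ δ > 0, ∀ t : ℝ, 0 < t → t < δ →
      single lam s (profileD (N := N) hlam hs) < single lam s (profileD hlam hs + t • b) := by
  obtain ⟨ρ, h₁, h₂, hρ, c, hc, ε, hε, hmin⟩ := single_strict_min (N := N) hlam0 hlam hs0 hs
  have hle : (ρ ^ 2)⁻¹ ≤ ρ := (inv_le_one_of_one_le₀ (by nlinarith)).trans hρ.le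
  let f : ContDiffBump (0 : E N) := ⟨(ρ ^ 2)⁻¹ / 4, (ρ ^ 2)⁻¹ / 2, by linarith, by linarith⟩
  have hf : IsTest (f : E N → ℝ) := ⟨f.contDiff, f.hasCompactSupport⟩
  have hker : ∀ {a : ℝ} (ha : 0 < a) (b : ℝ), (ρ ^ 2)⁻¹ ≤ a → shell ha b hf.toD12 = 0 := by
    intro a ha b hab
    rw [shell_apply]
    refine integral_eq_zero_of_ae ?_
    filter_upwards [hf.coe_toD12] with x hx
    by_cases hxa : ‖x‖ < a
    · have : shellFun N a b x = 0 :=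
        Set.indicator_of_notMem (fun h => absurd h.1 (not_le.2 hxa)) _
      rw [this, zero_mul]; rfl
    · have h0 : f x = 0 := by
        refine f.zero_of_le_dist ?_
        rw [dist_zero_right]
        change (ρ ^ 2)⁻¹ / 2 ≤ ‖x‖
        linarith [not_lt.1 hxa]
      rw [hx, h0, zero_div, mul_zero]; rfl
  have hne : hf.toD12 ≠ 0 := by
    intro h0
    have h1 := hf.coe_toD12
    rw [h0] at h1
    have h2 : (f : E N → ℝ) =ᵐ[volume] fun _ => 0 := h1.symm.trans (D12.coe_zero N)
    have h3 := Continuous.ae_eq_iff_eq volume f.continuous continuous_const |>.1 h2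
    have h4 := congrFun h3 0
    rw [f.one_of_mem_closedBall (Metric.mem_closedBall_self f.rIn_pos.le)] at h4
    exact one_ne_zero h4
  have hpos := norm_pos_iff.2 hne
  refine ⟨hf.toD12, ε / ‖hf.toD12‖, by positivity, fun t ht htδ => ?_⟩
  have hn : ‖t • hf.toD12‖ = t * ‖hf.toD12‖ := by rw [norm_smul, Real.norm_of_nonneg ht.le]
  have h1 := hmin (t • hf.toD12) (by rw [map_smul, hker _ _ le_rfl, smul_zero])
    (by rw [map_smul, hker _ _ hle, smul_zero]) (by rw [hn]; exact (lt_div_iff₀ hpos).1 htδ)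
  have h2 : 0 < c * ‖t • hf.toD12‖ ^ 2 := by rw [hn]; positivity
  linarith

end Derivatives

/-! ### The Nehari manifold near the semitrivial points -/

section Nehari

theorem one_add_mul_le_rpow {σ t : ℝ} (hσ : 2 ≤ σ) (ht : 0 < t) :
    1 + σ / 2 * (t ^ 2 - 1) ≤ t ^ σ := by
  have h := one_add_mul_self_le_rpow_one_add (s := t ^ 2 - 1) (p := σ / 2)
    (by nlinarith [sq_nonneg t]) (by linarith)
  refine h.trans (le_of_eq ?_)
  rw [add_sub_cancel, ← Real.rpow_natCast, ← Real.rpow_mul ht.le]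
  congr 1; push_cast; ring

theorem exists_mul_rpow_le_sq {K c σ : ℝ} (hσ : 2 < σ) (hc : 0 < c) :
    ∃ δ > 0, ∀ x : ℝ, 0 ≤ x → x < δ → K * x ^ σ ≤ c * x ^ 2 := by
  have h1 : ContinuousAt (fun x : ℝ => K * x ^ (σ - 2)) 0 :=
    (Real.continuousAt_rpow_const 0 _ (Or.inr (by linarith))).const_mul K
  have h2 := h1.tendsto
  rw [Real.zero_rpow (by linarith), mul_zero] at h2
  obtain ⟨δ, hδ, hball⟩ := Metric.eventually_nhds_iff.1 (h2.eventually (gt_mem_nhds hc))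
  refine ⟨δ, hδ, fun x hx hxδ => ?_⟩
  rcases hx.eq_or_lt with h0 | h0
  · rw [← h0, Real.zero_rpow (by linarith)]; simp
  · have h5 := hball (y := x) (by rwa [Real.dist_eq, sub_zero, abs_of_pos h0])
    have e : x ^ σ = x ^ (σ - 2) * x ^ 2 := by
      rw [← Real.rpow_natCast x 2, ← Real.rpow_add h0]; congr 1; push_cast; ring
    rw [e, ← mul_assoc]
    exact mul_le_mul_of_nonneg_right h5.le (sq_nonneg _)

theorem exists_sq_lt_mul_rpow {K c σ : ℝ} (hσ : σ < 2) (hc : 0 < c) :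
    ∃ δ > 0, ∀ x : ℝ, 0 < x → x < δ → K * x ^ 2 < c * x ^ σ := by
  have h1 : ContinuousAt (fun x : ℝ => K * x ^ (2 - σ)) 0 :=
    (Real.continuousAt_rpow_const 0 _ (Or.inr (by linarith))).const_mul K
  have h2 := h1.tendsto
  rw [Real.zero_rpow (by linarith), mul_zero] at h2
  obtain ⟨δ, hδ, hball⟩ := Metric.eventually_nhds_iff.1 (h2.eventually (gt_mem_nhds hc))
  refine ⟨δ, hδ, fun x hx hxδ => ?_⟩
  have h5 := hball (y := x) (by rwa [Real.dist_eq, sub_zero, abs_of_pos hx])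
  have e : x ^ 2 = x ^ (2 - σ) * x ^ σ := by
    rw [← Real.rpow_natCast x 2, ← Real.rpow_add hx]; congr 1; push_cast; ring
  rw [e, ← mul_assoc]
  exact mul_lt_mul_of_pos_right h5 (by positivity)

variable {N : ℕ} [hN : Fact (3 ≤ N)] {lam₁ lam₂ s α β ν : ℝ} {h : E N → ℝ}

theorem energy_eq (p : DD N) : energy lam₁ lam₂ s α β h ν p
    = single lam₁ s p.1 + single lam₂ s p.2 - ν * coupling s α β h p.1 p.2 := by
  unfold energy single coupling
  ring

/-- The functional defining the Nehari manifold, in terms of the energy and of two functionals whose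
derivatives at the semitrivial points are known. -/
theorem nehariFun_eq (hs : s < 2) (p : DD N) : nehariFun lam₁ lam₂ s α β h ν p
    = 2 * energy lam₁ lam₂ s α β h ν p
      + (2 / critExp N s - 1) * (critInt s p.1 + critInt s p.2)
      + ν * (2 - (α + β)) * coupling s α β h p.1 p.2 := by
  have := two_lt_critExp (N := N) hs
  unfold nehariFun energy coupling
  field_simp
  ring

theorem coupling_smul_smul (hα : 0 ≤ α) (hβ : 0 ≤ β) {t : ℝ} (ht : 0 ≤ t) (u v : D12 N) :
    coupling s α β h (t • u) (t • v) = t ^ (α + β) * coupling s α β h u v := by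
  rw [coupling_smul ht ht, Real.rpow_add_of_nonneg ht hα hβ]

theorem single_smul {lam t : ℝ} (ht : 0 ≤ t) (v : D12 N) : single lam s (t • v)
    = t ^ 2 * normSq lam v / 2 - t ^ critExp N s * critInt s v / critExp N s := by
  rw [single, normSq_smul, critInt_smul ht]

theorem single_zero {lam : ℝ} (hs : s < 2) : single lam s (0 : D12 N) = 0 := by
  have h := two_lt_critExp (N := N) hs
  have := single_smul (lam := lam) (s := s) le_rfl (0 : D12 N)
  rw [smul_zero, Real.zero_rpow (by linarith)] at this
  simpa using this

theorem nehariFun_smul (hα : 0 ≤ α) (hβ : 0 ≤ β) {t : ℝ} (ht : 0 ≤ t) (p : DD N) :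
    nehariFun lam₁ lam₂ s α β h ν (t • p) = t ^ 2 * (normSq lam₁ p.1 + normSq lam₂ p.2)
      - t ^ critExp N s * (critInt s p.1 + critInt s p.2)
      - t ^ (α + β) * (ν * (α + β) * coupling s α β h p.1 p.2) := by
  have e : nehariFun lam₁ lam₂ s α β h ν (t • p) = normSq lam₁ (t • p.1) + normSq lam₂ (t • p.2)
      - critInt s (t • p.1) - critInt s (t • p.2)
      - ν * (α + β) * coupling s α β h (t • p.1) (t • p.2) := rfl
  rw [e, normSq_smul, normSq_smul, critInt_smul ht, critInt_smul ht, coupling_smul_smul hα hβ ht]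
  ring

/-- On the Nehari manifold the energy is maximal along the ray through the point. -/
theorem energy_smul_le (hs : s < 2) (hα : 1 < α) (hβ : 1 < β) (hν : 0 < ν)
    (h0 : 0 ≤ᵐ[volume] h) {p : DD N} (hp : p ∈ nehari lam₁ lam₂ s α β h ν) {t : ℝ} (ht : 0 < t) :
    energy lam₁ lam₂ s α β h ν (t • p) ≤ energy lam₁ lam₂ s α β h ν p := by
  have hpe := two_lt_critExp (N := N) hs
  have h1 := one_add_mul_le_rpow hpe.le ht
  have h2 := one_add_mul_le_rpow (by linarith : 2 ≤ α + β) ht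
  have hΨ : normSq lam₁ p.1 + normSq lam₂ p.2 - critInt s p.1 - critInt s p.2
    - ν * (α + β) * coupling s α β h p.1 p.2 = 0 := hp.2
  have c1 := critInt_nonneg s p.1
  have c2 := critInt_nonneg s p.2
  have c3 := coupling_nonneg (s := s) (α := α) (β := β) h0 p.1 p.2
  rw [energy_eq, energy_eq, Prod.smul_fst, Prod.smul_snd, single_smul ht.le, single_smul ht.le,
    coupling_smul_smul (by linarith) (by linarith) ht.le]
  unfold single
  set P := critInt s p.1 + critInt s p.2 with hP
  set K := coupling s α β h p.1 p.2
  have k1 : 0 ≤ (t ^ critExp N s - (1 + critExp N s / 2 * (t ^ 2 - 1))) * P / critExp N s :=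
    div_nonneg (mul_nonneg (by linarith) (by linarith)) (by linarith)
  have k2 : 0 ≤ (t ^ (α + β) - (1 + (α + β) / 2 * (t ^ 2 - 1))) * (ν * K) :=
    mul_nonneg (by linarith) (by positivity)
  have k3 : (t ^ critExp N s - (1 + critExp N s / 2 * (t ^ 2 - 1))) * P / critExp N s
      = t ^ critExp N s * P / critExp N s - P / critExp N s - (t ^ 2 - 1) / 2 * P := by
    field_simp
    ring
  rw [k3] at k1
  have k4 : t ^ critExp N s * P / critExp N s = t ^ critExp N s * critInt s p.1 / critExp N s
      + t ^ critExp N s * critInt s p.2 / critExp N s := by rw [hP]; ring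
  have k5 : P / critExp N s = critInt s p.1 / critExp N s + critInt s p.2 / critExp N s := by
    rw [hP]; ring
  have k6 : (t ^ 2 - 1) / 2 * (normSq lam₁ p.1 + normSq lam₂ p.2)
      = (t ^ 2 - 1) / 2 * P + (t ^ 2 - 1) / 2 * (ν * (α + β) * K) := by
    rw [hP, ← mul_add]; congr 1; linarith
  nlinarith [k1, k2, k4, k5, k6]

theorem normSq_zero (lam : ℝ) : normSq lam (0 : D12 N) = 0 := by
  have := normSq_smul lam 0 (0 : D12 N)
  rw [smul_zero] at this
  simpa using this

theorem normSq_dil_profileD {lam μ : ℝ} (hlam : lam < hardyConst N) (hs : s < 2) (hμ : 0 < μ) :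
    normSq lam (dil hμ (profileD (N := N) hlam hs))
      = critInt s (dil hμ (profileD (N := N) hlam hs)) := by
  rw [normSq_dil, critInt_dil, normSq_profileD]

theorem normSq_pos {lam : ℝ} (hlam0 : 0 < lam) (hlam : lam < hardyConst N) {u : D12 N}
    (hu : u ≠ 0) : 0 < normSq lam u := by
  refine lt_of_lt_of_le (mul_pos ?_ (pow_pos (norm_pos_iff.2 hu) 2)) (normSq_coercive hlam0.le u)
  rw [sub_pos, div_lt_one hardyConst_pos]
  exact hlam

theorem dil_profileD_ne_zero {lam μ : ℝ} (hlam : lam < hardyConst N) (hs : s < 2) (hμ : 0 < μ) :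
    dil hμ (profileD (N := N) hlam hs) ≠ 0 := by
  rw [← norm_ne_zero_iff, norm_dil, norm_ne_zero_iff]
  exact profileD_ne_zero hlam hs

theorem semitrivial_mem_nehari {μ : ℝ} (hlam₂ : lam₂ < hardyConst N) (hs : s < 2) (hα : 1 < α)
    (hμ : 0 < μ) : ((0, dil hμ (profileD hlam₂ hs)) : DD N) ∈ nehari lam₁ lam₂ s α β h ν := by
  refine ⟨fun h0 => dil_profileD_ne_zero hlam₂ hs hμ (congrArg Prod.snd h0), ?_⟩
  have e : nehariFun lam₁ lam₂ s α β h ν ((0, dil hμ (profileD hlam₂ hs)) : DD N)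
      = normSq lam₁ (0 : D12 N) + normSq lam₂ (dil hμ (profileD hlam₂ hs))
        - critInt s (0 : D12 N) - critInt s (dil hμ (profileD hlam₂ hs))
        - ν * (α + β) * coupling s α β h (0 : D12 N) (dil hμ (profileD hlam₂ hs)) := rfl
  rw [e, normSq_zero, critInt_zero hs, coupling_zero_left (by linarith), normSq_dil_profileD]
  ring

theorem energy_semitrivial (hs : s < 2) (hα : 1 < α) (v : D12 N) :
    energy lam₁ lam₂ s α β h ν ((0, v) : DD N) = single lam₂ s v := by
  rw [energy_eq, single_zero hs, coupling_zero_left (by linarith)]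
  ring

/-- The semitrivial points are local minima as soon as, for small `x = ‖u‖`, the coupling term of
order `ν x^α` is dominated by the quadratic term `x^2`; the constant does not depend on the dilation
parameter. -/
theorem exists_isLocalMinimum (hlam₁ : 0 < lam₁ ∧ lam₁ < hardyConst N)
    (hlam₂ : 0 < lam₂ ∧ lam₂ < hardyConst N) (hs : 0 < s ∧ s < 2) (hα : 1 < α) (hβ : 1 < β)
    (h0 : 0 ≤ᵐ[volume] h) {C : ℝ} (hC : 0 < C)
    (hK : ∀ u v : D12 N, coupling s α β h u v ≤ C * (‖u‖ ^ α * ‖v‖ ^ β)) :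
    ∃ D > 0, ∀ ν > 0, (∃ δ > 0, ∀ x : ℝ, 0 ≤ x → x < δ → ν * (D * x ^ α) ≤ x ^ 2) →
      ∀ (μ : ℝ) (hμ : 0 < μ), IsLocalMinimum lam₁ lam₂ s α β h ν
        ((0, dil hμ (profileD hlam₂.2 hs.2)) : DD N) := by
  have hp := two_lt_critExp (N := N) hs.2
  obtain ⟨ε, hε, hmin⟩ := single_local_min (N := N) hlam₂.1 hlam₂.2 hs.1 hs.2
  obtain ⟨C', hC', hcrit⟩ := critInt_le (N := N) hs.1 hs.2
  set q := 1 - lam₁ / hardyConst N with hq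
  have hq0 : 0 < q := by
    rw [hq, sub_pos, div_lt_one hardyConst_pos]; exact hlam₁.2
  set z : D12 N := profileD hlam₂.2 hs.2 with hz
  set R := ‖z‖ + 1 with hR
  have hR0 : 0 < R := by positivity
  -- the quadratic term is at least `q x² / 8`, since `t ≥ 1/2`; the critical and the coupling term
  -- are each allowed half of it, with `t ≤ 2` and `‖v‖ ≤ R`
  refine ⟨16 * 2 ^ (α + β) * C * R ^ β / q, by positivity, fun ν hν hδ' μ hμ => ?_⟩
  obtain ⟨δ', hδ', hsmall'⟩ := hδ'
  obtain ⟨δ, hδ, hsmall⟩ := exists_mul_rpow_le_sq (K := 2 ^ critExp N s * C' / critExp N s) hp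
    (by positivity : 0 < q / 16)
  have hmem := semitrivial_mem_nehari (lam₁ := lam₁) (β := β) (ν := ν) (h := h) hlam₂.2 hs.2 hα hμ
  refine ⟨hmem, ?_⟩
  refine eventually_nhdsWithin_iff.2 (Metric.eventually_nhds_iff.2
    ⟨min (min ε 1) (min δ δ'), by positivity, fun p hp1 hp2 => ?_⟩)
  obtain ⟨u, v⟩ := p
  rw [Prod.dist_eq, dist_eq_norm, dist_eq_norm, max_lt_iff, sub_zero] at hp1
  obtain ⟨hu, hv⟩ := hp1
  change ‖u‖ < _ at hu
  change ‖v - dil hμ z‖ < _ at hv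
  have hu1 : ‖u‖ < δ := hu.trans_le ((min_le_right _ _).trans (min_le_left _ _))
  have hu2 : ‖u‖ < δ' := hu.trans_le ((min_le_right _ _).trans (min_le_right _ _))
  have hv1 : ‖v - dil hμ z‖ < ε := hv.trans_le ((min_le_left _ _).trans (min_le_left _ _))
  have hv2 : ‖v - dil hμ z‖ < 1 := hv.trans_le ((min_le_left _ _).trans (min_le_right _ _))
  have hvR : ‖v‖ ≤ R := by
    calc ‖v‖ = ‖(v - dil hμ z) + dil hμ z‖ := by rw [sub_add_cancel]
      _ ≤ ‖v - dil hμ z‖ + ‖z‖ := (norm_add_le _ _).trans (by rw [norm_dil])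
      _ ≤ R := by linarith
  obtain ⟨t, ht1, ht2, ht⟩ := hmin (dil (inv_pos.2 hμ) v) (by
    have e := norm_dil (inv_pos.2 hμ) (v - dil hμ z)
    rw [map_sub, dil_inv_dil] at e
    rwa [e])
  rw [← map_smul, single_dil] at ht
  have ht0 : 0 < t := by linarith
  have hJ := energy_smul_le hs.2 hα hβ hν h0 hp2 ht0
  rw [energy_semitrivial hs.2 hα, single_dil]
  refine le_trans ?_ hJ
  rw [energy_eq, Prod.smul_fst, Prod.smul_snd]
  change single lam₂ s z ≤ single lam₁ s (t • u) + single lam₂ s (t • v)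
    - ν * coupling s α β h (t • u) (t • v)
  rw [single_smul ht0.le, coupling_smul_smul (by linarith) (by linarith) ht0.le]
  have hx := norm_nonneg u
  have k1 : q * ‖u‖ ^ 2 / 8 ≤ t ^ 2 * normSq lam₁ u / 2 := by
    have h1 := normSq_coercive hlam₁.1.le u
    rw [← hq] at h1
    have h2 : (1 / 4 : ℝ) ≤ t ^ 2 := by nlinarith
    have h3 : 0 ≤ q * ‖u‖ ^ 2 := by positivity
    nlinarith
  have k2 : t ^ critExp N s * critInt s u / critExp N s ≤ q / 16 * ‖u‖ ^ 2 := by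
    refine le_trans ?_ (hsmall _ hx hu1)
    calc t ^ critExp N s * critInt s u / critExp N s
        ≤ 2 ^ critExp N s * (C' * ‖u‖ ^ critExp N s) / critExp N s := by
          gcongr
          · exact critInt_nonneg s u
          · exact hcrit u
      _ = _ := by ring
  have k3 : ν * (t ^ (α + β) * coupling s α β h u v) ≤ q / 16 * ‖u‖ ^ 2 := by
    have h1 := hsmall' _ hx hu2
    calc ν * (t ^ (α + β) * coupling s α β h u v)
        ≤ ν * (2 ^ (α + β) * (C * (‖u‖ ^ α * R ^ β))) := by
          have h2 : coupling s α β h u v ≤ C * (‖u‖ ^ α * R ^ β) := (hK u v).trans (by gcongr)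
          have h3 := coupling_nonneg (s := s) (α := α) (β := β) h0 u v
          gcongr
      _ = q / 16 * (ν * (16 * 2 ^ (α + β) * C * R ^ β / q * ‖u‖ ^ α)) := by field_simp
      _ ≤ q / 16 * ‖u‖ ^ 2 := by gcongr
  linarith

theorem hasFDerivAt_coupling (hα : 1 < α) (hβ : 1 < β) (h0 : 0 ≤ᵐ[volume] h) {C : ℝ} (hC : 0 < C)
    (hK : ∀ u v : D12 N, coupling s α β h u v ≤ C * (‖u‖ ^ α * ‖v‖ ^ β)) (v : D12 N) :
    HasFDerivAt (fun p : DD N => coupling s α β h p.1 p.2) (0 : DD N →L[ℝ] ℝ) (0, v) := by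
  refine hasFDerivAt_of_abs_le_rpow (q := α) (C := C * (‖v‖ + 1) ^ β) hα fun b hb => ?_
  have h1 : ‖b.1‖ ≤ ‖b‖ := norm_fst_le b
  have h2 : ‖v + b.2‖ ≤ ‖v‖ + 1 := (norm_add_le _ _).trans (by linarith [norm_snd_le b])
  change |coupling s α β h (0 + b.1) (v + b.2) - coupling s α β h 0 v - 0| ≤ _
  rw [coupling_zero_left (by linarith), zero_add, sub_zero, sub_zero,
    abs_of_nonneg (coupling_nonneg h0 _ _)]
  calc _ ≤ C * (‖b.1‖ ^ α * ‖v + b.2‖ ^ β) := hK _ _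
    _ ≤ C * (‖b‖ ^ α * (‖v‖ + 1) ^ β) := by gcongr
    _ = _ := by ring

theorem hasFDerivAt_energy {μ : ℝ} (hlam₁ : 0 < lam₁ ∧ lam₁ < hardyConst N)
    (hlam₂ : 0 < lam₂ ∧ lam₂ < hardyConst N) (hs : 0 < s ∧ s < 2) (hα : 1 < α) (hβ : 1 < β)
    (h0 : 0 ≤ᵐ[volume] h) {C : ℝ} (hC : 0 < C)
    (hK : ∀ u v : D12 N, coupling s α β h u v ≤ C * (‖u‖ ^ α * ‖v‖ ^ β)) (hμ : 0 < μ) :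
    HasFDerivAt (energy lam₁ lam₂ s α β h ν) (0 : DD N →L[ℝ] ℝ)
      ((0, dil hμ (profileD hlam₂.2 hs.2)) : DD N) := by
  set p : DD N := (0, dil hμ (profileD hlam₂.2 hs.2)) with hp
  have h1 : HasFDerivAt (single lam₁ s) (0 : D12 N →L[ℝ] ℝ) p.1 :=
    hasFDerivAt_single_zero hlam₁.1 hlam₁.2 hs.1 hs.2
  have h2 : HasFDerivAt (single lam₂ s) (0 : D12 N →L[ℝ] ℝ) p.2 :=
    hasFDerivAt_single_dil hμ hlam₂.1 hlam₂.2 hs.1 hs.2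
  have h3 : HasFDerivAt (fun p : DD N => coupling s α β h p.1 p.2) (0 : DD N →L[ℝ] ℝ) p :=
    hasFDerivAt_coupling hα hβ h0 hC hK _
  have h4 := ((h1.comp p hasFDerivAt_fst).add (h2.comp p hasFDerivAt_snd)).sub (h3.const_mul ν)
  refine (h4.congr_of_eventuallyEq (Eventually.of_forall fun q => energy_eq q)).congr_fderiv ?_
  simp

theorem differentiableAt_critInt_add {μ : ℝ} (hlam₂ : lam₂ < hardyConst N) (hs : 0 < s ∧ s < 2)
    (hμ : 0 < μ) : DifferentiableAt ℝ (fun p : DD N => critInt s p.1 + critInt s p.2)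
      (0, dil hμ (profileD hlam₂ hs.2)) := by
  set p : DD N := (0, dil hμ (profileD hlam₂ hs.2)) with hp
  have h1 : DifferentiableAt ℝ (critInt s) p.1 :=
    (hasFDerivAt_critInt_zero hs.1 hs.2).differentiableAt
  have h2 : DifferentiableAt ℝ (critInt s) p.2 := differentiableAt_critInt_dil hμ hlam₂ hs.1 hs.2
  exact (h1.comp p differentiableAt_fst).add (h2.comp p differentiableAt_snd)

/-- The semitrivial points are critical points of the energy itself: `α > 1` makes the derivative of
the coupling term vanish there. The multiplier is zero. -/
theorem isCriticalPoint_semitrivial {μ : ℝ} (hlam₁ : 0 < lam₁ ∧ lam₁ < hardyConst N)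
    (hlam₂ : 0 < lam₂ ∧ lam₂ < hardyConst N) (hs : 0 < s ∧ s < 2) (hα : 1 < α) (hβ : 1 < β)
    (h0 : 0 ≤ᵐ[volume] h) {C : ℝ} (hC : 0 < C)
    (hK : ∀ u v : D12 N, coupling s α β h u v ≤ C * (‖u‖ ^ α * ‖v‖ ^ β)) (hμ : 0 < μ) :
    IsCriticalPoint lam₁ lam₂ s α β h ν ((0, dil hμ (profileD hlam₂.2 hs.2)) : DD N) := by
  have h1 := hasFDerivAt_energy (ν := ν) hlam₁ hlam₂ hs hα hβ h0 hC hK hμ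
  have h2 := (differentiableAt_critInt_add hlam₂.2 hs hμ).hasFDerivAt
  have h3 := hasFDerivAt_coupling hα hβ h0 hC hK (dil hμ (profileD hlam₂.2 hs.2))
  have h4 := ((h1.const_mul 2).add (h2.const_mul (2 / critExp N s - 1))).add
    (h3.const_mul (ν * (2 - (α + β))))
  exact ⟨semitrivial_mem_nehari hlam₂.2 hs.2 hα hμ, 0, _, 0, h1,
    h4.congr_of_eventuallyEq (Eventually.of_forall fun q => nehariFun_eq hs.2 q), by simp⟩

/-- Points near a semitrivial point are projected to the Nehari manifold by a factor near `1`: at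
the semitrivial point itself, `Ψ` changes sign along the ray from positive to negative. -/
theorem exists_smul_mem_nehari {μ : ℝ} (hlam₂ : 0 < lam₂ ∧ lam₂ < hardyConst N)
    (hs : 0 < s ∧ s < 2) (hα : 1 < α) (hβ : 1 < β)
    (h0 : 0 ≤ᵐ[volume] h) {C : ℝ} (hC : 0 < C)
    (hK : ∀ u v : D12 N, coupling s α β h u v ≤ C * (‖u‖ ^ α * ‖v‖ ^ β)) (hμ : 0 < μ)
    {U : Set (DD N)} (hU : U ∈ 𝓝 ((0, dil hμ (profileD hlam₂.2 hs.2)) : DD N)) :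
    ∀ᶠ p in 𝓝 ((0, dil hμ (profileD hlam₂.2 hs.2)) : DD N),
      ∃ t : ℝ, 1 / 2 ≤ t ∧ t ≤ 2 ∧ t • p ∈ U ∩ nehari lam₁ lam₂ s α β h ν := by
  have hpe := two_lt_critExp (N := N) hs.2
  set Z : D12 N := dil hμ (profileD hlam₂.2 hs.2) with hZ
  set p₀ : DD N := (0, Z) with hp₀
  have hZ0 : Z ≠ 0 := dil_profileD_ne_zero hlam₂.2 hs.2 hμ
  have hp₀0 : p₀ ≠ 0 := fun h => hZ0 (congrArg Prod.snd h)
  have hcont : Tendsto (fun q : ℝ × DD N => q.1 • q.2) (𝓝 1 ×ˢ 𝓝 p₀) (𝓝 p₀) := by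
    have h1 : ContinuousAt (fun q : ℝ × DD N => q.1 • q.2) (1, p₀) := by fun_prop
    have h2 := h1.tendsto
    rwa [nhds_prod_eq, one_smul] at h2
  obtain ⟨pa, hpa, pb, hpb, hab⟩ := Filter.eventually_prod_iff.1
    (hcont.eventually (inter_mem hU (isOpen_compl_singleton.mem_nhds hp₀0)))
  obtain ⟨η', hη', hball⟩ := Metric.eventually_nhds_iff.1 hpa
  set η := min (η' / 2) (1 / 2) with hη
  have hη0 : 0 < η := by positivity
  have hη1 : η ≤ 1 / 2 := min_le_right _ _
  have hη2 : η < η' := (min_le_left _ _).trans_lt (by linarith)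
  set F : ℝ → DD N → ℝ := fun t p => t ^ 2 * (normSq lam₁ p.1 + normSq lam₂ p.2)
      - t ^ critExp N s * (critInt s p.1 + critInt s p.2)
      - t ^ (α + β) * (ν * (α + β) * coupling s α β h p.1 p.2) with hF
  have hFc : ∀ t, ContinuousAt (F t) p₀ := by
    intro t
    have c1 : Continuous fun p : DD N => normSq lam₁ p.1 + normSq lam₂ p.2 :=
      ((continuous_normSq lam₁).comp continuous_fst).add
        ((continuous_normSq lam₂).comp continuous_snd)
    have c2 := (differentiableAt_critInt_add hlam₂.2 hs hμ).continuousAt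
    have c3 := (hasFDerivAt_coupling hα hβ h0 hC hK Z).continuousAt
    exact ((c1.continuousAt.const_mul _).sub (c2.const_mul _)).sub
      ((c3.const_mul _).const_mul _)
  have hQ : 0 < normSq lam₂ Z := normSq_pos hlam₂.1 hlam₂.2 hZ0
  have hF0 : ∀ t, F t p₀ = (t ^ 2 - t ^ critExp N s) * normSq lam₂ Z := by
    intro t
    have e : F t p₀ = t ^ 2 * (normSq lam₁ (0 : D12 N) + normSq lam₂ Z)
      - t ^ critExp N s * (critInt s (0 : D12 N) + critInt s Z)
      - t ^ (α + β) * (ν * (α + β) * coupling s α β h (0 : D12 N) Z) := rfl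
    rw [e, normSq_zero, critInt_zero hs.2, coupling_zero_left (by linarith), hZ,
      ← normSq_dil_profileD]
    ring
  have hlo : 0 < F (1 - η) p₀ := by
    rw [hF0]
    refine mul_pos (sub_pos.2 ?_) hQ
    rw [← Real.rpow_natCast]
    exact Real.rpow_lt_rpow_of_exponent_gt (by linarith) (by linarith) (by push_cast; linarith)
  have hhi : F (1 + η) p₀ < 0 := by
    rw [hF0]
    refine mul_neg_of_neg_of_pos (sub_neg.2 ?_) hQ
    rw [← Real.rpow_natCast]
    exact Real.rpow_lt_rpow_of_exponent_lt (by linarith) (by push_cast; linarith)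
  filter_upwards [hpb, (hFc _).eventually (lt_mem_nhds hlo), (hFc _).eventually (gt_mem_nhds hhi)]
    with p h1 h2 h3
  have hFt : ContinuousOn (fun t => F t p) (Set.Icc (1 - η) (1 + η)) := by
    have hne : ∀ t ∈ Set.Icc (1 - η) (1 + η), t ≠ 0 := fun t ht => by
      have := ht.1; intro h; linarith
    refine ((ContinuousOn.mul (by fun_prop) continuousOn_const).sub
      (ContinuousOn.mul ?_ continuousOn_const)).sub (ContinuousOn.mul ?_ continuousOn_const)
    · exact continuousOn_id.rpow_const fun t ht => Or.inl (hne t ht)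
    · exact continuousOn_id.rpow_const fun t ht => Or.inl (hne t ht)
  obtain ⟨t, ht, hFt0⟩ := intermediate_value_Icc' (by linarith) hFt ⟨h3.le, h2.le⟩
  have ht0 : 0 ≤ t := by linarith [ht.1]
  have hm := hab (hball (y := t) (by
    rw [Real.dist_eq]
    exact (abs_le.2 ⟨by linarith [ht.1], by linarith [ht.2]⟩ : |t - 1| ≤ η).trans_lt hη2)) h1
  refine ⟨t, by linarith [ht.1], by linarith [ht.2], hm.1, hm.2, ?_⟩
  rw [nehariFun_smul (by linarith) (by linarith) ht0]
  exact hFt0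

theorem single_smul_le {lam μ t : ℝ} (hlam : lam < hardyConst N) (hs : s < 2) (hμ : 0 < μ)
    (ht : 0 < t) : single lam s (t • dil hμ (profileD (N := N) hlam hs))
      ≤ single lam s (dil hμ (profileD (N := N) hlam hs)) := by
  have hpe := two_lt_critExp (N := N) hs
  have h1 := one_add_mul_le_rpow hpe.le ht
  rw [single_smul ht.le, single, normSq_dil_profileD]
  have c1 := critInt_nonneg s (dil hμ (profileD (N := N) hlam hs))
  set P := critInt s (dil hμ (profileD (N := N) hlam hs))
  have k1 : 0 ≤ (t ^ critExp N s - (1 + critExp N s / 2 * (t ^ 2 - 1))) * P / critExp N s :=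
    div_nonneg (mul_nonneg (by linarith) (by linarith)) (by linarith)
  have k3 : (t ^ critExp N s - (1 + critExp N s / 2 * (t ^ 2 - 1))) * P / critExp N s
      = t ^ critExp N s * P / critExp N s - P / critExp N s - (t ^ 2 - 1) / 2 * P := by
    field_simp
    ring
  linarith

/-- Every neighbourhood of a semitrivial point contains points of the Nehari manifold of larger
energy: the decoupled functional increases strictly in some direction, and passing to the Nehari
manifold does not decrease the energy. -/
theorem exists_energy_gt {μ : ℝ} (hlam₂ : 0 < lam₂ ∧ lam₂ < hardyConst N)
    (hs : 0 < s ∧ s < 2) (hα : 1 < α) (hβ : 1 < β)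
    (h0 : 0 ≤ᵐ[volume] h) {C : ℝ} (hC : 0 < C)
    (hK : ∀ u v : D12 N, coupling s α β h u v ≤ C * (‖u‖ ^ α * ‖v‖ ^ β)) (hν : 0 < ν) (hμ : 0 < μ)
    {U : Set (DD N)} (hU : U ∈ 𝓝 ((0, dil hμ (profileD hlam₂.2 hs.2)) : DD N)) :
    ∃ q ∈ U ∩ nehari lam₁ lam₂ s α β h ν,
      energy lam₁ lam₂ s α β h ν ((0, dil hμ (profileD hlam₂.2 hs.2)) : DD N)
        < energy lam₁ lam₂ s α β h ν q := by
  obtain ⟨b, δ, hδ, hb⟩ := exists_single_lt (N := N) hlam₂.1 hlam₂.2 hs.1 hs.2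
  set z : D12 N := profileD hlam₂.2 hs.2 with hz
  have hlim : Tendsto (fun r : ℝ => ((0, dil hμ z + r • dil hμ b) : DD N)) (𝓝[>] 0)
      (𝓝 ((0, dil hμ z) : DD N)) := by
    have h1 : ContinuousAt (fun r : ℝ => ((0, dil hμ z + r • dil hμ b) : DD N)) 0 := by fun_prop
    have h2 := h1.tendsto
    simp only [zero_smul, add_zero] at h2
    exact h2.mono_left nhdsWithin_le_nhds
  obtain ⟨r, ⟨t, ht1, ht2, ht⟩, hr⟩ :=
    ((hlim.eventually (exists_smul_mem_nehari (lam₁ := lam₁) (ν := ν)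
    hlam₂ hs hα hβ h0 hC hK hμ hU)).and (Ioo_mem_nhdsGT hδ)).exists
  refine ⟨_, ht, ?_⟩
  have ht0 : 0 < t := by linarith
  have h1 := energy_smul_le hs.2 hα hβ hν h0 ht.2 (inv_pos.2 ht0)
  rw [inv_smul_smul₀ ht0.ne'] at h1
  refine lt_of_lt_of_le ?_ h1
  rw [energy_semitrivial hs.2 hα, energy_semitrivial hs.2 hα, ← map_smul, ← map_add, single_dil,
    single_dil]
  exact hb r hr.1 hr.2

/-- If the coupling term dominates the quadratic one, then every neighbourhood of a semitrivial
point contains points of the Nehari manifold of smaller energy. -/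
theorem exists_energy_lt {μ : ℝ} (hlam₂ : 0 < lam₂ ∧ lam₂ < hardyConst N)
    (hs : 0 < s ∧ s < 2) (hα : 1 < α) (hβ : 1 < β)
    (h0 : 0 ≤ᵐ[volume] h) {C : ℝ} (hC : 0 < C)
    (hK : ∀ u v : D12 N, coupling s α β h u v ≤ C * (‖u‖ ^ α * ‖v‖ ^ β)) (hν : 0 < ν) (hμ : 0 < μ)
    {w : D12 N} (hw : ∃ δ > 0, ∀ x : ℝ, 0 < x → x < δ → normSq lam₁ w / 2 * x ^ 2
      < ν * ((1 / 2) ^ (α + β - 2) * coupling s α β h w (dil hμ (profileD hlam₂.2 hs.2))) * x ^ α)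
    {U : Set (DD N)} (hU : U ∈ 𝓝 ((0, dil hμ (profileD hlam₂.2 hs.2)) : DD N)) :
    ∃ q ∈ U ∩ nehari lam₁ lam₂ s α β h ν, energy lam₁ lam₂ s α β h ν q
      < energy lam₁ lam₂ s α β h ν ((0, dil hμ (profileD hlam₂.2 hs.2)) : DD N) := by
  have hpe := two_lt_critExp (N := N) hs.2
  obtain ⟨δ, hδ, hw⟩ := hw
  set Z : D12 N := dil hμ (profileD hlam₂.2 hs.2) with hZ
  have hlim : Tendsto (fun r : ℝ => ((r • w, Z) : DD N)) (𝓝[>] 0) (𝓝 ((0, Z) : DD N)) := by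
    have h1 : ContinuousAt (fun r : ℝ => ((r • w, Z) : DD N)) 0 := by fun_prop
    have h2 := h1.tendsto
    simp only [zero_smul] at h2
    exact h2.mono_left nhdsWithin_le_nhds
  obtain ⟨r, ⟨t, ht1, ht2, ht⟩, hr⟩ :=
    ((hlim.eventually (exists_smul_mem_nehari (lam₁ := lam₁) (ν := ν)
    hlam₂ hs hα hβ h0 hC hK hμ hU)).and (Ioo_mem_nhdsGT hδ)).exists
  refine ⟨_, ht, ?_⟩
  have ht0 : 0 < t := by linarith
  have hr0 : 0 < r := hr.1
  have e : energy lam₁ lam₂ s α β h ν (t • ((r • w, Z) : DD N)) = single lam₁ s (t • r • w)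
      + single lam₂ s (t • Z) - ν * coupling s α β h (t • r • w) (t • Z) := energy_eq _
  have h1 := single_smul_le (N := N) hlam₂.2 hs.2 hμ ht0
  rw [← hZ] at h1
  have h2 : coupling s α β h (r • w) Z = r ^ α * coupling s α β h w Z := by
    have := coupling_smul (s := s) (α := α) (β := β) (h := h) hr0.le zero_le_one w Z
    rwa [one_smul, Real.one_rpow, mul_one] at this
  rw [e, energy_semitrivial hs.2 hα, single_smul ht0.le, normSq_smul,
    coupling_smul_smul (by linarith) (by linarith) ht0.le, h2]
  have h3 : 0 ≤ t ^ critExp N s * critInt s (r • w) / critExp N s :=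
    div_nonneg (mul_nonneg (by positivity) (critInt_nonneg _ _)) (by linarith)
  have h4 := hw r hr0 hr.2
  have hKn := coupling_nonneg (s := s) (α := α) (β := β) h0 w Z
  have h5 : ν * ((1 / 2) ^ (α + β - 2) * coupling s α β h w Z) * r ^ α
      ≤ ν * (t ^ (α + β - 2) * coupling s α β h w Z) * r ^ α := by
    gcongr
    linarith
  have h6 : t ^ (α + β) = t ^ 2 * t ^ (α + β - 2) := by
    rw [← Real.rpow_natCast t 2, ← Real.rpow_add ht0]; congr 1; push_cast; ring
  have h7 := mul_lt_mul_of_pos_left (h4.trans_le h5) (pow_pos ht0 2)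
  rw [h6]
  linarith

end Nehari

/-! ### Exchanging the two components -/

section Symmetry

variable {N : ℕ} [hN : Fact (3 ≤ N)] {lam₁ lam₂ s α β ν : ℝ} {h : E N → ℝ}

theorem energy_swap (p : DD N) : energy lam₂ lam₁ s β α h ν p.swap
    = energy lam₁ lam₂ s α β h ν p := by
  unfold energy
  rw [Prod.fst_swap, Prod.snd_swap, couplingFun_symm]
  ring

theorem nehariFun_swap (p : DD N) : nehariFun lam₂ lam₁ s β α h ν p.swap
    = nehariFun lam₁ lam₂ s α β h ν p := by
  unfold nehariFun
  rw [Prod.fst_swap, Prod.snd_swap, couplingFun_symm]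
  ring

theorem swap_mem_nehari {p : DD N} : p.swap ∈ nehari lam₂ lam₁ s β α h ν
    ↔ p ∈ nehari lam₁ lam₂ s α β h ν := by
  unfold nehari
  rw [Set.mem_ofPred_eq, Set.mem_ofPred_eq, nehariFun_swap]
  refine and_congr_left fun _ => not_congr ⟨fun h0 => ?_, fun h0 => ?_⟩
  · rw [← Prod.swap_swap p, h0]; rfl
  · rw [h0]; rfl

theorem IsLocalMinimum.of_swap {p : DD N} (hp : IsLocalMinimum lam₂ lam₁ s β α h ν p.swap) :
    IsLocalMinimum lam₁ lam₂ s α β h ν p := by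
  refine ⟨swap_mem_nehari.1 hp.1, ?_⟩
  have h1 : Tendsto Prod.swap (𝓝[nehari lam₁ lam₂ s α β h ν] p)
      (𝓝[nehari lam₂ lam₁ s β α h ν] p.swap) :=
    continuous_swap.continuousWithinAt.tendsto_nhdsWithin fun q hq => swap_mem_nehari.2 hq
  filter_upwards [h1.eventually hp.2] with q hq
  rwa [energy_swap, energy_swap] at hq

theorem IsSaddlePoint.of_swap {p : DD N} (hp : IsSaddlePoint lam₂ lam₁ s β α h ν p.swap) :
    IsSaddlePoint lam₁ lam₂ s α β h ν p := by
  obtain ⟨⟨h1, J', Ψ', k, hJ, hΨ, hk⟩, h2⟩ := hp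
  set σ : DD N →L[ℝ] DD N := (ContinuousLinearEquiv.prodComm ℝ (D12 N) (D12 N) : DD N →L[ℝ] DD N)
    with hσ
  refine ⟨⟨swap_mem_nehari.1 h1, J'.comp σ, Ψ'.comp σ, k, ?_, ?_, ?_⟩, fun U hU => ?_⟩
  · exact (hJ.comp p σ.hasFDerivAt).congr_of_eventuallyEq
      (Eventually.of_forall fun q => (energy_swap q).symm)
  · exact (hΨ.comp p σ.hasFDerivAt).congr_of_eventuallyEq
      (Eventually.of_forall fun q => (nehariFun_swap q).symm)
  · rw [hk, ContinuousLinearMap.smul_comp]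
  · have hU' : Prod.swap ⁻¹' U ∈ 𝓝 p.swap :=
      continuous_swap.continuousAt.preimage_mem_nhds (by rwa [Prod.swap_swap])
    obtain ⟨⟨q₁, hq₁, hl⟩, ⟨q₂, hq₂, hg⟩⟩ := h2 _ hU'
    refine ⟨⟨q₁.swap, ⟨hq₁.1, swap_mem_nehari.2 hq₁.2⟩, ?_⟩,
      ⟨q₂.swap, ⟨hq₂.1, swap_mem_nehari.2 hq₂.2⟩, ?_⟩⟩
    · rw [energy_swap] at hl
      rwa [energy_swap]
    · rw [energy_swap] at hg
      rwa [energy_swap]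

end Symmetry

/-! ### Minima and saddle points -/

section Semitrivial

variable {N : ℕ} [hN : Fact (3 ≤ N)] {lam₁ lam₂ s α β : ℝ} {h : E N → ℝ}

theorem dil_profileD_eq_zMu {lam μ : ℝ} (hlam : lam < hardyConst N) (hs : s < 2) (hμ : 0 < μ) :
    ∀ᵐ x, dil hμ (profileD (N := N) hlam hs) x = zMu N lam s μ x := by
  filter_upwards [coe_dil_profileD (N := N) hlam hs hμ, ae_ne_zero N] with x hx h0
  rw [hx, zMu, zOne_eq hs (smul_ne_zero (inv_ne_zero hμ.ne') h0), norm_smul, norm_inv,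
    Real.norm_of_nonneg hμ.le, profile_dilate_eq hμ (norm_pos_iff.2 h0)]

/-- The local minima with vanishing first component. For `α = 2` the threshold for `ν` can be chosen
independently of the dilation parameter, as the norm of the dilated profile does not depend on
it. -/
theorem isLocalMinimum_semitrivial (hlam₁ : 0 < lam₁ ∧ lam₁ < hardyConst N)
    (hlam₂ : 0 < lam₂ ∧ lam₂ < hardyConst N) (hs : 0 < s ∧ s < 2) (hα : 1 < α) (hβ : 1 < β)
    (hh : AEStronglyMeasurable h volume) (h0 : 0 ≤ᵐ[volume] h)
    (hint : ∀ u v : D12 N, Integrable (couplingFun s α β h u v) volume) :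
    (2 < α → ∀ ν > 0, ∀ (μ : ℝ) (hμ : 0 < μ), IsLocalMinimum lam₁ lam₂ s α β h ν
      ((0, dil hμ (profileD hlam₂.2 hs.2)) : DD N)) ∧
    (α = 2 → ∃ ν₀ > 0, ∀ ν, 0 < ν → ν < ν₀ → ∀ (μ : ℝ) (hμ : 0 < μ),
      IsLocalMinimum lam₁ lam₂ s α β h ν ((0, dil hμ (profileD hlam₂.2 hs.2)) : DD N)) := by
  obtain ⟨C, hC, hK⟩ := exists_coupling_le (s := s) (by linarith : 0 < α) (by linarith : 0 < β)
    hh h0 hint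
  obtain ⟨D, hD, H⟩ := exists_isLocalMinimum hlam₁ hlam₂ hs hα hβ h0 hC hK
  refine ⟨fun hα2 ν hν => H ν hν ?_, ?_⟩
  · obtain ⟨δ, hδ, hsmall⟩ := exists_mul_rpow_le_sq (K := ν * D) hα2 one_pos
    refine ⟨δ, hδ, fun x hx hxδ => ?_⟩
    have := hsmall x hx hxδ
    rwa [one_mul, mul_assoc] at this
  · rintro rfl
    refine ⟨D⁻¹, inv_pos.2 hD, fun ν hν hlt => H ν hν ⟨1, one_pos, fun x _ _ => ?_⟩⟩
    have h1 : ν * D ≤ 1 := by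
      have := mul_le_mul_of_nonneg_right hlt.le hD.le
      rwa [inv_mul_cancel₀ hD.ne'] at this
    have h2 : x ^ (2 : ℝ) = x ^ 2 := by norm_num
    rw [h2, ← mul_assoc]
    exact mul_le_of_le_one_left (sq_nonneg x) h1

/-- The saddle points with vanishing first component. The energy decreases when a small multiple of
a positive function is added in the first component. -/
theorem isSaddlePoint_semitrivial (hlam₁ : 0 < lam₁ ∧ lam₁ < hardyConst N)
    (hlam₂ : 0 < lam₂ ∧ lam₂ < hardyConst N) (hs : 0 < s ∧ s < 2) (hα : 1 < α) (hβ : 1 < β)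
    (hh : AEStronglyMeasurable h volume) (h0 : 0 ≤ᵐ[volume] h) (h_ne : ¬ h =ᵐ[volume] 0)
    (hint : ∀ u v : D12 N, Integrable (couplingFun s α β h u v) volume) :
    (α < 2 → ∀ ν > 0, ∀ (μ : ℝ) (hμ : 0 < μ), IsSaddlePoint lam₁ lam₂ s α β h ν
      ((0, dil hμ (profileD hlam₂.2 hs.2)) : DD N)) ∧
    (α = 2 → ∀ (μ : ℝ) (hμ : 0 < μ), ∃ ν₁ > 0, ∀ ν > ν₁,
      IsSaddlePoint lam₁ lam₂ s α β h ν ((0, dil hμ (profileD hlam₂.2 hs.2)) : DD N)) := by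
  obtain ⟨C, hC, hK⟩ := exists_coupling_le (s := s) (by linarith : 0 < α) (by linarith : 0 < β)
    hh h0 hint
  set w : D12 N := profileD hlam₁.2 hs.2 with hw
  have hpos : ∀ (μ : ℝ) (hμ : 0 < μ),
      0 < (1 / 2) ^ (α + β - 2) * coupling s α β h w (dil hμ (profileD hlam₂.2 hs.2)) :=
    fun μ hμ => mul_pos (by positivity) (coupling_pos h0 h_ne (hint _ _)
      (profileD_pos hlam₁.2 hs.2) (dil_profileD_pos hμ hlam₂.2 hs.2))
  have H : ∀ ν > 0, ∀ (μ : ℝ) (hμ : 0 < μ), (∃ δ > 0, ∀ x : ℝ, 0 < x → x < δ →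
      normSq lam₁ w / 2 * x ^ 2 < ν * ((1 / 2) ^ (α + β - 2)
        * coupling s α β h w (dil hμ (profileD hlam₂.2 hs.2))) * x ^ α) →
      IsSaddlePoint lam₁ lam₂ s α β h ν ((0, dil hμ (profileD hlam₂.2 hs.2)) : DD N) :=
    fun ν hν μ hμ hlow => ⟨isCriticalPoint_semitrivial hlam₁ hlam₂ hs hα hβ h0 hC hK hμ,
      fun U hU => ⟨exists_energy_lt hlam₂ hs hα hβ h0 hC hK hν hμ hlow hU,
        exists_energy_gt hlam₂ hs hα hβ h0 hC hK hν hμ hU⟩⟩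
  refine ⟨fun hα2 ν hν μ hμ => H ν hν μ hμ
    (exists_sq_lt_mul_rpow hα2 (mul_pos hν (hpos μ hμ))), ?_⟩
  rintro rfl μ hμ
  have hp := hpos μ hμ
  set K := (1 / 2 : ℝ) ^ (2 + β - 2) * coupling s 2 β h w (dil hμ (profileD hlam₂.2 hs.2)) with hKd
  have hQ : 0 < normSq lam₁ w / 2 :=
    half_pos (normSq_pos hlam₁.1 hlam₁.2 (profileD_ne_zero hlam₁.2 hs.2))
  refine ⟨normSq lam₁ w / 2 / K, by positivity, fun ν hν => ?_⟩
  have hν0 : 0 < ν := lt_trans (by positivity) hν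
  refine H ν hν0 μ hμ ⟨1, one_pos, fun x hx _ => ?_⟩
  have h2 : x ^ (2 : ℝ) = x ^ 2 := by norm_num
  rw [h2]
  exact mul_lt_mul_of_pos_right ((div_lt_iff₀ hp).1 hν) (pow_pos hx 2)

end Semitrivial

end HardySobolev

end

theorem theorem2p1 (N : ℕ) [Fact (3 ≤ N)] (lam₁ lam₂ s α β : ℝ) (h : E N → ℝ)
    (hlam₁ : 0 < lam₁ ∧ lam₁ < hardyConst N) (hlam₂ : 0 < lam₂ ∧ lam₂ < hardyConst N)
    (hs : 0 < s ∧ s < 2)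
    (hα : 1 < α) (hβ : 1 < β) (hαβ : α + β ≤ critExp N s)
    (h_bdd : MemLp h ⊤ volume) (h_nonneg : 0 ≤ᵐ[volume] h) (h_ne : ¬ h =ᵐ[volume] 0)
    (hH : HypH h)
    -- in the subcritical case: the energy is well defined on the whole energy space
    (h_wd : α + β < critExp N s → ∀ u v : D12 N, Integrable (couplingFun s α β h u v) volume) :
    -- `Z₁ μ` and `Z₂ μ` are the functions `z_μ^{(1)}` and `z_μ^{(2)}` as elements of `D^{1,2}`
    ∃ Z₁ Z₂ : ℝ → D12 N,
      (∀ μ > 0, (∀ᵐ x, Z₁ μ x = zMu N lam₁ s μ x) ∧ (∀ᵐ x, Z₂ μ x = zMu N lam₂ s μ x)) ∧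
      -- i)
      (2 < α → ∀ ν > 0, ∀ μ > 0, IsLocalMinimum lam₁ lam₂ s α β h ν (0, Z₂ μ)) ∧
      (α = 2 → ∃ ν₀ > 0, ∀ ν, 0 < ν → ν < ν₀ → ∀ μ > 0,
        IsLocalMinimum lam₁ lam₂ s α β h ν (0, Z₂ μ)) ∧
      -- ii)
      (2 < β → ∀ ν > 0, ∀ μ > 0, IsLocalMinimum lam₁ lam₂ s α β h ν (Z₁ μ, 0)) ∧
      (β = 2 → ∃ ν₀ > 0, ∀ ν, 0 < ν → ν < ν₀ → ∀ μ > 0,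
        IsLocalMinimum lam₁ lam₂ s α β h ν (Z₁ μ, 0)) ∧
      -- iii)
      (α < 2 → ∀ ν > 0, ∀ μ > 0, IsSaddlePoint lam₁ lam₂ s α β h ν (0, Z₂ μ)) ∧
      (α = 2 → ∀ μ > 0, ∃ ν₁ > 0, ∀ ν > ν₁, IsSaddlePoint lam₁ lam₂ s α β h ν (0, Z₂ μ)) ∧
      -- iv)
      (β < 2 → ∀ ν > 0, ∀ μ > 0, IsSaddlePoint lam₁ lam₂ s α β h ν (Z₁ μ, 0)) ∧
      (β = 2 → ∀ μ > 0, ∃ ν₁ > 0, ∀ ν > ν₁, IsSaddlePoint lam₁ lam₂ s α β h ν (Z₁ μ, 0)) := by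
  have hint : ∀ u v : D12 N, Integrable (couplingFun s α β h u v) volume := by
    rcases hαβ.lt_or_eq with hlt | heq
    · exact h_wd hlt
    · exact integrable_couplingFun_of_critical hs.1 hs.2 (by linarith) (by linarith) heq h_bdd
  have hint' : ∀ u v : D12 N, Integrable (couplingFun s β α h u v) volume := fun u v => by
    rw [couplingFun_symm]; exact hint v u
  refine ⟨fun μ => if hμ : 0 < μ then dil hμ (profileD hlam₁.2 hs.2) else 0,
    fun μ => if hμ : 0 < μ then dil hμ (profileD hlam₂.2 hs.2) else 0, fun μ hμ => ?_, ?_⟩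
  · simp only [dif_pos hμ]
    exact ⟨dil_profileD_eq_zMu hlam₁.2 hs.2 hμ, dil_profileD_eq_zMu hlam₂.2 hs.2 hμ⟩
  obtain ⟨m1, m2⟩ := isLocalMinimum_semitrivial hlam₁ hlam₂ hs hα hβ h_bdd.1 h_nonneg hint
  obtain ⟨m3, m4⟩ := isLocalMinimum_semitrivial hlam₂ hlam₁ hs hβ hα h_bdd.1 h_nonneg hint'
  obtain ⟨m5, m6⟩ := isSaddlePoint_semitrivial hlam₁ hlam₂ hs hα hβ h_bdd.1 h_nonneg h_ne hint
  obtain ⟨m7, m8⟩ := isSaddlePoint_semitrivial hlam₂ hlam₁ hs hβ hα h_bdd.1 h_nonneg h_ne hint'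
  refine ⟨fun hα2 ν hν μ hμ => ?_, fun hα2 => ?_, fun hβ2 ν hν μ hμ => ?_, fun hβ2 => ?_,
    fun hα2 ν hν μ hμ => ?_, fun hα2 μ hμ => ?_, fun hβ2 ν hν μ hμ => ?_, fun hβ2 μ hμ => ?_⟩
  · simp only [dif_pos hμ]
    exact m1 hα2 ν hν μ hμ
  · obtain ⟨ν₀, hν₀, H⟩ := m2 hα2
    refine ⟨ν₀, hν₀, fun ν hν hlt μ hμ => ?_⟩
    simp only [dif_pos hμ]
    exact H ν hν hlt μ hμ
  · simp only [dif_pos hμ]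
    exact (m3 hβ2 ν hν μ hμ).of_swap
  · obtain ⟨ν₀, hν₀, H⟩ := m4 hβ2
    refine ⟨ν₀, hν₀, fun ν hν hlt μ hμ => ?_⟩
    simp only [dif_pos hμ]
    exact (H ν hν hlt μ hμ).of_swap
  · simp only [dif_pos hμ]
    exact m5 hα2 ν hν μ hμ
  · obtain ⟨ν₁, hν₁, H⟩ := m6 hα2 μ hμ
    refine ⟨ν₁, hν₁, fun ν hν => ?_⟩
    simp only [dif_pos hμ]
    exact H ν hν
  · simp only [dif_pos hμ]
    exact (m7 hβ2 ν hν μ hμ).of_swap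
  · obtain ⟨ν₁, hν₁, H⟩ := m8 hβ2 μ hμ
    refine ⟨ν₁, hν₁, fun ν hν => ?_⟩
    simp only [dif_pos hμ]
    exact (H ν hν).of_swap
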